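/- **Setting.** Let $\mathcal T_0$ be a finite conforming triangulation of $\overline\Omega$, where $\Omega\subset\mathbb R^2$ is the polygonal domain $\Omega=\operatorname{int}\bigcup_{E\in\mathcal T_0}E$, with a newest vertex assigned to every triangle. Let $u\in H^1_0(\Omega)$ be a weak solution of $-\nabla\cdot(A\nabla u)+cu=f$ in $\Omega$, i.e. $\int_\Omega A\nabla u\cdot\nabla v+\int_\Omega c\,uv=\int_\Omega fv$ for all $v\in H^1_0(\Omega)$, with data $\mathcal D=(A,c,f)$: $A\in L^\infty(\Omega)^{2\times2}$ symmetric and uniformly positive definite, $0\le c\in L^\infty(\Omega)$, $f\in L^2(\Omega)$. *Meshes.* Let $\mathcal T$ be obtained from $\mathcal T_0$ by finitely many newest-vertex bisections of elements (hanging nodes are allowed). A node (vertex of some triangle of $\mathcal T$) is proper if it is a vertex of all triangles of $\mathcal T$ containing it, and hanging otherwise. The global index is $\lambda(x)=0$ for proper $x$, and $\lambda(x)=\max(\lambda(x'),\lambda(x''))+1$ for hanging $x$, where $x',x''$ are the endpoints of the triangle edge whose bisection created $x$. For an integer $\Lambda\ge1$, $\mathcal T$ is $\Lambda$-admissible if $\lambda\le\Lambda$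 at all nodes. For $E\in\mathcal T$, let $\mathcal N_E$ be the set of nodes on $\partial E$, $\mathcal E_E$ the set of edges of $E$ (the segments of $\partial E$ between consecutive nodes of $\mathcal N_E$), $h_E=|E|^{1/2}$, and assume $\mathcal D$ is constant, equal to $(A_E,c_E,f_E)$, in each $E\in\mathcal T$. *Discrete spaces.* For each $E\in\mathcal T$ let $\mathbb V_E\subset C^0(E)\cap H^1(E)$ be a linear space with $\dim\mathbb V_E=|\mathcal N_E|$, $\mathbb P_1(E)\subseteq\mathbb V_E$, whose traces on $\partial E$ are exactly the continuous functions on $\partial E$ that are affine on every $e\in\mathcal E_E$. Put $s_E(v,w)=\sum_{x\in\mathcal N_E}v(x)w(x)$ and assume, for constants $C_s\ge c_s>0$ independent of $E$ and $\mathcal T$, that $c_s|v|_{1,E}^2\le s_E(v,v)\le C_s|v|_{1,E}^2$ for all $v\in\mathbb V_E$ with $\sum_{x\in\mathcal N_E}v(x)=0$. Let $\mathbb V_{\mathcal T}=\{v\in H^1_0(\Omega): v|_E\in\mathbb V_E\ \forall E\in\mathcal T\}$. Let $\Pi^\nabla_Ev\in\mathbb P_1(E)$ be given by $\int_E\nabla(v-\Pi^\nabla_Ev)\cdot\nabla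 w=0$ for all $w\in\mathbb P_1(E)$ and $\int_{\partial E}(v-\Pi^\nabla_Ev)=0$; let $\mathcal I_Ev\in\mathbb P_1(E)$ interpolate $v$ at the three vertices of $E$; and put $S_{\mathcal T}(v,w)=\sum_{E\in\mathcal T}s_E(v-\mathcal I_Ev,\,w-\mathcal I_Ew)$. For $\gamma>0$ let $u_{\mathcal T}\in\mathbb V_{\mathcal T}$ satisfy, for all $v\in\mathbb V_{\mathcal T}$, $$\sum_{E\in\mathcal T}\int_EA_E\nabla\Pi^\nabla_Eu_{\mathcal T}\cdot\nabla\Pi^\nabla_Ev+\gamma S_{\mathcal T}(u_{\mathcal T},v)+\sum_{E\in\mathcal T}c_E\int_E\Pi^\nabla_Eu_{\mathcal T}\,\Pi^\nabla_Ev=\sum_{E\in\mathcal T}f_E\int_E\Pi^\nabla_Ev .$$ *Estimator.* Let $$\eta^2_{\mathcal T}(u_{\mathcal T},\mathcal D)=\sum_{E\in\mathcal T}\Big(h_E^2\|f_E-c_E\Pi^\nabla_Eu_{\mathcal T}\|_{0,E}^2+\tfrac12\sum_{e\in\mathcal E_E}h_E\|j_e\|_{0,e}^2\Big),$$ where $j_e=0$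 if $e\subset\partial\Omega$, and otherwise $j_e=A_{E_1}\nabla\Pi^\nabla_{E_1}u_{\mathcal T}\cdot n_1+A_{E_2}\nabla\Pi^\nabla_{E_2}u_{\mathcal T}\cdot n_2$ for the two elements $E_1,E_2$ having $e$ as an edge, $n_i$ being the unit normal to $e$ outward with respect to $E_i$. **Proposition 4.1 (upper bound).** There is a constant $C_{apost}>0$, depending only on $\mathcal T_0$ (hence $\Omega$), $\Lambda$, $\mathcal D$ and the stability constants $c_s,C_s$, but independent of $u$, $\mathcal T$, the spaces $\mathbb V_E$, $u_{\mathcal T}$ and $\gamma$, such that for every $\Lambda$-admissible $\mathcal T$ as above $$|u-u_{\mathcal T}|_{1,\Omega}^2\le C_{apost}\big(\eta^2_{\mathcal T}(u_{\mathcal T},\mathcal D)+S_{\mathcal T}(u_{\mathcal T},u_{\mathcal T})\big).$$ -/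

import Mathlib

open MeasureTheory Filter Topology

namespace VEM

noncomputable section

/-- The Euclidean plane. -/
abbrev Plane : Type := EuclideanSpace ℝ (Fin 2)

/-! ### Sobolev spaces on subsets of the plane -/

/-- `φ` is a test function in `C_c^∞(U)`. -/
def IsTestFunction (U : Set Plane) (φ : Plane → ℝ) : Prop :=
  ContDiff ℝ (⊤ : ℕ∞) φ ∧ HasCompactSupport φ ∧ tsupport φ ⊆ U

/-- `g ∈ L²(U)²` is the weak gradient of `v` on the open set `U`. -/
def IsWeakGrad (U : Set Plane) (v : Plane → ℝ) (g : Plane → Plane) : Prop :=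
  MemLp g 2 (volume.restrict U) ∧
    ∀ φ : Plane → ℝ, IsTestFunction U φ → ∀ w : Plane,
      ∫ x in U, v x * fderiv ℝ φ x w = - ∫ x in U, inner ℝ (g x) w * φ x

/-- `v ∈ H¹(U)`. -/
def MemH1 (U : Set Plane) (v : Plane → ℝ) : Prop :=
  MemLp v 2 (volume.restrict U) ∧ ∃ g, IsWeakGrad U v g

/-- The weak gradient on `U` (a.e. unique for `v ∈ H¹(U)`, and never used for other `v`). -/
def weakGrad (U : Set Plane) (v : Plane → ℝ) : Plane → Plane :=
  Classical.epsilon (IsWeakGrad U v)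

/-- `v ∈ H¹₀(U)`: the closure of `C_c^∞(U)` in `H¹(U)`. -/
def MemH10 (U : Set Plane) (v : Plane → ℝ) : Prop :=
  MemH1 U v ∧ ∃ φ : ℕ → Plane → ℝ, (∀ n, IsTestFunction U (φ n)) ∧
    Tendsto (fun n => eLpNorm (fun x => v x - φ n x) 2 (volume.restrict U)) atTop (𝓝 0) ∧
    Tendsto (fun n => eLpNorm (fun x => weakGrad U v x - gradient (φ n) x) 2
      (volume.restrict U)) atTop (𝓝 0)

/-- The squared seminorm `|v|²_{1,U}`. -/
def h1SemiSq (U : Set Plane) (v : Plane → ℝ) : ℝ :=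
  ∫ x in U, ‖weakGrad U v x‖ ^ 2

/-! ### The boundary value problem -/

/-- The data `(A, c, f)` of `-∇·(A∇u) + cu = f`. -/
structure ProblemData where
  A : Plane → Matrix (Fin 2) (Fin 2) ℝ
  c : Plane → ℝ
  f : Plane → ℝ

/-- `A ∈ L^∞(Ω)^{2×2}` symmetric and uniformly positive definite, `0 ≤ c ∈ L^∞(Ω)`,
`f ∈ L²(Ω)`. -/
structure ProblemData.IsValid (D : ProblemData) (Ω : Set Plane) : Prop where
  A_bdd : ∀ i j, MemLp (fun x => D.A x i j) ⊤ (volume.restrict Ω)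
  A_symm : ∀ᵐ x ∂(volume.restrict Ω), (D.A x).IsSymm
  A_pos : ∃ α : ℝ, 0 < α ∧ ∀ᵐ x ∂(volume.restrict Ω), ∀ ξ : Plane,
    α * ‖ξ‖ ^ 2 ≤ inner ℝ (Matrix.toEuclideanLin (D.A x) ξ) ξ
  c_bdd : MemLp D.c ⊤ (volume.restrict Ω)
  c_nonneg : ∀ᵐ x ∂(volume.restrict Ω), 0 ≤ D.c x
  f_sq : MemLp D.f 2 (volume.restrict Ω)

/-- `u ∈ H¹₀(Ω)` and `a(u,v) + m(u,v) = (f,v)_Ω` for all `v ∈ H¹₀(Ω)`. -/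
def IsWeakSolution (Ω : Set Plane) (D : ProblemData) (u : Plane → ℝ) : Prop :=
  MemH10 Ω u ∧ ∀ v, MemH10 Ω v →
    (∫ x in Ω, inner ℝ (Matrix.toEuclideanLin (D.A x) (weakGrad Ω u x)) (weakGrad Ω v x))
      + (∫ x in Ω, D.c x * u x * v x) = ∫ x in Ω, D.f x * v x

/-! ### Triangles, partitions and newest-vertex bisection -/

/-- A triangle with a distinguished newest vertex `vert 0`; its refinement edge is the opposite
side, with endpoints `vert 1` and `vert 2`. -/
@[ext] structure Tri where
  vert : Fin 3 → Plane

namespace Tri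

/-- The closed triangle. -/
def carrier (E : Tri) : Set Plane := convexHull ℝ (Set.range E.vert)

/-- The midpoint of the refinement edge. -/
def mid (E : Tri) : Plane := midpoint ℝ (E.vert 1) (E.vert 2)

/-- The two children of a newest-vertex bisection; their newest vertex is the midpoint. -/
def child₁ (E : Tri) : Tri := ⟨![E.mid, E.vert 0, E.vert 1]⟩

def child₂ (E : Tri) : Tri := ⟨![E.mid, E.vert 0, E.vert 2]⟩

def barycenter (E : Tri) : Plane := (3 : ℝ)⁻¹ • ∑ i, E.vert i

/-- The element size `h_E = |E|^{1/2}`. -/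
def h (E : Tri) : ℝ := Real.sqrt (volume.real E.carrier)

/-- The integral of `v` over `∂E` with respect to arc length. -/
def bdryIntegral (E : Tri) (v : Plane → ℝ) : ℝ :=
  ∑ i : Fin 3, dist (E.vert i) (E.vert (i + 1)) *
    ∫ t in (0 : ℝ)..1, v (AffineMap.lineMap (E.vert i) (E.vert (i + 1)) t)

end Tri

/-- A finite conforming family of nondegenerate triangles: any two distinct triangles have
disjoint interiors, and meet in a common vertex, in a common side or not at all. -/
structure IsConforming (T : Finset Tri) : Prop where
  nondegenerate : ∀ E ∈ T, AffineIndependent ℝ E.vert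
  disjoint : ∀ E ∈ T, ∀ E' ∈ T, E ≠ E' → Disjoint (interior E.carrier) (interior E'.carrier)
  conforming : ∀ E ∈ T, ∀ E' ∈ T,
    E.carrier ∩ E'.carrier = convexHull ℝ (Set.range E.vert ∩ Set.range E'.vert)

/-- The polygonal domain triangulated by `T`: the interior of the union of the triangles. -/
def domain (T : Finset Tri) : Set Plane := interior (⋃ E ∈ T, E.carrier)

open scoped Classical in
/-- `T` arises from `T₀` by finitely many successive newest-vertex bisections of elements. -/
inductive IsRefinement (T₀ : Finset Tri) : Finset Tri → Prop
  | refl : IsRefinement T₀ T₀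
  | bisect {T : Finset Tri} {E : Tri} (hT : IsRefinement T₀ T) (hE : E ∈ T) :
      IsRefinement T₀ (T.erase E ∪ {E.child₁, E.child₂})

/-- Membership in the infinite binary forest of all triangles obtained from `T₀` by newest-vertex
bisection. -/
inductive InForest (T₀ : Finset Tri) : Tri → Prop
  | root {E : Tri} (hE : E ∈ T₀) : InForest T₀ E
  | left {E : Tri} (hE : InForest T₀ E) : InForest T₀ E.child₁
  | right {E : Tri} (hE : InForest T₀ E) : InForest T₀ E.child₂

open scoped Classical in
/-- The set of nodes: all vertices of all triangles. -/
def nodes (T : Finset Tri) : Finset Plane := T.biUnion fun E => Finset.univ.image E.vert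

/-- A node is proper if it is a vertex of all triangles containing it, and hanging otherwise. -/
def IsProperNode (T : Finset Tri) (z : Plane) : Prop :=
  z ∈ nodes T ∧ ∀ E ∈ T, z ∈ E.carrier → z ∈ Set.range E.vert

/-- `HasIndex T₀ T x k`: the node `x` of `T` has global index `k`. Proper nodes have index `0`; a
hanging node `x` is the midpoint of the bisected edge `[x', x'']` of some triangle of the
bisection forest, and has index `max (λ x') (λ x'') + 1`. (The edge `[x', x'']` is determined by
`x`.) -/
inductive HasIndex (T₀ T : Finset Tri) : Plane → ℕ → Prop
  | proper {x : Plane} (hx : IsProperNode T x) : HasIndex T₀ T x 0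
  | hanging {P : Tri} {i j : ℕ} (hP : InForest T₀ P) (hn : P.mid ∈ nodes T)
      (hx : ¬ IsProperNode T P.mid) (h₁ : HasIndex T₀ T (P.vert 1) i)
      (h₂ : HasIndex T₀ T (P.vert 2) j) : HasIndex T₀ T P.mid (max i j + 1)

/-- `Λ`-admissibility: all global indices are at most `Λ`. -/
def IsAdmissible (T₀ T : Finset Tri) (Λ : ℕ) : Prop :=
  ∀ x ∈ nodes T, ∃ k ≤ Λ, HasIndex T₀ T x k

/-- The data are constant in (the interior of) each element of `T`; the value on `E` is the value
at the barycenter of `E`. -/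
def ProblemData.PiecewiseConstant (D : ProblemData) (T : Finset Tri) : Prop :=
  ∀ E ∈ T, ∀ x ∈ interior E.carrier,
    D.A x = D.A E.barycenter ∧ D.c x = D.c E.barycenter ∧ D.f x = D.f E.barycenter

open scoped Classical in
/-- `𝒩_E`: the nodes of `T` on the boundary of `E`, hanging ones included. -/
def nodesOn (T : Finset Tri) (E : Tri) : Finset Plane :=
  (nodes T).filter fun z => z ∈ frontier E.carrier

open scoped Classical in
/-- `ℰ_E`: the edges of `E` seen as a polygon with vertices `𝒩_E`, that is, the segments in `∂E`
between two consecutive nodes. -/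
def edges (T : Finset Tri) (E : Tri) : Finset (Set Plane) :=
  ((nodesOn T E ×ˢ nodesOn T E).filter fun p =>
      p.1 ≠ p.2 ∧ segment ℝ p.1 p.2 ⊆ frontier E.carrier ∧
        ∀ z ∈ nodesOn T E, z ∉ openSegment ℝ p.1 p.2).image fun p => segment ℝ p.1 p.2

/-! ### Affine functions, projection and interpolation -/

/-- A polynomial `x ↦ b + g · x` of degree at most one on the plane. -/
structure P1 where
  b : ℝ
  g : Plane

instance : Nonempty P1 := ⟨⟨0, 0⟩⟩

def P1.eval (p : P1) (x : Plane) : ℝ := p.b + inner ℝ p.g x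

/-- The defining conditions of `p = Π^∇_E v`: `(∇(v - p), ∇w)_E = 0` for all `w ∈ ℙ₁`, and
`∫_{∂E} (v - p) = 0`. -/
def IsPiNabla (E : Tri) (v : Plane → ℝ) (p : P1) : Prop :=
  (∀ w : P1, ∫ x in interior E.carrier,
      inner ℝ (weakGrad (interior E.carrier) v x - p.g) w.g = 0) ∧
    E.bdryIntegral (fun x => v x - p.eval x) = 0

/-- The projector `Π^∇_E` onto `ℙ₁`, for functions in `H¹(E) ∩ C⁰(E)`. -/
def piNabla (E : Tri) (v : Plane → ℝ) : P1 := Classical.epsilon (IsPiNabla E v)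

/-- The Lagrange interpolation operator `ℐ_E` at the three vertices of `E`. -/
def lagrange (E : Tri) (v : Plane → ℝ) : P1 :=
  Classical.epsilon fun p : P1 => ∀ i, p.eval (E.vert i) = v (E.vert i)

/-! ### Virtual element spaces

A function on the closed triangle `E` is represented by its extension by zero to the plane, so the
restriction `v|_E` of a function `v` on the plane is `E.carrier.indicator v`. -/

/-- The form `s_E(v,w) = ∑_{x ∈ 𝒩_E} v(x) w(x)`. -/
def sE (T : Finset Tri) (E : Tri) (v w : Plane → ℝ) : ℝ := ∑ x ∈ nodesOn T E, v x * w x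

/-- `g` is continuous on `∂E` and affine on every edge of `E`, i.e. its restriction to `∂E` lies
in `𝕍_{∂E}`. -/
def MemVBdry (T : Finset Tri) (E : Tri) (g : Plane → ℝ) : Prop :=
  ContinuousOn g (frontier E.carrier) ∧ ∀ e ∈ edges T E, ∃ p : P1, ∀ x ∈ e, g x = p.eval x

/-- `V` is a local virtual element space `𝕍_E ⊂ C⁰(E) ∩ H¹(E)` with `dim 𝕍_E = |𝒩_E|`,
`ℙ₁(E) ⊆ 𝕍_E` and trace space `𝕍_{∂E}`. -/
structure IsLocalSpace (T : Finset Tri) (E : Tri) (V : Submodule ℝ (Plane → ℝ)) : Prop where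
  zero_off : ∀ v ∈ V, ∀ x ∉ E.carrier, v x = 0
  continuousOn : ∀ v ∈ V, ContinuousOn v E.carrier
  memH1 : ∀ v ∈ V, MemH1 (interior E.carrier) v
  finrank_eq : Module.finrank ℝ V = (nodesOn T E).card
  affine_mem : ∀ p : P1, E.carrier.indicator p.eval ∈ V
  trace_mem : ∀ v ∈ V, MemVBdry T E v
  trace_surj : ∀ g, MemVBdry T E g → ∃ v ∈ V, ∀ x ∈ frontier E.carrier, v x = g x

/-- The stability condition `c_s |v|²_{1,E} ≤ s_E(v,v) ≤ C_s |v|²_{1,E}` on `𝕍_E / ℝ`, where each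
class modulo constants is represented by its element with `s_E(v,1) = 0`. -/
def IsStable (T : Finset Tri) (E : Tri) (cs Cs : ℝ) (V : Submodule ℝ (Plane → ℝ)) : Prop :=
  ∀ v ∈ V, ∑ x ∈ nodesOn T E, v x = 0 →
    cs * h1SemiSq (interior E.carrier) v ≤ sE T E v v ∧
      sE T E v v ≤ Cs * h1SemiSq (interior E.carrier) v

/-- `v ∈ 𝕍_𝒯`: `v ∈ H¹₀(Ω)` and `v|_E ∈ 𝕍_E` for all elements `E`. -/
def MemVT (Ω : Set Plane) (T : Finset Tri) (V : Tri → Submodule ℝ (Plane → ℝ))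
    (v : Plane → ℝ) : Prop :=
  MemH10 Ω v ∧ ∀ E ∈ T, E.carrier.indicator v ∈ V E

/-! ### The discrete problem -/

def aT (D : ProblemData) (T : Finset Tri) (v w : Plane → ℝ) : ℝ :=
  ∑ E ∈ T, ∫ _x in E.carrier,
    inner ℝ (Matrix.toEuclideanLin (D.A E.barycenter) (piNabla E v).g) (piNabla E w).g

def mT (D : ProblemData) (T : Finset Tri) (v w : Plane → ℝ) : ℝ :=
  ∑ E ∈ T, D.c E.barycenter * ∫ x in E.carrier, (piNabla E v).eval x * (piNabla E w).eval x

/-- `S_E(v,w) = s_E(v - ℐ_E v, w - ℐ_E w)`. -/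
def SE (T : Finset Tri) (E : Tri) (v w : Plane → ℝ) : ℝ :=
  sE T E (fun x => v x - (lagrange E v).eval x) (fun x => w x - (lagrange E w).eval x)

/-- The global stabilization form `S_𝒯`. -/
def ST (T : Finset Tri) (v w : Plane → ℝ) : ℝ := ∑ E ∈ T, SE T E v w

/-- The discrete load. -/
def FT (D : ProblemData) (T : Finset Tri) (v : Plane → ℝ) : ℝ :=
  ∑ E ∈ T, D.f E.barycenter * ∫ x in E.carrier, (piNabla E v).eval x

/-- `uT ∈ 𝕍_𝒯` solves `a_𝒯(uT,v) + γ S_𝒯(uT,v) + m_𝒯(uT,v) = ℱ_𝒯(v)` for all `v ∈ 𝕍_𝒯`. -/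
def IsGalerkinSolution (Ω : Set Plane) (D : ProblemData) (T : Finset Tri)
    (V : Tri → Submodule ℝ (Plane → ℝ)) (γ : ℝ) (uT : Plane → ℝ) : Prop :=
  MemVT Ω T V uT ∧ ∀ v, MemVT Ω T V v →
    aT D T uT v + γ * ST T uT v + mT D T uT v = FT D T v

/-! ### The residual estimator -/

/-- `n` is the unit normal to the edge `e` of `E` pointing outward with respect to `E`. -/
def IsOutwardNormal (E : Tri) (e : Set Plane) (n : Plane) : Prop :=
  ‖n‖ = 1 ∧ ∀ x ∈ e, ∀ y ∈ E.carrier, inner ℝ n (y - x) ≤ 0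

def outwardNormal (E : Tri) (e : Set Plane) : Plane := Classical.epsilon (IsOutwardNormal E e)

open scoped Classical in
/-- The jump residual `j_𝒯(e; v, D)`, a constant on each edge: zero on edges in `∂Ω`, and
otherwise the sum of `A_E ∇Π^∇_E v · n_E` over the two elements `E` that have `e` as an edge. -/
def jump (Ω : Set Plane) (D : ProblemData) (T : Finset Tri) (v : Plane → ℝ) (e : Set Plane) : ℝ :=
  if e ⊆ frontier Ω then 0
  else ∑ E ∈ T with e ∈ edges T E,
    inner ℝ (Matrix.toEuclideanLin (D.A E.barycenter) (piNabla E v).g) (outwardNormal E e)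

/-- The squared local estimator `h_E² ‖r‖²_{0,E} + ½ ∑_e h_E ‖j‖²_{0,e}`, where
`r = f_E - c_E Π^∇_E v`. As `j` is constant on the segment `e`, `‖j‖²_{0,e} = |e| j²`. -/
def etaSqLocal (Ω : Set Plane) (D : ProblemData) (T : Finset Tri) (v : Plane → ℝ) (E : Tri) : ℝ :=
  E.h ^ 2 * (∫ x in E.carrier,
      (D.f E.barycenter - D.c E.barycenter * (piNabla E v).eval x) ^ 2)
    + (1 / 2 : ℝ) * ∑ e ∈ edges T E, E.h * (Metric.diam e * jump Ω D T v e ^ 2)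

/-- The squared global estimator `η_𝒯²(v, D)`. -/
def etaSq (Ω : Set Plane) (D : ProblemData) (T : Finset Tri) (v : Plane → ℝ) : ℝ :=
  ∑ E ∈ T, etaSqLocal Ω D T v E

end

end VEM

/-! Let e = u - u_T. Since A is coercive and c ≥ 0, it suffices to bound the residual ∫ A∇e·∇φ + ∫ c
e φ for smooth φ with compact support in Ω, because e is an H¹ limit of such functions. The bound is
kept in the form t (η² + S_T(u_T,u_T)) + (K/t) ‖∇φ‖² for every t > 0. In this form it can be summed
over elements and it survives the limit φ → e; one choice of t then absorbs half of the coercive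
term (`error_le_of_residual_le`).

The discrete equation is tested with a function v that is continuous, affine on every element and
zero off Ω. On such v both local operators are the identity, so S_T(u_T,v) = 0: the parameter γ
disappears and only the projection Πu_T remains. Subtraction from the weak equation
(`residual_identity`) leaves three groups of terms. The element residuals f - cΠu_T act on φ - v.
The fluxes A∇Πu_T act on ∇(φ - v) and become, by the divergence theorem, jumps acting on the traces
of φ - v (`abs_sum_flux_le`). Finally there is the discrepancy between u_T and Πu_T: its gradient is
controlled by S_T, because ∇Πu_T is the best constant approximation of ∇u_T and the stability
condition applies (`stab_bound`); its L² norm follows from a Poincaré inequality for functions of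
vanishing mean over ∂E.

The heart is the construction of v, a quasi-interpolant of φ on a mesh with hanging nodes. Proper
nodes in Ω receive averages of φ over balls of the local mesh size, nodes off Ω receive zero, and a
hanging node receives the mean of the two values at the ends of the bisected edge that created it.
Continuity rests on `refinement_edge_subset_side`: if the midpoint of a bisected edge lies inside a
side of an element, the whole edge lies in that side, since edges on a common ancestral side are
dyadic subintervals, and these are nested or have disjoint interiors. Hence nodal values are affine
along each side.

The same fact places a node of index k at a multiple of 2^(-k) along any side containing it. In a
Λ-admissible mesh, elements with two common points therefore have comparable sizes; the star of an
interior point is connected and has boundedly many members, so all its elements have comparable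
sizes (`exists_star_constant`). Shape regularity is exact: bisection preserves the ratio of `q` to
|`det`|.

The approximation estimate is pointwise. For y and a node z in an element E, |φ(y) - v(z)| is at
most a constant times the size of E times the Hardy–Littlewood maximal function of |∇φ| at y
(`exists_nodal_constant`); the proof is an induction on the index, with at most Λ levels. Hence |φ -
v| and |∇v| are bounded at each point of E by the maximal function at that same point, and its L²
bound (`lintegral_maximal_sq`) allows summation over elements without counting overlaps of patches
(`exists_quasi_constant`). The Friedrichs inequality comes from the same tools. -/

open MeasureTheory Filter Topology

namespace VEM

noncomputable section

/-! ### Barycentric coordinates of a triangle -/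

namespace Tri

/-- The vertices of `E` are affinely independent. -/
abbrev Nondeg (E : Tri) : Prop := AffineIndependent ℝ E.vert

/-- The affine basis formed by the vertices of a nondegenerate triangle. -/
def basis (E : Tri) (hE : E.Nondeg) : AffineBasis (Fin 3) ℝ Plane :=
  ⟨E.vert, hE, by
    rw [hE.affineSpan_eq_top_iff_card_eq_finrank_add_one]; simp⟩

open scoped Classical in
/-- The barycentric coordinates with respect to the vertices. -/
def lam (E : Tri) (i : Fin 3) : Plane →ᵃ[ℝ] ℝ :=
  -- The default value 0 for degenerate triangles makes `lam` depend on the triangle alone, with no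
  -- proof argument.
  if hE : E.Nondeg then (E.basis hE).coord i else AffineMap.const ℝ Plane 0

variable {E : Tri}

theorem lam_eq (hE : E.Nondeg) (i : Fin 3) : E.lam i = (E.basis hE).coord i := by
  simp [lam, hE]

theorem sum_lam (hE : E.Nondeg) (x : Plane) : ∑ i, E.lam i x = 1 := by
  simp only [lam_eq hE]; exact (E.basis hE).sum_coord_apply_eq_one x

theorem sum_lam' (hE : E.Nondeg) (x : Plane) : E.lam 0 x + E.lam 1 x + E.lam 2 x = 1 := by
  simpa [Fin.sum_univ_three] using sum_lam hE x

theorem sum_lam_distinct (hE : E.Nondeg) (x : Plane) {i j k : Fin 3} (hij : i ≠ j) (hik : k ≠ i)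
    (hjk : k ≠ j) : E.lam i x + E.lam j x + E.lam k x = 1 := by
  have h := sum_lam' hE x
  fin_cases i <;> fin_cases j <;> fin_cases k <;> first | (exact absurd rfl ‹_›) | skip
  all_goals (simp only [Fin.zero_eta, Fin.mk_one, Fin.reduceFinMk]; linarith)

theorem comb_lam (hE : E.Nondeg) (x : Plane) : ∑ i, E.lam i x • E.vert i = x := by
  simp only [lam_eq hE]; exact (E.basis hE).linear_combination_coord_eq_self x

theorem lam_vert (hE : E.Nondeg) (i j : Fin 3) : E.lam i (E.vert j) = if i = j then 1 else 0 := by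
  rw [lam_eq hE]; exact (E.basis hE).coord_apply i j

theorem lam_vert_self (hE : E.Nondeg) (i : Fin 3) : E.lam i (E.vert i) = 1 := by
  simp [lam_vert hE]

theorem lam_vert_ne (hE : E.Nondeg) {i j : Fin 3} (h : i ≠ j) : E.lam i (E.vert j) = 0 := by
  simp [lam_vert hE, h]

theorem ext_lam (hE : E.Nondeg) {x y : Plane} (h : ∀ i, E.lam i x = E.lam i y) : x = y := by
  rw [← comb_lam hE x, ← comb_lam hE y]; simp [h]

theorem carrier_eq (hE : E.Nondeg) : E.carrier = {x | ∀ i, 0 ≤ E.lam i x} := by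
  simp only [lam_eq hE]; exact (E.basis hE).convexHull_eq_nonneg_coord

theorem interior_eq (hE : E.Nondeg) : interior E.carrier = {x | ∀ i, 0 < E.lam i x} := by
  simp only [lam_eq hE]; exact (E.basis hE).interior_convexHull

theorem mem_carrier (hE : E.Nondeg) {x : Plane} : x ∈ E.carrier ↔ ∀ i, 0 ≤ E.lam i x := by
  rw [carrier_eq hE]; rfl

theorem mem_interior (hE : E.Nondeg) {x : Plane} :
    x ∈ interior E.carrier ↔ ∀ i, 0 < E.lam i x := by
  rw [interior_eq hE]; rfl

theorem continuous_lam (E : Tri) (i : Fin 3) : Continuous (E.lam i) :=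
  (E.lam i).continuous_of_finiteDimensional

theorem convex_carrier (E : Tri) : Convex ℝ E.carrier := convex_convexHull _ _

theorem isCompact_carrier (E : Tri) : IsCompact E.carrier :=
  (Set.finite_range E.vert).isCompact_convexHull ℝ

theorem isClosed_carrier (E : Tri) : IsClosed E.carrier := E.isCompact_carrier.isClosed

theorem vert_mem (E : Tri) (i : Fin 3) : E.vert i ∈ E.carrier :=
  subset_convexHull _ _ (Set.mem_range_self i)

theorem lam_le_one (hE : E.Nondeg) {x : Plane} (hx : x ∈ E.carrier) (i : Fin 3) :
    E.lam i x ≤ 1 := by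
  have h := sum_lam' hE x
  have h' := (mem_carrier hE).1 hx
  have h0 := h' 0; have h1 := h' 1; have h2 := h' 2
  fin_cases i <;> simp only [Fin.zero_eta, Fin.mk_one, Fin.reduceFinMk] <;> linarith

theorem lam_lineMap (E : Tri) (i : Fin 3) (x y : Plane) (t : ℝ) :
    E.lam i (AffineMap.lineMap x y t) = (1 - t) * E.lam i x + t * E.lam i y := by
  rw [AffineMap.apply_lineMap, AffineMap.lineMap_apply_ring]

theorem lam_midpoint (E : Tri) (i : Fin 3) (x y : Plane) :
    E.lam i (midpoint ℝ x y) = (E.lam i x + E.lam i y) / 2 := by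
  rw [midpoint, lam_lineMap]; norm_num; ring

theorem lam_combo (E : Tri) (w : Fin 3 → ℝ) (hw : ∑ i, w i = 1) (p : Fin 3 → Plane)
    (i : Fin 3) : E.lam i (∑ j, w j • p j) = ∑ j, w j * E.lam i (p j) := by
  have := (Finset.univ : Finset (Fin 3)).map_affineCombination p w hw (E.lam i)
  rw [Finset.affineCombination_eq_linear_combination _ _ _ hw,
    Finset.affineCombination_eq_linear_combination _ _ _ hw] at this
  simpa using this

theorem lam_unique (hE : E.Nondeg) (w : Fin 3 → ℝ) (hw : ∑ i, w i = 1) (i : Fin 3) :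
    E.lam i (∑ j, w j • E.vert j) = w i := by
  rw [lam_combo E w hw]; simp [lam_vert hE]

theorem exists_other (k : Fin 3) : ∃ i j : Fin 3, i ≠ j ∧ k ≠ i ∧ k ≠ j := by
  revert k; decide

theorem exists_third (i j : Fin 3) (h : i ≠ j) : ∃ k : Fin 3, k ≠ i ∧ k ≠ j ∧
    ∀ m, m = i ∨ m = j ∨ m = k := by
  revert i j; decide

theorem eq_of_distinct {i j k : Fin 3} (hij : i ≠ j) (hik : k ≠ i) (hjk : k ≠ j) (m : Fin 3) :
    m = i ∨ m = j ∨ m = k := by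
  revert i j k m; decide

theorem frontier_eq (E : Tri) : frontier E.carrier = E.carrier \ interior E.carrier :=
  E.isClosed_carrier.frontier_eq

theorem exists_lam_eq_zero (hE : E.Nondeg) {x : Plane} (hx : x ∈ E.carrier)
    (h : x ∉ interior E.carrier) : ∃ k, E.lam k x = 0 := by
  rw [mem_interior hE] at h; push Not at h
  obtain ⟨k, hk⟩ := h
  exact ⟨k, le_antisymm hk ((mem_carrier hE).1 hx k)⟩

/-- Sides are handled throughout as the zero sets of the opposite barycentric coordinate; this is
the translation. -/
theorem mem_segment_iff (hE : E.Nondeg) {i j k : Fin 3} (hij : i ≠ j) (hik : k ≠ i) (hjk : k ≠ j)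
    {x : Plane} : x ∈ segment ℝ (E.vert i) (E.vert j) ↔ x ∈ E.carrier ∧ E.lam k x = 0 := by
  constructor
  · intro hx
    refine ⟨E.convex_carrier.segment_subset (E.vert_mem i) (E.vert_mem j) hx, ?_⟩
    rw [segment_eq_image_lineMap] at hx
    obtain ⟨t, -, rfl⟩ := hx
    rw [lam_lineMap, lam_vert_ne hE hik, lam_vert_ne hE hjk]; ring
  · rintro ⟨hx, h0⟩
    have hs := sum_lam_distinct hE x hij hik hjk
    have hi := (mem_carrier hE).1 hx i
    have hj := (mem_carrier hE).1 hx j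
    rw [segment_eq_image_lineMap]
    refine ⟨E.lam j x, ⟨hj, by linarith⟩, ?_⟩
    apply ext_lam hE
    intro m
    rw [lam_lineMap]
    rcases eq_of_distinct hij hik hjk m with rfl | rfl | rfl
    · rw [lam_vert_self hE, lam_vert_ne hE hij]; linarith
    · rw [lam_vert_self hE, lam_vert_ne hE hij.symm]; linarith
    · rw [lam_vert_ne hE hik, lam_vert_ne hE hjk]; linarith

theorem mem_openSegment_iff (hE : E.Nondeg) {i j k : Fin 3} (hij : i ≠ j) (hik : k ≠ i)
    (hjk : k ≠ j) {x : Plane} :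
    x ∈ openSegment ℝ (E.vert i) (E.vert j) ↔ 0 < E.lam i x ∧ 0 < E.lam j x ∧ E.lam k x = 0 := by
  constructor
  · intro hx
    rw [openSegment_eq_image_lineMap] at hx
    obtain ⟨t, ⟨ht0, ht1⟩, rfl⟩ := hx
    simp only [lam_lineMap, lam_vert_ne hE hik, lam_vert_ne hE hjk, lam_vert_self hE,
      lam_vert_ne hE hij, lam_vert_ne hE hij.symm]
    refine ⟨by linarith, by linarith, by ring⟩
  · rintro ⟨hi, hj, h0⟩
    have hs := sum_lam_distinct hE x hij hik hjk
    rw [openSegment_eq_image_lineMap]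
    refine ⟨E.lam j x, ⟨hj, by linarith⟩, ?_⟩
    apply ext_lam hE
    intro m
    rw [lam_lineMap]
    rcases eq_of_distinct hij hik hjk m with rfl | rfl | rfl
    · rw [lam_vert_self hE, lam_vert_ne hE hij]; linarith
    · rw [lam_vert_self hE, lam_vert_ne hE hij.symm]; linarith
    · rw [lam_vert_ne hE hik, lam_vert_ne hE hjk]; linarith

theorem vert_injective (hE : E.Nondeg) : Function.Injective E.vert := hE.injective

theorem eq_vert_of_lam_eq_one (hE : E.Nondeg) {x : Plane} (hx : x ∈ E.carrier) {i : Fin 3}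
    (h : E.lam i x = 1) : x = E.vert i := by
  apply ext_lam hE
  have hs := sum_lam' hE x
  have h' := (mem_carrier hE).1 hx
  have h0 := h' 0; have h1 := h' 1; have h2 := h' 2
  intro m
  fin_cases i <;> fin_cases m <;> simp [lam_vert hE] at h ⊢ <;> linarith

/-- A point of a triangle is an interior point, a vertex, or lies in the relative interior of a
side. -/
theorem cases_of_mem (hE : E.Nondeg) {x : Plane} (hx : x ∈ E.carrier) :
    x ∈ interior E.carrier ∨ x ∈ Set.range E.vert ∨
      ∃ i j, i ≠ j ∧ x ∈ openSegment ℝ (E.vert i) (E.vert j) := by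
  by_cases hint : x ∈ interior E.carrier
  · exact Or.inl hint
  right
  obtain ⟨k, hk⟩ := exists_lam_eq_zero hE hx hint
  obtain ⟨i, j, hij, hik, hjk⟩ := exists_other k
  have hs := sum_lam_distinct hE x hij hik hjk
  rcases ((mem_carrier hE).1 hx i).eq_or_lt with hi | hi
  · exact Or.inl ⟨j, (eq_vert_of_lam_eq_one hE hx (by linarith)).symm⟩
  rcases ((mem_carrier hE).1 hx j).eq_or_lt with hj | hj
  · exact Or.inl ⟨i, (eq_vert_of_lam_eq_one hE hx (by linarith)).symm⟩
  exact Or.inr ⟨i, j, hij, (mem_openSegment_iff hE hij hik hjk).2 ⟨hi, hj, hk⟩⟩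

theorem openSegment_not_interior (hE : E.Nondeg) {i j : Fin 3} (hij : i ≠ j) {x : Plane}
    (hx : x ∈ openSegment ℝ (E.vert i) (E.vert j)) : x ∉ interior E.carrier := by
  obtain ⟨k, hk1, hk2, -⟩ := exists_third i j hij
  intro h
  have := (mem_interior hE).1 h k
  rw [((mem_openSegment_iff hE hij hk1 hk2).1 hx).2.2] at this
  exact lt_irrefl _ this

theorem openSegment_not_vert (hE : E.Nondeg) {i j : Fin 3} (hij : i ≠ j) {x : Plane}
    (hx : x ∈ openSegment ℝ (E.vert i) (E.vert j)) : x ∉ Set.range E.vert := by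
  rintro ⟨m, rfl⟩
  obtain ⟨k, hk1, hk2, -⟩ := exists_third i j hij
  obtain ⟨h1, h2, -⟩ := (mem_openSegment_iff hE hij hk1 hk2).1 hx
  rw [lam_vert hE] at h1 h2
  split_ifs at h1 h2 with a b
  · exact hij (a.trans b.symm)
  all_goals linarith

theorem vert_not_interior (hE : E.Nondeg) (i : Fin 3) : E.vert i ∉ interior E.carrier := by
  intro h
  obtain ⟨j, -, -, hj, -⟩ := exists_other i
  have := (mem_interior hE).1 h j
  rw [lam_vert_ne hE hj.symm] at this
  exact lt_irrefl _ this

theorem interior_nonempty (hE : E.Nondeg) : (interior E.carrier).Nonempty := by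
  refine ⟨∑ i, (3 : ℝ)⁻¹ • E.vert i, ?_⟩
  rw [mem_interior hE]
  intro i
  rw [lam_unique hE (fun _ => (3 : ℝ)⁻¹) (by simp)]; norm_num

theorem closure_interior (hE : E.Nondeg) : closure (interior E.carrier) = E.carrier := by
  rw [E.convex_carrier.closure_interior_eq_closure_of_nonempty_interior (interior_nonempty hE),
    E.isClosed_carrier.closure_eq]

/-- The coordinate of index i is at most 1 on the triangle and equals 1 only at its own vertex, so
an open segment through that vertex must be degenerate. -/
theorem vert_extreme (hE : E.Nondeg) (i : Fin 3) : E.vert i ∈ E.carrier.extremePoints ℝ := by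
  rw [mem_extremePoints]
  refine ⟨E.vert_mem i, fun x hx y hy h => ?_⟩
  rw [openSegment_eq_image_lineMap] at h
  obtain ⟨t, ⟨ht0, ht1⟩, ht⟩ := h
  have h1 := congrArg (E.lam i) ht
  rw [lam_lineMap, lam_vert_self hE] at h1
  have hx1 := lam_le_one hE hx i
  have hy1 := lam_le_one hE hy i
  have ex : E.lam i x = 1 := by nlinarith
  have ey : E.lam i y = 1 := by nlinarith
  exact ⟨eq_vert_of_lam_eq_one hE hx ex, eq_vert_of_lam_eq_one hE hy ey⟩

/-- A vertex of `C` lying in a subtriangle `P` is a vertex of `P`. -/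
theorem vert_of_subset {C P : Tri} (hC : C.Nondeg) (h : P.carrier ⊆ C.carrier) {i : Fin 3}
    (hi : C.vert i ∈ P.carrier) : C.vert i ∈ Set.range P.vert :=
  extremePoints_convexHull_subset
    (inter_extremePoints_subset_extremePoints_of_subset h ⟨hi, vert_extreme hC i⟩)

/-! ### Size and shape -/

/-- The determinant of the edge vectors at the newest vertex. -/
def det (E : Tri) : ℝ :=
  (E.vert 1 0 - E.vert 0 0) * (E.vert 2 1 - E.vert 0 1)
    - (E.vert 1 1 - E.vert 0 1) * (E.vert 2 0 - E.vert 0 0)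

/-- The sum of the squared lengths of the two edges at the newest vertex. -/
def q (E : Tri) : ℝ := dist (E.vert 1) (E.vert 0) ^ 2 + dist (E.vert 2) (E.vert 0) ^ 2

theorem dist_sq (x y : Plane) : dist x y ^ 2 = (x 0 - y 0) ^ 2 + (x 1 - y 1) ^ 2 := by
  rw [EuclideanSpace.dist_eq, Real.sq_sqrt (by positivity)]
  simp [Real.dist_eq, sq_abs]

theorem det_ne_zero_iff : E.det ≠ 0 ↔ E.Nondeg := by
  have key : E.Nondeg ↔ LinearIndependent ℝ ![E.vert 1 - E.vert 0, E.vert 2 - E.vert 0] := by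
    rw [Nondeg, affineIndependent_iff_linearIndependent_vsub ℝ _ (0 : Fin 3)]
    let e : Fin 2 ≃ {x : Fin 3 // x ≠ 0} := finSuccAboveEquiv 0
    rw [← linearIndependent_equiv e]
    apply iff_of_eq; congr 1
    ext i : 1
    fin_cases i <;> rfl
  rw [key, LinearIndependent.pair_iff]
  constructor
  · intro hd s t hst
    have h0 := congrArg (fun v : Plane => v 0) hst
    have h1 := congrArg (fun v : Plane => v 1) hst
    simp at h0 h1
    constructor
    · apply mul_right_cancel₀ hd; rw [det]; linear_combination h0 * (E.vert 2 1 - E.vert 0 1) - h1 * (E.vert 2 0 - E.vert 0 0)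
    · apply mul_right_cancel₀ hd; rw [det]; linear_combination h1 * (E.vert 1 0 - E.vert 0 0) - h0 * (E.vert 1 1 - E.vert 0 1)
  · intro h hd
    rw [det] at hd
    -- With vanishing determinant the cofactors are coefficients of linear relations. Independence
    -- makes all of them zero, hence both edge vectors are zero, and then even the relation with
    -- coefficients 1 and 0 holds.
    have a := h (E.vert 2 1 - E.vert 0 1) (-(E.vert 1 1 - E.vert 0 1)) (by
      ext i; fin_cases i <;> simp <;> linarith)
    have b := h (E.vert 2 0 - E.vert 0 0) (-(E.vert 1 0 - E.vert 0 0)) (by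
      ext i; fin_cases i <;> simp <;> linarith)
    have c := (h 1 0 (by
      ext i; fin_cases i <;> simp <;> linarith [a.1, a.2, b.1, b.2])).1
    exact one_ne_zero c

end Tri

end

end VEM

/-! ### Newest-vertex bisection: children, descendants, shape and size. -/

namespace VEM

noncomputable section

namespace Tri

variable {E : Tri}

theorem midpoint_apply (x y : Plane) (i : Fin 2) : (midpoint ℝ x y) i = (x i + y i) / 2 := by
  rw [midpoint_eq_smul_add]; simp; ring

@[simp] theorem child₁_vert_zero (E : Tri) : E.child₁.vert 0 = E.mid := rfl
@[simp] theorem child₁_vert_one (E : Tri) : E.child₁.vert 1 = E.vert 0 := rfl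
@[simp] theorem child₁_vert_two (E : Tri) : E.child₁.vert 2 = E.vert 1 := rfl
@[simp] theorem child₂_vert_zero (E : Tri) : E.child₂.vert 0 = E.mid := rfl
@[simp] theorem child₂_vert_one (E : Tri) : E.child₂.vert 1 = E.vert 0 := rfl
@[simp] theorem child₂_vert_two (E : Tri) : E.child₂.vert 2 = E.vert 2 := rfl

theorem det_child₁ (E : Tri) : E.child₁.det = E.det / 2 := by
  simp only [det, child₁_vert_zero, child₁_vert_one, child₁_vert_two, mid, midpoint_apply]; ring

theorem det_child₂ (E : Tri) : E.child₂.det = -(E.det / 2) := by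
  simp only [det, child₂_vert_zero, child₂_vert_one, child₂_vert_two, mid, midpoint_apply]; ring

/-- Apollonius' theorem for the median from the newest vertex. Since the determinant is halved in
absolute value as well, the ratio of `q` to |`det`| is invariant under bisection, which is the whole
of shape regularity. -/
theorem q_child₁ (E : Tri) : E.child₁.q = E.q / 2 := by
  simp only [q, dist_sq, child₁_vert_zero, child₁_vert_one, child₁_vert_two, mid, midpoint_apply]
  ring

theorem q_child₂ (E : Tri) : E.child₂.q = E.q / 2 := by
  simp only [q, dist_sq, child₂_vert_zero, child₂_vert_one, child₂_vert_two, mid, midpoint_apply]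
  ring

theorem nondeg_child₁ (hE : E.Nondeg) : E.child₁.Nondeg := by
  rw [← det_ne_zero_iff] at hE ⊢; rw [det_child₁]; exact div_ne_zero hE two_ne_zero

theorem nondeg_child₂ (hE : E.Nondeg) : E.child₂.Nondeg := by
  rw [← det_ne_zero_iff] at hE ⊢; rw [det_child₂]; exact neg_ne_zero.2 (div_ne_zero hE two_ne_zero)

theorem mid_eq (E : Tri) : E.mid = (2 : ℝ)⁻¹ • E.vert 1 + (2 : ℝ)⁻¹ • E.vert 2 := by
  rw [mid, midpoint_eq_smul_add, smul_add]; simp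

/-- Substitute vertex 2 = 2·midpoint - vertex 1 in the barycentric expansion. The child is thus the
half of the triangle where coordinate 2 is at most coordinate 1. -/
theorem lam_child₁ (hE : E.Nondeg) (x : Plane) : E.child₁.lam 0 x = 2 * E.lam 2 x ∧
    E.child₁.lam 1 x = E.lam 0 x ∧ E.child₁.lam 2 x = E.lam 1 x - E.lam 2 x := by
  have hx : x = ∑ j, (![2 * E.lam 2 x, E.lam 0 x, E.lam 1 x - E.lam 2 x] : Fin 3 → ℝ) j •
      E.child₁.vert j := by
    nth_rewrite 1 [← comb_lam hE x]
    simp only [Fin.sum_univ_three, child₁_vert_zero, child₁_vert_one, child₁_vert_two, mid_eq,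
      Matrix.cons_val_zero, Matrix.cons_val_one, Matrix.cons_val]
    module
  have hs : ∑ j, (![2 * E.lam 2 x, E.lam 0 x, E.lam 1 x - E.lam 2 x] : Fin 3 → ℝ) j = 1 := by
    have := sum_lam' hE x
    simp only [Fin.sum_univ_three, Matrix.cons_val_zero, Matrix.cons_val_one, Matrix.cons_val]
    linarith
  have h := lam_unique (nondeg_child₁ hE) _ hs
  rw [← hx] at h
  exact ⟨h 0, h 1, h 2⟩

theorem lam_child₂ (hE : E.Nondeg) (x : Plane) : E.child₂.lam 0 x = 2 * E.lam 1 x ∧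
    E.child₂.lam 1 x = E.lam 0 x ∧ E.child₂.lam 2 x = E.lam 2 x - E.lam 1 x := by
  have hx : x = ∑ j, (![2 * E.lam 1 x, E.lam 0 x, E.lam 2 x - E.lam 1 x] : Fin 3 → ℝ) j •
      E.child₂.vert j := by
    nth_rewrite 1 [← comb_lam hE x]
    simp only [Fin.sum_univ_three, child₂_vert_zero, child₂_vert_one, child₂_vert_two, mid_eq,
      Matrix.cons_val_zero, Matrix.cons_val_one, Matrix.cons_val]
    module
  have hs : ∑ j, (![2 * E.lam 1 x, E.lam 0 x, E.lam 2 x - E.lam 1 x] : Fin 3 → ℝ) j = 1 := by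
    have := sum_lam' hE x
    simp only [Fin.sum_univ_three, Matrix.cons_val_zero, Matrix.cons_val_one, Matrix.cons_val]
    linarith
  have h := lam_unique (nondeg_child₂ hE) _ hs
  rw [← hx] at h
  exact ⟨h 0, h 1, h 2⟩

theorem mem_child₁ (hE : E.Nondeg) {x : Plane} :
    x ∈ E.child₁.carrier ↔ x ∈ E.carrier ∧ E.lam 2 x ≤ E.lam 1 x := by
  obtain ⟨h0, h1, h2⟩ := lam_child₁ hE x
  rw [mem_carrier hE, mem_carrier (nondeg_child₁ hE)]
  simp only [Fin.forall_fin_succ, Fin.succ_zero_eq_one, Fin.succ_one_eq_two, h0, h1, h2,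
    IsEmpty.forall_iff, and_true]
  constructor
  · rintro ⟨a, b, c⟩; exact ⟨⟨by linarith, by linarith, by linarith⟩, by linarith⟩
  · rintro ⟨⟨a, b, c⟩, d⟩; exact ⟨by linarith, by linarith, by linarith⟩

theorem mem_child₂ (hE : E.Nondeg) {x : Plane} :
    x ∈ E.child₂.carrier ↔ x ∈ E.carrier ∧ E.lam 1 x ≤ E.lam 2 x := by
  obtain ⟨h0, h1, h2⟩ := lam_child₂ hE x
  rw [mem_carrier hE, mem_carrier (nondeg_child₂ hE)]
  simp only [Fin.forall_fin_succ, Fin.succ_zero_eq_one, Fin.succ_one_eq_two, h0, h1, h2,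
    IsEmpty.forall_iff, and_true]
  constructor
  · rintro ⟨a, b, c⟩; exact ⟨⟨by linarith, by linarith, by linarith⟩, by linarith⟩
  · rintro ⟨⟨a, b, c⟩, d⟩; exact ⟨by linarith, by linarith, by linarith⟩

theorem carrier_union_children (hE : E.Nondeg) :
    E.child₁.carrier ∪ E.child₂.carrier = E.carrier := by
  ext x
  rw [Set.mem_union, mem_child₁ hE, mem_child₂ hE]
  have := le_total (E.lam 2 x) (E.lam 1 x)
  tauto

theorem child₁_subset (hE : E.Nondeg) : E.child₁.carrier ⊆ E.carrier :=
  fun _ hx => ((mem_child₁ hE).1 hx).1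

theorem child₂_subset (hE : E.Nondeg) : E.child₂.carrier ⊆ E.carrier :=
  fun _ hx => ((mem_child₂ hE).1 hx).1

theorem disjoint_children (hE : E.Nondeg) :
    Disjoint (interior E.child₁.carrier) (interior E.child₂.carrier) := by
  rw [Set.disjoint_left]
  intro x h1 h2
  have a := (mem_interior (nondeg_child₁ hE)).1 h1 2
  have b := (mem_interior (nondeg_child₂ hE)).1 h2 2
  rw [(lam_child₁ hE x).2.2] at a
  rw [(lam_child₂ hE x).2.2] at b
  linarith

/-! ### Descendants -/

/-- `Desc C P`: the triangle `P` is obtained from `C` by finitely many bisections. -/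
inductive Desc (C : Tri) : Tri → Prop
  | refl : Desc C C
  | left {P : Tri} (h : Desc C P) : Desc C P.child₁
  | right {P : Tri} (h : Desc C P) : Desc C P.child₂

theorem Desc.head {C P : Tri} (h : Desc C P) : P = C ∨ Desc C.child₁ P ∨ Desc C.child₂ P := by
  induction h with
  | refl => exact Or.inl rfl
  | left _ ih =>
    rcases ih with rfl | ih | ih
    · exact Or.inr (Or.inl .refl)
    · exact Or.inr (Or.inl ih.left)
    · exact Or.inr (Or.inr ih.left)
  | right _ ih =>
    rcases ih with rfl | ih | ih
    · exact Or.inr (Or.inr .refl)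
    · exact Or.inr (Or.inl ih.right)
    · exact Or.inr (Or.inr ih.right)

theorem Desc.nondeg {C P : Tri} (h : Desc C P) (hC : C.Nondeg) : P.Nondeg := by
  induction h with
  | refl => exact hC
  | left _ ih => exact nondeg_child₁ ih
  | right _ ih => exact nondeg_child₂ ih

theorem Desc.subset {C P : Tri} (h : Desc C P) (hC : C.Nondeg) : P.carrier ⊆ C.carrier := by
  induction h with
  | refl => exact subset_rfl
  | left h ih => exact (child₁_subset (h.nondeg hC)).trans ih
  | right h ih => exact (child₂_subset (h.nondeg hC)).trans ih

theorem Desc.ratio {C P : Tri} (h : Desc C P) {κ : ℝ} (hC : C.q ≤ κ * |C.det|) :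
    P.q ≤ κ * |P.det| := by
  induction h with
  | refl => exact hC
  | left _ ih => rw [q_child₁, det_child₁, abs_div, abs_two]; linarith
  | right _ ih => rw [q_child₂, det_child₂, abs_neg, abs_div, abs_two]; linarith

theorem q_nonneg (E : Tri) : 0 ≤ E.q := by unfold q; positivity

theorem Desc.q_le {C P : Tri} (h : Desc C P) : P.q ≤ C.q := by
  induction h with
  | refl => exact le_rfl
  | @left P _ ih => rw [q_child₁]; linarith [P.q_nonneg]
  | @right P _ ih => rw [q_child₂]; linarith [P.q_nonneg]

/-! ### Sides contained in a side of an ancestor -/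

/-- `{p, r}` are the endpoints of a dyadic subsegment of the segment from `c` to `d`. -/
def IsDyadic (c d p r : Plane) : Prop :=
  ∃ n l : ℕ, (p = AffineMap.lineMap c d ((l : ℝ) / 2 ^ n) ∧
      r = AffineMap.lineMap c d (((l : ℝ) + 1) / 2 ^ n)) ∨
    (r = AffineMap.lineMap c d ((l : ℝ) / 2 ^ n) ∧
      p = AffineMap.lineMap c d (((l : ℝ) + 1) / 2 ^ n))

theorem IsDyadic.symm {c d p r : Plane} (h : IsDyadic c d p r) : IsDyadic c d r p := by
  obtain ⟨n, l, h⟩ := h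
  exact ⟨n, l, h.symm⟩

theorem midpoint_lineMap (c d : Plane) (s t : ℝ) :
    midpoint ℝ (AffineMap.lineMap c d s) (AffineMap.lineMap c d t) =
      AffineMap.lineMap c d ((s + t) / 2) := by
  simp only [midpoint_eq_smul_add, AffineMap.lineMap_apply_module, invOf_eq_inv]
  module

theorem IsDyadic.half {c d p r : Plane} (h : IsDyadic c d p r) :
    IsDyadic c d (midpoint ℝ p r) p := by
  obtain ⟨n, l, ⟨rfl, rfl⟩ | ⟨rfl, rfl⟩⟩ := h
  · refine ⟨n + 1, 2 * l, Or.inr ⟨?_, ?_⟩⟩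
    · congr 1; push_cast; field_simp; ring
    · rw [midpoint_lineMap]; congr 1; push_cast; field_simp; ring
  · refine ⟨n + 1, 2 * l + 1, Or.inl ⟨?_, ?_⟩⟩
    · rw [midpoint_lineMap]; congr 1; push_cast; field_simp; ring
    · congr 1; push_cast; field_simp; ring

/-- No side of a nondegenerate triangle in which a barycentric coordinate of an ancestor vanishes
passes through the interior bisector. -/
theorem not_all_lam_zero {C P : Tri} (hC : C.Nondeg) (hP : P.Nondeg) (k : Fin 3)
    (h : ∀ i, C.lam k (P.vert i) = 0) : False := by
  have hall : ∀ x, C.lam k x = 0 := fun x => by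
    rw [← comb_lam hP x, lam_combo C _ (sum_lam hP x)]; simp [h]
  have := hall (C.vert k)
  rw [lam_vert_self hC] at this
  exact one_ne_zero this

/-- A nonnegative affine function whose mean over two points is zero vanishes at both. -/
theorem lam_zero_of_midpoint {C P : Tri} (hC : C.Nondeg) (hs : P.carrier ⊆ C.carrier) {k : Fin 3}
    (h : C.lam k P.mid = 0) : C.lam k (P.vert 1) = 0 ∧ C.lam k (P.vert 2) = 0 := by
  rw [mid, lam_midpoint] at h
  have h1 := (mem_carrier hC).1 (hs (P.vert_mem 1)) k
  have h2 := (mem_carrier hC).1 (hs (P.vert_mem 2)) k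
  exact ⟨by linarith, by linarith⟩

/-- A side of a descendant of `C` contained in a side of `C` is a dyadic subsegment of it. -/
theorem Desc.isDyadic {C P : Tri} (h : Desc C P) (hC : C.Nondeg) {a b k : Fin 3} (hab : a ≠ b)
    (hka : k ≠ a) (hkb : k ≠ b) : ∀ i j : Fin 3, i ≠ j → C.lam k (P.vert i) = 0 →
      C.lam k (P.vert j) = 0 → IsDyadic (C.vert a) (C.vert b) (P.vert i) (P.vert j) := by
  induction h with
  | refl =>
    intro i j hij hi hj
    have hik : i ≠ k := by rintro rfl; rw [lam_vert_self hC] at hi; exact one_ne_zero hi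
    have hjk : j ≠ k := by rintro rfl; rw [lam_vert_self hC] at hj; exact one_ne_zero hj
    have hi' := eq_of_distinct hab hka hkb i
    have hj' := eq_of_distinct hab hka hkb j
    refine ⟨0, 0, ?_⟩
    rcases hi' with rfl | rfl | h
    · rcases hj' with rfl | rfl | h
      · exact absurd rfl hij
      · left; simp
      · exact absurd h hjk
    · rcases hj' with rfl | rfl | h
      · right; simp
      · exact absurd rfl hij
      · exact absurd h hjk
    · exact absurd h hik
  | @left P h ih =>
    have hP := h.nondeg hC
    have hs := h.subset hC
    -- The bisector is never contained in the ancestral side: its midpoint end would pull in both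
    -- ends of the refinement edge, and all three vertices of the parent would lie on one line. The
    -- other two sides of the child are half of the refinement edge and an old side.
    have h01 : C.lam k P.mid = 0 → C.lam k (P.vert 0) = 0 → False := fun h0 h1 => by
      obtain ⟨h2, h3⟩ := lam_zero_of_midpoint hC hs h0
      exact not_all_lam_zero hC hP k (fun i => by fin_cases i <;> assumption)
    have h02 : C.lam k P.mid = 0 → IsDyadic (C.vert a) (C.vert b) P.mid (P.vert 1) := fun h0 => by
      obtain ⟨h2, h3⟩ := lam_zero_of_midpoint hC hs h0
      exact (ih 1 2 (by decide) h2 h3).half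
    have h12 : C.lam k (P.vert 0) = 0 → C.lam k (P.vert 1) = 0 →
        IsDyadic (C.vert a) (C.vert b) (P.vert 0) (P.vert 1) := fun h0 h1 =>
      ih 0 1 (by decide) h0 h1
    intro i j hij hi hj
    fin_cases i <;> fin_cases j <;> first | exact absurd rfl hij | skip
    · exact (h01 hi hj).elim
    · exact h02 hi
    · exact (h01 hj hi).elim
    · exact h12 hi hj
    · exact (h02 hj).symm
    · exact (h12 hj hi).symm
  | @right P h ih =>
    have hP := h.nondeg hC
    have hs := h.subset hC
    have h01 : C.lam k P.mid = 0 → C.lam k (P.vert 0) = 0 → False := fun h0 h1 => by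
      obtain ⟨h2, h3⟩ := lam_zero_of_midpoint hC hs h0
      exact not_all_lam_zero hC hP k (fun i => by fin_cases i <;> assumption)
    have h02 : C.lam k P.mid = 0 → IsDyadic (C.vert a) (C.vert b) P.mid (P.vert 2) := fun h0 => by
      obtain ⟨h2, h3⟩ := lam_zero_of_midpoint hC hs h0
      have := (ih 2 1 (by decide) h3 h2).half
      rwa [midpoint_comm] at this
    have h12 : C.lam k (P.vert 0) = 0 → C.lam k (P.vert 2) = 0 →
        IsDyadic (C.vert a) (C.vert b) (P.vert 0) (P.vert 2) := fun h0 h1 =>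
      ih 0 2 (by decide) h0 h1
    intro i j hij hi hj
    fin_cases i <;> fin_cases j <;> first | exact absurd rfl hij | skip
    · exact (h01 hi hj).elim
    · exact h02 hi
    · exact (h01 hj hi).elim
    · exact h12 hi hj
    · exact (h02 hj).symm
    · exact (h12 hj hi).symm

/-- If the midpoint of a dyadic segment lies inside another dyadic segment, then so do its
endpoints. -/
theorem IsDyadic.mem_segment {c d p r a b : Plane} (hcd : c ≠ d) (h : IsDyadic c d p r)
    (h' : IsDyadic c d a b) (hm : midpoint ℝ p r ∈ openSegment ℝ a b) :
    p ∈ segment ℝ a b ∧ r ∈ segment ℝ a b := by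
  wlog h1 : ∃ n l : ℕ, p = AffineMap.lineMap c d ((l : ℝ) / 2 ^ n) ∧
      r = AffineMap.lineMap c d (((l : ℝ) + 1) / 2 ^ n) generalizing p r
  · obtain ⟨n, l, g⟩ := h
    rcases g with g | g
    · exact absurd ⟨n, l, g⟩ h1
    · have := this (p := r) (r := p) ⟨n, l, Or.inl g⟩ (by rwa [midpoint_comm]) ⟨n, l, g⟩
      exact this.symm
  wlog h2 : ∃ n l : ℕ, a = AffineMap.lineMap c d ((l : ℝ) / 2 ^ n) ∧
      b = AffineMap.lineMap c d (((l : ℝ) + 1) / 2 ^ n) generalizing a b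
  · obtain ⟨n, l, g⟩ := h'
    rcases g with g | g
    · exact absurd ⟨n, l, g⟩ h2
    · have := this (a := b) (b := a) ⟨n, l, Or.inl g⟩ (by rwa [openSegment_symm]) ⟨n, l, g⟩
      rwa [segment_symm]
  obtain ⟨n, l, rfl, rfl⟩ := h1
  obtain ⟨m, k, rfl, rfl⟩ := h2
  rw [midpoint_lineMap, ← Set.mem_preimage] at hm
  have hinj := AffineMap.lineMap_injective ℝ hcd
  rw [← image_openSegment] at hm
  rw [← image_segment]
  obtain ⟨s, hs, hse⟩ := hm
  have hs' := hinj hse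
  subst hs'
  have hlt : (k : ℝ) / 2 ^ m < (k + 1) / 2 ^ m := by gcongr; linarith
  rw [openSegment_eq_Ioo hlt] at hs
  obtain ⟨hs1, hs2⟩ := hs
  have e : ((l : ℝ) / 2 ^ n + (l + 1) / 2 ^ n) / 2 = (2 * l + 1) / 2 ^ (n + 1) := by
    field_simp; ring
  rw [e, div_lt_div_iff₀ (by positivity) (by positivity)] at hs1 hs2
  have hs1' : k * 2 ^ (n + 1) < (2 * l + 1) * 2 ^ m := by exact_mod_cast hs1
  have hs2' : (2 * l + 1) * 2 ^ m < (k + 1) * 2 ^ (n + 1) := by exact_mod_cast hs2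
  -- The midpoint is a multiple of 2^(-(n+1)). If m > n it would be a multiple of 2^(-m) lying
  -- strictly between two consecutive ones.
  have hmn : m ≤ n := by
    by_contra hc
    push Not at hc
    obtain ⟨j, rfl⟩ := Nat.exists_eq_add_of_le (Nat.succ_le_of_lt hc)
    rw [Nat.succ_eq_add_one, pow_add (2 : ℕ) (n + 1) j, ← mul_assoc] at hs1' hs2'
    rw [mul_right_comm] at hs1' hs2'
    have a1 := Nat.lt_of_mul_lt_mul_right hs1'
    have a2 := Nat.lt_of_mul_lt_mul_right hs2'
    omega
  obtain ⟨j, rfl⟩ := Nat.exists_eq_add_of_le hmn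
  have e2 : (2 : ℕ) ^ (m + j + 1) = 2 ^ m * (2 * 2 ^ j) := by ring
  rw [e2] at hs1' hs2'
  have b1 : k * (2 * 2 ^ j) < 2 * l + 1 := by
    apply Nat.lt_of_mul_lt_mul_left (a := 2 ^ m); nlinarith
  have b2 : 2 * l + 1 < (k + 1) * (2 * 2 ^ j) := by
    apply Nat.lt_of_mul_lt_mul_left (a := 2 ^ m); nlinarith
  -- An even integer below the odd integer 2l+1 is at most 2l; likewise on the other side. This
  -- turns the strict inequalities for the midpoint into inclusion of the endpoints.
  have c1 : k * 2 ^ j ≤ l := by nlinarith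
  have c2 : l + 1 ≤ (k + 1) * 2 ^ j := by nlinarith
  have c1' : (k : ℝ) * 2 ^ j ≤ l := by exact_mod_cast c1
  have c2' : (l : ℝ) + 1 ≤ (k + 1) * 2 ^ j := by exact_mod_cast c2
  rw [segment_eq_Icc hlt.le]
  refine ⟨⟨_, ⟨?_, ?_⟩, rfl⟩, ⟨_, ⟨?_, ?_⟩, rfl⟩⟩ <;>
    · rw [pow_add, div_le_div_iff₀ (by positivity) (by positivity)]
      nlinarith [pow_pos (two_pos : (0 : ℝ) < 2) m]

/-! ### Size -/

/-- An upper bound for the diameter, comparable with it for shape-regular triangles. -/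
def sz (E : Tri) : ℝ := Real.sqrt (2 * E.q)

theorem sz_nonneg (E : Tri) : 0 ≤ E.sz := Real.sqrt_nonneg _

theorem sz_sq (E : Tri) : E.sz ^ 2 = 2 * E.q := Real.sq_sqrt (by linarith [E.q_nonneg])

theorem dist_vert_sq_le (E : Tri) (i j : Fin 3) : dist (E.vert i) (E.vert j) ^ 2 ≤ 2 * E.q := by
  have h1 := sq_nonneg (dist (E.vert 1) (E.vert 0))
  have h2 := sq_nonneg (dist (E.vert 2) (E.vert 0))
  have h3 : dist (E.vert 1) (E.vert 2) ^ 2 ≤ 2 * E.q := by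
    simp only [q, dist_sq]
    nlinarith [sq_nonneg (E.vert 1 0 - E.vert 0 0 + (E.vert 2 0 - E.vert 0 0)),
      sq_nonneg (E.vert 1 1 - E.vert 0 1 + (E.vert 2 1 - E.vert 0 1))]
  fin_cases i <;> fin_cases j <;>
    simp only [Fin.zero_eta, Fin.mk_one, Fin.reduceFinMk, dist_self, dist_comm (E.vert 0),
      dist_comm (E.vert 2) (E.vert 1)] <;> first | exact h3 | (unfold q; nlinarith)

theorem dist_vert_le (E : Tri) (i j : Fin 3) : dist (E.vert i) (E.vert j) ≤ E.sz :=
  Real.le_sqrt_of_sq_le (E.dist_vert_sq_le i j)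

theorem dist_le_sz (E : Tri) {x y : Plane} (hx : x ∈ E.carrier) (hy : y ∈ E.carrier) :
    dist x y ≤ E.sz := by
  obtain ⟨_, ⟨i, rfl⟩, _, ⟨j, rfl⟩, h⟩ := convexHull_exists_dist_ge2 hx hy
  exact h.trans (E.dist_vert_le i j)

theorem two_abs_det_le (E : Tri) : 2 * |E.det| ≤ E.q := by
  have : |2 * E.det| ≤ E.q := by
    rw [abs_le, det, q, dist_sq, dist_sq]
    constructor <;>
    nlinarith [sq_nonneg ((E.vert 1 0 - E.vert 0 0) + (E.vert 2 1 - E.vert 0 1)),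
      sq_nonneg ((E.vert 1 1 - E.vert 0 1) + (E.vert 2 0 - E.vert 0 0)),
      sq_nonneg ((E.vert 1 0 - E.vert 0 0) - (E.vert 2 1 - E.vert 0 1)),
      sq_nonneg ((E.vert 1 1 - E.vert 0 1) - (E.vert 2 0 - E.vert 0 0))]
  rwa [abs_mul, abs_two] at this

theorem sz_pos (hE : E.Nondeg) : 0 < E.sz := by
  have h := abs_pos.2 (det_ne_zero_iff.2 hE)
  exact Real.sqrt_pos.2 (by linarith [E.two_abs_det_le])

/-- By Lagrange's identity the determinant is at most the product of two side lengths, and either of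
the two may be estimated by `2 * E.q` for its square. -/
theorem det_sq_le (E : Tri) {i j : Fin 3} (hij : i ≠ j) :
    E.det ^ 2 ≤ dist (E.vert i) (E.vert j) ^ 2 * (2 * E.q) := by
  have lag : ∀ a b c d : ℝ, (a * d - b * c) ^ 2 ≤ (a ^ 2 + b ^ 2) * (c ^ 2 + d ^ 2) :=
    fun a b c d => by nlinarith [sq_nonneg (a * c + b * d)]
  have e1 := lag (E.vert 1 0 - E.vert 0 0) (E.vert 1 1 - E.vert 0 1)
    (E.vert 2 0 - E.vert 0 0) (E.vert 2 1 - E.vert 0 1)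
  have e2 := lag (E.vert 1 0 - E.vert 2 0) (E.vert 1 1 - E.vert 2 1)
    (E.vert 0 0 - E.vert 2 0) (E.vert 0 1 - E.vert 2 1)
  have d1 : E.det ^ 2 ≤ dist (E.vert 1) (E.vert 0) ^ 2 * dist (E.vert 2) (E.vert 0) ^ 2 := by
    rw [det, dist_sq, dist_sq]; linarith
  have d2 : E.det ^ 2 ≤ dist (E.vert 1) (E.vert 2) ^ 2 * dist (E.vert 0) (E.vert 2) ^ 2 := by
    rw [det, dist_sq, dist_sq]; refine le_trans (le_of_eq ?_) e2; ring
  have b := E.dist_vert_sq_le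
  have b1 := b 2 0; have b2 := b 1 0; have b3 := b 0 2
  have n1 := sq_nonneg (dist (E.vert 1) (E.vert 0))
  have n2 := sq_nonneg (dist (E.vert 2) (E.vert 0))
  have n3 := sq_nonneg (dist (E.vert 1) (E.vert 2))
  have m : E.det ^ 2 ≤ dist (E.vert 1) (E.vert 0) ^ 2 * (2 * E.q) ∧
      E.det ^ 2 ≤ dist (E.vert 2) (E.vert 0) ^ 2 * (2 * E.q) ∧
      E.det ^ 2 ≤ dist (E.vert 1) (E.vert 2) ^ 2 * (2 * E.q) :=
    ⟨by nlinarith, by nlinarith, by nlinarith⟩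
  fin_cases i <;> fin_cases j <;> first | exact absurd rfl hij | skip
  all_goals simp only [Fin.zero_eta, Fin.mk_one, Fin.reduceFinMk, dist_comm (E.vert 0),
      dist_comm (E.vert 2) (E.vert 1)]
  · exact m.1
  · exact m.2.1
  · exact m.1
  · exact m.2.2
  · exact m.2.1
  · exact m.2.2

/-- Shape regularity excludes short sides: q² ≤ κ² det² ≤ 2κ² d² q for the length d of any side, and
one factor q cancels. -/
theorem sz_le_dist_vert {κ : ℝ} (hκ : E.q ≤ κ * |E.det|) (hE : E.Nondeg) {i j : Fin 3}
    (hij : i ≠ j) : E.sz ≤ 2 * κ * dist (E.vert i) (E.vert j) := by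
  have hd := abs_pos.2 (det_ne_zero_iff.2 hE)
  have hq : 0 < E.q := by linarith [E.two_abs_det_le]
  have hκ0 : 0 < κ := by
    by_contra h; push Not at h; nlinarith
  apply Real.sqrt_le_iff.2
  refine ⟨by positivity, ?_⟩
  have h := E.det_sq_le hij
  rw [← sq_abs] at h
  have h2 : E.q ^ 2 ≤ κ ^ 2 * |E.det| ^ 2 := by
    rw [← mul_pow]; exact pow_le_pow_left₀ hq.le hκ 2
  have h3 : E.q ^ 2 ≤ κ ^ 2 * (dist (E.vert i) (E.vert j) ^ 2 * (2 * E.q)) :=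
    h2.trans (mul_le_mul_of_nonneg_left h (sq_nonneg _))
  have h4 : E.q ≤ κ ^ 2 * (dist (E.vert i) (E.vert j) ^ 2 * 2) := by
    apply le_of_mul_le_mul_right _ hq; nlinarith
  nlinarith

end Tri

end

end VEM

/-! ### The bisection forest and the position of hanging nodes. -/

namespace VEM

noncomputable section

open Tri

theorem inForest_iff {T₀ : Finset Tri} {P : Tri} : InForest T₀ P ↔ ∃ R ∈ T₀, Desc R P := by
  constructor
  · intro h
    induction h with
    | root hE => exact ⟨_, hE, .refl⟩
    | left _ ih => obtain ⟨R, hR, h⟩ := ih; exact ⟨R, hR, h.left⟩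
    | right _ ih => obtain ⟨R, hR, h⟩ := ih; exact ⟨R, hR, h.right⟩
  · rintro ⟨R, hR, h⟩
    induction h with
    | refl => exact .root hR
    | left _ ih => exact ih.left
    | right _ ih => exact ih.right

theorem InForest.nondeg {T₀ : Finset Tri} (hT₀ : IsConforming T₀) {P : Tri} (h : InForest T₀ P) :
    P.Nondeg := by
  obtain ⟨R, hR, h⟩ := inForest_iff.1 h
  exact h.nondeg (hT₀.nondegenerate R hR)

/-- A nondegenerate triangle is the closure of its interior, so an open set meeting it meets its
interior. -/
theorem notMem_of_disjoint_interior {E E' : Tri} (hE' : E'.Nondeg)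
    (h : Disjoint (interior E.carrier) (interior E'.carrier)) {x : Plane}
    (hx : x ∈ interior E.carrier) : x ∉ E'.carrier := by
  intro hx'
  rw [← closure_interior hE', mem_closure_iff] at hx'
  obtain ⟨y, hy, hy'⟩ := hx' _ isOpen_interior hx
  exact Set.disjoint_left.1 h hy hy'

/-- Two triangles with disjoint interiors that meet in a common vertex, in a common side or not
at all. -/
structure Facing (C C' : Tri) : Prop where
  left : C.Nondeg
  right : C'.Nondeg
  disj : Disjoint (interior C.carrier) (interior C'.carrier)
  common : ∀ x ∈ C.carrier ∩ C'.carrier, (x ∈ Set.range C.vert ∧ x ∈ Set.range C'.vert) ∨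
    ∃ a b k a' b' k' : Fin 3, a ≠ b ∧ k ≠ a ∧ k ≠ b ∧ a' ≠ b' ∧ k' ≠ a' ∧ k' ≠ b' ∧
      C.vert a = C'.vert a' ∧ C.vert b = C'.vert b' ∧ C.lam k x = 0 ∧ C'.lam k' x = 0

theorem Facing.symm {C C' : Tri} (h : Facing C C') : Facing C' C :=
  ⟨h.right, h.left, h.disj.symm, fun x hx => by
    rcases h.common x hx.symm with ⟨a, b⟩ |
      ⟨a, b, k, a', b', k', h1, h2, h3, h4, h5, h6, h7, h8, h9, h10⟩
    · exact Or.inl ⟨b, a⟩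
    · exact Or.inr ⟨a', b', k', a, b, k, h4, h5, h6, h1, h2, h3, h7.symm, h8.symm, h10, h9⟩⟩

/-- Siblings meet exactly in the bisector, which in either child joins the vertices 0 and 1. -/
theorem facing_children {Q : Tri} (hQ : Q.Nondeg) : Facing Q.child₁ Q.child₂ := by
  refine ⟨nondeg_child₁ hQ, nondeg_child₂ hQ, disjoint_children hQ, fun x hx => Or.inr ?_⟩
  refine ⟨0, 1, 2, 0, 1, 2, by decide, by decide, by decide, by decide, by decide, by decide,
    rfl, rfl, ?_, ?_⟩
  · rw [(lam_child₁ hQ x).2.2]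
    linarith [((mem_child₁ hQ).1 hx.1).2, ((mem_child₂ hQ).1 hx.2).2]
  · rw [(lam_child₂ hQ x).2.2]
    linarith [((mem_child₁ hQ).1 hx.1).2, ((mem_child₂ hQ).1 hx.2).2]

/-- If a point in the relative interior of a side lies in the hull of some vertices, then these
comprise the endpoints of the side. -/
theorem vert_mem_of_mem_convexHull {C : Tri} (hC : C.Nondeg) {S : Set Plane}
    (hS : S ⊆ Set.range C.vert) {x : Plane} (hx : x ∈ convexHull ℝ S) {i : Fin 3}
    (hi : 0 < C.lam i x) : C.vert i ∈ S := by
  by_contra h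
  have : convexHull ℝ S ⊆ {y | C.lam i y ≤ 0} := by
    apply convexHull_min
    · intro y hy
      obtain ⟨m, rfl⟩ := hS hy
      have : i ≠ m := by rintro rfl; exact h hy
      simp [lam_vert_ne hC this]
    · exact (convex_Iic (0 : ℝ)).affine_preimage (C.lam i)
  exact absurd (this hx) (not_le.2 hi)

/-- Conformity presents the intersection as the hull of the common vertices. A common point inside a
side has two positive coordinates, which forces both endpoints of that side to be common vertices.
-/
theorem facing_roots {T₀ : Finset Tri} (hT₀ : IsConforming T₀) {C C' : Tri} (hC : C ∈ T₀)
    (hC' : C' ∈ T₀) (hne : C ≠ C') : Facing C C' := by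
  have nC := hT₀.nondegenerate C hC
  have nC' := hT₀.nondegenerate C' hC'
  have hd := hT₀.disjoint C hC C' hC' hne
  refine ⟨nC, nC', hd, fun x hx => ?_⟩
  have hx' := hx
  rw [hT₀.conforming C hC C' hC'] at hx'
  have key : ∀ i, 0 < C.lam i x → C.vert i ∈ Set.range C'.vert := fun i hi =>
    (vert_mem_of_mem_convexHull nC Set.inter_subset_left hx' hi).2
  rcases cases_of_mem nC hx.1 with h | ⟨i, rfl⟩ | ⟨i, j, hij, h⟩
  · exact absurd hx.2 (notMem_of_disjoint_interior nC' hd h)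
  · exact Or.inl ⟨⟨i, rfl⟩, key i (by rw [lam_vert_self nC]; exact one_pos)⟩
  · obtain ⟨k, hki, hkj, -⟩ := exists_third i j hij
    have hl := (mem_openSegment_iff nC hij hki hkj).1 h
    obtain ⟨a', ha'⟩ := key i hl.1
    obtain ⟨b', hb'⟩ := key j hl.2.1
    have hab' : a' ≠ b' := by
      rintro rfl; exact hij (vert_injective nC (ha'.symm.trans hb'))
    obtain ⟨k', hk1, hk2, -⟩ := exists_third a' b' hab'
    refine Or.inr ⟨i, j, k, a', b', k', hij, hki, hkj, hab', hk1, hk2, ha'.symm, hb'.symm,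
      hl.2.2, ?_⟩
    refine ((mem_segment_iff nC' hab' hk1 hk2 (x := x)).1 ?_).2
    rw [ha', hb']
    exact openSegment_subset_segment _ _ _ h

/-- Two triangles separated by a pair of facing ancestors. -/
def Separated (P E : Tri) : Prop := ∃ C C', Desc C P ∧ Desc C' E ∧ Facing C C'

/-- Two nodes of a binary tree are comparable or branch off at a last common ancestor, whose two
children are facing. -/
theorem desc_trichotomy {R P E : Tri} (hR : R.Nondeg) (hP : Desc R P) (hE : Desc R E) :
    Desc P E ∨ Desc E P ∨ Separated P E := by
  induction hP with
  | refl => exact Or.inl hE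
  | @left P hP ih =>
    rcases ih with h | h | ⟨C, C', h1, h2, h3⟩
    · rcases h.head with rfl | h | h
      · exact Or.inr (Or.inl (Desc.refl.left))
      · exact Or.inl h
      · exact Or.inr (Or.inr ⟨_, _, .refl, h, facing_children (hP.nondeg hR)⟩)
    · exact Or.inr (Or.inl h.left)
    · exact Or.inr (Or.inr ⟨C, C', h1.left, h2, h3⟩)
  | @right P hP ih =>
    rcases ih with h | h | ⟨C, C', h1, h2, h3⟩
    · rcases h.head with rfl | h | h
      · exact Or.inr (Or.inl (Desc.refl.right))
      · exact Or.inr (Or.inr ⟨_, _, .refl, h, (facing_children (hP.nondeg hR)).symm⟩)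
      · exact Or.inl h
    · exact Or.inr (Or.inl h.right)
    · exact Or.inr (Or.inr ⟨C, C', h1.right, h2, h3⟩)

theorem forest_trichotomy {T₀ : Finset Tri} (hT₀ : IsConforming T₀) {P E : Tri}
    (hP : InForest T₀ P) (hE : InForest T₀ E) : Desc P E ∨ Desc E P ∨ Separated P E := by
  obtain ⟨R, hR, hP⟩ := inForest_iff.1 hP
  obtain ⟨R', hR', hE⟩ := inForest_iff.1 hE
  by_cases h : R = R'
  · subst h; exact desc_trichotomy (hT₀.nondegenerate R hR) hP hE
  · exact Or.inr (Or.inr ⟨R, R', hP, hE, facing_roots hT₀ hR hR' h⟩)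

theorem openSegment_lam_zero {C E : Tri} (hC : C.Nondeg) (hs : E.carrier ⊆ C.carrier)
    {i j k : Fin 3} {x : Plane} (hx : x ∈ openSegment ℝ (E.vert i) (E.vert j))
    (h0 : C.lam k x = 0) : C.lam k (E.vert i) = 0 ∧ C.lam k (E.vert j) = 0 := by
  rw [openSegment_eq_image_lineMap] at hx
  obtain ⟨t, ⟨ht0, ht1⟩, rfl⟩ := hx
  rw [lam_lineMap] at h0
  have h1 := (mem_carrier hC).1 (hs (E.vert_mem i)) k
  have h2 := (mem_carrier hC).1 (hs (E.vert_mem j)) k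
  constructor <;> nlinarith

theorem mid_mem_openSegment {P : Tri} : P.mid ∈ openSegment ℝ (P.vert 1) (P.vert 2) := by
  rw [openSegment_eq_image_lineMap, mid, midpoint]
  exact ⟨_, ⟨by norm_num, by norm_num⟩, rfl⟩

/-- If the midpoint of the refinement edge of `P` lies inside a side of another triangle of the
forest, then this side contains the refinement edge. -/
theorem refinement_edge_subset_side {T₀ : Finset Tri} (hT₀ : IsConforming T₀) {P E : Tri}
    (hP : InForest T₀ P) (hE : InForest T₀ E) {i j : Fin 3} (hij : i ≠ j)
    (h : P.mid ∈ openSegment ℝ (E.vert i) (E.vert j)) :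
    P.vert 1 ∈ segment ℝ (E.vert i) (E.vert j) ∧ P.vert 2 ∈ segment ℝ (E.vert i) (E.vert j) := by
  have nP := hP.nondeg hT₀
  have nE := hE.nondeg hT₀
  have hmE : P.mid ∈ E.carrier :=
    E.convex_carrier.openSegment_subset (E.vert_mem i) (E.vert_mem j) h
  have hnv := openSegment_not_vert nE hij h
  have hself : ∀ {E : Tri}, E.Nondeg → P.carrier ⊆ E.carrier →
      P.mid ∈ openSegment ℝ (E.vert i) (E.vert j) →
      P.vert 1 ∈ segment ℝ (E.vert i) (E.vert j) ∧
        P.vert 2 ∈ segment ℝ (E.vert i) (E.vert j) := by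
    intro E nE hsub h
    obtain ⟨k, hki, hkj, -⟩ := exists_third i j hij
    have h0 := ((mem_openSegment_iff nE hij hki hkj).1 h).2.2
    obtain ⟨h1, h2⟩ := lam_zero_of_midpoint nE hsub h0
    exact ⟨(mem_segment_iff nE hij hki hkj).2 ⟨hsub (P.vert_mem 1), h1⟩,
      (mem_segment_iff nE hij hki hkj).2 ⟨hsub (P.vert_mem 2), h2⟩⟩
  -- If `E` lies strictly below `P`, the midpoint is a vertex of a child of `P` and hence of every
  -- descendant containing it, so it cannot be inside a side. If `E` is an ancestor of `P` or `P`
  -- itself, vanishing of a coordinate at the midpoint passes to both ends.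
  rcases forest_trichotomy hT₀ hP hE with hd | hd | ⟨C, C', h1, h2, hF⟩
  · rcases hd.head with rfl | hd | hd
    · exact hself nP subset_rfl h
    · exact absurd (vert_of_subset (i := 0) (nondeg_child₁ nP) (hd.subset (nondeg_child₁ nP)) hmE)
        hnv
    · exact absurd (vert_of_subset (i := 0) (nondeg_child₂ nP) (hd.subset (nondeg_child₂ nP)) hmE)
        hnv
  · exact hself nE (hd.subset nE) h
  · have hmP : P.mid ∈ P.carrier :=
      P.convex_carrier.openSegment_subset (P.vert_mem 1) (P.vert_mem 2) mid_mem_openSegment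
    rcases hF.common _ ⟨h1.subset hF.left hmP, h2.subset hF.right hmE⟩ with ⟨-, ⟨m, hm⟩⟩ |
      ⟨a, b, k, a', b', k', g1, g2, g3, g4, g5, g6, g7, g8, g9, g10⟩
    · rw [← hm] at hmE hnv
      exact absurd (vert_of_subset hF.right (h2.subset hF.right) hmE) hnv
    -- In the separated case both segments lie on the side shared by the facing ancestors. Both are
    -- dyadic there, and the comparison of dyadic intervals finishes.
    · obtain ⟨p1, p2⟩ := lam_zero_of_midpoint hF.left (h1.subset hF.left) g9
      obtain ⟨e1, e2⟩ := openSegment_lam_zero hF.right (h2.subset hF.right) h g10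
      have d1 := h1.isDyadic hF.left g1 g2 g3 1 2 (by decide) p1 p2
      have d2 := h2.isDyadic hF.right g4 g5 g6 i j hij e1 e2
      rw [← g7, ← g8] at d2
      exact d1.mem_segment (fun hab => g1 (vert_injective hF.left hab)) d2 h

/-! ### Refinements -/

section Refinement

variable {T₀ T : Finset Tri}

theorem IsRefinement.inForest (h : IsRefinement T₀ T) : ∀ E ∈ T, InForest T₀ E := by
  induction h with
  | refl => exact fun E hE => .root hE
  | @bisect T E hT hE ih =>
    intro E' hE'
    simp only [Finset.mem_union, Finset.mem_erase, Finset.mem_insert, Finset.mem_singleton] at hE'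
    rcases hE' with ⟨-, h⟩ | rfl | rfl
    · exact ih E' h
    · exact (ih E hE).left
    · exact (ih E hE).right

theorem IsRefinement.union_eq (hT₀ : IsConforming T₀) (h : IsRefinement T₀ T) :
    ⋃ E ∈ T, E.carrier = ⋃ E ∈ T₀, E.carrier := by
  induction h with
  | refl => rfl
  | @bisect T E hT hE ih =>
    rw [← ih]
    have nE := (hT.inForest E hE).nondeg hT₀
    ext x
    simp only [Finset.mem_union, Finset.mem_erase, Finset.mem_insert, Finset.mem_singleton,
      Set.mem_iUnion, exists_prop]
    constructor
    · rintro ⟨E', ⟨-, h⟩ | rfl | rfl, hx⟩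
      · exact ⟨E', h, hx⟩
      · exact ⟨E, hE, child₁_subset nE hx⟩
      · exact ⟨E, hE, child₂_subset nE hx⟩
    · rintro ⟨E', hE', hx⟩
      by_cases he : E' = E
      · subst he
        rw [← carrier_union_children nE] at hx
        rcases hx with hx | hx
        · exact ⟨_, Or.inr (Or.inl rfl), hx⟩
        · exact ⟨_, Or.inr (Or.inr rfl), hx⟩
      · exact ⟨E', Or.inl ⟨he, hE'⟩, hx⟩

theorem IsRefinement.disjoint (hT₀ : IsConforming T₀) (h : IsRefinement T₀ T) :
    ∀ E ∈ T, ∀ E' ∈ T, E ≠ E' → Disjoint (interior E.carrier) (interior E'.carrier) := by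
  induction h with
  | refl => exact hT₀.disjoint
  | @bisect T E hT hE ih =>
    have nE := (hT.inForest E hE).nondeg hT₀
    have s1 := interior_mono (child₁_subset nE)
    have s2 := interior_mono (child₂_subset nE)
    intro E₁ h₁ E₂ h₂ hne
    simp only [Finset.mem_union, Finset.mem_erase, Finset.mem_insert, Finset.mem_singleton]
      at h₁ h₂
    rcases h₁ with ⟨n1, h₁⟩ | rfl | rfl <;> rcases h₂ with ⟨n2, h₂⟩ | rfl | rfl
    · exact ih _ h₁ _ h₂ hne
    · exact (ih _ h₁ _ hE n1).mono_right s1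
    · exact (ih _ h₁ _ hE n1).mono_right s2
    · exact (ih _ hE _ h₂ n2.symm).mono_left s1
    · exact absurd rfl hne
    · exact disjoint_children nE
    · exact (ih _ hE _ h₂ n2.symm).mono_left s2
    · exact (disjoint_children nE).symm
    · exact absurd rfl hne

theorem mem_nodes {z : Plane} : z ∈ nodes T ↔ ∃ E ∈ T, z ∈ Set.range E.vert := by
  simp [nodes]

theorem vert_mem_nodes {E : Tri} (hE : E ∈ T) (i : Fin 3) : E.vert i ∈ nodes T :=
  mem_nodes.2 ⟨E, hE, i, rfl⟩

theorem HasIndex.mem_nodes {x : Plane} {k : ℕ} (h : HasIndex T₀ T x k) : x ∈ nodes T := by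
  cases h with
  | proper hx => exact hx.1
  | hanging _ hn _ _ _ => exact hn

/-- A node on the boundary of an element is not interior to it. -/
theorem node_notMem_interior (hT₀ : IsConforming T₀) (h : IsRefinement T₀ T) {z : Plane}
    (hz : z ∈ nodes T) {E : Tri} (hE : E ∈ T) : z ∉ interior E.carrier := by
  obtain ⟨E', hE', i, rfl⟩ := mem_nodes.1 hz
  by_cases he : E' = E
  · subst he; exact vert_not_interior ((h.inForest E' hE').nondeg hT₀) i
  · exact fun hi => notMem_of_disjoint_interior ((h.inForest E' hE').nondeg hT₀)
      (h.disjoint hT₀ E hE E' hE' (Ne.symm he)) hi (E'.vert_mem i)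

/-- No node is interior to an element, so the frontier condition amounts to membership in the closed
triangle. -/
theorem mem_nodesOn (hT₀ : IsConforming T₀) (h : IsRefinement T₀ T) {z : Plane} {E : Tri}
    (hE : E ∈ T) : z ∈ nodesOn T E ↔ z ∈ nodes T ∧ z ∈ E.carrier := by
  classical
  simp only [nodesOn, Finset.mem_filter, frontier_eq]
  exact ⟨fun h' => ⟨h'.1, h'.2.1⟩, fun h' => ⟨h'.1, h'.2, node_notMem_interior hT₀ h h'.1 hE⟩⟩

/-- The parent edge of a hanging node lies in every side containing the node in its relative
interior. -/
theorem hanging_parent_mem (hT₀ : IsConforming T₀) (h : IsRefinement T₀ T) {P E : Tri}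
    (hP : InForest T₀ P) (hE : E ∈ T) {i j : Fin 3} (hij : i ≠ j)
    (hx : P.mid ∈ openSegment ℝ (E.vert i) (E.vert j)) :
    P.vert 1 ∈ segment ℝ (E.vert i) (E.vert j) ∧ P.vert 2 ∈ segment ℝ (E.vert i) (E.vert j) :=
  refinement_edge_subset_side hT₀ hP (h.inForest E hE) hij hx

/-- Nodes on a side of an element are dyadic points of it, of level at most their index. -/
theorem HasIndex.dyadic_point (hT₀ : IsConforming T₀) (hT : IsRefinement T₀ T) {x : Plane}
    {k : ℕ} (h : HasIndex T₀ T x k) {E : Tri} (hE : E ∈ T) {i j : Fin 3} (hij : i ≠ j)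
    (hx : x ∈ segment ℝ (E.vert i) (E.vert j)) :
    ∃ l : ℕ, x = AffineMap.lineMap (E.vert i) (E.vert j) ((l : ℝ) / 2 ^ k) := by
  have nE := (hT.inForest E hE).nondeg hT₀
  induction h with
  | @proper x hp =>
    have hxE := E.convex_carrier.segment_subset (E.vert_mem i) (E.vert_mem j) hx
    obtain ⟨m, rfl⟩ := hp.2 E hE hxE
    obtain ⟨k, hki, hkj, -⟩ := exists_third i j hij
    have h0 := ((mem_segment_iff nE hij hki hkj).1 hx).2
    rcases eq_of_distinct hij hki hkj m with rfl | rfl | rfl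
    · exact ⟨0, by simp⟩
    · exact ⟨1, by simp⟩
    · rw [lam_vert_self nE] at h0; exact absurd h0 one_ne_zero
  | @hanging P a b hP hn hnp h₁ h₂ ih₁ ih₂ =>
    by_cases e1 : P.mid = E.vert i
    · exact ⟨0, by simp [e1]⟩
    by_cases e2 : P.mid = E.vert j
    · exact ⟨2 ^ (max a b + 1), by simp [e2]⟩
    have ho : P.mid ∈ openSegment ℝ (E.vert i) (E.vert j) :=
      mem_openSegment_of_ne_left_right (Ne.symm e1) (Ne.symm e2) hx
    -- The ends of the parent edge stay on the same side of the same element, so the induction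
    -- hypotheses apply to them, and taking the midpoint costs one dyadic level, just as the index
    -- rises by one.
    obtain ⟨p1, p2⟩ := hanging_parent_mem hT₀ hT hP hE hij ho
    obtain ⟨l₁, e₁⟩ := ih₁ p1
    obtain ⟨l₂, e₂⟩ := ih₂ p2
    refine ⟨l₁ * 2 ^ (max a b - a) + l₂ * 2 ^ (max a b - b), ?_⟩
    rw [mid, e₁, e₂, midpoint_lineMap]
    congr 1
    have ha : (2 : ℝ) ^ max a b = 2 ^ a * 2 ^ (max a b - a) := by
      rw [← pow_add, Nat.add_sub_cancel' (le_max_left a b)]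
    have hb : (2 : ℝ) ^ max a b = 2 ^ b * 2 ^ (max a b - b) := by
      rw [← pow_add, Nat.add_sub_cancel' (le_max_right a b)]
    have f1 : (l₁ : ℝ) / 2 ^ a = l₁ * 2 ^ (max a b - a) / 2 ^ max a b := by
      rw [ha]; field_simp
    have f2 : (l₂ : ℝ) / 2 ^ b = l₂ * 2 ^ (max a b - b) / 2 ^ max a b := by
      rw [hb]; field_simp
    rw [f1, f2]; push_cast; rw [pow_succ]; field_simp

end Refinement

end

end VEM

namespace VEM

noncomputable section

namespace Tri

variable {E : Tri}

/-! ### Affine parametrization of a triangle -/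

/-- The parametrization `(s, t) ↦ v₀ + s (v₁ - v₀) + t (v₂ - v₀)` of the plane. -/
def param (E : Tri) (p : ℝ × ℝ) : Plane :=
  E.vert 0 + (p.1 • (E.vert 1 - E.vert 0) + p.2 • (E.vert 2 - E.vert 0))

theorem continuous_param (E : Tri) : Continuous E.param := by unfold param; fun_prop

theorem lam_param (hE : E.Nondeg) (p : ℝ × ℝ) :
    E.lam 0 (E.param p) = 1 - p.1 - p.2 ∧ E.lam 1 (E.param p) = p.1 ∧
      E.lam 2 (E.param p) = p.2 := by
  have hx : E.param p = ∑ j, (![1 - p.1 - p.2, p.1, p.2] : Fin 3 → ℝ) j • E.vert j := by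
    simp only [Fin.sum_univ_three, Matrix.cons_val_zero, Matrix.cons_val_one, Matrix.cons_val,
      param]
    module
  have h := lam_unique hE (![1 - p.1 - p.2, p.1, p.2]) (by simp [Fin.sum_univ_three]; ring)
  rw [hx]
  exact ⟨h 0, h 1, h 2⟩

theorem measurableEmbedding_param (hE : E.Nondeg) : MeasurableEmbedding E.param := by
  apply E.continuous_param.measurableEmbedding
  intro p p' h
  have h1 := lam_param hE p
  have h2 := lam_param hE p'
  rw [h] at h1
  exact Prod.ext (h1.2.1.symm.trans h2.2.1) (h1.2.2.symm.trans h2.2.2)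

/-- The standard identification of `ℝ × ℝ` with the plane. -/
def planeEquiv : ℝ × ℝ ≃ᵐ Plane :=
  MeasurableEquiv.finTwoArrow.symm.trans (MeasurableEquiv.toLp 2 (Fin 2 → ℝ))

theorem measurePreserving_planeEquiv : MeasurePreserving planeEquiv volume volume :=
  (PiLp.volume_preserving_toLp (Fin 2)).comp (volume_preserving_finTwoArrow ℝ).symm

theorem planeEquiv_apply (p : ℝ × ℝ) : planeEquiv p = !₂[p.1, p.2] := rfl

/-- The parametrization is a measure-preserving identification of ℝ × ℝ with the plane, followed by
a linear map of determinant `E.det` and a translation. -/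
theorem map_param (hE : E.Nondeg) :
    Measure.map E.param volume = ENNReal.ofReal |E.det|⁻¹ • volume := by
  let A : Matrix (Fin 2) (Fin 2) ℝ := !![E.vert 1 0 - E.vert 0 0, E.vert 2 0 - E.vert 0 0;
    E.vert 1 1 - E.vert 0 1, E.vert 2 1 - E.vert 0 1]
  let M : Plane →ₗ[ℝ] Plane := Matrix.toEuclideanLin A
  have hM : LinearMap.det M = E.det := by
    have : M = Matrix.toLin (EuclideanSpace.basisFun (Fin 2) ℝ).toBasis
      (EuclideanSpace.basisFun (Fin 2) ℝ).toBasis A := by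
      rw [← Matrix.toEuclideanLin_eq_toLin_orthonormal]
    rw [this, LinearMap.det_toLin, Matrix.det_fin_two_of, det]; ring
  have hp : E.param = (fun x => E.vert 0 + x) ∘ M ∘ planeEquiv := by
    funext p
    simp only [Function.comp, planeEquiv_apply, param, M]
    congr 1
    ext i
    fin_cases i <;> simp [A]
  rw [hp, ← Measure.map_map (measurable_const_add _)
    ((LinearMap.continuous_of_finiteDimensional M).measurable.comp planeEquiv.measurable),
    ← Measure.map_map (LinearMap.continuous_of_finiteDimensional M).measurable
    planeEquiv.measurable, measurePreserving_planeEquiv.map_eq,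
    Measure.map_linearMap_addHaar_eq_smul_addHaar volume
      (by rw [hM]; exact det_ne_zero_iff.2 hE), Measure.map_smul, hM, map_add_left_eq_self,
      abs_inv]

theorem volume_eq_smul_map (hE : E.Nondeg) :
    (volume : Measure Plane) = ENNReal.ofReal |E.det| • Measure.map E.param volume := by
  have h := abs_pos.2 (det_ne_zero_iff.2 hE)
  rw [map_param hE, smul_smul, ← ENNReal.ofReal_mul h.le, mul_inv_cancel₀ h.ne']
  simp

theorem volume_eq_param (hE : E.Nondeg) (S : Set Plane) :
    volume S = ENNReal.ofReal |E.det| * volume (E.param ⁻¹' S) := by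
  conv_lhs => rw [volume_eq_smul_map hE]
  rw [Measure.smul_apply, (measurableEmbedding_param hE).map_apply, smul_eq_mul]

theorem setIntegral_eq_param (hE : E.Nondeg) {F : Type*} [NormedAddCommGroup F] [NormedSpace ℝ F]
    (S : Set Plane) (f : Plane → F) :
    ∫ x in S, f x = |E.det| • ∫ p in E.param ⁻¹' S, f (E.param p) := by
  conv_lhs => rw [volume_eq_smul_map hE]
  rw [Measure.restrict_smul, integral_smul_measure, (measurableEmbedding_param hE).setIntegral_map,
    ENNReal.toReal_ofReal (abs_nonneg _)]

theorem integrableOn_iff_param (hE : E.Nondeg) {F : Type*} [NormedAddCommGroup F]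
    (S : Set Plane) (f : Plane → F) :
    IntegrableOn f S ↔ IntegrableOn (fun p => f (E.param p)) (E.param ⁻¹' S) := by
  have h := abs_pos.2 (det_ne_zero_iff.2 hE)
  conv_lhs => rw [volume_eq_smul_map hE]
  rw [IntegrableOn, Measure.restrict_smul,
    integrable_smul_measure (by simpa using h) ENNReal.ofReal_ne_top]
  exact (measurableEmbedding_param hE).integrableOn_map_iff

/-- The reference triangle. -/
def refTri : Set (ℝ × ℝ) := {p | 0 ≤ p.1 ∧ 0 ≤ p.2 ∧ p.1 + p.2 ≤ 1}

theorem param_preimage_carrier (hE : E.Nondeg) : E.param ⁻¹' E.carrier = refTri := by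
  ext p
  obtain ⟨h0, h1, h2⟩ := lam_param hE p
  rw [Set.mem_preimage, mem_carrier hE]
  simp only [Fin.forall_fin_succ, Fin.succ_zero_eq_one, Fin.succ_one_eq_two, h0, h1, h2,
    IsEmpty.forall_iff, and_true, refTri, Set.mem_ofPred_eq]
  constructor
  · rintro ⟨a, b, c⟩; exact ⟨b, c, by linarith⟩
  · rintro ⟨a, b, c⟩; exact ⟨by linarith, a, b⟩

/-- The area of the reference triangle. -/
def refArea : ℝ := volume.real refTri

theorem refTri_subset : refTri ⊆ Set.Icc (0 : ℝ) 1 ×ˢ Set.Icc (0 : ℝ) 1 := by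
  rintro ⟨s, t⟩ ⟨h1, h2, h3⟩
  simp only at h1 h2 h3
  exact ⟨⟨h1, by linarith⟩, ⟨h2, by linarith⟩⟩

theorem volume_refTri_ne_top : volume refTri ≠ ⊤ :=
  ((isCompact_Icc.prod isCompact_Icc).measure_lt_top.trans_le' (measure_mono refTri_subset)).ne

/-- The reference triangle contains the open square of side 1/2. The exact area is never needed. -/
theorem refArea_pos : 0 < refArea := by
  rw [refArea, measureReal_def, ENNReal.toReal_pos_iff]
  refine ⟨?_, volume_refTri_ne_top.lt_top⟩
  have : Set.Ioo (0 : ℝ) (1 / 2) ×ˢ Set.Ioo (0 : ℝ) (1 / 2) ⊆ refTri := by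
    rintro ⟨s, t⟩ ⟨⟨h1, h2⟩, ⟨h3, h4⟩⟩
    exact ⟨h1.le, h3.le, by simp only at *; linarith⟩
  exact (IsOpen.measure_pos volume (isOpen_Ioo.prod isOpen_Ioo)
    ⟨(1 / 4, 1 / 4), by norm_num, by norm_num⟩).trans_le (measure_mono this)

theorem volume_carrier (hE : E.Nondeg) : volume.real E.carrier = |E.det| * refArea := by
  rw [measureReal_def, volume_eq_param hE, param_preimage_carrier hE, ENNReal.toReal_mul,
    ENNReal.toReal_ofReal (abs_nonneg _)]; rfl

theorem h_sq (hE : E.Nondeg) : E.h ^ 2 = |E.det| * refArea := by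
  rw [h, Real.sq_sqrt measureReal_nonneg, volume_carrier hE]

theorem volume_frontier (E : Tri) : volume (frontier E.carrier) = 0 :=
  E.convex_carrier.addHaar_frontier volume

end Tri

end

end VEM

/-! ### Intersections of elements, comparable sizes, cardinality of stars. -/

namespace VEM

noncomputable section

open Tri

namespace Tri

variable {E : Tri}

theorem lam_add_smul (E : Tri) (m : Fin 3) (x a b : Plane) (t : ℝ) :
    E.lam m (x + t • (a - b)) = E.lam m x + t * (E.lam m a - E.lam m b) := by
  have h1 := (E.lam m).map_vadd x (t • (a - b))
  have h2 := (E.lam m).linearMap_vsub a b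
  simp only [vadd_eq_add, vsub_eq_sub, map_smul, smul_eq_mul] at h1 h2
  rw [add_comm x, h1, h2]; ring

/-- An extreme point of the intersection of two triangles with disjoint interiors is a vertex of
one of them. -/
theorem extreme_inter {E' : Tri} (hE : E.Nondeg) (hE' : E'.Nondeg)
    (hd : Disjoint (interior E.carrier) (interior E'.carrier)) {x : Plane}
    (hx : x ∈ (E.carrier ∩ E'.carrier).extremePoints ℝ) :
    x ∈ Set.range E.vert ∪ Set.range E'.vert := by
  by_contra hn
  rw [Set.mem_union, not_or] at hn
  rw [mem_extremePoints] at hx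
  obtain ⟨⟨hxE, hxE'⟩, hext⟩ := hx
  rcases cases_of_mem hE hxE with h | h | ⟨i, j, hij, h⟩
  · exact notMem_of_disjoint_interior hE' hd h hxE'
  · exact hn.1 h
  rcases cases_of_mem hE' hxE' with h' | h' | ⟨i', j', hij', h'⟩
  · exact notMem_of_disjoint_interior hE hd.symm h' hxE
  · exact hn.2 h'
  obtain ⟨k, hki, hkj, -⟩ := exists_third i j hij
  obtain ⟨k', hki', hkj', -⟩ := exists_third i' j' hij'
  obtain ⟨a1, a2, a3⟩ := (mem_openSegment_iff hE hij hki hkj).1 h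
  obtain ⟨b1, b2, b3⟩ := (mem_openSegment_iff hE' hij' hki' hkj').1 h'
  set y : ℝ → Plane := fun t => x + t • (E.vert j - E.vert i) with hy
  have ycont : Continuous y := by fun_prop
  have y0 : y 0 = x := by simp [hy]
  have ev : ∀ (F : Tri) (m : Fin 3), 0 < F.lam m x → ∀ᶠ t in 𝓝 (0 : ℝ), 0 < F.lam m (y t) :=
    fun F m hm => ((F.continuous_lam m).comp ycont).continuousAt.eventually_const_lt
      (by simpa [y0] using hm)
  have hev := (ev E i a1).and ((ev E j a2).and ((ev E' i' b1).and (ev E' j' b2)))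
  obtain ⟨ε, hε, hb⟩ := Metric.eventually_nhds_iff.1 hev
  have yE : ∀ t, |t| < ε → y t ∈ E.carrier := fun t ht => by
    obtain ⟨c1, c2, -, -⟩ := hb (show dist t 0 < ε by simpa using ht)
    rw [mem_carrier hE]
    intro m
    rcases eq_of_distinct hij hki hkj m with rfl | rfl | rfl
    · exact c1.le
    · exact c2.le
    · rw [hy]; simp only; rw [lam_add_smul, a3, lam_vert_ne hE hki, lam_vert_ne hE hkj]; simp
  -- Move from `x` along the side of `E` containing it; `s` is the slope of the critical coordinate
  -- of `E'`. If `s ≠ 0`, a small move in one direction stays in `E` and enters the interior of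
  -- `E'`. If `s = 0`, small moves both ways remain in both triangles, against extremality.
  set s := E'.lam k' (E.vert j) - E'.lam k' (E.vert i) with hs
  have yk : ∀ t, E'.lam k' (y t) = t * s := fun t => by
    rw [hy]; simp only; rw [lam_add_smul, b3]; ring
  have yint : ∀ t, |t| < ε → 0 < t * s → False := fun t ht hts => by
    obtain ⟨-, -, c3, c4⟩ := hb (show dist t 0 < ε by simpa using ht)
    refine notMem_of_disjoint_interior hE hd.symm (x := y t) ?_ (yE t ht)
    rw [mem_interior hE']
    intro m
    rcases eq_of_distinct hij' hki' hkj' m with rfl | rfl | rfl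
    · exact c3
    · exact c4
    · rw [yk]; exact hts
  have habs : |ε / 2| < ε := by rw [abs_of_pos (by linarith)]; linarith
  have habs' : |-(ε / 2)| < ε := by rwa [abs_neg]
  rcases lt_trichotomy s 0 with hs0 | hs0 | hs0
  · exact yint (-(ε / 2)) habs' (by nlinarith)
  · have yE' : ∀ t, |t| < ε → y t ∈ E'.carrier := fun t ht => by
      obtain ⟨-, -, c3, c4⟩ := hb (show dist t 0 < ε by simpa using ht)
      rw [mem_carrier hE']
      intro m
      rcases eq_of_distinct hij' hki' hkj' m with rfl | rfl | rfl
      · exact c3.le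
      · exact c4.le
      · rw [yk, hs0, mul_zero]
    have := hext (y (ε / 2)) ⟨yE _ habs, yE' _ habs⟩ (y (-(ε / 2))) ⟨yE _ habs', yE' _ habs'⟩ (by
      refine ⟨1 / 2, 1 / 2, by norm_num, by norm_num, by norm_num, ?_⟩
      simp only [hy]; module)
    have h1 := this.1
    simp only [hy, add_eq_left, smul_eq_zero] at h1
    rcases h1 with h1 | h1
    · linarith
    · exact hij (vert_injective hE (sub_eq_zero.1 h1).symm)
  · exact yint (ε / 2) habs (by nlinarith)

/-- The intersection of two triangles with disjoint interiors is spanned by vertices. -/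
theorem inter_subset_convexHull {E' : Tri} (hE : E.Nondeg) (hE' : E'.Nondeg)
    (hd : Disjoint (interior E.carrier) (interior E'.carrier)) :
    E.carrier ∩ E'.carrier ⊆
      convexHull ℝ (E.carrier ∩ E'.carrier ∩ (Set.range E.vert ∪ Set.range E'.vert)) := by
  have hK := closure_convexHull_extremePoints (E.isCompact_carrier.inter E'.isCompact_carrier)
    (E.convex_carrier.inter E'.convex_carrier)
  have hfin : (E.carrier ∩ E'.carrier ∩ (Set.range E.vert ∪ Set.range E'.vert)).Finite :=
    ((Set.finite_range _).union (Set.finite_range _)).inter_of_right _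
  rw [← (hfin.isClosed_convexHull ℝ).closure_eq]
  nth_rewrite 1 [← hK]
  apply closure_mono
  apply convexHull_mono
  intro x hx
  exact ⟨extremePoints_subset hx, extreme_inter hE hE' hd hx⟩

end Tri

section Mesh

variable {T₀ T : Finset Tri}

/-- Affine relations on the intersection of two elements thus need checking only at their common
nodes, even though hanging nodes prevent the intersection from being a full side. -/
theorem inter_subset_convexHull_nodes (hT₀ : IsConforming T₀) (hT : IsRefinement T₀ T)
    {E E' : Tri} (hE : E ∈ T) (hE' : E' ∈ T) (hne : E ≠ E') :
    E.carrier ∩ E'.carrier ⊆ convexHull ℝ (E.carrier ∩ E'.carrier ∩ nodes T) := by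
  refine (inter_subset_convexHull ((hT.inForest E hE).nondeg hT₀) ((hT.inForest E' hE').nondeg hT₀)
    (hT.disjoint hT₀ E hE E' hE' hne)).trans (convexHull_mono ?_)
  rintro x ⟨hx, ⟨i, rfl⟩ | ⟨i, rfl⟩⟩
  · exact ⟨hx, vert_mem_nodes hE i⟩
  · exact ⟨hx, vert_mem_nodes hE' i⟩

/-- A common shape-regularity constant of all triangles in the bisection forest. -/
theorem exists_shape_constant (hT₀ : IsConforming T₀) :
    ∃ κ : ℝ, 1 ≤ κ ∧ ∀ P, InForest T₀ P → P.q ≤ κ * |P.det| := by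
  have : ∃ κ : ℝ, 1 ≤ κ ∧ ∀ R ∈ T₀, R.q ≤ κ * |R.det| := by
    -- The sum dominates the ratio of each root, and descendants inherit the ratio unchanged.
    refine ⟨1 + ∑ R ∈ T₀, R.q / |R.det|, ?_, fun R hR => ?_⟩
    · have : 0 ≤ ∑ R ∈ T₀, R.q / |R.det| :=
        Finset.sum_nonneg fun R _ => div_nonneg R.q_nonneg (abs_nonneg _)
      linarith
    · have h := abs_pos.2 (det_ne_zero_iff.2 (hT₀.nondegenerate R hR))
      have h1 : R.q / |R.det| ≤ ∑ R ∈ T₀, R.q / |R.det| :=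
        Finset.single_le_sum (f := fun R : Tri => R.q / |R.det|)
          (fun R _ => div_nonneg R.q_nonneg (abs_nonneg _)) hR
      rw [← div_le_iff₀ h]; linarith
  obtain ⟨κ, h1, h⟩ := this
  refine ⟨κ, h1, fun P hP => ?_⟩
  obtain ⟨R, hR, hd⟩ := inForest_iff.1 hP
  exact hd.ratio (h R hR)

/-- After multiplication by 2^Λ both numbers are integers, and distinct integers differ by at least
1. -/
theorem abs_sub_dyadic {a b k l Λ : ℕ} (hk : k ≤ Λ) (hl : l ≤ Λ)
    (hne : (a : ℝ) / 2 ^ k ≠ (b : ℝ) / 2 ^ l) :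
    1 ≤ 2 ^ Λ * |(a : ℝ) / 2 ^ k - (b : ℝ) / 2 ^ l| := by
  have ek : (2 : ℝ) ^ Λ = 2 ^ k * 2 ^ (Λ - k) := by rw [← pow_add, Nat.add_sub_cancel' hk]
  have el : (2 : ℝ) ^ Λ = 2 ^ l * 2 ^ (Λ - l) := by rw [← pow_add, Nat.add_sub_cancel' hl]
  have e : 2 ^ Λ * |(a : ℝ) / 2 ^ k - (b : ℝ) / 2 ^ l| =
      |(((a * 2 ^ (Λ - k) : ℤ) - (b * 2 ^ (Λ - l) : ℤ) : ℤ) : ℝ)| := by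
    have hp : (2 : ℝ) ^ Λ = |2 ^ Λ| := (abs_of_pos (by positivity)).symm
    rw [hp, ← abs_mul, mul_sub]
    congr 1; push_cast; congr 1
    · rw [ek]; field_simp
    · rw [el]; field_simp
  rw [e, ← Int.cast_abs]
  have : (((a * 2 ^ (Λ - k) : ℤ) - (b * 2 ^ (Λ - l) : ℤ) : ℤ)) ≠ 0 := by
    intro h0
    rw [h0] at e
    have hp : (0 : ℝ) < 2 ^ Λ := by positivity
    simp [hp.ne', sub_eq_zero] at e
    exact hne e
  exact_mod_cast Int.one_le_abs this

/-- Two elements sharing two points have comparable sizes. -/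
theorem size_le_of_two_points (hT₀ : IsConforming T₀) {κ : ℝ} (hκ1 : 1 ≤ κ)
    (hκ : ∀ P, InForest T₀ P → P.q ≤ κ * |P.det|) (hT : IsRefinement T₀ T) {Λ : ℕ}
    (hA : IsAdmissible T₀ T Λ) {E E' : Tri} (hE : E ∈ T) (hE' : E' ∈ T) (hne : E ≠ E')
    {p r : Plane} (hp : p ∈ E.carrier ∩ E'.carrier) (hr : r ∈ E.carrier ∩ E'.carrier)
    (hpr : p ≠ r) : E.sz ≤ 2 * κ * 2 ^ Λ * E'.sz := by
  have nE := (hT.inForest E hE).nondeg hT₀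
  have nE' := (hT.inForest E' hE').nondeg hT₀
  have hd := hT.disjoint hT₀ E hE E' hE' hne
  have hsub := inter_subset_convexHull_nodes hT₀ hT hE hE' hne
  -- The intersection is spanned by common nodes; with fewer than two of them it could not contain
  -- two points.
  obtain ⟨x, hx, y, hy, hxy⟩ : ∃ x ∈ E.carrier ∩ E'.carrier ∩ nodes T,
      ∃ y ∈ E.carrier ∩ E'.carrier ∩ nodes T, x ≠ y := by
    by_contra hc
    push Not at hc
    have hss : (E.carrier ∩ E'.carrier ∩ (nodes T : Set Plane)).Subsingleton :=
      fun x hx y hy => hc x hx y hy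
    rw [hss.convex.convexHull_eq] at hsub
    exact hpr (hss (hsub hp) (hsub hr))
  -- The midpoint of the two common nodes is not interior to `E`, so a coordinate of `E` vanishes
  -- there and hence at both nodes: they lie on one side of `E`, at dyadic positions of level at
  -- most Λ.
  have hm : midpoint ℝ x y ∈ E.carrier ∩ E'.carrier :=
    (E.convex_carrier.inter E'.convex_carrier).segment_subset hx.1 hy.1 (midpoint_mem_segment x y)
  obtain ⟨k, hk⟩ := exists_lam_eq_zero nE hm.1
    fun hi => notMem_of_disjoint_interior nE' hd hi hm.2
  rw [lam_midpoint] at hk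
  have hx0 := (mem_carrier nE).1 hx.1.1 k
  have hy0 := (mem_carrier nE).1 hy.1.1 k
  obtain ⟨i, j, hij, hki, hkj⟩ := exists_other k
  have sx := (mem_segment_iff nE hij hki hkj).2 ⟨hx.1.1, show E.lam k x = 0 by linarith⟩
  have sy := (mem_segment_iff nE hij hki hkj).2 ⟨hy.1.1, show E.lam k y = 0 by linarith⟩
  obtain ⟨k₁, hk₁, i₁⟩ := hA x hx.2
  obtain ⟨k₂, hk₂, i₂⟩ := hA y hy.2
  obtain ⟨l₁, e₁⟩ := i₁.dyadic_point hT₀ hT hE hij sx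
  obtain ⟨l₂, e₂⟩ := i₂.dyadic_point hT₀ hT hE hij sy
  have hne' : (l₁ : ℝ) / 2 ^ k₁ ≠ (l₂ : ℝ) / 2 ^ k₂ := by
    intro h; rw [h] at e₁; exact hxy (e₁.trans e₂.symm)
  have h1 := abs_sub_dyadic hk₁ hk₂ hne'
  have h2 : dist x y = |(l₁ : ℝ) / 2 ^ k₁ - (l₂ : ℝ) / 2 ^ k₂| * dist (E.vert i) (E.vert j) := by
    rw [e₁, e₂, dist_lineMap_lineMap, Real.dist_eq]
  have h3 := sz_le_dist_vert (hκ E (hT.inForest E hE)) nE hij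
  have h4 := E'.dist_le_sz hx.1.2 hy.1.2
  have hdp := dist_nonneg (x := E.vert i) (y := E.vert j)
  calc E.sz ≤ 2 * κ * dist (E.vert i) (E.vert j) := h3
    _ ≤ 2 * κ * ((2 ^ Λ * |(l₁ : ℝ) / 2 ^ k₁ - (l₂ : ℝ) / 2 ^ k₂|) *
        dist (E.vert i) (E.vert j)) := by
        gcongr; exact le_mul_of_one_le_left hdp h1
    _ = 2 * κ * 2 ^ Λ * dist x y := by rw [h2]; ring
    _ ≤ _ := by gcongr

open scoped Classical in
/-- The number of elements containing a given point is bounded by shape regularity. -/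
theorem card_star_le (hT₀ : IsConforming T₀) {κ : ℝ} (hκ1 : 1 ≤ κ)
    (hκ : ∀ P, InForest T₀ P → P.q ≤ κ * |P.det|) (hT : IsRefinement T₀ T) (z : Plane) :
    ((T.filter fun E => z ∈ E.carrier).card : ℝ) * refArea ≤
      2 * κ * volume.real (Metric.closedBall (0 : Plane) 1) := by
  set S := T.filter fun E => z ∈ E.carrier with hS
  have memS : ∀ {E}, E ∈ S → E ∈ T ∧ z ∈ E.carrier := fun h => by simpa [hS] using h
  obtain ⟨ε, hε, hεs⟩ : ∃ ε : ℝ, 0 < ε ∧ ∀ E ∈ S, ε ≤ E.sz := by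
    by_cases hne : S.Nonempty
    · refine ⟨S.inf' hne Tri.sz, ?_, fun E hE => Finset.inf'_le _ hE⟩
      rw [Finset.lt_inf'_iff]
      exact fun E hE => sz_pos ((hT.inForest E (memS hE).1).nondeg hT₀)
    · exact ⟨1, one_pos, fun E hE => absurd ⟨E, hE⟩ hne⟩
  -- Each element of the star is shrunk towards `z` to the smallest size ε. The images are disjoint,
  -- lie in the ball of radius ε about `z`, and have area comparable to ε², so an area count bounds
  -- their number.
  let H : Tri → Set Plane := fun E => AffineMap.homothety z (ε / E.sz) '' interior E.carrier
  have hsub : ∀ E ∈ S, H E ⊆ interior E.carrier ∩ Metric.closedBall z ε := by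
    rintro E hE _ ⟨x, hx, rfl⟩
    have nE := (hT.inForest E (memS hE).1).nondeg hT₀
    have hpos := sz_pos nE
    have ht : 0 < ε / E.sz := div_pos hε hpos
    have ht1 : ε / E.sz ≤ 1 := (div_le_one hpos).2 (hεs E hE)
    rw [AffineMap.homothety_eq_lineMap]
    constructor
    · rw [mem_interior nE]
      intro i
      rw [lam_lineMap]
      have h1 := (mem_interior nE).1 hx i
      have h2 := (mem_carrier nE).1 (memS hE).2 i
      nlinarith [mul_nonneg (sub_nonneg.2 ht1) h2, mul_pos ht h1]
    · rw [Metric.mem_closedBall, dist_lineMap_left, Real.norm_of_nonneg ht.le]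
      calc ε / E.sz * dist z x ≤ ε / E.sz * E.sz := by
            gcongr; exact E.dist_le_sz (memS hE).2 (interior_subset hx)
        _ = ε := div_mul_cancel₀ _ hpos.ne'
  have hHo : ∀ E ∈ S, MeasurableSet (H E) := fun E hE => by
    have nE := (hT.inForest E (memS hE).1).nondeg hT₀
    have ht : ε / E.sz ≠ 0 := (div_pos hε (sz_pos nE)).ne'
    exact ((AffineMap.homothety_isOpenMap z _ ht) _ isOpen_interior).measurableSet
  have hvol : ∀ E ∈ S, ε ^ 2 / (2 * κ) * refArea ≤ volume.real (H E) := fun E hE => by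
    have nE := (hT.inForest E (memS hE).1).nondeg hT₀
    have hpos := sz_pos nE
    have hq := hκ E (hT.inForest E (memS hE).1)
    have hv : volume.real (interior E.carrier) = |E.det| * refArea := by
      rw [← volume_carrier nE, measureReal_def, measureReal_def,
        measure_congr (interior_ae_eq_of_null_frontier E.volume_frontier)]
    have : volume.real (H E) = (ε / E.sz) ^ 2 * (|E.det| * refArea) := by
      rw [measureReal_def, Measure.addHaar_image_homothety, ENNReal.toReal_mul,
        ENNReal.toReal_ofReal (abs_nonneg _), ← measureReal_def, hv]
      simp
    rw [this, div_pow, sz_sq]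
    have hr := refArea_pos
    have hqp : 0 < E.q := by
      have := abs_pos.2 (det_ne_zero_iff.2 nE); linarith [E.two_abs_det_le]
    rw [← mul_assoc]
    gcongr
    rw [div_mul_eq_mul_div, div_le_div_iff₀ (by positivity) (by positivity)]
    have := mul_le_mul_of_nonneg_left hq (sq_nonneg ε)
    nlinarith
  have hdisj : (S : Set Tri).PairwiseDisjoint H := by
    intro E hE E' hE' hne
    exact (hT.disjoint hT₀ E (memS hE).1 E' (memS hE').1 hne).mono
      (fun x hx => (hsub E hE hx).1) (fun x hx => (hsub E' hE' hx).1)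
  have hsum : ∑ E ∈ S, volume.real (H E) ≤ volume.real (Metric.closedBall z ε) := by
    have hfin : volume (Metric.closedBall z ε) ≠ ⊤ := measure_closedBall_lt_top.ne
    rw [← measureReal_biUnion_finset hdisj hHo
      (fun E hE => measure_ne_top_of_subset (fun x hx => (hsub E hE hx).2) hfin)]
    refine measureReal_mono (Set.iUnion₂_subset fun E hE x hx => (hsub E hE hx).2) hfin
  have hball : volume.real (Metric.closedBall z ε) =
      ε ^ 2 * volume.real (Metric.closedBall (0 : Plane) 1) := by
    rw [measureReal_def, Measure.addHaar_closedBall' volume z hε.le, ENNReal.toReal_mul,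
      ENNReal.toReal_ofReal (by positivity)]
    simp [measureReal_def]
  have h1 := (Finset.card_nsmul_le_sum S _ _ hvol).trans hsum
  rw [hball, nsmul_eq_mul] at h1
  have hε2 : 0 < ε ^ 2 := by positivity
  apply le_of_mul_le_mul_left _ hε2
  have h2 := mul_le_mul_of_nonneg_left h1 (show 0 ≤ 2 * κ by linarith)
  calc ε ^ 2 * (S.card * refArea) = 2 * κ * (S.card * (ε ^ 2 / (2 * κ) * refArea)) := by
        field_simp
    _ ≤ 2 * κ * (ε ^ 2 * volume.real (Metric.closedBall (0 : Plane) 1)) := h2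
    _ = _ := by ring

end Mesh

end

end VEM

/-! ### Connectedness of stars and comparable sizes around interior points. -/

namespace VEM

noncomputable section

open Tri

section Mesh

variable {T₀ T : Finset Tri}

theorem exists_vert_ne {E : Tri} (hE : E.Nondeg) (z : Plane) : ∃ i, E.vert i ≠ z := by
  by_contra h
  push Not at h
  exact absurd (vert_injective hE ((h 0).trans (h 1).symm)) (by decide)

theorem one_lt_rank_plane : 1 < Module.rank ℝ Plane := by
  rw [← Module.finrank_eq_rank]; simp

/-- A connected set meeting `E` at distance at least `ε` meets spheres: a triangle containing `z`
meets every sphere about `z` of radius less than the distance to some vertex. -/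
theorem carrier_inter_sphere {E : Tri} {z : Plane} (hz : z ∈ E.carrier) {x : Plane}
    (hx : x ∈ E.carrier) {ε : ℝ} (hε : 0 < ε) (h : ε ≤ dist z x) :
    ∃ p ∈ E.carrier, p ∈ Metric.sphere z ε := by
  have hd : 0 < dist z x := hε.trans_le h
  refine ⟨AffineMap.lineMap z x (ε / dist z x), ?_, ?_⟩
  · exact E.convex_carrier.lineMap_mem hz hx ⟨by positivity, (div_le_one hd).2 h⟩
  · rw [Metric.mem_sphere, dist_lineMap_left, Real.norm_of_nonneg (by positivity),
      div_mul_cancel₀ _ hd.ne']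

open scoped Classical in
/-- Elements around an interior point form a connected star. -/
theorem star_connected (hT₀ : IsConforming T₀) (hT : IsRefinement T₀ T) {z : Plane}
    (hz : z ∈ domain T₀) {A : Finset Tri} (hA : A ⊆ T.filter fun E => z ∈ E.carrier)
    (hne : A.Nonempty) (hA' : A ≠ T.filter fun E => z ∈ E.carrier) :
    ∃ E ∈ A, ∃ E' ∈ T.filter (fun E => z ∈ E.carrier), E' ∉ A ∧
      ∃ p ∈ E.carrier ∩ E'.carrier, p ≠ z := by
  set S := T.filter fun E => z ∈ E.carrier with hS
  have memS : ∀ {E}, E ∈ S ↔ E ∈ T ∧ z ∈ E.carrier := by simp [hS]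
  have h1 : ∀ᶠ ε in 𝓝[>] (0 : ℝ), Metric.closedBall z ε ⊆ ⋃ E ∈ T, E.carrier := by
    rw [hT.union_eq hT₀]
    exact (eventually_closedBall_subset (mem_interior_iff_mem_nhds.1 hz)).filter_mono
      nhdsWithin_le_nhds
  have h2 : ∀ᶠ ε in 𝓝[>] (0 : ℝ), ∀ E ∈ T, z ∉ E.carrier →
      Metric.closedBall z ε ⊆ E.carrierᶜ := by
    rw [Filter.eventually_all_finset]
    intro E hE
    by_cases hzE : z ∈ E.carrier
    · simp [hzE]
    · filter_upwards [(eventually_closedBall_subset (E.isClosed_carrier.isOpen_compl.mem_nhds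
        hzE)).filter_mono nhdsWithin_le_nhds] with ε hε _ using hε
  have h3 : ∀ᶠ ε in 𝓝[>] (0 : ℝ), ∀ E ∈ T, ∃ i, ε ≤ dist z (E.vert i) := by
    rw [Filter.eventually_all_finset]
    intro E hE
    obtain ⟨i, hi⟩ := exists_vert_ne ((hT.inForest E hE).nondeg hT₀) z
    filter_upwards [(eventually_le_nhds (dist_pos.2 hi.symm)).filter_mono nhdsWithin_le_nhds]
      with ε hε using ⟨i, hε⟩
  obtain ⟨ε, h1, h2, h3, hε⟩ := (h1.and (h2.and (h3.and self_mem_nhdsWithin))).exists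
  have hε : 0 < ε := hε
  have hclosed : ∀ B : Finset Tri, IsClosed (⋃ E ∈ B, E.carrier) := fun B =>
    B.finite_toSet.isClosed_biUnion fun E _ => E.isClosed_carrier
  have hmeet : ∀ B ⊆ S, B.Nonempty →
      (Metric.sphere z ε ∩ ⋃ E ∈ B, E.carrier).Nonempty := by
    rintro B hB ⟨E, hE⟩
    obtain ⟨hET, hzE⟩ := memS.1 (hB hE)
    obtain ⟨i, hi⟩ := h3 E hET
    obtain ⟨p, hp, hps⟩ := carrier_inter_sphere hzE (E.vert_mem i) hε hi
    exact ⟨p, hps, Set.mem_biUnion hE hp⟩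
  have hcov : Metric.sphere z ε ⊆ (⋃ E ∈ A, E.carrier) ∪ ⋃ E ∈ S \ A, E.carrier := by
    intro p hp
    obtain ⟨E, hE, hpE⟩ := Set.mem_iUnion₂.1 (h1 (Metric.sphere_subset_closedBall hp))
    have hzE : z ∈ E.carrier := by
      by_contra hzE
      exact h2 E hE hzE (Metric.sphere_subset_closedBall hp) hpE
    by_cases hEA : E ∈ A
    · exact Or.inl (Set.mem_biUnion hEA hpE)
    · exact Or.inr (Set.mem_biUnion (show E ∈ S \ A from
        Finset.mem_sdiff.2 ⟨memS.2 ⟨hE, hzE⟩, hEA⟩) hpE)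
  have hBne : (S \ A).Nonempty := by
    rw [Finset.sdiff_nonempty]
    exact fun h => hA' (Finset.Subset.antisymm hA h)
  -- The circle is connected and covered by two closed unions of elements, each of which it meets;
  -- so they share a point of it, and this point is not `z`.
  obtain ⟨p, hps, hpA, hpB⟩ := isPreconnected_closed_iff.1
    (isPreconnected_sphere one_lt_rank_plane z ε) _ _ (hclosed A) (hclosed (S \ A)) hcov
    (hmeet A hA hne) (hmeet _ Finset.sdiff_subset hBne)
  obtain ⟨E, hE, hpE⟩ := Set.mem_iUnion₂.1 hpA
  obtain ⟨E', hE', hpE'⟩ := Set.mem_iUnion₂.1 hpB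
  obtain ⟨hS', hnA⟩ := Finset.mem_sdiff.1 hE'
  refine ⟨E, hE, E', hS', hnA, p, ⟨hpE, hpE'⟩, ?_⟩
  rintro rfl
  simp at hps
  exact hε.ne' hps.symm

/-- In admissible meshes, all elements around an interior point have comparable sizes. -/
theorem exists_star_constant (hT₀ : IsConforming T₀) (Λ : ℕ) :
    ∃ K : ℝ, 1 ≤ K ∧ ∀ T, IsRefinement T₀ T → IsAdmissible T₀ T Λ → ∀ z ∈ domain T₀,
      ∀ E ∈ T, ∀ E' ∈ T, z ∈ E.carrier → z ∈ E'.carrier → E'.sz ≤ K * E.sz := by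
  classical
  obtain ⟨κ, hκ1, hκ⟩ := exists_shape_constant hT₀
  set K₀ := 2 * κ * 2 ^ Λ with hK₀
  have hK₀1 : 1 ≤ K₀ := by
    have : (1 : ℝ) ≤ 2 ^ Λ := one_le_pow₀ one_le_two
    nlinarith
  obtain ⟨N, hN⟩ := exists_nat_ge
    (2 * κ * volume.real (Metric.closedBall (0 : Plane) 1) / refArea)
  refine ⟨K₀ ^ N, one_le_pow₀ hK₀1, fun T hT hA z hz E hE E' hE' hzE hzE' => ?_⟩
  set S := T.filter fun E => z ∈ E.carrier with hS
  have hcard : S.card ≤ N := by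
    have h := card_star_le hT₀ hκ1 hκ hT z
    have : (S.card : ℝ) ≤ N := by
      refine le_trans ?_ hN
      rw [le_div_iff₀ refArea_pos]; exact h
    exact_mod_cast this
  -- `A k` collects the elements of size at most K₀^k times that of `E`. As long as it is not the
  -- whole star, connectedness gives a neighbour outside it, which enters at the next level. At most
  -- `N` elements are available, so `A N` is the whole star.
  let A : ℕ → Finset Tri := fun k => S.filter fun F => F.sz ≤ K₀ ^ k * E.sz
  have hES : E ∈ S := by simp [hS, hE, hzE]
  have hEA : ∀ k, E ∈ A k := fun k => by
    simp only [A, Finset.mem_filter, hES, true_and]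
    exact le_mul_of_one_le_left E.sz_nonneg (one_le_pow₀ hK₀1)
  have step : ∀ k, A k = S ∨ k + 1 ≤ (A k).card := by
    intro k
    induction k with
    | zero => right; exact Finset.card_pos.2 ⟨E, hEA 0⟩
    | succ k ih =>
      have hmono : A k ⊆ A (k + 1) := by
        intro F hF
        simp only [A, Finset.mem_filter] at hF ⊢
        refine ⟨hF.1, hF.2.trans ?_⟩
        have := E.sz_nonneg
        gcongr
        omega
      by_cases hk : A k = S
      · left
        exact Finset.Subset.antisymm (Finset.filter_subset _ _) (hk ▸ hmono)
      · obtain ⟨F, hF, F', hF', hnF', p, hp, hpz⟩ :=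
          star_connected hT₀ hT hz (Finset.filter_subset _ _) ⟨E, hEA k⟩ hk
        have hFS : F ∈ S ∧ F.sz ≤ K₀ ^ k * E.sz := Finset.mem_filter.1 hF
        have hFT : F ∈ T ∧ z ∈ F.carrier := by simpa [hS] using hFS.1
        have hFT' : F' ∈ T ∧ z ∈ F'.carrier := by simpa using hF'
        have hne : F' ≠ F := by rintro rfl; exact hnF' hF
        have hsz := size_le_of_two_points hT₀ hκ1 hκ hT hA hFT'.1 hFT.1 hne
          hp.symm ⟨hFT'.2, hFT.2⟩ hpz
        have hF'A : F' ∈ A (k + 1) := by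
          simp only [A, Finset.mem_filter]
          refine ⟨hF', hsz.trans ?_⟩
          calc K₀ * F.sz ≤ K₀ * (K₀ ^ k * E.sz) := by gcongr; exact hFS.2
            _ = K₀ ^ (k + 1) * E.sz := by ring
        right
        have hlt : A k ⊂ A (k + 1) :=
          Finset.ssubset_iff_subset_ne.2 ⟨hmono, fun h => hnF' ((Finset.ext_iff.1 h F').2 hF'A)⟩
        have := Finset.card_lt_card hlt
        have := ih.resolve_left hk
        omega
  have hAN : A N = S := by
    rcases step N with h | h
    · exact h
    · have : (A N).card ≤ S.card := Finset.card_filter_le S _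
      omega
  have : E' ∈ A N := by rw [hAN]; simp [hS, hE', hzE']
  simpa [A] using (Finset.mem_filter.1 this).2

end Mesh

end

end VEM

/-! ### The boundary of the domain and the sides it consists of. -/

namespace VEM

noncomputable section

open Tri

section Boundary

variable {T₀ : Finset Tri}

/-- The closed region triangulated by `T₀`. -/
def region (T₀ : Finset Tri) : Set Plane := ⋃ E ∈ T₀, E.carrier

theorem isOpen_domain (T₀ : Finset Tri) : IsOpen (domain T₀) := isOpen_interior

theorem isCompact_region (T₀ : Finset Tri) : IsCompact (region T₀) :=
  T₀.finite_toSet.isCompact_biUnion fun E _ => E.isCompact_carrier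

theorem domain_subset_region (T₀ : Finset Tri) : domain T₀ ⊆ region T₀ := interior_subset

theorem mem_region {x : Plane} : x ∈ region T₀ ↔ ∃ R ∈ T₀, x ∈ R.carrier := by simp [region]

theorem root_subset_region {R : Tri} (hR : R ∈ T₀) : R.carrier ⊆ region T₀ :=
  fun _ hx => mem_region.2 ⟨R, hR, hx⟩

theorem interior_root_subset_domain {R : Tri} (hR : R ∈ T₀) :
    interior R.carrier ⊆ domain T₀ := interior_mono (root_subset_region hR)

/-- The region is closed and each root is the closure of its interior, so the closure of the domain
is the whole region. -/
theorem frontier_domain (hT₀ : IsConforming T₀) :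
    frontier (domain T₀) = region T₀ \ domain T₀ := by
  rw [(isOpen_domain T₀).frontier_eq]
  congr 1
  apply Set.Subset.antisymm
  · exact closure_minimal (domain_subset_region T₀) (isCompact_region T₀).isClosed
  · intro x hx
    obtain ⟨R, hR, hx⟩ := mem_region.1 hx
    rw [← closure_interior (hT₀.nondegenerate R hR)] at hx
    exact closure_mono (interior_root_subset_domain hR) hx

/-- A point in the relative interior of a side shared by two triangles is interior to their
union. -/
theorem mem_interior_of_shared {C C' : Tri} (hC : C.Nondeg) (hC' : C'.Nondeg)
    (hd : Disjoint (interior C.carrier) (interior C'.carrier)) {a b k a' b' k' : Fin 3}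
    (hab : a ≠ b) (hka : k ≠ a) (hkb : k ≠ b) (hab' : a' ≠ b') (hka' : k' ≠ a') (hkb' : k' ≠ b')
    (ha : C.vert a = C'.vert a') (hb : C.vert b = C'.vert b') {x : Plane}
    (hx : x ∈ openSegment ℝ (C.vert a) (C.vert b)) :
    x ∈ interior (C.carrier ∪ C'.carrier) := by
  obtain ⟨a1, a2, a3⟩ := (mem_openSegment_iff hC hab hka hkb).1 hx
  have hx' := hx
  rw [ha, hb] at hx'
  obtain ⟨b1, b2, b3⟩ := (mem_openSegment_iff hC' hab' hka' hkb').1 hx'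
  -- The two coordinates opposite to the common side vanish on the same line and are therefore
  -- proportional.
  have hlam : ∀ y, C.lam k y = C'.lam k' y * C.lam k (C'.vert k') := fun y => by
    have h := lam_combo C _ (sum_lam hC' y) C'.vert k
    rw [comb_lam hC' y] at h
    rw [h, Finset.sum_eq_single k']
    · intro m _ hm
      rcases eq_of_distinct hab' hka' hkb' m with rfl | rfl | rfl
      · rw [← ha, lam_vert_ne hC hka, mul_zero]
      · rw [← hb, lam_vert_ne hC hkb, mul_zero]
      · exact absurd rfl hm
    · simp
  have ev : ∀ (F : Tri) (m : Fin 3), 0 < F.lam m x → ∀ᶠ y in 𝓝 x, 0 < F.lam m y :=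
    fun F m hm => (F.continuous_lam m).continuousAt.eventually_const_lt hm
  -- The third vertices lie on opposite sides of the common line. Otherwise, moving from `x` towards
  -- the third vertex of `C'` would enter the interior of `C`.
  have hneg : C.lam k (C'.vert k') < 0 := by
    by_contra hge
    push Not at hge
    rcases hge.eq_or_lt with h0 | hpos
    · have := hlam (C.vert k)
      rw [lam_vert_self hC, ← h0, mul_zero] at this
      exact one_ne_zero this
    · have hcont : Continuous fun t : ℝ => (AffineMap.lineMap x (C'.vert k') t : Plane) :=
        AffineMap.lineMap_continuous
      have ht : Tendsto (fun t : ℝ => (AffineMap.lineMap x (C'.vert k') t : Plane)) (𝓝[>] 0)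
          (𝓝 x) := by
        have := (hcont.tendsto 0).mono_left (nhdsWithin_le_nhds (s := Set.Ioi 0))
        rwa [AffineMap.lineMap_apply_zero] at this
      obtain ⟨t, ⟨⟨t1, t2⟩, t3⟩, t4⟩ := ((ht.eventually ((ev C a a1).and (ev C b a2))).and
        (self_mem_nhdsWithin (s := Set.Ioi (0 : ℝ)))).and ((eventually_le_nhds
          (one_pos (α := ℝ))).filter_mono nhdsWithin_le_nhds) |>.exists
      have t3 : 0 < t := t3
      refine notMem_of_disjoint_interior hC' hd (x := AffineMap.lineMap x (C'.vert k') t) ?_ ?_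
      · rw [mem_interior hC]
        intro m
        rcases eq_of_distinct hab hka hkb m with rfl | rfl | rfl
        · exact t1
        · exact t2
        · rw [lam_lineMap, a3]; nlinarith
      · exact C'.convex_carrier.lineMap_mem (C'.convex_carrier.openSegment_subset
          (C'.vert_mem _) (C'.vert_mem _) hx') (C'.vert_mem _) ⟨t3.le, t4⟩
  rw [mem_interior_iff_mem_nhds]
  filter_upwards [ev C a a1, ev C b a2, ev C' a' b1, ev C' b' b2] with y y1 y2 y3 y4
  rcases le_or_gt 0 (C.lam k y) with h | h
  · left
    rw [mem_carrier hC]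
    intro m
    rcases eq_of_distinct hab hka hkb m with rfl | rfl | rfl
    exacts [y1.le, y2.le, h]
  · right
    rw [mem_carrier hC']
    rw [hlam] at h
    intro m
    rcases eq_of_distinct hab' hka' hkb' m with rfl | rfl | rfl
    exacts [y3.le, y4.le, (pos_of_mul_neg_left h hneg.le).le]

/-- A point inside a side that belongs to two roots determines a common side. -/
theorem shared_side (hT₀ : IsConforming T₀) {R R' : Tri} (hR : R ∈ T₀) (hR' : R' ∈ T₀)
    {i j : Fin 3} (hij : i ≠ j) {x : Plane}
    (hx : x ∈ openSegment ℝ (R.vert i) (R.vert j)) (hx' : x ∈ R'.carrier) :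
    ∃ a b : Fin 3, a ≠ b ∧ R.vert i = R'.vert a ∧ R.vert j = R'.vert b := by
  have nR := hT₀.nondegenerate R hR
  obtain ⟨k, hki, hkj, -⟩ := exists_third i j hij
  have hl := (mem_openSegment_iff nR hij hki hkj).1 hx
  have hxR : x ∈ R.carrier := R.convex_carrier.openSegment_subset (R.vert_mem i) (R.vert_mem j) hx
  have hmem : x ∈ R.carrier ∩ R'.carrier := ⟨hxR, hx'⟩
  rw [hT₀.conforming R hR R' hR'] at hmem
  obtain ⟨a, ha⟩ := (vert_mem_of_mem_convexHull nR Set.inter_subset_left hmem hl.1).2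
  obtain ⟨b, hb⟩ := (vert_mem_of_mem_convexHull nR Set.inter_subset_left hmem hl.2.1).2
  refine ⟨a, b, ?_, ha.symm, hb.symm⟩
  rintro rfl
  exact hij (vert_injective nR (ha.symm.trans hb))

theorem mem_domain_of_two_roots (hT₀ : IsConforming T₀) {R R' : Tri} (hR : R ∈ T₀)
    (hR' : R' ∈ T₀) (hne : R ≠ R') {i j : Fin 3} (hij : i ≠ j) {x : Plane}
    (hx : x ∈ openSegment ℝ (R.vert i) (R.vert j)) (hx' : x ∈ R'.carrier) : x ∈ domain T₀ := by
  obtain ⟨a, b, hab, ha, hb⟩ := shared_side hT₀ hR hR' hij hx hx'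
  obtain ⟨k, hki, hkj, -⟩ := exists_third i j hij
  obtain ⟨k', hka, hkb, -⟩ := exists_third a b hab
  refine interior_mono (Set.union_subset (root_subset_region hR) (root_subset_region hR'))
    (mem_interior_of_shared (hT₀.nondegenerate R hR) (hT₀.nondegenerate R' hR')
      (hT₀.disjoint R hR R' hR' hne) hij hki hkj hab hka hkb ha hb hx)

/-- A side of a root with a relatively interior boundary point is a boundary side. -/
theorem side_subset_boundary (hT₀ : IsConforming T₀) {R : Tri} (hR : R ∈ T₀) {i j : Fin 3}
    (hij : i ≠ j) {x : Plane} (hx : x ∈ openSegment ℝ (R.vert i) (R.vert j))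
    (hxΩ : x ∉ domain T₀) :
    segment ℝ (R.vert i) (R.vert j) ⊆ region T₀ \ domain T₀ := by
  have nR := hT₀.nondegenerate R hR
  have hseg : segment ℝ (R.vert i) (R.vert j) ⊆ R.carrier :=
    R.convex_carrier.segment_subset (R.vert_mem i) (R.vert_mem j)
  -- Suppose a point `w` of the open side is interior to the domain. If another root contains `w`,
  -- it shares the whole side and makes `x` interior as well. If none does, `R` alone covers a
  -- neighbourhood of `w`, which would make `w` interior to `R`.
  have hopen : openSegment ℝ (R.vert i) (R.vert j) ⊆ (domain T₀)ᶜ := by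
    intro w hw hwΩ
    have honly : ∀ R' ∈ T₀, R' ≠ R → w ∉ R'.carrier := by
      intro R' hR' hne hwR'
      obtain ⟨a, b, hab, ha, hb⟩ := shared_side hT₀ hR hR' hij hw hwR'
      apply hxΩ
      refine mem_domain_of_two_roots hT₀ hR hR' hne.symm hij hx ?_
      rw [ha, hb] at hx
      exact R'.convex_carrier.openSegment_subset (R'.vert_mem a) (R'.vert_mem b) hx
    have h1 : ∀ᶠ y in 𝓝 w, ∀ R' ∈ T₀, R' ≠ R → y ∉ R'.carrier := by
      rw [Filter.eventually_all_finset]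
      intro R' hR'
      by_cases hne : R' = R
      · simp [hne]
      · filter_upwards [R'.isClosed_carrier.isOpen_compl.mem_nhds (honly R' hR' hne)] with y hy _
          using hy
    have h2 : ∀ᶠ y in 𝓝 w, y ∈ region T₀ := mem_interior_iff_mem_nhds.1 hwΩ
    refine openSegment_not_interior nR hij hw (mem_interior_iff_mem_nhds.2 ?_)
    filter_upwards [h1, h2] with y hy1 hy2
    obtain ⟨R', hR', hy⟩ := mem_region.1 hy2
    by_cases hne : R' = R
    · exact hne ▸ hy
    · exact absurd hy (hy1 R' hR' hne)
  intro w hw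
  refine ⟨root_subset_region hR (hseg hw), ?_⟩
  rw [← closure_openSegment] at hw
  exact closure_minimal hopen (isOpen_domain T₀).isClosed_compl hw

/-- Every boundary point lies on a side of a root contained in the boundary. -/
theorem exists_boundary_side (hT₀ : IsConforming T₀) {z : Plane} (hz : z ∈ region T₀ \ domain T₀) :
    ∃ R ∈ T₀, ∃ i j : Fin 3, i ≠ j ∧ z ∈ segment ℝ (R.vert i) (R.vert j) ∧
      segment ℝ (R.vert i) (R.vert j) ⊆ region T₀ \ domain T₀ := by
  classical
  let I : Finset (Tri × Fin 3 × Fin 3) := (T₀ ×ˢ Finset.univ).filter fun p =>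
    p.2.1 ≠ p.2.2 ∧ segment ℝ (p.1.vert p.2.1) (p.1.vert p.2.2) ⊆ region T₀ \ domain T₀
  let B : Set Plane := ⋃ p ∈ I, segment ℝ (p.1.vert p.2.1) (p.1.vert p.2.2)
  have hBc : IsClosed B := I.finite_toSet.isClosed_biUnion fun p _ => by
    rw [segment_eq_image_lineMap]
    exact (isCompact_Icc.image AffineMap.lineMap_continuous).isClosed
  suffices h : z ∈ B by
    obtain ⟨⟨R, i, j⟩, hp, hzp⟩ := Set.mem_iUnion₂.1 h
    simp only [I, Finset.mem_filter, Finset.mem_product, Finset.mem_univ, and_true] at hp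
    exact ⟨R, hp.1, i, j, hp.2.1, hzp, hp.2.2⟩
  -- The finite union `B` of boundary sides is closed, so it is enough to find points of `B`
  -- arbitrarily close to `z`.
  rw [← hBc.closure_eq, Metric.mem_closure_iff]
  intro δ hδ
  have h1 : ∀ᶠ ε in 𝓝[>] (0 : ℝ), ∀ R ∈ T₀, ∀ i, R.vert i ≠ z → ε < dist z (R.vert i) := by
    rw [Filter.eventually_all_finset]
    intro R hR
    rw [Filter.eventually_all]
    intro i
    by_cases hi : R.vert i = z
    · simp [hi]
    · filter_upwards [(eventually_lt_nhds (dist_pos.2 (Ne.symm hi))).filter_mono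
        nhdsWithin_le_nhds] with ε hε _ using hε
  have h2 : ∀ᶠ ε in 𝓝[>] (0 : ℝ), ε < δ :=
    (eventually_lt_nhds hδ).filter_mono nhdsWithin_le_nhds
  obtain ⟨ε, ⟨h1, h2⟩, hε⟩ := ((h1.and h2).and self_mem_nhdsWithin).exists
  have hε : 0 < ε := hε
  -- Close to a boundary point there are points outside the region. The circle about `z` through
  -- such a point also meets the region and hence, being connected, the boundary. Its radius is
  -- below the distance to every vertex other than `z`, so the boundary point found lies inside a
  -- side.
  obtain ⟨y, hy, hyK⟩ : ∃ y ∈ Metric.ball z ε, y ∉ region T₀ := by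
    by_contra hc
    push Not at hc
    exact hz.2 (mem_interior.2 ⟨_, hc, Metric.isOpen_ball, Metric.mem_ball_self hε⟩)
  have hyz : y ≠ z := by rintro rfl; exact hyK hz.1
  obtain ⟨R, hR, hzR⟩ := mem_region.1 hz.1
  obtain ⟨i, hi⟩ := exists_vert_ne (hT₀.nondegenerate R hR) z
  have hs : 0 < dist z y := dist_pos.2 hyz.symm
  have hsε : dist z y < ε := by rw [dist_comm]; exact hy
  obtain ⟨p₀, hp₀, hp₀s⟩ := carrier_inter_sphere hzR (R.vert_mem i) hs
    (hsε.le.trans (h1 R hR i hi).le)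
  obtain ⟨p, hps, hpf⟩ : ∃ p ∈ Metric.sphere z (dist z y), p ∈ region T₀ \ domain T₀ := by
    by_contra hc
    push Not at hc
    have hcl := (isCompact_region T₀).isClosed.isOpen_compl
    obtain ⟨w, -, hw1, hw2⟩ := isPreconnected_sphere one_lt_rank_plane z (dist z y) _ _
      (isOpen_domain T₀) hcl (fun w hw => by
        by_contra hn
        rw [Set.mem_union, not_or, Set.mem_compl_iff, not_not] at hn
        exact hc w hw ⟨hn.2, hn.1⟩)
      ⟨p₀, hp₀s, by
        by_contra hn
        exact hc p₀ hp₀s ⟨root_subset_region hR hp₀, hn⟩⟩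
      ⟨y, by rw [Metric.mem_sphere, dist_comm], hyK⟩
    exact hw2 (domain_subset_region T₀ hw1)
  obtain ⟨R', hR', hpR'⟩ := mem_region.1 hpf.1
  rw [Metric.mem_sphere] at hps
  refine ⟨p, ?_, by rw [dist_comm, hps]; linarith⟩
  rcases cases_of_mem (hT₀.nondegenerate R' hR') hpR' with h | ⟨m, hm⟩ | ⟨a, b, hab, h⟩
  · exact absurd (interior_root_subset_domain hR' h) hpf.2
  · exfalso
    have hne : R'.vert m ≠ z := by
      rw [hm]; rintro rfl; rw [dist_self] at hps; exact hs.ne hps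
    have := h1 R' hR' m hne
    rw [hm, dist_comm, hps] at this
    linarith
  · have hsub := side_subset_boundary hT₀ hR' hab h hpf.2
    refine Set.mem_iUnion₂.2 ⟨(R', a, b), ?_, openSegment_subset_segment _ _ _ h⟩
    simp only [I, Finset.mem_filter, Finset.mem_product, Finset.mem_univ, and_true]
    exact ⟨hR', hab, hsub⟩

theorem forest_subset_region (hT₀ : IsConforming T₀) {P : Tri} (hP : InForest T₀ P) :
    P.carrier ⊆ region T₀ := by
  obtain ⟨R, hR, hd⟩ := inForest_iff.1 hP
  exact (hd.subset (hT₀.nondegenerate R hR)).trans (root_subset_region hR)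

/-- A side of a triangle of the forest with a relatively interior boundary point lies in the
boundary. -/
theorem forest_side_subset_boundary (hT₀ : IsConforming T₀) {P : Tri} (hP : InForest T₀ P)
    {i j : Fin 3} (hij : i ≠ j) {x : Plane} (hx : x ∈ openSegment ℝ (P.vert i) (P.vert j))
    (hxΩ : x ∉ domain T₀) : segment ℝ (P.vert i) (P.vert j) ⊆ region T₀ \ domain T₀ := by
  have nP := hP.nondeg hT₀
  obtain ⟨R, hR, hd⟩ := inForest_iff.1 hP
  have nR := hT₀.nondegenerate R hR
  have hs := hd.subset nR
  have hxP : x ∈ P.carrier := P.convex_carrier.openSegment_subset (P.vert_mem i) (P.vert_mem j) hx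
  rcases cases_of_mem nR (hs hxP) with h | ⟨m, rfl⟩ | ⟨a, b, hab, h⟩
  · exact absurd (interior_root_subset_domain hR h) hxΩ
  · exact absurd (vert_of_subset nR hs hxP) (openSegment_not_vert nP hij hx)
  · obtain ⟨k, hka, hkb, -⟩ := exists_third a b hab
    have h0 := ((mem_openSegment_iff nR hab hka hkb).1 h).2.2
    obtain ⟨e1, e2⟩ := openSegment_lam_zero nR hs hx h0
    refine Set.Subset.trans ?_ (side_subset_boundary hT₀ hR hab h hxΩ)
    exact (convex_segment _ _).segment_subset
      ((mem_segment_iff nR hab hka hkb).2 ⟨hs (P.vert_mem i), e1⟩)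
      ((mem_segment_iff nR hab hka hkb).2 ⟨hs (P.vert_mem j), e2⟩)

end Boundary

end

end VEM

/-! ### Affine functions and continuous piecewise affine functions with hanging nodes. -/

namespace VEM

noncomputable section

open Tri

namespace Tri

variable {E : Tri}

/-- The gradient of a barycentric coordinate. -/
def gradLam (E : Tri) (i : Fin 3) : Plane :=
  (InnerProductSpace.toDual ℝ Plane).symm (LinearMap.toContinuousLinearMap (E.lam i).linear)

theorem inner_gradLam (E : Tri) (i : Fin 3) (v : Plane) :
    inner ℝ (E.gradLam i) v = (E.lam i).linear v := by
  rw [gradLam, InnerProductSpace.toDual_symm_apply]; rfl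

theorem lam_eq_inner (E : Tri) (i : Fin 3) (x : Plane) :
    E.lam i x = E.lam i 0 + inner ℝ (E.gradLam i) x := by
  rw [inner_gradLam]
  have := (E.lam i).map_vadd 0 x
  simp only [vadd_eq_add, add_zero] at this
  rw [this]; ring

theorem inner_gradLam_sub (E : Tri) (i : Fin 3) (x y : Plane) :
    inner ℝ (E.gradLam i) (x - y) = E.lam i x - E.lam i y := by
  rw [inner_sub_right]
  have h1 := E.lam_eq_inner i x
  have h2 := E.lam_eq_inner i y
  linarith

/-- The affine function with prescribed values at the vertices. -/
def interp (E : Tri) (w : Fin 3 → ℝ) : P1 :=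
  ⟨∑ i, w i * E.lam i 0, ∑ i, w i • E.gradLam i⟩

theorem interp_eval (E : Tri) (w : Fin 3 → ℝ) (x : Plane) :
    (E.interp w).eval x = ∑ i, w i * E.lam i x := by
  simp only [P1.eval, interp, sum_inner, real_inner_smul_left, ← Finset.sum_add_distrib]
  exact Finset.sum_congr rfl fun i _ => by rw [E.lam_eq_inner i x]; ring

theorem interp_vert (hE : E.Nondeg) (w : Fin 3 → ℝ) (i : Fin 3) :
    (E.interp w).eval (E.vert i) = w i := by
  simp [interp_eval, lam_vert hE]

end Tri

theorem P1.eval_sub (p : P1) (x y : Plane) : p.eval x - p.eval y = inner ℝ p.g (x - y) := by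
  simp only [P1.eval, inner_sub_right]; ring

theorem P1.eval_combo (p : P1) {ι : Type*} (s : Finset ι) (w : ι → ℝ) (hw : ∑ i ∈ s, w i = 1)
    (y : ι → Plane) : p.eval (∑ i ∈ s, w i • y i) = ∑ i ∈ s, w i * p.eval (y i) := by
  simp only [P1.eval, inner_sum, inner_smul_right, mul_add, Finset.sum_add_distrib,
    ← Finset.sum_mul, hw, one_mul]

theorem P1.eval_eq_lam (p : P1) {E : Tri} (hE : E.Nondeg) (x : Plane) :
    p.eval x = ∑ i, E.lam i x * p.eval (E.vert i) := by
  conv_lhs => rw [← comb_lam hE x]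
  exact p.eval_combo _ _ (sum_lam hE x) _

theorem P1.continuous_eval (p : P1) : Continuous p.eval := by unfold P1.eval; fun_prop

theorem P1.eval_lineMap (p : P1) (x y : Plane) (t : ℝ) :
    p.eval (AffineMap.lineMap x y t) = (1 - t) * p.eval x + t * p.eval y := by
  simp only [P1.eval, AffineMap.lineMap_apply_module, inner_add_right, inner_smul_right]; ring

theorem P1.ext_vert {p r : P1} {E : Tri} (hE : E.Nondeg)
    (h : ∀ i, p.eval (E.vert i) = r.eval (E.vert i)) : p = r := by
  have hall : ∀ x, p.eval x = r.eval x := fun x => by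
    rw [p.eval_eq_lam hE, r.eval_eq_lam hE]; simp [h]
  have hg : p.g = r.g := by
    refine ext_inner_right ℝ fun v => ?_
    have h1 := p.eval_sub v 0
    have h2 := r.eval_sub v 0
    rw [hall, hall, h2] at h1
    simpa using h1.symm
  have hb : p.b = r.b := by simpa [P1.eval] using hall 0
  cases p; cases r; simp_all

section Nodal

variable (T₀ T : Finset Tri)

/-- The least global index of a node. -/
def minIndex (z : Plane) : ℕ := sInf {k | HasIndex T₀ T z k}

/-- `P` is a triangle of the forest whose bisection creates the hanging node `z`. -/
structure IsParent (z : Plane) (P : Tri) : Prop where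
  forest : InForest T₀ P
  mid : P.mid = z
  left : P.vert 1 ∈ nodes T
  right : P.vert 2 ∈ nodes T
  left_lt : minIndex T₀ T (P.vert 1) < minIndex T₀ T z
  right_lt : minIndex T₀ T (P.vert 2) < minIndex T₀ T z

variable {T₀ T}

theorem HasIndex.minIndex_le {z : Plane} {k : ℕ} (h : HasIndex T₀ T z k) :
    minIndex T₀ T z ≤ k := Nat.sInf_le h

theorem IsProperNode.not_isParent {z : Plane} (h : IsProperNode T z) {P : Tri} :
    ¬ IsParent T₀ T z P := fun hP => by
  have := (HasIndex.proper (T₀ := T₀) h).minIndex_le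
  have := hP.left_lt
  omega

/-- The index is only a relation, and its uniqueness is not needed: a derivation of the least index
exhibits a parent edge whose endpoints have smaller least index. This makes recursion along the
index well founded. -/
theorem exists_isParent {Λ : ℕ} (hA : IsAdmissible T₀ T Λ) {z : Plane} (hz : z ∈ nodes T)
    (hp : ¬ IsProperNode T z) : ∃ P, IsParent T₀ T z P := by
  obtain ⟨k, -, hk⟩ := hA z hz
  have h : HasIndex T₀ T z (minIndex T₀ T z) := Nat.sInf_mem (s := {k | HasIndex T₀ T z k}) ⟨k, hk⟩
  generalize hn : minIndex T₀ T z = n at h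
  cases h with
  | proper h => exact absurd h hp
  | @hanging P i j hP _ _ h₁ h₂ =>
    refine ⟨P, hP, rfl, h₁.mem_nodes, h₂.mem_nodes, ?_, ?_⟩
    · rw [hn]; exact Nat.lt_succ_of_le (h₁.minIndex_le.trans (le_max_left _ _))
    · rw [hn]; exact Nat.lt_succ_of_le (h₂.minIndex_le.trans (le_max_right _ _))

theorem minIndex_le {Λ : ℕ} (hA : IsAdmissible T₀ T Λ) {z : Plane} (hz : z ∈ nodes T) :
    minIndex T₀ T z ≤ Λ := by
  obtain ⟨k, hk, h⟩ := hA z hz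
  exact h.minIndex_le.trans hk

variable (T₀ T)

open scoped Classical in
/-- The values at the nodes of the continuous piecewise affine function with given values at the
proper nodes. -/
def nodalVal (g : Plane → ℝ) (z : Plane) : ℝ :=
  -- Some parent is chosen. Proper nodes have least index 0, hence no parent, and keep the
  -- prescribed value.
  if h : ∃ P, IsParent T₀ T z P then
    (nodalVal g (h.choose.vert 1) + nodalVal g (h.choose.vert 2)) / 2
  else g z
termination_by minIndex T₀ T z
decreasing_by
  · exact h.choose_spec.left_lt
  · exact h.choose_spec.right_lt

variable {T₀ T}

theorem nodalVal_proper (g : Plane → ℝ) {z : Plane} (h : IsProperNode T z) :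
    nodalVal T₀ T g z = g z := by
  rw [nodalVal, dif_neg]
  rintro ⟨P, hP⟩
  exact h.not_isParent hP

theorem nodalVal_hanging {Λ : ℕ} (hA : IsAdmissible T₀ T Λ) (g : Plane → ℝ) {z : Plane}
    (hz : z ∈ nodes T) (hp : ¬ IsProperNode T z) : ∃ P, IsParent T₀ T z P ∧
      nodalVal T₀ T g z = (nodalVal T₀ T g (P.vert 1) + nodalVal T₀ T g (P.vert 2)) / 2 := by
  have h := exists_isParent hA hz hp
  refine ⟨h.choose, h.choose_spec, ?_⟩
  rw [nodalVal, dif_pos h]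

/-- Induction over the nodes along the global index. -/
theorem node_induction {Λ : ℕ} (hA : IsAdmissible T₀ T Λ) (g : Plane → ℝ) {p : Plane → Prop}
    (h0 : ∀ z, IsProperNode T z → p z)
    (h1 : ∀ z ∈ nodes T, ¬ IsProperNode T z → ∀ P, IsParent T₀ T z P →
      nodalVal T₀ T g z = (nodalVal T₀ T g (P.vert 1) + nodalVal T₀ T g (P.vert 2)) / 2 →
      p (P.vert 1) → p (P.vert 2) → p z) : ∀ z ∈ nodes T, p z := by
  intro z
  induction hn : minIndex T₀ T z using Nat.strong_induction_on generalizing z with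
  | _ n ih =>
    intro hz
    by_cases hp : IsProperNode T z
    · exact h0 z hp
    · obtain ⟨P, hP, hv⟩ := nodalVal_hanging hA g hz hp
      exact h1 z hz hp P hP hv (ih _ (hn ▸ hP.left_lt) _ rfl hP.left)
        (ih _ (hn ▸ hP.right_lt) _ rfl hP.right)

/-- Nodal values are affine along every side of an element. A node inside the side is not proper, so
it is the midpoint of a parent edge; that edge lies in the same side, and induction applies to its
endpoints. -/
theorem nodalVal_side (hT₀ : IsConforming T₀) (hT : IsRefinement T₀ T) {Λ : ℕ}
    (hA : IsAdmissible T₀ T Λ) (g : Plane → ℝ) {E : Tri} (hE : E ∈ T) {i j : Fin 3} (hij : i ≠ j)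
    {z : Plane} (hz : z ∈ nodes T) (hzs : z ∈ segment ℝ (E.vert i) (E.vert j)) :
    nodalVal T₀ T g z = E.lam i z * nodalVal T₀ T g (E.vert i) +
      E.lam j z * nodalVal T₀ T g (E.vert j) := by
  have nE := (hT.inForest E hE).nondeg hT₀
  have hvi : nodalVal T₀ T g (E.vert i) = E.lam i (E.vert i) * nodalVal T₀ T g (E.vert i) +
      E.lam j (E.vert i) * nodalVal T₀ T g (E.vert j) := by
    rw [lam_vert_self nE, lam_vert_ne nE hij.symm]; ring
  have hvj : nodalVal T₀ T g (E.vert j) = E.lam i (E.vert j) * nodalVal T₀ T g (E.vert i) +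
      E.lam j (E.vert j) * nodalVal T₀ T g (E.vert j) := by
    rw [lam_vert_self nE, lam_vert_ne nE hij]; ring
  revert hzs
  refine node_induction hA g (p := fun z => z ∈ segment ℝ (E.vert i) (E.vert j) →
    nodalVal T₀ T g z = E.lam i z * nodalVal T₀ T g (E.vert i) +
      E.lam j z * nodalVal T₀ T g (E.vert j)) ?_ ?_ z hz
  · intro z hp hzs
    by_cases e1 : z = E.vert i
    · rw [e1]; exact hvi
    by_cases e2 : z = E.vert j
    · rw [e2]; exact hvj
    have ho := mem_openSegment_of_ne_left_right (Ne.symm e1) (Ne.symm e2) hzs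
    exact absurd (hp.2 E hE (E.convex_carrier.segment_subset (E.vert_mem i) (E.vert_mem j) hzs))
      (openSegment_not_vert nE hij ho)
  · intro z _ _ P hP hv ih₁ ih₂ hzs
    by_cases e1 : z = E.vert i
    · rw [e1]; exact hvi
    by_cases e2 : z = E.vert j
    · rw [e2]; exact hvj
    have ho := mem_openSegment_of_ne_left_right (Ne.symm e1) (Ne.symm e2) hzs
    rw [← hP.mid] at ho
    obtain ⟨p1, p2⟩ := hanging_parent_mem hT₀ hT hP.forest hE hij ho
    rw [hv, ih₁ p1, ih₂ p2, ← hP.mid, Tri.mid, lam_midpoint, lam_midpoint]; ring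

/-- The parent edge of a hanging boundary node lies in the boundary, so zero values are passed on
along the index. -/
theorem nodalVal_boundary (hT₀ : IsConforming T₀) {Λ : ℕ} (hA : IsAdmissible T₀ T Λ)
    {g : Plane → ℝ} (hg : ∀ z ∉ domain T₀, g z = 0) {z : Plane} (hz : z ∈ nodes T)
    (hzΩ : z ∉ domain T₀) : nodalVal T₀ T g z = 0 := by
  revert hzΩ
  refine node_induction hA g (p := fun z => z ∉ domain T₀ → nodalVal T₀ T g z = 0) ?_ ?_ z hz
  · intro z hp hzΩ
    rw [nodalVal_proper g hp, hg z hzΩ]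
  · intro z _ _ P hP hv ih₁ ih₂ hzΩ
    rw [← hP.mid] at hzΩ
    have hs := forest_side_subset_boundary hT₀ hP.forest (by decide) mid_mem_openSegment hzΩ
    rw [hv, ih₁ (hs (left_mem_segment _ _ _)).2, ih₂ (hs (right_mem_segment _ _ _)).2]; norm_num

variable (T₀ T)

/-- The affine function on `E` with the given nodal values. -/
def nodalAffine (g : Plane → ℝ) (E : Tri) : P1 := E.interp fun i => nodalVal T₀ T g (E.vert i)

open scoped Classical in
/-- The continuous piecewise affine function with the given values at proper nodes. -/
def nodalFun (g : Plane → ℝ) (x : Plane) : ℝ :=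
  if h : ∃ E ∈ T, x ∈ E.carrier then (nodalAffine T₀ T g h.choose).eval x else 0

variable {T₀ T}

theorem nodalAffine_node (hT₀ : IsConforming T₀) (hT : IsRefinement T₀ T) {Λ : ℕ}
    (hA : IsAdmissible T₀ T Λ) (g : Plane → ℝ) {E : Tri} (hE : E ∈ T) {z : Plane}
    (hz : z ∈ nodes T) (hzE : z ∈ E.carrier) :
    (nodalAffine T₀ T g E).eval z = nodalVal T₀ T g z := by
  have nE := (hT.inForest E hE).nondeg hT₀
  rcases cases_of_mem nE hzE with h | ⟨i, rfl⟩ | ⟨i, j, hij, h⟩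
  · exact absurd h (node_notMem_interior hT₀ hT hz hE)
  · rw [nodalAffine, interp_vert nE]
  · obtain ⟨k, hki, hkj, hall⟩ := exists_third i j hij
    have h0 := ((mem_openSegment_iff nE hij hki hkj).1 h).2.2
    rw [nodalVal_side hT₀ hT hA g hE hij hz (openSegment_subset_segment _ _ _ h), nodalAffine,
      interp_eval]
    have huniv : (Finset.univ : Finset (Fin 3)) = {i, j, k} := by
      ext m; simpa using hall m
    rw [huniv, Finset.sum_insert (by simp [hij, hki.symm]), Finset.sum_insert
      (by simp [hkj.symm]), Finset.sum_singleton, h0]; ring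

/-- Continuity across elements: the two affine functions agree at all common nodes, and these span
the intersection. -/
theorem nodalAffine_eq (hT₀ : IsConforming T₀) (hT : IsRefinement T₀ T) {Λ : ℕ}
    (hA : IsAdmissible T₀ T Λ) (g : Plane → ℝ) {E E' : Tri} (hE : E ∈ T) (hE' : E' ∈ T)
    {x : Plane} (hx : x ∈ E.carrier) (hx' : x ∈ E'.carrier) :
    (nodalAffine T₀ T g E).eval x = (nodalAffine T₀ T g E').eval x := by
  by_cases hne : E = E'
  · rw [hne]
  have hsub : convexHull ℝ (E.carrier ∩ E'.carrier ∩ nodes T) ⊆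
      {y | (nodalAffine T₀ T g E).eval y = (nodalAffine T₀ T g E').eval y} := by
    apply convexHull_min
    · rintro y ⟨⟨h1, h2⟩, h3⟩
      show _ = _
      rw [nodalAffine_node hT₀ hT hA g hE h3 h1, nodalAffine_node hT₀ hT hA g hE' h3 h2]
    · rw [convex_iff_segment_subset]
      intro y hy w hw u hu
      rw [segment_eq_image_lineMap] at hu
      obtain ⟨t, -, rfl⟩ := hu
      show _ = _
      rw [P1.eval_lineMap, P1.eval_lineMap, show _ = _ from hy, show _ = _ from hw]
  exact hsub (inter_subset_convexHull_nodes hT₀ hT hE hE' hne ⟨hx, hx'⟩)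

theorem nodalFun_eq (hT₀ : IsConforming T₀) (hT : IsRefinement T₀ T) {Λ : ℕ}
    (hA : IsAdmissible T₀ T Λ) (g : Plane → ℝ) {E : Tri} (hE : E ∈ T) {x : Plane}
    (hx : x ∈ E.carrier) : nodalFun T₀ T g x = (nodalAffine T₀ T g E).eval x := by
  have h : ∃ E ∈ T, x ∈ E.carrier := ⟨E, hE, hx⟩
  rw [nodalFun, dif_pos h]
  exact nodalAffine_eq hT₀ hT hA g h.choose_spec.1 hE h.choose_spec.2 hx

theorem nodalFun_boundary (hT₀ : IsConforming T₀) (hT : IsRefinement T₀ T) {Λ : ℕ}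
    (hA : IsAdmissible T₀ T Λ) {g : Plane → ℝ} (hg : ∀ z ∉ domain T₀, g z = 0) {x : Plane}
    (hx : x ∉ domain T₀) : nodalFun T₀ T g x = 0 := by
  by_cases h : ∃ E ∈ T, x ∈ E.carrier
  swap
  · rw [nodalFun, dif_neg h]
  obtain ⟨E, hE, hxE⟩ := h
  have hF := hT.inForest E hE
  have nE := hF.nondeg hT₀
  rw [nodalFun_eq hT₀ hT hA g hE hxE]
  rcases cases_of_mem nE hxE with h | ⟨i, rfl⟩ | ⟨i, j, hij, h⟩
  · exact absurd (interior_mono (forest_subset_region hT₀ hF) h) hx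
  · rw [nodalAffine_node hT₀ hT hA g hE (vert_mem_nodes hE i) hxE,
      nodalVal_boundary hT₀ hA hg (vert_mem_nodes hE i) hx]
  · have hs := forest_side_subset_boundary hT₀ hF hij h hx
    have hsub : segment ℝ (E.vert i) (E.vert j) ⊆
        {y | (nodalAffine T₀ T g E).eval y = 0} := by
      intro y hy
      rw [segment_eq_image_lineMap] at hy
      obtain ⟨t, -, rfl⟩ := hy
      have hv : ∀ m, E.vert m ∉ domain T₀ → (nodalAffine T₀ T g E).eval (E.vert m) = 0 :=
        fun m hm => by
          rw [nodalAffine_node hT₀ hT hA g hE (vert_mem_nodes hE m) (E.vert_mem m),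
            nodalVal_boundary hT₀ hA hg (vert_mem_nodes hE m) hm]
      show _ = _
      rw [P1.eval_lineMap, hv i (hs (left_mem_segment _ _ _)).2,
        hv j (hs (right_mem_segment _ _ _)).2]; ring
    exact hsub (openSegment_subset_segment _ _ _ h)

end Nodal

/-! ### Gluing Lipschitz functions -/

/-- Induction on the number of sets: go from `a` to the last point c of the interval in a set
containing `a`. This set is not needed to cover the rest, except at c itself, which closedness of
the remaining union supplies. -/
theorem lipschitz_glue_real {ι : Type*} [DecidableEq ι] (S : Finset ι) (G : ι → Set ℝ)
    (hG : ∀ i, IsClosed (G i)) (h : ℝ → ℝ) (L : ℝ)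
    (hL : ∀ i, ∀ s ∈ G i, ∀ t ∈ G i, |h s - h t| ≤ L * |s - t|) :
    ∀ a b : ℝ, a ≤ b → Set.Icc a b ⊆ ⋃ i ∈ S, G i → |h a - h b| ≤ L * (b - a) := by
  induction hn : S.card generalizing S with
  | zero =>
    intro a b hab hcov
    rw [Finset.card_eq_zero] at hn
    have := hcov ⟨le_rfl, hab⟩
    simp [hn] at this
  | succ n ih =>
    intro a b hab hcov
    obtain ⟨i, hi, ha⟩ := Set.mem_iUnion₂.1 (hcov ⟨le_rfl, hab⟩)
    have hK : IsCompact (G i ∩ Set.Icc a b) := isCompact_Icc.inter_left (hG i)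
    have hc := hK.sSup_mem ⟨a, ha, le_rfl, hab⟩
    set c := sSup (G i ∩ Set.Icc a b) with hcdef
    have h1 := hL i a ha c hc.1
    rw [abs_sub_comm a c, abs_of_nonneg (sub_nonneg.2 hc.2.1)] at h1
    rcases hc.2.2.eq_or_lt with hcb | hcb
    · rwa [hcb] at h1
    have hcov' : Set.Icc c b ⊆ ⋃ j ∈ S.erase i, G j := by
      rw [← closure_Ioc hcb.ne]
      refine closure_minimal (fun t ht => ?_)
        ((S.erase i).finite_toSet.isClosed_biUnion fun j _ => hG j)
      obtain ⟨j, hj, htj⟩ := Set.mem_iUnion₂.1 (hcov ⟨hc.2.1.trans ht.1.le, ht.2⟩)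
      refine Set.mem_iUnion₂.2 ⟨j, Finset.mem_erase.2 ⟨?_, hj⟩, htj⟩
      rintro rfl
      exact absurd (le_csSup hK.bddAbove ⟨htj, hc.2.1.trans ht.1.le, ht.2⟩) (not_le.2 ht.1)
    have h2 := ih (S.erase i) (by rw [Finset.card_erase_of_mem hi, hn]; rfl) c b hcb.le hcov'
    calc |h a - h b| ≤ |h a - h c| + |h c - h b| := abs_sub_le _ _ _
      _ ≤ L * (b - a) := by linarith

/-- A function that is `L`-Lipschitz on each set of a finite closed cover is `L`-Lipschitz. -/
theorem lipschitz_glue {ι : Type*} (S : Finset ι) (F : ι → Set Plane)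
    (hF : ∀ i, IsClosed (F i)) (f : Plane → ℝ) (L : ℝ)
    (hL : ∀ i, ∀ x ∈ F i, ∀ y ∈ F i, |f x - f y| ≤ L * dist x y) (hcov : ⋃ i ∈ S, F i = Set.univ)
    (x y : Plane) : |f x - f y| ≤ L * dist x y := by
  classical
  have hc : Continuous fun t : ℝ => (AffineMap.lineMap x y t : Plane) :=
    AffineMap.lineMap_continuous
  have := lipschitz_glue_real S (fun i => (fun t : ℝ => (AffineMap.lineMap x y t : Plane)) ⁻¹' F i)
    (fun i => (hF i).preimage hc) (fun t => f (AffineMap.lineMap x y t)) (L * dist x y)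
    (fun i s hs t ht => by
      have := hL i _ hs _ ht
      rwa [dist_lineMap_lineMap, Real.dist_eq, mul_comm |s - t|, ← mul_assoc] at this)
    0 1 zero_le_one (by
      intro t _
      have : (AffineMap.lineMap x y t : Plane) ∈ ⋃ i ∈ S, F i := hcov ▸ Set.mem_univ _
      obtain ⟨i, hi, h⟩ := Set.mem_iUnion₂.1 this
      exact Set.mem_iUnion₂.2 ⟨i, hi, h⟩)
  simpa using this

/-- The plane is covered by the elements, where the function is affine, and the complement of the
domain, where it is zero. -/
theorem nodalFun_lipschitz {T₀ T : Finset Tri} (hT₀ : IsConforming T₀) (hT : IsRefinement T₀ T)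
    {Λ : ℕ} (hA : IsAdmissible T₀ T Λ) {g : Plane → ℝ} (hg : ∀ z ∉ domain T₀, g z = 0) :
    ∃ L, LipschitzWith L (nodalFun T₀ T g) := by
  classical
  let L : ℝ := ∑ E ∈ T, ‖(nodalAffine T₀ T g E).g‖
  have hL0 : 0 ≤ L := Finset.sum_nonneg fun E _ => norm_nonneg _
  let F : Option Tri → Set Plane := fun o => match o with
    | none => (domain T₀)ᶜ
    | some E => if E ∈ T then E.carrier else ∅
  refine ⟨L.toNNReal, LipschitzWith.of_dist_le_mul fun x y => ?_⟩
  rw [Real.coe_toNNReal _ hL0, Real.dist_eq]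
  refine lipschitz_glue (insert none (T.image some)) F ?_ _ L ?_ ?_ x y
  · rintro (_ | E)
    · exact (isOpen_domain T₀).isClosed_compl
    · by_cases hE : E ∈ T
      · simpa [F, hE] using E.isClosed_carrier
      · simp [F, hE]
  · rintro (_ | E) x hx y hy
    · rw [nodalFun_boundary hT₀ hT hA hg hx, nodalFun_boundary hT₀ hT hA hg hy]
      simp only [sub_self, abs_zero]; positivity
    · by_cases hE : E ∈ T
      · simp only [F, hE, if_true] at hx hy
        rw [nodalFun_eq hT₀ hT hA g hE hx, nodalFun_eq hT₀ hT hA g hE hy, P1.eval_sub,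
          dist_eq_norm]
        refine (abs_real_inner_le_norm _ _).trans ?_
        gcongr
        exact Finset.single_le_sum (f := fun E => ‖(nodalAffine T₀ T g E).g‖)
          (fun E _ => norm_nonneg _) hE
      · simp [F, hE] at hx
  · rw [Set.eq_univ_iff_forall]
    intro x
    by_cases hx : x ∈ domain T₀
    · have hxr := domain_subset_region T₀ hx
      rw [region, ← hT.union_eq hT₀] at hxr
      obtain ⟨E, hE, hxE⟩ := Set.mem_iUnion₂.1 hxr
      exact Set.mem_iUnion₂.2 ⟨some E, by simp [hE], by simpa [F, hE] using hxE⟩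
    · exact Set.mem_iUnion₂.2 ⟨none, by simp, hx⟩

end

end VEM

namespace VEM

noncomputable section

/-! ### The maximal function -/

/-- The area of the unit disc. -/
def discArea : ℝ := volume.real (Metric.closedBall (0 : Plane) 1)

theorem volume_closedBall_eq (y : Plane) {r : ℝ} (hr : 0 ≤ r) :
    volume.real (Metric.closedBall y r) = r ^ 2 * discArea := by
  rw [measureReal_def, Measure.addHaar_closedBall' volume y hr, ENNReal.toReal_mul,
    ENNReal.toReal_ofReal (by positivity)]
  simp [discArea, measureReal_def]

theorem discArea_pos : 0 < discArea := by
  rw [discArea, measureReal_def, ENNReal.toReal_pos_iff]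
  exact ⟨Metric.measure_closedBall_pos _ _ one_pos, measure_closedBall_lt_top⟩

/-- The average of `f` over the closed ball of radius `r` about `y`. -/
def ballAvg (f : Plane → ℝ) (r : ℝ) (y : Plane) : ℝ :=
  (∫ w in Metric.closedBall (0 : Plane) r, f (y + w)) / volume.real (Metric.closedBall (0 : Plane) r)

theorem setIntegral_ball_translate (f : Plane → ℝ) (r : ℝ) (y : Plane) :
    ∫ w in Metric.closedBall (0 : Plane) r, f (y + w) = ∫ x in Metric.closedBall y r, f x := by
  have h := (measurePreserving_add_left volume y).setIntegral_preimage_emb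
    (measurableEmbedding_addLeft y) f (Metric.closedBall y r)
  rw [← h]
  congr 2
  ext w; simp [dist_eq_norm]

theorem continuous_ballAvg {f : Plane → ℝ} (hf : Continuous f) (r : ℝ) :
    Continuous (ballAvg f r) := by
  unfold ballAvg
  apply Continuous.div_const
  exact continuous_parametric_integral_of_continuous (by fun_prop) (isCompact_closedBall 0 r)

theorem ballAvg_le {f : Plane → ℝ} (hf : Continuous f) {B : ℝ} (hB : ∀ x, f x ≤ B) {r : ℝ}
    (hr : 0 < r) (y : Plane) : ballAvg f r y ≤ B := by
  have hv : 0 < volume.real (Metric.closedBall (0 : Plane) r) := by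
    rw [volume_closedBall_eq _ hr.le]; have := discArea_pos; positivity
  rw [ballAvg, div_le_iff₀ hv]
  have h : ∫ w in Metric.closedBall (0 : Plane) r, f (y + w) ≤
      ∫ _w in Metric.closedBall (0 : Plane) r, B := by
    apply integral_mono
    · exact ((hf.comp (continuous_const.add continuous_id)).continuousOn.integrableOn_compact
        (isCompact_closedBall 0 r))
    · exact integrableOn_const measure_closedBall_lt_top.ne
    · exact fun w => hB _
  rw [setIntegral_const, smul_eq_mul] at h
  linarith

/-- The centered maximal function. -/
def maximal (f : Plane → ℝ) (y : Plane) : ℝ := ⨆ r : {r : ℝ // 0 < r}, ballAvg f r y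

section Maximal

variable {f : Plane → ℝ}

theorem exists_bound (hf : Continuous f) (hc : HasCompactSupport f) : ∃ B, ∀ x, f x ≤ B := by
  obtain ⟨B, hB⟩ := hc.exists_bound_of_continuous hf
  exact ⟨B, fun x => (le_abs_self _).trans (hB x)⟩

/-- The supremum is taken in ℝ, where an unbounded family has the default supremum 0; this excludes
that case. -/
theorem bddAbove_ballAvg (hf : Continuous f) (hc : HasCompactSupport f) (y : Plane) :
    BddAbove (Set.range fun r : {r : ℝ // 0 < r} => ballAvg f r y) := by
  obtain ⟨B, hB⟩ := exists_bound hf hc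
  exact ⟨B, by rintro _ ⟨r, rfl⟩; exact ballAvg_le hf hB r.2 y⟩

/-- For a fixed radius the average is continuous in the centre, and a supremum of continuous
functions is lower semicontinuous. -/
theorem measurable_maximal (hf : Continuous f) (hc : HasCompactSupport f) :
    Measurable (maximal f) := by
  apply LowerSemicontinuous.measurable
  exact lowerSemicontinuous_ciSup (fun y => bddAbove_ballAvg hf hc y)
    fun r => (continuous_ballAvg hf r).lowerSemicontinuous

theorem ballAvg_le_maximal (hf : Continuous f) (hc : HasCompactSupport f) {r : ℝ} (hr : 0 < r)
    (y : Plane) : ballAvg f r y ≤ maximal f y :=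
  le_ciSup (bddAbove_ballAvg hf hc y) ⟨r, hr⟩

theorem maximal_nonneg (h0 : ∀ x, 0 ≤ f x) (y : Plane) : 0 ≤ maximal f y :=
  Real.iSup_nonneg fun _ => div_nonneg (integral_nonneg fun _ => h0 _) measureReal_nonneg

theorem setIntegral_le_maximal (hf : Continuous f) (hc : HasCompactSupport f) {r : ℝ}
    (hr : 0 < r) (y : Plane) :
    ∫ w in Metric.closedBall (0 : Plane) r, f (y + w) ≤ r ^ 2 * discArea * maximal f y := by
  have h := ballAvg_le_maximal hf hc hr y
  have hv : 0 < volume.real (Metric.closedBall (0 : Plane) r) := by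
    rw [volume_closedBall_eq _ hr.le]; have := discArea_pos; positivity
  rw [ballAvg, div_le_iff₀ hv, volume_closedBall_eq _ hr.le] at h
  linarith

/-- The weak-type estimate, with the truncated function on the right-hand side. -/
theorem maximal_weak (hf : Continuous f) (hc : HasCompactSupport f)
    {t : ℝ} (ht : 0 < t) : volume {y | t < maximal f y} ≤
      ENNReal.ofReal (50 / t) * ∫⁻ x, ENNReal.ofReal (f x - t / 2) := by
  set J := ∫⁻ x, ENNReal.ofReal (f x - t / 2) with hJ
  have hJfin : J ≠ ⊤ := by
    have hint := hf.integrable_of_hasCompactSupport (μ := volume) hc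
    refine ne_top_of_le_ne_top hint.norm.lintegral_lt_top.ne (lintegral_mono fun x => ?_)
    exact ENNReal.ofReal_le_ofReal (by linarith [Real.le_norm_self (f x)])
  have hex : ∀ y ∈ {y | t < maximal f y}, ∃ r : ℝ, 0 < r ∧ t < ballAvg f r y := by
    intro y hy
    obtain ⟨r, hr⟩ := exists_lt_of_lt_ciSup (show t < ⨆ r : {r : ℝ // 0 < r}, ballAvg f r y from hy)
    exact ⟨r, r.2, hr⟩
  choose! ρ hρ0 hρ using hex
  -- On a ball with average above t, subtracting t/2 from `f` still leaves an integral of at least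
  -- t/2 times the area. The truncation makes the later integral over t converge.
  have hball : ∀ y ∈ {y | t < maximal f y}, volume (Metric.closedBall y (ρ y)) ≤
      ENNReal.ofReal (2 / t) *
        ∫⁻ x in Metric.closedBall y (ρ y), ENNReal.ofReal (f x - t / 2) := by
    intro y hy
    have h1 := hρ y hy
    have hr := hρ0 y hy
    have hv : 0 < volume.real (Metric.closedBall (0 : Plane) (ρ y)) := by
      rw [volume_closedBall_eq _ hr.le]; have := discArea_pos; positivity
    have hv' : volume.real (Metric.closedBall y (ρ y)) =
        volume.real (Metric.closedBall (0 : Plane) (ρ y)) := by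
      rw [volume_closedBall_eq _ hr.le, volume_closedBall_eq _ hr.le]
    rw [ballAvg, lt_div_iff₀ hv, setIntegral_ball_translate, ← hv'] at h1
    have hi : IntegrableOn (fun x => f x - t / 2) (Metric.closedBall y (ρ y)) :=
      (hf.sub continuous_const).continuousOn.integrableOn_compact (isCompact_closedBall _ _)
    have h2 : ∫ x in Metric.closedBall y (ρ y), (f x - t / 2) =
        (∫ x in Metric.closedBall y (ρ y), f x) -
          volume.real (Metric.closedBall y (ρ y)) * (t / 2) := by
      rw [integral_sub (hf.continuousOn.integrableOn_compact (isCompact_closedBall _ _))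
        (integrableOn_const measure_closedBall_lt_top.ne), setIntegral_const, smul_eq_mul]
    have h3 : ENNReal.ofReal (∫ x in Metric.closedBall y (ρ y), (f x - t / 2)) ≤
        ∫⁻ x in Metric.closedBall y (ρ y), ENNReal.ofReal (f x - t / 2) := by
      rw [integral_eq_lintegral_pos_part_sub_lintegral_neg_part hi]
      refine (ENNReal.ofReal_le_ofReal (sub_le_self _ ENNReal.toReal_nonneg)).trans ?_
      exact ENNReal.ofReal_toReal_le
    calc volume (Metric.closedBall y (ρ y))
        = ENNReal.ofReal (volume.real (Metric.closedBall y (ρ y))) := by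
          rw [measureReal_def, ENNReal.ofReal_toReal measure_closedBall_lt_top.ne]
      _ ≤ ENNReal.ofReal (2 / t * ∫ x in Metric.closedBall y (ρ y), (f x - t / 2)) := by
          apply ENNReal.ofReal_le_ofReal
          rw [h2, div_mul_eq_mul_div, le_div_iff₀ ht]; nlinarith
      _ ≤ _ := by
          rw [ENNReal.ofReal_mul (by positivity)]
          gcongr
  -- Vitali's covering lemma needs bounded radii. The areas of the selected balls are bounded by the
  -- finite integral `J`.
  obtain ⟨R, hR⟩ : ∃ R, ∀ y ∈ {y | t < maximal f y}, ρ y ≤ R := by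
    set W := (ENNReal.ofReal (2 / t) * J).toReal with hW
    refine ⟨W / discArea + 1, fun y hy => ?_⟩
    have h1 : volume (Metric.closedBall y (ρ y)) ≤ ENNReal.ofReal (2 / t) * J :=
      (hball y hy).trans (by gcongr; exact setLIntegral_le_lintegral _ _)
    have h2 := ENNReal.toReal_mono (ENNReal.mul_ne_top ENNReal.ofReal_ne_top hJfin) h1
    rw [← measureReal_def, volume_closedBall_eq _ (hρ0 y hy).le, ← hW] at h2
    have h3 : ρ y ^ 2 ≤ W / discArea := by rwa [le_div_iff₀ discArea_pos]
    nlinarith [sq_nonneg (ρ y - 1), hρ0 y hy, sq_nonneg (ρ y)]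
  obtain ⟨u, hu, hdisj, hcov⟩ := Vitali.exists_disjoint_subfamily_covering_enlargement_closedBall
    {y | t < maximal f y} id ρ R hR 5 (by norm_num)
  simp only [id] at hdisj hcov
  have hcount : u.Countable := hdisj.countable_of_nonempty_interior fun y hy => by
    refine ⟨y, ?_⟩
    exact interior_mono Metric.ball_subset_closedBall
      (by rw [Metric.isOpen_ball.interior_eq]; exact Metric.mem_ball_self (hρ0 y (hu hy)))
  have hsub : {y | t < maximal f y} ⊆ ⋃ b ∈ u, Metric.closedBall b (5 * ρ b) := by
    intro y hy
    obtain ⟨b, hb, h⟩ := hcov y hy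
    exact Set.mem_iUnion₂.2 ⟨b, hb, h (Metric.mem_closedBall_self (hρ0 y hy).le)⟩
  calc volume {y | t < maximal f y} ≤ volume (⋃ b ∈ u, Metric.closedBall b (5 * ρ b)) :=
        measure_mono hsub
    _ ≤ ∑' b : u, volume (Metric.closedBall (b : Plane) (5 * ρ b)) := measure_biUnion_le _ hcount _
    _ ≤ ∑' b : u, ENNReal.ofReal (50 / t) *
        ∫⁻ x in Metric.closedBall (b : Plane) (ρ b), ENNReal.ofReal (f x - t / 2) := by
        refine ENNReal.tsum_le_tsum fun b => ?_
        have hb := hρ0 b (hu b.2)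
        have e : volume (Metric.closedBall (b : Plane) (5 * ρ b)) =
            ENNReal.ofReal 25 * volume (Metric.closedBall (b : Plane) (ρ b)) := by
          rw [Measure.addHaar_closedBall' volume _ (by positivity),
            Measure.addHaar_closedBall' volume _ hb.le, ← mul_assoc, ← ENNReal.ofReal_mul
            (by norm_num)]
          congr 2; simp; ring
        rw [e, show 50 / t = 25 * (2 / t) by ring, ENNReal.ofReal_mul (by norm_num), mul_assoc]
        gcongr
        exact hball b (hu b.2)
    _ = ENNReal.ofReal (50 / t) *
        ∫⁻ x in ⋃ b ∈ u, Metric.closedBall b (ρ b), ENNReal.ofReal (f x - t / 2) := by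
        rw [ENNReal.tsum_mul_left, lintegral_biUnion hcount
          (fun b _ => Metric.isClosed_closedBall.measurableSet) hdisj]
    _ ≤ _ := by gcongr; exact setLIntegral_le_lintegral _ _

/-- The maximal theorem in `L²`. -/
theorem lintegral_maximal_sq (hf : Continuous f) (hc : HasCompactSupport f)
    (h0 : ∀ x, 0 ≤ f x) :
    ∫⁻ y, ENNReal.ofReal (maximal f y ^ 2) ≤ 200 * ∫⁻ x, ENNReal.ofReal (f x ^ 2) := by
  -- Layer-cake formula: the square integral is 2 ∫ t |{maximal > t}| dt. The weak-type bound and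
  -- Tonelli reduce it to the integral in t of (f - t/2)⁺ at each point, which is at most f·2f, as
  -- the integrand is at most f and vanishes beyond 2f. The constants multiply to 2·50·2 = 200.
  have hlc := lintegral_rpow_eq_lintegral_meas_lt_mul (μ := (volume : Measure Plane))
    (f := maximal f) (ae_of_all _ (maximal_nonneg h0)) (measurable_maximal hf hc).aemeasurable
    (p := 2) (by norm_num)
  simp only [Real.rpow_two] at hlc
  rw [hlc]
  have h1 : ∫⁻ t in Set.Ioi (0 : ℝ), volume {y | t < maximal f y} *
      ENNReal.ofReal (t ^ ((2 : ℝ) - 1)) ≤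
      ∫⁻ t in Set.Ioi (0 : ℝ), ∫⁻ x, 50 * ENNReal.ofReal (f x - t / 2) := by
    refine setLIntegral_mono' measurableSet_Ioi fun t ht => ?_
    have ht : 0 < t := ht
    rw [lintegral_const_mul _ (by fun_prop)]
    norm_num
    calc volume {y | t < maximal f y} * ENNReal.ofReal t ≤
        (ENNReal.ofReal (50 / t) * ∫⁻ x, ENNReal.ofReal (f x - t / 2)) * ENNReal.ofReal t := by
          gcongr; exact maximal_weak hf hc ht
      _ = (ENNReal.ofReal (50 / t) * ENNReal.ofReal t) *
          ∫⁻ x, ENNReal.ofReal (f x - t / 2) := by ring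
      _ = _ := by
          rw [← ENNReal.ofReal_mul (by positivity), div_mul_cancel₀ _ ht.ne']; norm_num
  have h2 : ∫⁻ t in Set.Ioi (0 : ℝ), ∫⁻ x, 50 * ENNReal.ofReal (f x - t / 2) =
      ∫⁻ x, ∫⁻ t in Set.Ioi (0 : ℝ), 50 * ENNReal.ofReal (f x - t / 2) := by
    refine lintegral_lintegral_swap ?_
    apply Measurable.aemeasurable
    apply Measurable.const_mul
    apply ENNReal.measurable_ofReal.comp
    exact ((hf.measurable.comp measurable_snd).sub (measurable_fst.div_const 2))
  have h3 : ∀ x, ∫⁻ t in Set.Ioi (0 : ℝ), 50 * ENNReal.ofReal (f x - t / 2) ≤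
      100 * ENNReal.ofReal (f x ^ 2) := by
    intro x
    rw [lintegral_const_mul _ (by fun_prop)]
    have : ∫⁻ t in Set.Ioi (0 : ℝ), ENNReal.ofReal (f x - t / 2) ≤
        ∫⁻ t, (Set.Ioc (0 : ℝ) (2 * f x)).indicator (fun _ => ENNReal.ofReal (f x)) t := by
      rw [← lintegral_indicator measurableSet_Ioi]
      refine lintegral_mono fun t => ?_
      by_cases ht : 0 < t
      · rw [Set.indicator_of_mem (show t ∈ Set.Ioi 0 from ht)]
        by_cases ht2 : t ≤ 2 * f x
        · rw [Set.indicator_of_mem (show t ∈ Set.Ioc 0 (2 * f x) from ⟨ht, ht2⟩)]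
          exact ENNReal.ofReal_le_ofReal (by linarith)
        · rw [ENNReal.ofReal_of_nonpos (by linarith)]; exact zero_le
      · rw [Set.indicator_of_notMem (by simpa using ht)]; exact zero_le
    rw [lintegral_indicator_const measurableSet_Ioc, Real.volume_Ioc, sub_zero,
      ← ENNReal.ofReal_mul (h0 x)] at this
    calc 50 * ∫⁻ t in Set.Ioi (0 : ℝ), ENNReal.ofReal (f x - t / 2)
        ≤ 50 * ENNReal.ofReal (f x * (2 * f x)) := by gcongr
      _ = 100 * ENNReal.ofReal (f x ^ 2) := by
          rw [show f x * (2 * f x) = 2 * f x ^ 2 by ring, ENNReal.ofReal_mul (by norm_num),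
            ← mul_assoc]
          norm_num
  calc ENNReal.ofReal 2 * _ ≤ ENNReal.ofReal 2 *
        ∫⁻ x, 100 * ENNReal.ofReal (f x ^ 2) := by
        gcongr
        exact h1.trans (h2.le.trans (lintegral_mono h3))
    _ = _ := by
        rw [lintegral_const_mul _ (by fun_prop), ← mul_assoc]; norm_num

theorem integrable_sq_of_compact (hf : Continuous f) (hc : HasCompactSupport f) :
    Integrable fun x => f x ^ 2 :=
  (hf.pow 2).integrable_of_hasCompactSupport
    (by simpa [sq] using hc.mul_right (f' := f))

theorem integrable_maximal_sq (hf : Continuous f) (hc : HasCompactSupport f)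
    (h0 : ∀ x, 0 ≤ f x) : Integrable fun y => maximal f y ^ 2 := by
  refine ⟨((measurable_maximal hf hc).pow_const 2).aestronglyMeasurable, ?_⟩
  rw [hasFiniteIntegral_iff_ofReal (ae_of_all _ fun y => sq_nonneg _)]
  refine (lintegral_maximal_sq hf hc h0).trans_lt (ENNReal.mul_lt_top (by norm_num) ?_)
  exact (integrable_sq_of_compact hf hc).lintegral_lt_top

theorem integral_maximal_sq (hf : Continuous f) (hc : HasCompactSupport f)
    (h0 : ∀ x, 0 ≤ f x) : ∫ y, maximal f y ^ 2 ≤ 200 * ∫ x, f x ^ 2 := by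
  have h := lintegral_maximal_sq hf hc h0
  rw [← ofReal_integral_eq_lintegral_ofReal (integrable_maximal_sq hf hc h0)
    (ae_of_all _ fun y => sq_nonneg _), ← ofReal_integral_eq_lintegral_ofReal
    (integrable_sq_of_compact hf hc) (ae_of_all _ fun y => sq_nonneg _),
    show (200 : ENNReal) = ENNReal.ofReal 200 by norm_num, ← ENNReal.ofReal_mul (by norm_num)] at h
  exact (ENNReal.ofReal_le_ofReal_iff (by
    have : 0 ≤ ∫ x, f x ^ 2 := integral_nonneg fun x => sq_nonneg _
    positivity)).1 h

end Maximal

/-! ### Pointwise bounds by the maximal function of the gradient -/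

/-- The norm of the derivative. -/
def gradNorm (φ : Plane → ℝ) (x : Plane) : ℝ := ‖fderiv ℝ φ x‖

section Pointwise

variable {φ : Plane → ℝ}

theorem continuous_gradNorm (hφ : ContDiff ℝ 1 φ) : Continuous (gradNorm φ) :=
  (hφ.continuous_fderiv (by norm_num)).norm

theorem hasCompactSupport_gradNorm (hc : HasCompactSupport φ) : HasCompactSupport (gradNorm φ) :=
  (hc.fderiv ℝ).norm

theorem abs_sub_le_integral (hφ : ContDiff ℝ 1 φ) (y v : Plane) :
    |φ (y + v) - φ y| ≤ ‖v‖ * ∫ t in Set.Ioc (0 : ℝ) 1, gradNorm φ (y + t • v) := by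
  have hd : ∀ t : ℝ, HasDerivAt (fun t : ℝ => φ (y + t • v)) (fderiv ℝ φ (y + t • v) v) t := by
    intro t
    have h1 : HasDerivAt (fun t : ℝ => y + t • v) v t := by
      simpa using ((hasDerivAt_id t).smul_const v).const_add y
    exact ((hφ.differentiable (by norm_num)).differentiableAt.hasFDerivAt.comp_hasDerivAt t h1)
  have hcont : Continuous fun t : ℝ => fderiv ℝ φ (y + t • v) v :=
    ((hφ.continuous_fderiv (by norm_num)).comp (by fun_prop)).clm_apply continuous_const
  have h := intervalIntegral.integral_eq_sub_of_hasDerivAt (a := 0) (b := 1) (fun t _ => hd t)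
    (hcont.intervalIntegrable 0 1)
  simp only [one_smul, zero_smul, add_zero] at h
  rw [← h, ← Real.norm_eq_abs, ← integral_const_mul]
  refine (intervalIntegral.norm_integral_le_integral_norm zero_le_one).trans ?_
  rw [intervalIntegral.integral_of_le zero_le_one]
  have hcg := continuous_gradNorm hφ
  refine integral_mono (hcont.norm.integrableOn_Ioc) ?_ fun t => ?_
  · exact (Continuous.integrableOn_Ioc (by fun_prop))
  · simp only
    rw [mul_comm]
    exact (fderiv ℝ φ (y + t • v)).le_opNorm v

/-- The mean deviation of `φ` from `φ y` on a ball about `y` is controlled by the maximal function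
of the gradient. -/
theorem integral_abs_sub_le (hφ : ContDiff ℝ 1 φ) (hc : HasCompactSupport φ) (y : Plane) {R : ℝ}
    (hR : 0 < R) : ∫ x in Metric.closedBall y R, |φ x - φ y| ≤
      R ^ 3 * discArea * maximal (gradNorm φ) y := by
  have hcg := continuous_gradNorm hφ
  have hsg := hasCompactSupport_gradNorm hc
  set B := Metric.closedBall (0 : Plane) R with hB
  have hBc : IsCompact B := isCompact_closedBall 0 R
  rw [← setIntegral_ball_translate (fun x => |φ x - φ y|)]
  have hF : Continuous fun p : Plane × ℝ => gradNorm φ (y + p.2 • p.1) := by fun_prop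
  have hint : Integrable (Function.uncurry fun (v : Plane) (t : ℝ) => gradNorm φ (y + t • v))
      ((volume.restrict B).prod (volume.restrict (Set.Ioc (0 : ℝ) 1))) := by
    rw [Measure.prod_restrict]
    exact (hF.continuousOn.integrableOn_compact (hBc.prod isCompact_Icc)).mono_set
      (Set.prod_mono subset_rfl Set.Ioc_subset_Icc_self)
  have h1 : ∫ v in B, |φ (y + v) - φ y| ≤
      ∫ v in B, R * ∫ t in Set.Ioc (0 : ℝ) 1, gradNorm φ (y + t • v) := by
    have hφc := hφ.continuous
    refine setIntegral_mono_on ?_ (hint.integral_prod_left.const_mul R)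
      Metric.isClosed_closedBall.measurableSet fun v hv => ?_
    · exact (Continuous.continuousOn (by fun_prop)).integrableOn_compact hBc
    · refine (abs_sub_le_integral hφ y v).trans ?_
      have : ‖v‖ ≤ R := by simpa [hB] using hv
      gcongr
      exact integral_nonneg fun t => norm_nonneg _
  -- Rescaling by t gives an integral over the ball of radius tR; the Jacobian t^(-2) cancels
  -- against the area in the maximal bound, so the estimate is uniform in t.
  have h2 : ∀ t ∈ Set.Ioc (0 : ℝ) 1, ∫ v in B, gradNorm φ (y + t • v) ≤
      R ^ 2 * discArea * maximal (gradNorm φ) y := by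
    intro t ht
    have ht0 : 0 < t := ht.1
    have e := Measure.setIntegral_comp_smul_of_pos volume (fun v => gradNorm φ (y + v)) B ht0
    rw [e, hB, smul_closedBall _ _ hR.le, smul_zero, Real.norm_of_nonneg ht0.le]
    have h := setIntegral_le_maximal hcg hsg (mul_pos ht0 hR) y
    have hd : Module.finrank ℝ Plane = 2 := by simp
    rw [hd, smul_eq_mul]
    calc (t ^ 2)⁻¹ * _ ≤ (t ^ 2)⁻¹ * ((t * R) ^ 2 * discArea * maximal (gradNorm φ) y) := by gcongr
      _ = _ := by field_simp
  rw [integral_const_mul, integral_integral_swap hint] at h1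
  have h3 : ∫ t in Set.Ioc (0 : ℝ) 1, ∫ v in B, gradNorm φ (y + t • v) ≤
      ∫ _t in Set.Ioc (0 : ℝ) 1, R ^ 2 * discArea * maximal (gradNorm φ) y :=
    setIntegral_mono_on hint.integral_prod_right (integrableOn_const (by simp))
      measurableSet_Ioc h2
  rw [setIntegral_const] at h3
  simp at h3
  calc _ ≤ _ := h1
    _ ≤ R * (R ^ 2 * discArea * maximal (gradNorm φ) y) := by gcongr
    _ = _ := by ring

/-- Comparison of a point value with the values on a set of positive area. -/
theorem integral_abs_sub_le_of_subset (hφ : ContDiff ℝ 1 φ) (hc : HasCompactSupport φ)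
    (y : Plane) {R : ℝ} (hR : 0 < R) {S : Set Plane} (hS : S ⊆ Metric.closedBall y R) :
    ∫ x in S, |φ x - φ y| ≤ R ^ 3 * discArea * maximal (gradNorm φ) y := by
  refine le_trans ?_ (integral_abs_sub_le hφ hc y hR)
  have hφc := hφ.continuous
  exact setIntegral_mono_set ((Continuous.continuousOn (by fun_prop)).integrableOn_compact
    (isCompact_closedBall y R)) (ae_of_all _ fun x => abs_nonneg _) (ae_of_all _ hS)

end Pointwise

end

end VEM

namespace VEM

noncomputable section

/-! ### Iterated integrals over a triangle -/

theorem Tri.measurableSet_refTri : MeasurableSet Tri.refTri :=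
  ((isClosed_le continuous_const continuous_fst).inter ((isClosed_le continuous_const
    continuous_snd).inter (isClosed_le (continuous_fst.add continuous_snd)
      continuous_const))).measurableSet

theorem integral_refTri {F : ℝ × ℝ → ℝ} (hF : IntegrableOn F Tri.refTri) :
    ∫ p in Tri.refTri, F p = ∫ s in (0 : ℝ)..1, ∫ t in (0 : ℝ)..(1 - s), F (s, t) := by
  have hm : MeasurableSet Tri.refTri := Tri.measurableSet_refTri
  rw [← integral_indicator hm, Measure.volume_eq_prod, integral_prod _ (by
    rw [← Measure.volume_eq_prod]; exact hF.integrable_indicator hm),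
    intervalIntegral.integral_of_le zero_le_one, ← integral_Icc_eq_integral_Ioc,
    ← integral_indicator measurableSet_Icc]
  congr 1
  funext s
  by_cases hs : s ∈ Set.Icc (0 : ℝ) 1
  · rw [Set.indicator_of_mem hs, intervalIntegral.integral_of_le (by linarith [hs.2]),
      ← integral_Icc_eq_integral_Ioc, ← integral_indicator measurableSet_Icc]
    congr 1
    funext t
    by_cases ht : t ∈ Set.Icc (0 : ℝ) (1 - s)
    · rw [Set.indicator_of_mem ht, Set.indicator_of_mem]
      exact (show 0 ≤ s ∧ 0 ≤ t ∧ s + t ≤ 1 from ⟨hs.1, ht.1, by linarith [ht.2]⟩)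
    · rw [Set.indicator_of_notMem ht, Set.indicator_of_notMem]
      rintro ⟨-, h1, h2⟩
      exact ht ⟨h1, by simp only at h2; linarith⟩
  · rw [Set.indicator_of_notMem hs, integral_eq_zero_of_ae]
    refine ae_of_all _ fun t => Set.indicator_of_notMem ?_ _
    rintro ⟨h0, h1, h2⟩
    exact hs ⟨h0, by simp only at *; linarith⟩

/-- A function vanishing on one side of a triangle is controlled by its gradient. -/
theorem integral_abs_le_of_zero_side {E : Tri} (hE : E.Nondeg) {φ : Plane → ℝ}
    (hφ : ContDiff ℝ 1 φ) (h0 : ∀ x ∈ segment ℝ (E.vert 0) (E.vert 1), φ x = 0) :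
    ∫ x in E.carrier, |φ x| ≤
      dist (E.vert 2) (E.vert 0) * ∫ x in E.carrier, gradNorm φ x := by
  have hcg := continuous_gradNorm hφ
  have hφc := hφ.continuous
  have hpar := E.continuous_param
  set d := dist (E.vert 2) (E.vert 0) with hd
  rw [Tri.setIntegral_eq_param hE, Tri.setIntegral_eq_param hE, Tri.param_preimage_carrier hE,
    smul_eq_mul, smul_eq_mul, mul_left_comm]
  refine mul_le_mul_of_nonneg_left ?_ (abs_nonneg _)
  have hi : ∀ F : ℝ × ℝ → ℝ, Continuous F → IntegrableOn F Tri.refTri := fun F hF =>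
    (hF.continuousOn.integrableOn_compact (isCompact_Icc.prod isCompact_Icc)).mono_set
      Tri.refTri_subset
  rw [integral_refTri (hi _ (by fun_prop)), integral_refTri (hi _ (by fun_prop)),
    ← intervalIntegral.integral_const_mul]
  have hcont : ∀ F : ℝ × ℝ → ℝ, Continuous F →
      Continuous fun s : ℝ => ∫ t in (0 : ℝ)..(1 - s), F (s, t) := fun F hF =>
    intervalIntegral.continuous_parametric_intervalIntegral_of_continuous
      (f := fun s t => F (s, t)) (by exact hF) (by fun_prop)
  refine intervalIntegral.integral_mono_on zero_le_one
    ((hcont (fun p => |φ (E.param p)|) (by fun_prop)).intervalIntegrable _ _)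
    (((hcont (fun p => gradNorm φ (E.param p)) (by fun_prop)).const_mul d).intervalIntegrable _ _)
    fun s hs => ?_
  set A := ∫ t in (0 : ℝ)..(1 - s), gradNorm φ (E.param (s, t)) with hA
  have hs1 : 0 ≤ 1 - s := by linarith [hs.2]
  have hA0 : 0 ≤ A := intervalIntegral.integral_nonneg hs1 fun _ _ => norm_nonneg _
  -- The line s = const starts at t = 0 on the side where φ vanishes, so the fundamental theorem
  -- bounds φ by the integral of its gradient along the line.
  have hpt : ∀ t ∈ Set.Icc (0 : ℝ) (1 - s), |φ (E.param (s, t))| ≤ d * A := by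
    intro t ht
    have hder : ∀ τ : ℝ, HasDerivAt (fun τ => φ (E.param (s, τ)))
        (fderiv ℝ φ (E.param (s, τ)) (E.vert 2 - E.vert 0)) τ := by
      intro τ
      have h1 : HasDerivAt (fun τ : ℝ => E.param (s, τ)) (E.vert 2 - E.vert 0) τ := by
        unfold Tri.param
        simpa using ((((hasDerivAt_id τ).smul_const (E.vert 2 - E.vert 0)).const_add
          (s • (E.vert 1 - E.vert 0))).const_add (E.vert 0))
      exact ((hφ.differentiable (by norm_num)).differentiableAt.hasFDerivAt.comp_hasDerivAt τ h1)
    have hcd : Continuous fun τ : ℝ => fderiv ℝ φ (E.param (s, τ)) (E.vert 2 - E.vert 0) :=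
      ((hφ.continuous_fderiv (by norm_num)).comp (by fun_prop)).clm_apply continuous_const
    have h := intervalIntegral.integral_eq_sub_of_hasDerivAt (a := 0) (b := t)
      (fun τ _ => hder τ) (hcd.intervalIntegrable 0 t)
    have hz : φ (E.param (s, 0)) = 0 := by
      apply h0
      rw [segment_eq_image']
      exact ⟨s, hs, by simp [Tri.param]⟩
    rw [hz, sub_zero] at h
    rw [← h, ← Real.norm_eq_abs]
    calc _ ≤ ∫ τ in (0 : ℝ)..t, ‖fderiv ℝ φ (E.param (s, τ)) (E.vert 2 - E.vert 0)‖ :=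
          intervalIntegral.norm_integral_le_integral_norm ht.1
      _ ≤ ∫ τ in (0 : ℝ)..t, d * gradNorm φ (E.param (s, τ)) := by
          refine intervalIntegral.integral_mono_on ht.1 (hcd.norm.intervalIntegrable _ _)
            ((by fun_prop : Continuous fun τ => d * gradNorm φ (E.param (s, τ))).intervalIntegrable
              _ _) fun τ _ => ?_
          rw [mul_comm, hd, dist_eq_norm]
          exact (fderiv ℝ φ _).le_opNorm _
      _ ≤ ∫ τ in (0 : ℝ)..(1 - s), d * gradNorm φ (E.param (s, τ)) := by
          refine intervalIntegral.integral_mono_interval le_rfl ht.1 ht.2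
            (ae_of_all _ fun τ => mul_nonneg dist_nonneg (norm_nonneg _))
            ((by fun_prop : Continuous fun τ => d * gradNorm φ (E.param (s, τ))).intervalIntegrable
              _ _)
      _ = d * A := by rw [intervalIntegral.integral_const_mul]
  have hdA : 0 ≤ d * A := mul_nonneg dist_nonneg hA0
  calc ∫ t in (0 : ℝ)..(1 - s), |φ (E.param (s, t))| ≤ ∫ _t in (0 : ℝ)..(1 - s), d * A :=
        intervalIntegral.integral_mono_on hs1
          ((by fun_prop : Continuous fun t => |φ (E.param (s, t))|).intervalIntegrable _ _)
          (by simp) hpt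
    _ = (1 - s) * (d * A) := by simp; ring
    _ ≤ _ := mul_le_of_le_one_left hdA (by linarith [hs.1])

/-! ### Pointwise estimates for the values at the nodes -/

section Pointwise

variable {φ : Plane → ℝ}

theorem setIntegral_gradNorm_le (hφ : ContDiff ℝ 1 φ) (hc : HasCompactSupport φ) (y : Plane)
    {R : ℝ} (hR : 0 < R) {S : Set Plane} (hS : S ⊆ Metric.closedBall y R) :
    ∫ x in S, gradNorm φ x ≤ R ^ 2 * discArea * maximal (gradNorm φ) y := by
  have hcg := continuous_gradNorm hφ
  refine le_trans ?_ (setIntegral_le_maximal hcg (hasCompactSupport_gradNorm hc) hR y)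
  rw [setIntegral_ball_translate (gradNorm φ)]
  exact setIntegral_mono_set (hcg.continuousOn.integrableOn_compact
    (isCompact_closedBall y R)) (ae_of_all _ fun x => norm_nonneg _) (ae_of_all _ hS)

/-- If `φ` is close to the constant `a` on a set of positive area near `y`, then so is `φ y`. -/
theorem abs_sub_mul_le (hφ : ContDiff ℝ 1 φ) (hc : HasCompactSupport φ) (y : Plane) {R : ℝ}
    (hR : 0 < R) {S : Set Plane} (hS : S ⊆ Metric.closedBall y R) (a : ℝ) :
    volume.real S * |φ y - a| ≤
      R ^ 3 * discArea * maximal (gradNorm φ) y + ∫ x in S, |φ x - a| := by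
  have hφc := hφ.continuous
  have hi : ∀ b, IntegrableOn (fun x => |φ x - b|) S := fun b =>
    ((Continuous.continuousOn (by fun_prop)).integrableOn_compact
      (isCompact_closedBall y R)).mono_set hS
  have hfin : volume S ≠ ⊤ := ne_top_of_le_ne_top measure_closedBall_lt_top.ne (measure_mono hS)
  have h := integral_abs_sub_le_of_subset hφ hc y hR hS
  have h2 : ∫ _x in S, |φ y - a| ≤ ∫ x in S, (|φ x - φ y| + |φ x - a|) := by
    refine integral_mono (integrableOn_const hfin) ((hi _).add (hi _)) fun x => ?_
    have := abs_sub_le (φ y) (φ x) a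
    rwa [abs_sub_comm (φ y) (φ x)] at this
  rw [setIntegral_const, smul_eq_mul, integral_add (hi _) (hi _)] at h2
  linarith

/-- The ball about z lies in the ball of radius |y - z| + r about y, where the mean deviation from
φ(y) is known; the disc area cancels. -/
theorem abs_sub_ballAvg_mul_le (hφ : ContDiff ℝ 1 φ) (hc : HasCompactSupport φ) (y z : Plane)
    {r : ℝ} (hr : 0 < r) : r ^ 2 * |φ y - ballAvg φ r z| ≤
      (dist y z + r) ^ 3 * maximal (gradNorm φ) y := by
  have hφc := hφ.continuous
  have hv : volume.real (Metric.closedBall z r) = r ^ 2 * discArea := volume_closedBall_eq z hr.le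
  have hv0 : volume.real (Metric.closedBall (0 : Plane) r) = r ^ 2 * discArea :=
    volume_closedBall_eq 0 hr.le
  have hd := discArea_pos
  have hS : Metric.closedBall z r ⊆ Metric.closedBall y (dist y z + r) :=
    Metric.closedBall_subset_closedBall' (by rw [dist_comm]; linarith)
  have h := integral_abs_sub_le_of_subset hφ hc y (by positivity) hS
  have e : ∫ x in Metric.closedBall z r, (φ x - φ y) =
      r ^ 2 * discArea * (ballAvg φ r z - φ y) := by
    rw [integral_sub (hφc.continuousOn.integrableOn_compact (isCompact_closedBall _ _))
      (integrableOn_const measure_closedBall_lt_top.ne), setIntegral_const, smul_eq_mul, hv,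
      ballAvg, setIntegral_ball_translate, hv0]
    field_simp
  have h2 := (abs_integral_le_integral_abs (f := fun x => φ x - φ y)
    (μ := volume.restrict (Metric.closedBall z r))).trans h
  rw [e, abs_mul, abs_of_pos (by positivity), abs_sub_comm] at h2
  refine le_of_mul_le_mul_right ?_ hd
  linarith

end Pointwise

end

end VEM

/-! ### Pointwise estimates for the nodal values of the quasi-interpolant. -/

namespace VEM

noncomputable section

variable {T₀ T : Finset Tri}

theorem Tri.abs_det_perm (E : Tri) {i j k : Fin 3} (hij : i ≠ j) (hki : k ≠ i) (hkj : k ≠ j) :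
    |(E.vert j 0 - E.vert i 0) * (E.vert k 1 - E.vert i 1)
      - (E.vert j 1 - E.vert i 1) * (E.vert k 0 - E.vert i 0)| = |E.det| := by
  unfold Tri.det
  rw [abs_eq_abs]
  fin_cases i <;> fin_cases j <;> fin_cases k <;> simp at hij hki hkj ⊢ <;>
    first | (left; ring1) | (right; ring1)

/-- A small triangle in `R`, with one side on a given side of `R` and starting at a given point. -/
theorem exists_corner {R : Tri} (hR : R.Nondeg) {i j : Fin 3} (hij : i ≠ j) {z : Plane}
    (hz : z ∈ segment ℝ (R.vert i) (R.vert j)) {θ : ℝ} (hθ : 0 < θ) (hθ1 : θ ≤ 1) :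
    ∃ P : Tri, P.Nondeg ∧ θ ^ 2 * |R.det| ≤ 2 * |P.det| ∧
      P.carrier ⊆ Metric.closedBall z (θ * R.sz) ∧
      dist (P.vert 2) (P.vert 0) ≤ θ * R.sz ∧
      segment ℝ (P.vert 0) (P.vert 1) ⊆ segment ℝ (R.vert i) (R.vert j) := by
  have hdet := abs_pos.2 (Tri.det_ne_zero_iff.2 hR)
  obtain ⟨k, hki, hkj, -⟩ := Tri.exists_third i j hij
  -- By symmetry at least half of the side remains in the direction of `R.vert j`; this is the
  -- source of the factor 2 in the area bound.
  wlog hlam : R.lam i z ≥ 1 / 2 generalizing i j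
  · have hkz := ((Tri.mem_segment_iff hR hij hki hkj).1 hz).2
    have hs := Tri.sum_lam_distinct hR z hij hki hkj
    have h := this hij.symm (by rwa [segment_symm]) hkj hki (by linarith)
    rwa [segment_symm ℝ (R.vert j)] at h
  have hkz := ((Tri.mem_segment_iff hR hij hki hkj).1 hz).2
  have hs := Tri.sum_lam_distinct hR z hij hki hkj
  set a := R.lam j z with ha
  have hz' : z = AffineMap.lineMap (R.vert i) (R.vert j) a := by
    refine Tri.ext_lam hR fun m => ?_
    rw [Tri.lam_lineMap]
    rcases Tri.eq_of_distinct hij hki hkj m with rfl | rfl | rfl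
    · rw [Tri.lam_vert_self hR, Tri.lam_vert_ne hR hij]; linarith
    · rw [Tri.lam_vert_self hR, Tri.lam_vert_ne hR hij.symm]; linarith
    · rw [Tri.lam_vert_ne hR hki, Tri.lam_vert_ne hR hkj, hkz]; ring
  have hzR : z ∈ R.carrier := ((Tri.mem_segment_iff hR hij hki hkj).1 hz).1
  let P : Tri := ⟨![z, AffineMap.lineMap z (R.vert j) θ, AffineMap.lineMap z (R.vert k) θ]⟩
  have hz0 : z 0 = (1 - a) * R.vert i 0 + a * R.vert j 0 := by
    rw [hz']; simp [AffineMap.lineMap_apply_module]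
  have hz1 : z 1 = (1 - a) * R.vert i 1 + a * R.vert j 1 := by
    rw [hz']; simp [AffineMap.lineMap_apply_module]
  have hPdet : |P.det| = θ ^ 2 * (1 - a) * |R.det| := by
    rw [← R.abs_det_perm hij hki hkj, ← abs_of_nonneg (show 0 ≤ θ ^ 2 * (1 - a) by
      have : 0 ≤ 1 - a := by linarith
      positivity), ← abs_mul]
    congr 1
    simp only [Tri.det, P, Matrix.cons_val_zero, Matrix.cons_val_one, Matrix.cons_val,
      AffineMap.lineMap_apply_module, PiLp.add_apply, PiLp.smul_apply, smul_eq_mul, hz0, hz1]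
    ring
  have hd2 : ∀ m, dist (AffineMap.lineMap z (R.vert m) θ : Plane) z ≤ θ * R.sz := fun m => by
    rw [dist_lineMap_left, Real.norm_of_nonneg hθ.le]
    have := R.dist_le_sz hzR (R.vert_mem m)
    gcongr
  refine ⟨P, ?_, ?_, ?_, hd2 k, ?_⟩
  · rw [← Tri.det_ne_zero_iff, ← abs_pos, hPdet]
    have : 0 < 1 - a := by linarith
    positivity
  · rw [hPdet]
    have : 0 ≤ θ ^ 2 * |R.det| := by positivity
    nlinarith
  · refine convexHull_min ?_ (convex_closedBall z _)
    rintro _ ⟨m, rfl⟩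
    fin_cases m
    · exact Metric.mem_closedBall_self (mul_nonneg hθ.le R.sz_nonneg)
    · exact hd2 j
    · exact hd2 k
  · refine (convex_segment _ _).segment_subset hz ?_
    exact (convex_segment _ _).lineMap_mem hz (right_mem_segment _ _ _) ⟨hθ.le, hθ1⟩

/-- An upper bound for the sizes of all triangles in the forest. -/
def maxSize (T₀ : Finset Tri) : ℝ := 1 + ∑ R ∈ T₀, R.sz

theorem maxSize_pos (T₀ : Finset Tri) : 0 < maxSize T₀ :=
  add_pos_of_pos_of_nonneg one_pos (Finset.sum_nonneg fun R _ => R.sz_nonneg)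

theorem root_sz_le {R : Tri} (hR : R ∈ T₀) : R.sz ≤ maxSize T₀ := by
  have := Finset.single_le_sum (f := Tri.sz) (fun R _ => R.sz_nonneg) hR
  unfold maxSize; linarith

theorem InForest.sz_le {P : Tri} (h : InForest T₀ P) : P.sz ≤ maxSize T₀ := by
  obtain ⟨R, hR, hd⟩ := inForest_iff.1 h
  exact (Real.sqrt_le_sqrt (by linarith [hd.q_le])).trans (root_sz_le hR)

/-- Every boundary point lies on a side of a root contained in the boundary, and that root contains
a corner triangle of diameter about s with a side on this boundary side. There φ vanishes, so the
integral of |φ| over the corner is controlled by its gradient, and φ(y) is compared with φ on the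
corner. The constants involve the roots only. -/
theorem exists_boundary_constant (hT₀ : IsConforming T₀) : ∃ C : ℝ, 0 ≤ C ∧
    ∀ φ : Plane → ℝ, ContDiff ℝ 1 φ → HasCompactSupport φ → (∀ x ∉ domain T₀, φ x = 0) →
    ∀ z ∈ region T₀ \ domain T₀, ∀ s : ℝ, 0 < s → s ≤ maxSize T₀ → ∀ L : ℝ, 0 ≤ L →
    ∀ y : Plane, dist y z ≤ L * s → |φ y| ≤ C * (L + 1) ^ 3 * s * maximal (gradNorm φ) y := by
  set B := ∑ R ∈ T₀, |R.det|⁻¹ with hB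
  set S := maxSize T₀ with hS
  have hS0 : 0 < S := maxSize_pos T₀
  have hB0 : 0 ≤ B := Finset.sum_nonneg fun R _ => by positivity
  have ha := Tri.refArea_pos
  have hdp := discArea_pos
  refine ⟨4 * S ^ 2 * B * discArea / Tri.refArea, by positivity, ?_⟩
  intro φ hφ hc hφ0 z hz s hs hsS L hL y hy
  obtain ⟨R, hR, i, j, hij, hzs, hsub⟩ := exists_boundary_side hT₀ hz
  have nR := hT₀.nondegenerate R hR
  have hdet := abs_pos.2 (Tri.det_ne_zero_iff.2 nR)
  -- The scale is normalized by `maxSize T₀`, so that the ratio is admissible for every root and the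
  -- corner has diameter at most a multiple of `s`.
  obtain ⟨P, nP, hPd, hPs, hPdist, hPside⟩ := exists_corner nR hij hzs (θ := s / S)
    (by positivity) (by rw [div_le_one hS0]; exact hsS)
  have hθ : s / S * R.sz ≤ s := by
    rw [div_mul_eq_mul_div, div_le_iff₀ hS0]
    exact mul_le_mul_of_nonneg_left (root_sz_le hR) hs.le
  set M := maximal (gradNorm φ) y with hM
  have hM0 : 0 ≤ M := maximal_nonneg (fun _ => norm_nonneg _) y
  set ρ := (L + 1) * s with hρ
  have hρ0 : 0 < ρ := by positivity
  have hPball : P.carrier ⊆ Metric.closedBall y ρ :=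
    hPs.trans (Metric.closedBall_subset_closedBall' (by rw [dist_comm]; linarith))
  have h1 := abs_sub_mul_le hφ hc y hρ0 hPball 0
  have h2 := integral_abs_le_of_zero_side nP hφ fun x hx => hφ0 x (hsub (hPside hx)).2
  have h3 := setIntegral_gradNorm_le hφ hc y hρ0 hPball
  simp only [sub_zero] at h1
  have h4 : ∫ x in P.carrier, |φ x| ≤ s * (ρ ^ 2 * discArea * M) :=
    h2.trans (mul_le_mul (hPdist.trans hθ) h3 (integral_nonneg fun _ => norm_nonneg _) hs.le)
  have h5 : s * (ρ ^ 2 * discArea * M) ≤ ρ * (ρ ^ 2 * discArea * M) := by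
    have : s ≤ ρ := by rw [hρ]; nlinarith
    gcongr
  have h6 : volume.real P.carrier * |φ y| ≤ 2 * ρ ^ 3 * discArea * M := by linarith
  rw [Tri.volume_carrier nP] at h6
  have hBR : 1 ≤ B * |R.det| := by
    have : |R.det|⁻¹ ≤ B := Finset.single_le_sum (f := fun R : Tri => |R.det|⁻¹)
      (fun R _ => by positivity) hR
    rwa [inv_le_iff_one_le_mul₀ hdet] at this
  have h7 : s ^ 2 ≤ 2 * S ^ 2 * B * |P.det| := by
    have e : s ^ 2 = S ^ 2 * (s / S) ^ 2 := by field_simp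
    calc s ^ 2 = S ^ 2 * (s / S) ^ 2 * 1 := by rw [← e]; ring
      _ ≤ S ^ 2 * (s / S) ^ 2 * (B * |R.det|) := by gcongr
      _ = S ^ 2 * B * ((s / S) ^ 2 * |R.det|) := by ring
      _ ≤ S ^ 2 * B * (2 * |P.det|) := by gcongr
      _ = _ := by ring
  have h8 : s ^ 2 * (Tri.refArea * |φ y|) ≤
      s ^ 2 * (4 * S ^ 2 * B * discArea * (L + 1) ^ 3 * s * M) := by
    calc s ^ 2 * (Tri.refArea * |φ y|) ≤ 2 * S ^ 2 * B * |P.det| * (Tri.refArea * |φ y|) := by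
          gcongr
      _ = 2 * S ^ 2 * B * (|P.det| * Tri.refArea * |φ y|) := by ring
      _ ≤ 2 * S ^ 2 * B * (2 * ρ ^ 3 * discArea * M) := by gcongr
      _ = _ := by rw [hρ]; ring
  have h9 := le_of_mul_le_mul_left h8 (by positivity)
  calc |φ y| = (Tri.refArea * |φ y|) / Tri.refArea := by field_simp
    _ ≤ (4 * S ^ 2 * B * discArea * (L + 1) ^ 3 * s * M) / Tri.refArea := by gcongr
    _ = _ := by ring

/-- The radius is chosen so that a ball about any point exceeds the region in area by at least
`discArea`. As φ vanishes on the excess, the deviation estimate bounds φ(y) itself. -/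
theorem exists_friedrichs_pointwise (T₀ : Finset Tri) : ∃ C : ℝ, 0 ≤ C ∧
    ∀ φ : Plane → ℝ, ContDiff ℝ 1 φ → HasCompactSupport φ → (∀ x ∉ domain T₀, φ x = 0) →
    ∀ y, |φ y| ≤ C * maximal (gradNorm φ) y := by
  have hdp := discArea_pos
  set W := volume.real (region T₀) with hW
  have hW0 : 0 ≤ W := measureReal_nonneg
  set ρ := 1 + W / discArea with hρ
  have hρ0 : 0 < ρ := by positivity
  refine ⟨ρ ^ 3, by positivity, fun φ hφ hc hφ0 y => ?_⟩
  have hsub : Metric.closedBall y ρ \ region T₀ ⊆ Metric.closedBall y ρ := Set.sdiff_subset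
  have h1 := abs_sub_mul_le hφ hc y hρ0 hsub 0
  have hzero : ∫ x in Metric.closedBall y ρ \ region T₀, |φ x - 0| = 0 := by
    rw [setIntegral_congr_fun (g := fun _ => (0 : ℝ))
      (Metric.isClosed_closedBall.measurableSet.diff (isCompact_region T₀).measurableSet)]
    · simp
    · intro x hx
      simp [hφ0 x fun h => hx.2 (domain_subset_region T₀ h)]
  have hvol : discArea ≤ volume.real (Metric.closedBall y ρ \ region T₀) := by
    have h := le_measureReal_sdiff (μ := volume) (s₁ := Metric.closedBall y ρ) (s₂ := region T₀)
      (isCompact_region T₀).measure_lt_top.ne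
    rw [volume_closedBall_eq y hρ0.le] at h
    have e : ρ * discArea = discArea + W := by rw [hρ]; field_simp
    have : ρ * discArea ≤ ρ ^ 2 * discArea := by
      have : 1 ≤ ρ := by rw [hρ]; linarith [div_nonneg hW0 hdp.le]
      nlinarith [mul_pos hρ0 hdp]
    linarith
  rw [hzero, add_zero, sub_zero] at h1
  have h2 : discArea * |φ y| ≤ discArea * (ρ ^ 3 * maximal (gradNorm φ) y) := by
    calc _ ≤ _ := mul_le_mul_of_nonneg_right hvol (abs_nonneg _)
      _ ≤ _ := h1
      _ = _ := by ring
  exact le_of_mul_le_mul_left h2 hdp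

open scoped Classical in
/-- The size of an element containing `z`. -/
def starSize (T : Finset Tri) (z : Plane) : ℝ :=
  if h : ∃ E ∈ T, z ∈ E.carrier then h.choose.sz else 1

theorem exists_starSize {E : Tri} (hE : E ∈ T) {z : Plane} (hz : z ∈ E.carrier) :
    ∃ E' ∈ T, z ∈ E'.carrier ∧ starSize T z = E'.sz := by
  have h : ∃ E ∈ T, z ∈ E.carrier := ⟨E, hE, hz⟩
  exact ⟨h.choose, h.choose_spec.1, h.choose_spec.2, dif_pos h⟩

open scoped Classical in
/-- The local averages that serve as nodal values of the quasi-interpolant. -/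
def nodalAvg (T₀ T : Finset Tri) (φ : Plane → ℝ) (z : Plane) : ℝ :=
  if z ∈ domain T₀ then ballAvg φ (starSize T z) z else 0

theorem nodalAvg_of_notMem (φ : Plane → ℝ) {z : Plane} (hz : z ∉ domain T₀) :
    nodalAvg T₀ T φ z = 0 := if_neg hz

/-- Strong induction on the index. A node off the domain has value 0, and the boundary estimate
applies. A proper node carries a ball average at a size comparable to that of `E`. A hanging node
carries the mean of two values at nodes of smaller index. The distance factor `L` is quantified
inside the induction because it grows at every level; the number of levels is bounded in terms of
the index only. -/
theorem exists_nodal_constant (hT₀ : IsConforming T₀) (Λ : ℕ) : ∀ n : ℕ, ∀ L : ℝ, 0 ≤ L →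
    ∃ C : ℝ, 0 ≤ C ∧ ∀ T, IsRefinement T₀ T → IsAdmissible T₀ T Λ →
    ∀ φ : Plane → ℝ, ContDiff ℝ 1 φ → HasCompactSupport φ → (∀ x ∉ domain T₀, φ x = 0) →
    ∀ z ∈ nodes T, minIndex T₀ T z ≤ n → ∀ E ∈ T, z ∈ E.carrier → ∀ y, dist y z ≤ L * E.sz →
    |φ y - nodalVal T₀ T (nodalAvg T₀ T φ) z| ≤ C * E.sz * maximal (gradNorm φ) y := by
  obtain ⟨Cb, hCb, hb⟩ := exists_boundary_constant hT₀
  obtain ⟨K, hK, hstar⟩ := exists_star_constant hT₀ Λ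
  have hK0 : 0 < K := by linarith
  intro n
  induction n using Nat.strong_induction_on with
  | _ n ih =>
    intro L hL
    -- The induction hypothesis is used relative to another element around `z`: the change of size
    -- turns `L` into `L * K`, and reaching the parent endpoints costs one more diameter. For n = 0
    -- the statement is void.
    have ih' : ∃ C : ℝ, 0 ≤ C ∧ ∀ T, IsRefinement T₀ T → IsAdmissible T₀ T Λ →
        ∀ φ : Plane → ℝ, ContDiff ℝ 1 φ → HasCompactSupport φ → (∀ x ∉ domain T₀, φ x = 0) →
        ∀ z ∈ nodes T, minIndex T₀ T z < n → ∀ E ∈ T, z ∈ E.carrier →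
        ∀ y, dist y z ≤ (L * K + 1) * E.sz →
        |φ y - nodalVal T₀ T (nodalAvg T₀ T φ) z| ≤ C * E.sz * maximal (gradNorm φ) y := by
      rcases Nat.eq_zero_or_pos n with rfl | hn
      · exact ⟨0, le_rfl, fun _ _ _ _ _ _ _ _ _ h => absurd h (by omega)⟩
      · obtain ⟨C, hC, h⟩ := ih (n - 1) (by omega) (L * K + 1) (by positivity)
        exact ⟨C, hC, fun T hT hA φ h1 h2 h3 z hz hlt => h T hT hA φ h1 h2 h3 z hz (by omega)⟩
    obtain ⟨C, hC, hind⟩ := ih'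
    refine ⟨Cb * (L + 1) ^ 3 + K ^ 2 * (L + K) ^ 3 + C * K, by positivity, ?_⟩
    intro T hT hA φ hφ hc hφ0 z hz hzn E hE hzE y hy
    have hM0 : 0 ≤ maximal (gradNorm φ) y := maximal_nonneg (fun _ => norm_nonneg _) y
    have hEsz := Tri.sz_pos ((hT.inForest E hE).nondeg hT₀)
    set M := maximal (gradNorm φ) y
    have e : (Cb * (L + 1) ^ 3 + K ^ 2 * (L + K) ^ 3 + C * K) * E.sz * M =
      Cb * (L + 1) ^ 3 * E.sz * M + K ^ 2 * (L + K) ^ 3 * E.sz * M + C * K * E.sz * M := by ring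
    have t1 : 0 ≤ Cb * (L + 1) ^ 3 * E.sz * M := by positivity
    have t2 : 0 ≤ K ^ 2 * (L + K) ^ 3 * E.sz * M := by positivity
    have t3 : 0 ≤ C * K * E.sz * M := by positivity
    by_cases hzΩ : z ∈ domain T₀
    swap
    · rw [nodalVal_boundary hT₀ hA (fun z h => nodalAvg_of_notMem φ h) hz hzΩ, sub_zero]
      have := hb φ hφ hc hφ0 z ⟨forest_subset_region hT₀ (hT.inForest E hE) hzE, hzΩ⟩ E.sz hEsz
        (hT.inForest E hE).sz_le L hL y hy
      linarith
    by_cases hp : IsProperNode T z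
    · rw [nodalVal_proper _ hp, nodalAvg, if_pos hzΩ]
      obtain ⟨E', hE', hzE', hsz⟩ := exists_starSize hE hzE
      rw [hsz]
      have hE'sz := Tri.sz_pos ((hT.inForest E' hE').nondeg hT₀)
      have k1 := hstar T hT hA z hzΩ E hE E' hE' hzE hzE'
      have k2 := hstar T hT hA z hzΩ E' hE' E hE hzE' hzE
      have h := abs_sub_ballAvg_mul_le hφ hc y z hE'sz
      have h2 : E.sz ^ 2 * |φ y - ballAvg φ E'.sz z| ≤
          E.sz ^ 2 * (K ^ 2 * (L + K) ^ 3 * E.sz * M) := by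
        calc E.sz ^ 2 * |φ y - ballAvg φ E'.sz z|
            ≤ (K * E'.sz) ^ 2 * |φ y - ballAvg φ E'.sz z| := by gcongr
          _ = K ^ 2 * (E'.sz ^ 2 * |φ y - ballAvg φ E'.sz z|) := by ring
          _ ≤ K ^ 2 * ((dist y z + E'.sz) ^ 3 * M) := by gcongr
          _ ≤ K ^ 2 * ((L * E.sz + K * E.sz) ^ 3 * M) := by gcongr
          _ = _ := by ring
      have h3 := le_of_mul_le_mul_left h2 (by positivity)
      linarith
    · obtain ⟨P, hP, hval⟩ := nodalVal_hanging hA (nodalAvg T₀ T φ) hz hp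
      rw [hval]
      -- A hanging node lies inside a side of some element, and this side contains both ends of the
      -- parent edge; hence these are within the size of that element from `z`.
      obtain ⟨E', hE', hzE', hnv⟩ : ∃ E' ∈ T, z ∈ E'.carrier ∧ z ∉ Set.range E'.vert := by
        by_contra hcon
        push Not at hcon
        exact hp ⟨hz, hcon⟩
      have nE' := (hT.inForest E' hE').nondeg hT₀
      have hE'sz := Tri.sz_pos nE'
      obtain ⟨i, j, hij, hopen⟩ : ∃ i j, i ≠ j ∧ z ∈ openSegment ℝ (E'.vert i) (E'.vert j) := by
        rcases Tri.cases_of_mem nE' hzE' with h | h | h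
        · exact absurd h (node_notMem_interior hT₀ hT hz hE')
        · exact absurd h hnv
        · exact h
      have hpar := hanging_parent_mem hT₀ hT hP.forest hE' hij (by rw [hP.mid]; exact hopen)
      have hsegsub : segment ℝ (E'.vert i) (E'.vert j) ⊆ E'.carrier :=
        E'.convex_carrier.segment_subset (E'.vert_mem i) (E'.vert_mem j)
      have k1 := hstar T hT hA z hzΩ E hE E' hE' hzE hzE'
      have k2 := hstar T hT hA z hzΩ E' hE' E hE hzE' hzE
      have hpt : ∀ p ∈ segment ℝ (E'.vert i) (E'.vert j), p ∈ nodes T →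
          minIndex T₀ T p < minIndex T₀ T z →
          |φ y - nodalVal T₀ T (nodalAvg T₀ T φ) p| ≤ C * K * E.sz * M := by
        intro p hps hpn hlt
        have hd : dist y p ≤ (L * K + 1) * E'.sz := by
          have h1 := dist_triangle y z p
          have h2 := E'.dist_le_sz hzE' (hsegsub hps)
          have h3 : L * E.sz ≤ L * (K * E'.sz) := by gcongr
          linarith
        refine (hind T hT hA φ hφ hc hφ0 p hpn (by omega) E' hE' (hsegsub hps) y hd).trans ?_
        calc C * E'.sz * M ≤ C * (K * E.sz) * M := by gcongr
          _ = _ := by ring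
      have q1 := abs_le.1 (hpt _ hpar.1 hP.left hP.left_lt)
      have q2 := abs_le.1 (hpt _ hpar.2 hP.right hP.right_lt)
      rw [abs_le]
      constructor <;> linarith [q1.1, q1.2, q2.1, q2.2]

end

end VEM

/-! ### Stability and approximation in L² of the quasi-interpolant. -/

namespace VEM

noncomputable section

variable {T₀ T : Finset Tri}

theorem norm_le_abs_add_abs (v : Plane) : ‖v‖ ≤ |v 0| + |v 1| := by
  rw [EuclideanSpace.norm_eq, Fin.sum_univ_two]
  simp only [Real.norm_eq_abs]
  rw [Real.sqrt_le_left (by positivity)]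
  nlinarith [abs_nonneg (v 0), abs_nonneg (v 1), mul_nonneg (abs_nonneg (v 0)) (abs_nonneg (v 1))]

theorem abs_apply_le_norm (v : Plane) (i : Fin 2) : |v i| ≤ ‖v‖ := by
  simpa using PiLp.norm_apply_le v i

theorem inner_plane (v w : Plane) : inner ℝ v w = v 0 * w 0 + v 1 * w 1 := by
  simp [PiLp.inner_apply, Fin.sum_univ_two, mul_comm]

/-- The gradient of an affine function on a triangle is controlled by its increments. -/
theorem P1.norm_g_mul_le (p : P1) (E : Tri) {δ : ℝ}
    (h : ∀ i, |p.eval (E.vert i) - p.eval (E.vert 0)| ≤ δ) :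
    |E.det| * ‖p.g‖ ≤ 4 * E.sz * δ := by
  have hδ : 0 ≤ δ := (abs_nonneg _).trans (h 0)
  have h1 := h 1
  have h2 := h 2
  rw [p.eval_sub, inner_plane] at h1 h2
  set a := E.vert 1 - E.vert 0 with ha
  set b := E.vert 2 - E.vert 0 with hb
  have hna : ∀ m, |a m| ≤ E.sz := fun m => (abs_apply_le_norm a m).trans (by
    rw [ha, ← dist_eq_norm]; exact E.dist_vert_le 1 0)
  have hnb : ∀ m, |b m| ≤ E.sz := fun m => (abs_apply_le_norm b m).trans (by
    rw [hb, ← dist_eq_norm]; exact E.dist_vert_le 2 0)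
  have hdet : E.det = a 0 * b 1 - a 1 * b 0 := by simp [Tri.det, ha, hb]
  have key : ∀ x y s t : ℝ, |x| ≤ E.sz → |y| ≤ E.sz → |s| ≤ δ → |t| ≤ δ →
      |s * x - t * y| ≤ 2 * E.sz * δ := by
    intro x y s t hx hy hs ht
    calc |s * x - t * y| ≤ |s * x| + |t * y| := abs_sub _ _
      _ = |s| * |x| + |t| * |y| := by rw [abs_mul, abs_mul]
      _ ≤ δ * E.sz + δ * E.sz := by gcongr
      _ = _ := by ring
  -- Cramer's rule: the gradient solves two linear equations with the edge vectors as rows and the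
  -- increments as right-hand sides.
  have e0 := key _ _ _ _ (hnb 1) (hna 1) h1 h2
  have e1 := key _ _ _ _ (hna 0) (hnb 0) h2 h1
  have f0 : |E.det| * |p.g 0| ≤ 2 * E.sz * δ := by
    rw [← abs_mul]; convert e0 using 1; rw [hdet]; ring_nf
  have f1 : |E.det| * |p.g 1| ≤ 2 * E.sz * δ := by
    rw [← abs_mul]; convert e1 using 1; rw [hdet]; ring_nf
  calc |E.det| * ‖p.g‖ ≤ |E.det| * (|p.g 0| + |p.g 1|) := by
        gcongr; exact norm_le_abs_add_abs _
    _ ≤ _ := by linarith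

/-- The affine functions of the quasi-interpolant of `φ`. -/
abbrev quasi (T₀ T : Finset Tri) (φ : Plane → ℝ) (E : Tri) : P1 :=
  nodalAffine T₀ T (nodalAvg T₀ T φ) E

/-- Admissibility bounds all indices by Λ, so the nodal estimate holds at the three vertices for
every y in the element. Convex combination gives the first bound. Comparing two vertices through
φ(y) bounds the increments of the affine function, and shape regularity turns this into the gradient
bound. -/
theorem exists_interp_constant (hT₀ : IsConforming T₀) (Λ : ℕ) :
    ∃ C : ℝ, 0 ≤ C ∧ ∀ T, IsRefinement T₀ T → IsAdmissible T₀ T Λ →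
    ∀ φ : Plane → ℝ, ContDiff ℝ 1 φ → HasCompactSupport φ → (∀ x ∉ domain T₀, φ x = 0) →
    ∀ E ∈ T, ∀ y ∈ E.carrier,
      |φ y - (quasi T₀ T φ E).eval y| ≤ C * E.sz * maximal (gradNorm φ) y ∧
      ‖(quasi T₀ T φ E).g‖ ≤ C * maximal (gradNorm φ) y := by
  obtain ⟨C, hC, hn⟩ := exists_nodal_constant hT₀ Λ Λ 1 zero_le_one
  obtain ⟨κ, hκ1, hκ⟩ := exists_shape_constant hT₀
  refine ⟨C + 16 * κ * C, by positivity, fun T hT hA φ hφ hc hφ0 E hE y hy => ?_⟩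
  have nE := (hT.inForest E hE).nondeg hT₀
  have hsz := Tri.sz_pos nE
  set M := maximal (gradNorm φ) y with hM
  have hM0 : 0 ≤ M := maximal_nonneg (fun _ => norm_nonneg _) y
  set p := quasi T₀ T φ E with hp
  have hv : ∀ i, |φ y - p.eval (E.vert i)| ≤ C * E.sz * M := fun i => by
    have hz := vert_mem_nodes hE i
    rw [hp, nodalAffine_node hT₀ hT hA _ hE hz (E.vert_mem i)]
    exact hn T hT hA φ hφ hc hφ0 _ hz (minIndex_le hA hz) E hE (E.vert_mem i) y
      (by rw [one_mul]; exact E.dist_le_sz hy (E.vert_mem i))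
  constructor
  · have e : φ y - p.eval y = ∑ i, E.lam i y * (φ y - p.eval (E.vert i)) := by
      rw [p.eval_eq_lam nE y]
      simp only [mul_sub, Finset.sum_sub_distrib, ← Finset.sum_mul, Tri.sum_lam nE y, one_mul]
    have hl := (Tri.mem_carrier nE).1 hy
    calc |φ y - p.eval y| ≤ ∑ i, |E.lam i y * (φ y - p.eval (E.vert i))| := by
          rw [e]; exact Finset.abs_sum_le_sum_abs _ _
      _ ≤ ∑ i, E.lam i y * (C * E.sz * M) := by
          refine Finset.sum_le_sum fun i _ => ?_
          rw [abs_mul, abs_of_nonneg (hl i)]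
          exact mul_le_mul_of_nonneg_left (hv i) (hl i)
      _ = C * E.sz * M := by rw [← Finset.sum_mul, Tri.sum_lam nE y, one_mul]
      _ ≤ _ := by
          have : 0 ≤ 16 * κ * C * E.sz * M := by positivity
          linarith
  · have h := p.norm_g_mul_le E (δ := 2 * (C * E.sz * M)) fun i => by
      have h1 := abs_le.1 (hv i)
      have h2 := abs_le.1 (hv 0)
      rw [abs_le]; constructor <;> linarith [h1.1, h1.2, h2.1, h2.2]
    have hq := hκ E (hT.inForest E hE)
    have hs := E.sz_sq
    have h3 : E.sz ^ 2 * ‖p.g‖ ≤ E.sz ^ 2 * (16 * κ * C * M) := by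
      calc E.sz ^ 2 * ‖p.g‖ ≤ 2 * (κ * |E.det|) * ‖p.g‖ := by rw [hs]; gcongr
        _ = 2 * κ * (|E.det| * ‖p.g‖) := by ring
        _ ≤ 2 * κ * (4 * E.sz * (2 * (C * E.sz * M))) := by gcongr
        _ = _ := by ring
    have h4 := le_of_mul_le_mul_left h3 (by positivity)
    have : 0 ≤ C * M := by positivity
    linarith

theorem Tri.interior_ae_eq (E : Tri) :
    interior E.carrier =ᵐ[(volume : Measure Plane)] E.carrier :=
  interior_ae_eq_of_null_frontier E.volume_frontier

/-- Integrals over the region decompose into integrals over the elements. -/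
theorem setIntegral_region (hT₀ : IsConforming T₀) (hT : IsRefinement T₀ T) {f : Plane → ℝ}
    (hf : IntegrableOn f (region T₀)) :
    ∫ x in region T₀, f x = ∑ E ∈ T, ∫ x in E.carrier, f x := by
  have e : region T₀ = ⋃ E ∈ T, E.carrier := (hT.union_eq hT₀).symm
  have hsub : ∀ E ∈ T, E.carrier ⊆ region T₀ := fun E hE => by
    rw [e]; exact Set.subset_biUnion_of_mem (u := fun E : Tri => E.carrier) hE
  have h1 : (⋃ E ∈ T, interior E.carrier : Set Plane) =ᵐ[volume] region T₀ := by
    rw [e]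
    exact Filter.EventuallyEq.countable_bUnion T.countable_toSet fun E _ => E.interior_ae_eq
  rw [← setIntegral_congr_set h1, integral_biUnion_finset T
    (fun E _ => isOpen_interior.measurableSet) (fun E hE E' hE' => hT.disjoint hT₀ E hE E' hE')
    fun E hE => hf.mono_set (interior_subset.trans (hsub E hE))]
  exact Finset.sum_congr rfl fun E _ => setIntegral_congr_set E.interior_ae_eq

theorem sum_setIntegral_le (hT₀ : IsConforming T₀) (hT : IsRefinement T₀ T) {f : Plane → ℝ}
    (hf : Integrable f) (h0 : ∀ x, 0 ≤ f x) : ∑ E ∈ T, ∫ x in E.carrier, f x ≤ ∫ x, f x := by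
  rw [← setIntegral_region hT₀ hT hf.integrableOn]
  exact setIntegral_le_integral hf (ae_of_all _ h0)

/-- The stability and approximation properties of the quasi-interpolant. -/
theorem exists_quasi_constant (hT₀ : IsConforming T₀) (Λ : ℕ) :
    ∃ C : ℝ, 0 ≤ C ∧ ∀ T, IsRefinement T₀ T → IsAdmissible T₀ T Λ →
    ∀ φ : Plane → ℝ, ContDiff ℝ 1 φ → HasCompactSupport φ → (∀ x ∉ domain T₀, φ x = 0) →
    ∑ E ∈ T, ((E.sz ^ 2)⁻¹ * (∫ x in E.carrier, (φ x - (quasi T₀ T φ E).eval x) ^ 2) +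
      ∫ x in E.carrier, ‖gradient φ x - (quasi T₀ T φ E).g‖ ^ 2) ≤ C * ∫ x, ‖gradient φ x‖ ^ 2 := by
  obtain ⟨C, hC, hi⟩ := exists_interp_constant hT₀ Λ
  -- The value bound contributes C² and the gradient bound 2C² times the squared maximal function,
  -- whose integral costs a factor 200; the summand 2 comes from the gradient of φ itself.
  refine ⟨600 * C ^ 2 + 2, by positivity, fun T hT hA φ hφ hc hφ0 => ?_⟩
  have hg : ∀ x, ‖gradient φ x‖ = gradNorm φ x := fun x => by
    rw [gradNorm, gradient, LinearIsometryEquiv.norm_map]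
  have hcg := continuous_gradNorm hφ
  have hsg := hasCompactSupport_gradNorm hc
  have hφc := hφ.continuous
  have hgc : Continuous (gradient φ) :=
    (LinearIsometryEquiv.continuous _).comp (hφ.continuous_fderiv (by norm_num))
  simp only [hg]
  set M := maximal (gradNorm φ) with hM
  have hMi : Integrable fun x => M x ^ 2 :=
    integrable_maximal_sq hcg hsg fun _ => norm_nonneg _
  have hGi : Integrable fun x => gradNorm φ x ^ 2 := integrable_sq_of_compact hcg hsg
  have hMle := integral_maximal_sq hcg hsg fun _ => norm_nonneg _
  have hFi : Integrable fun x => 3 * C ^ 2 * M x ^ 2 + 2 * gradNorm φ x ^ 2 :=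
    (hMi.const_mul _).add (hGi.const_mul _)
  calc _ ≤ ∑ E ∈ T, ∫ x in E.carrier, (3 * C ^ 2 * M x ^ 2 + 2 * gradNorm φ x ^ 2) := by
        refine Finset.sum_le_sum fun E hE => ?_
        have hsz := Tri.sz_pos ((hT.inForest E hE).nondeg hT₀)
        have hpc := (quasi T₀ T φ E).continuous_eval
        rw [← integral_const_mul, ← integral_add]
        rotate_left
        · exact ((Continuous.continuousOn (by fun_prop)).integrableOn_compact
            E.isCompact_carrier)
        · exact ((Continuous.continuousOn (by fun_prop)).integrableOn_compact
            E.isCompact_carrier)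
        refine setIntegral_mono_on ((Continuous.continuousOn (by fun_prop)).integrableOn_compact
            E.isCompact_carrier) hFi.integrableOn E.isClosed_carrier.measurableSet fun x hx => ?_
        obtain ⟨h1, h2⟩ := hi T hT hA φ hφ hc hφ0 E hE x hx
        have hMx : 0 ≤ M x := maximal_nonneg (fun _ => norm_nonneg _) x
        have a1 : (φ x - (quasi T₀ T φ E).eval x) ^ 2 ≤ (C * E.sz * M x) ^ 2 := by
          rw [← sq_abs]; gcongr
        have a2 : (E.sz ^ 2)⁻¹ * (φ x - (quasi T₀ T φ E).eval x) ^ 2 ≤ C ^ 2 * M x ^ 2 := by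
          calc _ ≤ (E.sz ^ 2)⁻¹ * (C * E.sz * M x) ^ 2 := by gcongr
            _ = _ := by field_simp
        have a3 : ‖gradient φ x - (quasi T₀ T φ E).g‖ ≤ gradNorm φ x + C * M x := by
          rw [← hg]; exact (norm_sub_le _ _).trans (by gcongr)
        have a4 : ‖gradient φ x - (quasi T₀ T φ E).g‖ ^ 2 ≤
            2 * gradNorm φ x ^ 2 + 2 * C ^ 2 * M x ^ 2 := by
          calc _ ≤ (gradNorm φ x + C * M x) ^ 2 := by gcongr
            _ ≤ _ := by nlinarith [sq_nonneg (gradNorm φ x - C * M x)]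
        linarith
    _ ≤ ∫ x, (3 * C ^ 2 * M x ^ 2 + 2 * gradNorm φ x ^ 2) :=
        sum_setIntegral_le hT₀ hT hFi fun x => by positivity
    _ = 3 * C ^ 2 * (∫ x, M x ^ 2) + 2 * ∫ x, gradNorm φ x ^ 2 := by
        rw [integral_add (hMi.const_mul _) (hGi.const_mul _), integral_const_mul,
          integral_const_mul]
    _ ≤ 3 * C ^ 2 * (200 * ∫ x, gradNorm φ x ^ 2) + 2 * ∫ x, gradNorm φ x ^ 2 := by gcongr
    _ = _ := by ring

theorem exists_friedrichs_constant (T₀ : Finset Tri) : ∃ C : ℝ, 0 ≤ C ∧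
    ∀ φ : Plane → ℝ, ContDiff ℝ 1 φ → HasCompactSupport φ → (∀ x ∉ domain T₀, φ x = 0) →
    ∫ x, φ x ^ 2 ≤ C * ∫ x, ‖gradient φ x‖ ^ 2 := by
  obtain ⟨C, hC, h⟩ := exists_friedrichs_pointwise T₀
  refine ⟨200 * C ^ 2, by positivity, fun φ hφ hc hφ0 => ?_⟩
  have hg : ∀ x, ‖gradient φ x‖ = gradNorm φ x := fun x => by
    rw [gradNorm, gradient, LinearIsometryEquiv.norm_map]
  have hcg := continuous_gradNorm hφ
  have hsg := hasCompactSupport_gradNorm hc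
  simp only [hg]
  have hMi := integrable_maximal_sq hcg hsg fun _ => norm_nonneg _
  have hMle := integral_maximal_sq hcg hsg fun _ => norm_nonneg _
  calc ∫ x, φ x ^ 2 ≤ ∫ x, C ^ 2 * maximal (gradNorm φ) x ^ 2 := by
        refine integral_mono (integrable_sq_of_compact hφ.continuous hc) (hMi.const_mul _)
          fun x => ?_
        have := h φ hφ hc hφ0 x
        simp only
        rw [← mul_pow, ← sq_abs]
        gcongr
    _ = C ^ 2 * ∫ x, maximal (gradNorm φ) x ^ 2 := integral_const_mul _ _
    _ ≤ C ^ 2 * (200 * ∫ x, gradNorm φ x ^ 2) := by gcongr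
    _ = _ := by ring

end

end VEM

namespace VEM

noncomputable section

/-! ### Square integrable functions -/

section SquareIntegrable

variable {α : Type*} {m : MeasurableSpace α} {μ : Measure α}
variable {F : Type*} [NormedAddCommGroup F]

/-- Trades the extended norms in the definition of H¹₀ for real integrals, where Young's inequality
and limits are convenient. -/
theorem tendsto_eLpNorm_two_iff {f : ℕ → α → F} (hf : ∀ n, MemLp (f n) 2 μ) :
    Tendsto (fun n => eLpNorm (f n) 2 μ) atTop (𝓝 0) ↔
      Tendsto (fun n => ∫ x, ‖f n x‖ ^ 2 ∂μ) atTop (𝓝 0) := by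
  have e : ∀ n, eLpNorm (f n) 2 μ = ENNReal.ofReal (Real.sqrt (∫ x, ‖f n x‖ ^ 2 ∂μ)) := fun n => by
    rw [(hf n).eLpNorm_eq_integral_rpow_norm (by norm_num) (by norm_num), Real.sqrt_eq_rpow]
    norm_num
  simp only [e]
  constructor
  · intro h
    have h1 := (ENNReal.tendsto_toReal ENNReal.zero_ne_top).comp h
    have h2 : Tendsto (fun n => Real.sqrt (∫ x, ‖f n x‖ ^ 2 ∂μ) ^ 2) atTop (𝓝 (0 ^ 2)) := by
      refine Tendsto.pow ?_ 2
      convert h1 using 2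
      · simp [Function.comp, Real.sqrt_nonneg]
      · simp
    convert h2 using 2
    · rw [Real.sq_sqrt (integral_nonneg fun x => by positivity)]
    · simp
  · intro h
    have h1 := ENNReal.tendsto_ofReal ((Real.continuous_sqrt.tendsto _).comp h)
    simpa using h1

theorem integrable_mul_two {f g : α → ℝ} (hf : MemLp f 2 μ) (hg : MemLp g 2 μ) :
    Integrable (fun x => f x * g x) μ := hf.integrable_mul hg

theorem integrable_inner {E : Type*} [NormedAddCommGroup E] [InnerProductSpace ℝ E] {f g : α → E}
    (hf : MemLp f 2 μ) (hg : MemLp g 2 μ) : Integrable (fun x => inner ℝ (f x) (g x)) μ := by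
  refine ((hf.norm.integrable_mul hg.norm)).mono' (hf.1.inner hg.1) (ae_of_all _ fun x => ?_)
  exact norm_inner_le_norm _ _

theorem abs_integral_mul_le {f g : α → ℝ} (hf : MemLp f 2 μ) (hg : MemLp g 2 μ) :
    |∫ x, f x * g x ∂μ| ≤ Real.sqrt (∫ x, ‖f x‖ ^ 2 ∂μ) * Real.sqrt (∫ x, ‖g x‖ ^ 2 ∂μ) := by
  have hpq : Real.HolderConjugate 2 2 := by constructor <;> norm_num
  have h := integral_mul_norm_le_Lp_mul_Lq (μ := μ) (f := f) (g := g) hpq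
    (by simpa using hf) (by simpa using hg)
  simp only [Real.rpow_two] at h
  rw [← Real.sqrt_eq_rpow, ← Real.sqrt_eq_rpow] at h
  refine le_trans ?_ h
  refine (abs_integral_le_integral_abs).trans (le_of_eq ?_)
  simp [abs_mul]

end SquareIntegrable

/-! ### Weak gradients -/

section WeakGradient

variable {U : Set Plane} {v v' : Plane → ℝ} {g g' : Plane → Plane} {φ : Plane → ℝ}

theorem fderiv_eq_inner (φ : Plane → ℝ) (x w : Plane) :
    fderiv ℝ φ x w = inner ℝ (gradient φ x) w := by
  rw [gradient, InnerProductSpace.toDual_symm_apply]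

theorem continuous_gradient (hφ : ContDiff ℝ 1 φ) : Continuous (gradient φ) :=
  (LinearIsometryEquiv.continuous _).comp (hφ.continuous_fderiv (by norm_num))

theorem IsTestFunction.contDiff_one (h : IsTestFunction U φ) : ContDiff ℝ 1 φ :=
  h.1.of_le (by exact_mod_cast le_top)

theorem hasCompactSupport_gradient (h : HasCompactSupport φ) : HasCompactSupport (gradient φ) :=
  (h.fderiv ℝ).comp_left (g := (InnerProductSpace.toDual ℝ Plane).symm) (map_zero _)

theorem IsTestFunction.memLp (h : IsTestFunction U φ) (S : Set Plane) :
    MemLp φ 2 (volume.restrict S) :=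
  h.1.continuous.memLp_of_hasCompactSupport h.2.1

theorem IsTestFunction.memLp_gradient (h : IsTestFunction U φ) (S : Set Plane) :
    MemLp (gradient φ) 2 (volume.restrict S) :=
  (continuous_gradient h.contDiff_one).memLp_of_hasCompactSupport (hasCompactSupport_gradient h.2.1)

theorem IsTestFunction.memLp_fderiv (h : IsTestFunction U φ) (S : Set Plane) (w : Plane) :
    MemLp (fun x => fderiv ℝ φ x w) 2 (volume.restrict S) := by
  simp only [fderiv_eq_inner]
  refine ((h.memLp_gradient S).norm.const_mul ‖w‖).mono'
    ((continuous_gradient h.contDiff_one).inner continuous_const).aestronglyMeasurable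
    (ae_of_all _ fun x => ?_)
  rw [mul_comm]; exact norm_inner_le_norm _ _

theorem MemLp.inner_const {μ : Measure Plane} (hg : MemLp g 2 μ) (w : Plane) :
    MemLp (fun x => inner ℝ (g x) w) 2 μ := by
  refine (hg.norm.const_mul ‖w‖).mono' (hg.1.inner aestronglyMeasurable_const)
    (ae_of_all _ fun x => ?_)
  rw [mul_comm]; exact norm_inner_le_norm _ _

theorem IsTestFunction.mono {U' : Set Plane} (h : IsTestFunction U φ) (hU : U ⊆ U') :
    IsTestFunction U' φ := ⟨h.1, h.2.1, h.2.2.trans hU⟩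

theorem IsTestFunction.zero_off (h : IsTestFunction U φ) {x : Plane} (hx : x ∉ U) : φ x = 0 :=
  image_eq_zero_of_notMem_tsupport fun hm => hx (h.2.2 hm)

theorem IsTestFunction.fderiv_zero_off (h : IsTestFunction U φ) {x : Plane} (hx : x ∉ U) :
    fderiv ℝ φ x = 0 := by
  by_contra hne
  exact hx (h.2.2 (support_fderiv_subset ℝ hne))

theorem IsTestFunction.gradient_zero_off (h : IsTestFunction U φ) {x : Plane} (hx : x ∉ U) :
    gradient φ x = 0 := by rw [gradient, h.fderiv_zero_off hx, map_zero]

theorem MemH1.spec (h : MemH1 U v) : IsWeakGrad U v (weakGrad U v) := Classical.epsilon_spec h.2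

/-- The fundamental lemma of the calculus of variations for the difference of the two fields, tested
against each fixed direction. -/
theorem IsWeakGrad.ae_unique (hU : IsOpen U) (h : IsWeakGrad U v g) (h' : IsWeakGrad U v g') :
    g =ᵐ[volume.restrict U] g' := by
  have hd : MemLp (fun x => g x - g' x) 2 (volume.restrict U) := h.1.sub h'.1
  have key := hU.ae_eq_zero_of_integral_contDiff_smul_eq_zero (f := fun x => g x - g' x)
    (μ := volume) ?_ ?_
  · rw [EventuallyEq, ae_restrict_iff' hU.measurableSet]
    filter_upwards [key] with x hx hxU
    exact sub_eq_zero.1 (hx hxU)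
  · exact (locallyIntegrableOn_of_locallyIntegrable_restrict
      (hd.locallyIntegrable (by norm_num)))
  · intro ψ h1 h2 h3
    have hψ : IsTestFunction U ψ := ⟨h1, h2, h3⟩
    rw [← setIntegral_eq_integral_of_forall_compl_eq_zero (s := U)
      fun x hx => by rw [hψ.zero_off hx, zero_smul]]
    refine ext_inner_right ℝ fun w => ?_
    have hi : Integrable (fun x => ψ x • (g x - g' x)) (volume.restrict U) := by
      refine ((hψ.memLp U).norm.integrable_mul hd.norm).mono' ((hψ.memLp U).1.smul hd.1)
        (ae_of_all _ fun x => ?_)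
      simp [norm_smul]
    rw [inner_zero_left, real_inner_comm, ← integral_inner hi]
    have e1 := h.2 ψ hψ w
    have e2 := h'.2 ψ hψ w
    rw [e1, neg_inj] at e2
    have e3 : ∀ x, inner ℝ w (ψ x • (g x - g' x)) =
        inner ℝ (g x) w * ψ x - inner ℝ (g' x) w * ψ x := fun x => by
      rw [inner_smul_right, inner_sub_right, real_inner_comm w, real_inner_comm w]; ring
    simp only [e3]
    rw [integral_sub (integrable_mul_two (MemLp.inner_const h.1 w) (hψ.memLp U))
      (integrable_mul_two (MemLp.inner_const h'.1 w) (hψ.memLp U)), e2, sub_self]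

/-- The gradient in the definitions is an arbitrary choice; up to null sets it may be replaced by
any weak gradient at hand. -/
theorem IsWeakGrad.weakGrad_ae (hU : IsOpen U) (h : IsWeakGrad U v g) :
    weakGrad U v =ᵐ[volume.restrict U] g :=
  IsWeakGrad.ae_unique hU (Classical.epsilon_spec ⟨g, h⟩) h

theorem IsWeakGrad.congr (hU : MeasurableSet U) (h : IsWeakGrad U v g) (hv : ∀ x ∈ U, v x = v' x) :
    IsWeakGrad U v' g := by
  refine ⟨h.1, fun φ hφ w => ?_⟩
  rw [← h.2 φ hφ w]
  exact setIntegral_congr_fun hU fun x hx => by simp only [hv x hx]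

theorem IsWeakGrad.mono {U' : Set Plane} (hU' : U' ⊆ U) (h : IsWeakGrad U v g) :
    IsWeakGrad U' v g := by
  refine ⟨h.1.mono_measure (Measure.restrict_mono_set _ hU'), fun φ hφ w => ?_⟩
  have h1 := h.2 φ (hφ.mono hU') w
  have z1 : ∀ x ∉ U', v x * fderiv ℝ φ x w = 0 := fun x hx => by rw [hφ.fderiv_zero_off hx]; simp
  have z2 : ∀ x ∉ U', inner ℝ (g x) w * φ x = 0 := fun x hx => by rw [hφ.zero_off hx, mul_zero]
  rwa [setIntegral_eq_integral_of_forall_compl_eq_zero fun x hx => z1 x fun h => hx (hU' h),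
    setIntegral_eq_integral_of_forall_compl_eq_zero fun x hx => z2 x fun h => hx (hU' h),
    ← setIntegral_eq_integral_of_forall_compl_eq_zero z1,
    ← setIntegral_eq_integral_of_forall_compl_eq_zero z2] at h1

theorem IsWeakGrad.sub (h : IsWeakGrad U v g) (h' : IsWeakGrad U v' g')
    (hv : MemLp v 2 (volume.restrict U)) (hv' : MemLp v' 2 (volume.restrict U)) :
    IsWeakGrad U (fun x => v x - v' x) (fun x => g x - g' x) := by
  refine ⟨h.1.sub h'.1, fun φ hφ w => ?_⟩
  have e : ∀ x, inner ℝ (g x - g' x) w * φ x = inner ℝ (g x) w * φ x - inner ℝ (g' x) w * φ x :=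
    fun x => by rw [inner_sub_left]; ring
  simp only [e, sub_mul]
  rw [integral_sub (integrable_mul_two hv (hφ.memLp_fderiv U w))
    (integrable_mul_two hv' (hφ.memLp_fderiv U w)),
    integral_sub (integrable_mul_two (MemLp.inner_const h.1 w) (hφ.memLp U))
      (integrable_mul_two (MemLp.inner_const h'.1 w) (hφ.memLp U)), h.2 φ hφ w, h'.2 φ hφ w]
  ring

theorem isWeakGrad_gradient (hφ : ContDiff ℝ 1 φ)
    (hg : MemLp (gradient φ) 2 (volume.restrict U)) : IsWeakGrad U φ (gradient φ) := by
  refine ⟨hg, fun ψ hψ w => ?_⟩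
  have hψ1 := hψ.contDiff_one
  have hc := hψ.2.1
  have hcg := (continuous_gradient hφ)
  have hφc := hφ.continuous
  have hcψ := continuous_gradient hψ1
  have hψc := hψ1.continuous
  rw [setIntegral_eq_integral_of_forall_compl_eq_zero fun x hx => by
      rw [hψ.fderiv_zero_off hx]; simp,
    setIntegral_eq_integral_of_forall_compl_eq_zero fun x hx => by rw [hψ.zero_off hx, mul_zero]]
  simp only [← fderiv_eq_inner]
  refine integral_mul_fderiv_eq_neg_fderiv_mul_of_integrable ?_ ?_ ?_
    (fun x _ => (hφ.differentiable (by norm_num)).differentiableAt)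
    (fun x _ => (hψ1.differentiable (by norm_num)).differentiableAt)
  · simp only [fderiv_eq_inner]
    exact Continuous.integrable_of_hasCompactSupport (by fun_prop) hc.mul_left
  · simp only [fderiv_eq_inner]
    refine Continuous.integrable_of_hasCompactSupport (by fun_prop) (HasCompactSupport.mul_left ?_)
    exact (hasCompactSupport_gradient hc).comp_left (g := fun y => inner ℝ y w) (inner_zero_left _)
  · exact Continuous.integrable_of_hasCompactSupport (by fun_prop) hc.mul_left

/-- Limits in `H¹` of functions with a weak gradient. -/
theorem isWeakGrad_of_tendsto {φ : ℕ → Plane → ℝ} (hφ : ∀ n, IsTestFunction U (φ n))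
    (hv : MemLp v 2 (volume.restrict U)) (hg : MemLp g 2 (volume.restrict U))
    (h0 : Tendsto (fun n => ∫ x in U, ‖v x - φ n x‖ ^ 2) atTop (𝓝 0))
    (h1 : Tendsto (fun n => ∫ x in U, ‖g x - gradient (φ n) x‖ ^ 2) atTop (𝓝 0)) :
    IsWeakGrad U v g := by
  refine ⟨hg, fun ψ hψ w => ?_⟩
  have hw : ∀ n, IsWeakGrad U (φ n) (gradient (φ n)) := fun n =>
    isWeakGrad_gradient (hφ n).contDiff_one ((hφ n).memLp_gradient U)
  -- Convergence in L² passes to integrals against a fixed square integrable factor; this carries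
  -- both sides of the defining identity to the limit.
  have key : ∀ {a : Plane → ℝ} {b : ℕ → Plane → ℝ} {χ : Plane → ℝ},
      MemLp a 2 (volume.restrict U) → (∀ n, MemLp (b n) 2 (volume.restrict U)) →
      MemLp χ 2 (volume.restrict U) →
      Tendsto (fun n => ∫ x in U, ‖a x - b n x‖ ^ 2) atTop (𝓝 0) →
      Tendsto (fun n => ∫ x in U, b n x * χ x) atTop (𝓝 (∫ x in U, a x * χ x)) := by
    intro a b χ ha hb hχ hlim
    rw [tendsto_iff_dist_tendsto_zero]
    have hl : Tendsto (fun n => Real.sqrt (∫ x in U, ‖a x - b n x‖ ^ 2) *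
        Real.sqrt (∫ x in U, ‖χ x‖ ^ 2)) atTop (𝓝 0) := by
      have := ((Real.continuous_sqrt.tendsto _).comp hlim).mul_const
        (Real.sqrt (∫ x in U, ‖χ x‖ ^ 2))
      simpa using this
    refine squeeze_zero (fun n => dist_nonneg) (fun n => ?_) hl
    rw [dist_comm, Real.dist_eq, ← integral_sub (integrable_mul_two ha hχ) (integrable_mul_two (hb n) hχ)]
    simp only [← sub_mul]
    exact abs_integral_mul_le (ha.sub (hb n)) hχ
  have l1 := key hv (fun n => (hφ n).memLp U) (hψ.memLp_fderiv U w) h0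
  have l2 : Tendsto (fun n => ∫ x in U, inner ℝ (gradient (φ n) x) w * ψ x) atTop
      (𝓝 (∫ x in U, inner ℝ (g x) w * ψ x)) := by
    refine key (MemLp.inner_const hg w) (fun n => MemLp.inner_const ((hφ n).memLp_gradient U) w)
      (hψ.memLp U) ?_
    have hl := h1.const_mul (‖w‖ ^ 2)
    rw [mul_zero] at hl
    refine squeeze_zero (fun n => integral_nonneg fun x => by positivity) (fun n => ?_) hl
    have hd := hg.sub ((hφ n).memLp_gradient U)
    rw [← integral_const_mul]
    refine integral_mono ?_ (hd.integrable_norm_pow (by norm_num) |>.const_mul _) fun x => ?_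
    · have := ((MemLp.inner_const hg w).sub
        (MemLp.inner_const ((hφ n).memLp_gradient U) w)).integrable_norm_pow (p := 2) (by norm_num)
      exact this
    · simp only
      rw [← inner_sub_left, ← mul_pow, mul_comm]
      gcongr
      exact norm_inner_le_norm _ _
  have l3 := l2.neg
  refine tendsto_nhds_unique l1 (l3.congr fun n => ?_)
  exact ((hw n).2 ψ hψ w).symm

/-- Limits in `H¹` of test functions belong to `H¹₀`. -/
theorem memH10_of_tendsto (hU : IsOpen U) {φ : ℕ → Plane → ℝ} (hφ : ∀ n, IsTestFunction U (φ n))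
    (hv : MemLp v 2 (volume.restrict U)) (hg : MemLp g 2 (volume.restrict U))
    (h0 : Tendsto (fun n => ∫ x in U, ‖v x - φ n x‖ ^ 2) atTop (𝓝 0))
    (h1 : Tendsto (fun n => ∫ x in U, ‖g x - gradient (φ n) x‖ ^ 2) atTop (𝓝 0)) :
    MemH10 U v := by
  have hw := isWeakGrad_of_tendsto hφ hv hg h0 h1
  refine ⟨⟨hv, g, hw⟩, φ, hφ, ?_, ?_⟩
  · exact (tendsto_eLpNorm_two_iff fun n => hv.sub ((hφ n).memLp U)).2 h0
  · have h2 := (tendsto_eLpNorm_two_iff fun n => hg.sub ((hφ n).memLp_gradient U)).2 h1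
    refine h2.congr fun n => eLpNorm_congr_ae ?_
    filter_upwards [hw.weakGrad_ae hU] with x hx
    simp [hx]

theorem MemH10.exists_seq (h : MemH10 U v) : ∃ φ : ℕ → Plane → ℝ, (∀ n, IsTestFunction U (φ n)) ∧
    Tendsto (fun n => ∫ x in U, ‖v x - φ n x‖ ^ 2) atTop (𝓝 0) ∧
    Tendsto (fun n => ∫ x in U, ‖weakGrad U v x - gradient (φ n) x‖ ^ 2) atTop (𝓝 0) := by
  obtain ⟨h1, φ, hφ, h2, h3⟩ := h
  refine ⟨φ, hφ, ?_, ?_⟩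
  · exact (tendsto_eLpNorm_two_iff fun n => h1.1.sub ((hφ n).memLp U)).1 h2
  · exact (tendsto_eLpNorm_two_iff fun n => h1.spec.1.sub ((hφ n).memLp_gradient U)).1 h3

theorem IsTestFunction.memH10 (hU : IsOpen U) (h : IsTestFunction U φ) : MemH10 U φ :=
  memH10_of_tendsto hU (φ := fun _ => φ) (fun _ => h) (h.memLp U) (h.memLp_gradient U)
    (by simp) (by simp)

theorem IsTestFunction.sub {ψ : Plane → ℝ} (h : IsTestFunction U φ) (h' : IsTestFunction U ψ) :
    IsTestFunction U fun x => φ x - ψ x := by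
  refine ⟨h.1.sub h'.1, h.2.1.sub h'.2.1, ?_⟩
  exact (tsupport_sub φ ψ).trans (Set.union_subset h.2.2 h'.2.2)

theorem gradient_sub {ψ : Plane → ℝ} (h : ContDiff ℝ 1 φ) (h' : ContDiff ℝ 1 ψ) (x : Plane) :
    gradient (fun x => φ x - ψ x) x = gradient φ x - gradient ψ x := by
  rw [gradient, fderiv_fun_sub (h.differentiable (by norm_num)).differentiableAt
    (h'.differentiable (by norm_num)).differentiableAt, map_sub]
  rfl

theorem tendsto_integral_sub_sq {F : Type*} [NormedAddCommGroup F] {μ : Measure Plane}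
    {a a' : Plane → F} {b b' : ℕ → Plane → F} (ha : MemLp a 2 μ) (ha' : MemLp a' 2 μ)
    (hb : ∀ n, MemLp (b n) 2 μ) (hb' : ∀ n, MemLp (b' n) 2 μ)
    (h : Tendsto (fun n => ∫ x, ‖a x - b n x‖ ^ 2 ∂μ) atTop (𝓝 0))
    (h' : Tendsto (fun n => ∫ x, ‖a' x - b' n x‖ ^ 2 ∂μ) atTop (𝓝 0)) :
    Tendsto (fun n => ∫ x, ‖(a x - a' x) - (b n x - b' n x)‖ ^ 2 ∂μ) atTop (𝓝 0) := by
  have hl := (h.const_mul 2).add (h'.const_mul 2)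
  simp only [mul_zero, add_zero] at hl
  refine squeeze_zero (fun n => integral_nonneg fun x => by positivity) (fun n => ?_) hl
  have i1 := (ha.sub (hb n)).integrable_norm_pow (p := 2) (by norm_num)
  have i2 := (ha'.sub (hb' n)).integrable_norm_pow (p := 2) (by norm_num)
  simp only [Pi.sub_apply] at i1 i2
  have i3 := ((ha.sub ha').sub ((hb n).sub (hb' n))).integrable_norm_pow (p := 2) (by norm_num)
  rw [← integral_const_mul, ← integral_const_mul, ← integral_add (i1.const_mul 2) (i2.const_mul 2)]
  refine integral_mono i3 ((i1.const_mul 2).add (i2.const_mul 2)) fun x => ?_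
  beta_reduce
  have e : (a x - a' x) - (b n x - b' n x) = (a x - b n x) - (a' x - b' n x) := by abel
  have h3 := norm_sub_le (a x - b n x) (a' x - b' n x)
  rw [e]
  calc _ ≤ (‖a x - b n x‖ + ‖a' x - b' n x‖) ^ 2 := by gcongr
    _ ≤ _ := by nlinarith [sq_nonneg (‖a x - b n x‖ - ‖a' x - b' n x‖)]

theorem MemH10.sub (hU : IsOpen U) (h : MemH10 U v) (h' : MemH10 U v') :
    MemH10 U (fun x => v x - v' x) := by
  obtain ⟨φ, hφ, a0, a1⟩ := h.exists_seq
  obtain ⟨ψ, hψ, b0, b1⟩ := h'.exists_seq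
  refine memH10_of_tendsto hU (g := fun x => weakGrad U v x - weakGrad U v' x)
    (fun n => (hφ n).sub (hψ n)) (h.1.1.sub h'.1.1) (h.1.spec.1.sub h'.1.spec.1) ?_ ?_
  · exact tendsto_integral_sub_sq h.1.1 h'.1.1 (fun n => (hφ n).memLp U) (fun n => (hψ n).memLp U)
      a0 b0
  · simp only [gradient_sub (hφ _).contDiff_one (hψ _).contDiff_one]
    exact tendsto_integral_sub_sq h.1.spec.1 h'.1.spec.1 (fun n => (hφ n).memLp_gradient U)
      (fun n => (hψ n).memLp_gradient U) a1 b1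

theorem weakGrad_sub_ae (hU : IsOpen U) (h : MemH1 U v) (h' : MemH1 U v') :
    weakGrad U (fun x => v x - v' x) =ᵐ[volume.restrict U]
      fun x => weakGrad U v x - weakGrad U v' x :=
  (h.spec.sub h'.spec h.1 h'.1).weakGrad_ae hU

end WeakGradient

end

end VEM

/-! ### Truncation and mollification: piecewise affine functions in H¹₀. -/

namespace VEM

noncomputable section

open scoped Convolution

/-- Truncation of small values. -/
def trunc (ε s : ℝ) : ℝ := s - max (-ε) (min ε s)

theorem abs_trunc_sub_le {ε : ℝ} (hε : 0 ≤ ε) (s t : ℝ) : |trunc ε s - trunc ε t| ≤ |s - t| := by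
  unfold trunc
  rw [abs_le]
  rcases le_total ε s with h1 | h1 <;> rcases le_total ε t with h2 | h2 <;>
    rcases le_total (-ε) s with h3 | h3 <;> rcases le_total (-ε) t with h4 | h4 <;>
    simp only [min_eq_left, min_eq_right, max_eq_left, max_eq_right, h1, h2, h3, h4,
      neg_le_self hε] <;>
    constructor <;> cases abs_cases (s - t) <;> linarith

theorem abs_trunc_sub_self_le {ε : ℝ} (hε : 0 ≤ ε) (s : ℝ) : |s - trunc ε s| ≤ ε := by
  unfold trunc
  rw [sub_sub_cancel, abs_le]
  exact ⟨le_max_left _ _, max_le (by linarith) (min_le_left _ _)⟩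

theorem trunc_eq_zero {ε s : ℝ} (h : |s| ≤ ε) : trunc ε s = 0 := by
  rw [abs_le] at h
  rw [trunc, min_eq_right h.2, max_eq_right h.1, sub_self]

theorem trunc_of_le {ε s : ℝ} (hε : 0 ≤ ε) (h : ε ≤ s) : trunc ε s = s - ε := by
  rw [trunc, min_eq_left h, max_eq_right (by linarith)]

theorem trunc_of_le_neg {ε s : ℝ} (hε : 0 ≤ ε) (h : s ≤ -ε) : trunc ε s = s + ε := by
  rw [trunc, min_eq_right (by linarith), max_eq_left h]; ring

theorem P1.hasFDerivAt_eval (p : P1) (x : Plane) :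
    HasFDerivAt p.eval (InnerProductSpace.toDual ℝ Plane p.g) x := by
  have : p.eval = fun x => p.b + InnerProductSpace.toDual ℝ Plane p.g x := rfl
  rw [this]
  exact (ContinuousLinearMap.hasFDerivAt _).const_add _

theorem P1.contDiff_eval (p : P1) : ContDiff ℝ 1 p.eval := by
  exact contDiff_const.add (contDiff_const.inner ℝ contDiff_id)

theorem P1.gradient_eval (p : P1) (x : Plane) : gradient p.eval x = p.g := by
  rw [gradient, (p.hasFDerivAt_eval x).fderiv, LinearIsometryEquiv.symm_apply_apply]

/-! ### Mollification -/

section Mollify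

variable (ρ : ContDiffBump (0 : Plane)) (w : Plane → ℝ)

/-- Mollification of `w` by the bump function `ρ`. -/
def mollify : Plane → ℝ := ρ.normed volume ⋆[ContinuousLinearMap.lsmul ℝ ℝ, volume] w

variable {w}

theorem contDiff_mollify (hw : Continuous w) : ContDiff ℝ (⊤ : ℕ∞) (mollify ρ w) :=
  ρ.hasCompactSupport_normed.contDiff_convolution_left _ ρ.contDiff_normed hw.locallyIntegrable

theorem mollify_sub (hw : Continuous w) (x y : Plane) : mollify ρ w x - mollify ρ w y =
    ∫ t, ρ.normed volume t * (w (x - t) - w (y - t)) := by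
  have hρ := ρ.continuous_normed (μ := (volume : Measure Plane))
  have hi : ∀ x, Integrable fun t => ρ.normed volume t * w (x - t) := fun x =>
    Continuous.integrable_of_hasCompactSupport (by fun_prop) ρ.hasCompactSupport_normed.mul_right
  simp only [mollify, convolution, ContinuousLinearMap.lsmul_apply, smul_eq_mul, mul_sub]
  rw [integral_sub (hi x) (hi y)]

/-- The bump has mass one, so a constant difference of translates is reproduced exactly. -/
theorem mollify_sub_eq (hw : Continuous w) {x y : Plane} {c : ℝ}
    (h : ∀ t ∈ Metric.ball (0 : Plane) ρ.rOut, w (x - t) - w (y - t) = c) :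
    mollify ρ w x - mollify ρ w y = c := by
  rw [mollify_sub ρ hw]
  have : ∀ t, ρ.normed volume t * (w (x - t) - w (y - t)) = ρ.normed volume t * c := fun t => by
    by_cases ht : t ∈ Metric.ball (0 : Plane) ρ.rOut
    · rw [h t ht]
    · have : ρ.normed volume t = 0 := by
        rw [← Function.notMem_support, ρ.support_normed_eq]; exact ht
      rw [this, zero_mul, zero_mul]
  simp only [this]
  rw [integral_mul_const, ρ.integral_normed, one_mul]

theorem abs_mollify_sub_le {L : NNReal} (hw : LipschitzWith L w) (x y : Plane) :
    |mollify ρ w x - mollify ρ w y| ≤ L * ‖x - y‖ := by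
  rw [mollify_sub ρ hw.continuous, ← Real.norm_eq_abs]
  have hρ := ρ.continuous_normed (μ := (volume : Measure Plane))
  refine (norm_integral_le_of_norm_le (g := fun t => ρ.normed volume t * (L * ‖x - y‖))
    ((hρ.integrable_of_hasCompactSupport ρ.hasCompactSupport_normed).mul_const _)
    (ae_of_all _ fun t => ?_)).trans ?_
  · rw [norm_mul, Real.norm_of_nonneg (ρ.nonneg_normed t)]
    refine mul_le_mul_of_nonneg_left ?_ (ρ.nonneg_normed t)
    have := hw.dist_le_mul (x - t) (y - t)
    rwa [dist_sub_right, dist_eq_norm, dist_eq_norm] at this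
  · rw [integral_mul_const, ρ.integral_normed, one_mul]

theorem norm_gradient_mollify_le {L : NNReal} (hw : LipschitzWith L w) (x : Plane) :
    ‖gradient (mollify ρ w) x‖ ≤ L := by
  rw [gradient, LinearIsometryEquiv.norm_map]
  exact norm_fderiv_le_of_lip' ℝ L.2 (Eventually.of_forall fun y => by
    rw [Real.norm_eq_abs]; exact abs_mollify_sub_le ρ hw y x)

/-- On a ball larger than the support of the bump an affine function keeps its slope under
mollification. Pointwise convergence of gradients is thus eventual equality. -/
theorem gradient_mollify_eq (hw : Continuous w) {x g : Plane} {s : ℝ} (hs : ρ.rOut < s)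
    (h : ∀ y ∈ Metric.ball x s, ∀ z ∈ Metric.ball x s, w y - w z = inner ℝ g (y - z)) :
    gradient (mollify ρ w) x = g := by
  have hev : ∀ᶠ y in 𝓝 x, mollify ρ w y = (⟨mollify ρ w x - inner ℝ g x, g⟩ : P1).eval y := by
    filter_upwards [Metric.ball_mem_nhds x (sub_pos.2 hs)] with y hy
    have := mollify_sub_eq ρ hw (x := y) (y := x) (c := inner ℝ g (y - x)) fun t ht => by
      rw [h (y - t) ?_ (x - t) ?_, sub_sub_sub_cancel_right]
      · rw [Metric.mem_ball, dist_eq_norm] at *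
        rw [sub_zero] at ht
        calc ‖y - t - x‖ = ‖(y - x) - t‖ := by congr 1; abel
          _ ≤ ‖y - x‖ + ‖t‖ := norm_sub_le _ _
          _ < s := by linarith
      · rw [Metric.mem_ball, dist_eq_norm] at *
        rw [sub_zero] at ht
        simp only [sub_sub_cancel_left, norm_neg]; linarith
    rw [inner_sub_right] at this
    simp only [P1.eval]; linarith
  rw [gradient, Filter.EventuallyEq.fderiv_eq hev]
  exact P1.gradient_eval _ x

theorem abs_mollify_sub_self_le {L : NNReal} (hw : LipschitzWith L w) (x : Plane) :
    |mollify ρ w x - w x| ≤ L * ρ.rOut := by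
  rw [← Real.dist_eq]
  refine ρ.dist_normed_convolution_le hw.continuous.aestronglyMeasurable fun y hy => ?_
  refine (hw.dist_le_mul y x).trans ?_
  have : dist y x ≤ ρ.rOut := (Metric.mem_ball.1 hy).le
  gcongr

theorem mollify_eq_zero {x : Plane} (h : ∀ y ∈ Metric.ball x ρ.rOut, w y = 0) :
    mollify ρ w x = 0 := by
  have hx := h x (Metric.mem_ball_self ρ.rOut_pos)
  rw [mollify, ρ.normed_convolution_eq_right fun y hy => by rw [h y hy, hx], hx]

end Mollify

/-- A piecewise affine Lipschitz function vanishing off a bounded open set `U` is in `H¹₀(U)`. -/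
theorem memH10_of_lipschitz {U : Set Plane} (hU : IsOpen U) (hUb : Bornology.IsBounded U)
    {v : Plane → ℝ} {L : NNReal} (hv : LipschitzWith L v) (h0 : ∀ x ∉ U, v x = 0)
    (hloc : ∀ᵐ x ∂(volume.restrict U), ∃ p : P1, v =ᶠ[𝓝 x] p.eval ∧ (v x = 0 → p.g = 0)) :
    MemH10 U v := by
  have hUfin : volume U < ⊤ := hUb.measure_lt_top
  have : IsFiniteMeasure (volume.restrict U) := ⟨by simpa using hUfin⟩
  set ε : ℕ → ℝ := fun n => 1 / ((n : ℝ) + 1) with hε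
  have hε0 : ∀ n, 0 < ε n := fun n => Nat.one_div_pos_of_nat
  have hεlim : Tendsto ε atTop (𝓝 0) := tendsto_one_div_add_atTop_nhds_zero_nat
  -- Truncation at level ε confines the support to a compact subset of `U`; mollification at a
  -- radius below its distance to the complement then yields test functions.
  have hK : ∀ n, IsCompact {x | ε n ≤ |v x|} ∧ {x | ε n ≤ |v x|} ⊆ U := fun n => by
    have hs : {x | ε n ≤ |v x|} ⊆ U := fun x hx => by
      by_contra h
      have hx' : ε n ≤ |v x| := hx
      rw [h0 x h, abs_zero] at hx'
      linarith [hε0 n]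
    exact ⟨Metric.isCompact_of_isClosed_isBounded
      (isClosed_le continuous_const hv.continuous.abs) (hUb.subset hs), hs⟩
  have hδ : ∀ n, ∃ δ, 0 < δ ∧ Metric.cthickening δ {x | ε n ≤ |v x|} ⊆ U := fun n =>
    (hK n).1.exists_cthickening_subset_open hU (hK n).2
  choose δ hδ0 hδU using hδ
  let r : ℕ → ℝ := fun n => min (δ n) (ε n)
  have hr0 : ∀ n, 0 < r n := fun n => lt_min (hδ0 n) (hε0 n)
  have hrlim : Tendsto r atTop (𝓝 0) :=
    squeeze_zero (fun n => (hr0 n).le) (fun n => min_le_right _ _) hεlim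
  let ρ : ∀ n, ContDiffBump (0 : Plane) := fun n =>
    ⟨r n / 2, r n, half_pos (hr0 n), half_lt_self (hr0 n)⟩
  let w : ℕ → Plane → ℝ := fun n x => trunc (ε n) (v x)
  have hw : ∀ n, LipschitzWith L (w n) := fun n => LipschitzWith.of_dist_le_mul fun x y => by
    rw [Real.dist_eq]
    exact (abs_trunc_sub_le (hε0 n).le _ _).trans (by
      rw [← Real.dist_eq]; exact hv.dist_le_mul x y)
  let φ : ℕ → Plane → ℝ := fun n => mollify (ρ n) (w n)
  have hsupp : ∀ n, tsupport (φ n) ⊆ Metric.cthickening (δ n) {x | ε n ≤ |v x|} := fun n => by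
    refine closure_minimal (fun x hx => ?_) Metric.isClosed_cthickening
    by_contra hnot
    refine hx (mollify_eq_zero _ fun y hy => ?_)
    by_contra hwy
    have hy' : ε n ≤ |v y| := by
      by_contra hlt
      exact hwy (trunc_eq_zero (not_le.1 hlt).le)
    refine hnot (Metric.mem_cthickening_of_dist_le x y _ _ hy' ?_)
    rw [dist_comm]
    exact (Metric.mem_ball.1 hy).le.trans (min_le_left _ _)
  have hφ : ∀ n, IsTestFunction U (φ n) := fun n =>
    ⟨contDiff_mollify _ (hw n).continuous,
      HasCompactSupport.of_support_subset_isCompact ((hK n).1.cthickening)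
        ((subset_tsupport _).trans (hsupp n)), (hsupp n).trans (hδU n)⟩
  have hclose : ∀ n x, ‖v x - φ n x‖ ≤ (1 + L) * ε n := fun n x => by
    rw [Real.norm_eq_abs]
    have h1 := abs_trunc_sub_self_le (hε0 n).le (v x)
    have h2 := abs_mollify_sub_self_le (ρ n) (hw n) x
    have h3 : (L : ℝ) * (ρ n).rOut ≤ L * ε n :=
      mul_le_mul_of_nonneg_left (min_le_right _ _) L.2
    have h4 := abs_sub_le (v x) (w n x) (φ n x)
    rw [abs_sub_comm (w n x)] at h4
    linarith
  have hae : ∀ᵐ x ∂(volume.restrict U),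
      Tendsto (fun n => gradient (φ n) x) atTop (𝓝 (gradient v x)) := by
    filter_upwards [hloc] with x ⟨p, hp, hp0⟩
    have hgrad : gradient v x = p.g := by
      rw [gradient, Filter.EventuallyEq.fderiv_eq hp]; exact p.gradient_eval x
    rw [hgrad]
    refine tendsto_const_nhds.congr' ?_
    obtain ⟨s, hs, hball⟩ := Metric.eventually_nhds_iff_ball.1 hp
    -- At a zero of `v` the local affine piece has zero slope, so `v` and its truncations vanish
    -- nearby. Away from the zeros, small truncation levels shift `v` by a constant, which leaves
    -- the slope unchanged.
    by_cases hvx : v x = 0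
    · filter_upwards [hrlim.eventually (gt_mem_nhds hs)] with n hn
      refine (gradient_mollify_eq (ρ n) (hw n).continuous hn fun y hy z hz => ?_).symm
      have hz : ∀ y ∈ Metric.ball x s, v y = 0 := fun y hy => by
        have := p.eval_sub y x
        rwa [← hball y hy, ← hball x (Metric.mem_ball_self hs), hvx, hp0 hvx, inner_zero_left,
          sub_zero] at this
      have hw0 : w n y = w n z := by simp only [w]; rw [hz y hy, hz z ‹_›]
      rw [hw0, sub_self, hp0 hvx, inner_zero_left]
    · have hpos : 0 < |v x| / 2 := half_pos (abs_pos.2 hvx)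
      obtain ⟨s', hs', hball'⟩ := Metric.eventually_nhds_iff_ball.1
        ((hv.continuous.continuousAt (x := x)).eventually (Metric.ball_mem_nhds (v x) hpos))
      filter_upwards [hrlim.eventually (gt_mem_nhds (lt_min hs hs')),
        hεlim.eventually (gt_mem_nhds hpos)] with n hn hn2
      refine (gradient_mollify_eq (ρ n) (hw n).continuous hn fun y hy z hz => ?_).symm
      have hb : ∀ y ∈ Metric.ball x (min s s'), v y = p.eval y ∧ |v y - v x| < |v x| / 2 :=
        fun y hy => ⟨hball y (Metric.ball_subset_ball (min_le_left _ _) hy), by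
          rw [← Real.dist_eq]
          exact hball' y (Metric.ball_subset_ball (min_le_right _ _) hy)⟩
      obtain ⟨ey, ly⟩ := hb y hy
      obtain ⟨ez, lz⟩ := hb z hz
      rw [← p.eval_sub, ← ey, ← ez]
      simp only [w]
      rw [abs_lt] at ly lz
      rcases lt_or_gt_of_ne hvx with hneg | hpos'
      · rw [abs_of_neg hneg] at *
        rw [trunc_of_le_neg (hε0 n).le (by linarith), trunc_of_le_neg (hε0 n).le (by linarith)]
        ring
      · rw [abs_of_pos hpos'] at *
        rw [trunc_of_le (hε0 n).le (by linarith), trunc_of_le (hε0 n).le (by linarith)]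
        ring
  have hgm : AEStronglyMeasurable (gradient v) (volume.restrict U) :=
    aestronglyMeasurable_of_tendsto_ae atTop
      (fun n => (continuous_gradient (hφ n).contDiff_one).aestronglyMeasurable) hae
  have hgb : ∀ x, ‖gradient v x‖ ≤ L := fun x => by
    rw [gradient, LinearIsometryEquiv.norm_map]
    exact norm_fderiv_le_of_lipschitz ℝ hv
  refine memH10_of_tendsto hU hφ ?_ (MemLp.of_bound hgm L (ae_of_all _ hgb)) ?_ ?_
  · refine hv.continuous.memLp_of_hasCompactSupport ?_
    refine HasCompactSupport.of_support_subset_isCompact hUb.isCompact_closure fun x hx => ?_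
    by_contra h
    exact hx (h0 x fun hxU => h (subset_closure hxU))
  · have hl : Tendsto (fun n => volume.real U * ((1 + L) * ε n) ^ 2) atTop (𝓝 0) := by
      have := ((hεlim.const_mul (1 + (L : ℝ))).pow 2).const_mul (volume.real U)
      simpa using this
    refine squeeze_zero (fun n => integral_nonneg fun x => by positivity) (fun n => ?_) hl
    have := norm_setIntegral_le_of_norm_le_const (C := ((1 + L) * ε n) ^ 2) hUfin
      (f := fun x => ‖v x - φ n x‖ ^ 2) fun x _ => by
        rw [norm_pow, norm_norm]
        have := hclose n x
        gcongr
    rw [mul_comm]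
    exact (le_abs_self _).trans this
  · have : (0 : ℝ) = ∫ x in U, (0 : ℝ) := by simp
    rw [this]
    -- Both gradients are bounded by the Lipschitz constant, so almost everywhere convergence on a
    -- set of finite measure gives L² convergence.
    refine tendsto_integral_of_dominated_convergence (fun _ => (2 * L : ℝ) ^ 2) (fun n => ?_)
      (integrable_const _) (fun n => ae_of_all _ fun x => ?_) ?_
    · exact ((hgm.sub (continuous_gradient (hφ n).contDiff_one).aestronglyMeasurable).norm.pow 2)
    · rw [norm_pow, norm_norm]
      have h1 := norm_sub_le (gradient v x) (gradient (φ n) x)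
      have h2 := hgb x
      have h3 := norm_gradient_mollify_le (ρ n) (hw n) x
      have h4 : ‖gradient v x - gradient (φ n) x‖ ≤ 2 * L := by simp only [φ] at *; linarith
      gcongr
    · filter_upwards [hae] with x hx
      have := ((hx.const_sub (gradient v x)).norm.pow 2)
      simpa using this

end

end VEM

/-! ### Conformity of nodal functions; projection and stabilization on an element. -/

namespace VEM

noncomputable section

variable {T₀ T : Finset Tri}

theorem P1.volume_zero_set (p : P1) (hp : p.g ≠ 0) : volume {x | p.eval x = 0} = 0 := by
  rcases Set.eq_empty_or_nonempty {x | p.eval x = 0} with h | ⟨x₀, hx₀⟩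
  · rw [h, measure_empty]
  let K : Submodule ℝ Plane := LinearMap.ker (innerₛₗ ℝ p.g)
  refine measure_mono_null (t := (AffineSubspace.mk' x₀ K : Set Plane)) (fun x hx => ?_)
    (Measure.addHaar_affineSubspace volume _ fun h => ?_)
  · rw [SetLike.mem_coe, AffineSubspace.mem_mk', LinearMap.mem_ker]
    have h1 : p.eval x = 0 := hx
    have h2 : p.eval x₀ = 0 := hx₀
    have := p.eval_sub x x₀
    simp only [innerₛₗ_apply_apply, vsub_eq_sub]
    linarith
  · have h1 := congrArg AffineSubspace.direction h
    rw [AffineSubspace.direction_mk', AffineSubspace.direction_top] at h1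
    have h2 : p.g ∈ K := by rw [h1]; trivial
    rw [LinearMap.mem_ker, innerₛₗ_apply_apply, inner_self_eq_zero] at h2
    exact hp h2

theorem isBounded_domain (T₀ : Finset Tri) : Bornology.IsBounded (domain T₀) :=
  (isCompact_region T₀).isBounded.subset (domain_subset_region T₀)

theorem interior_subset_domain (hT₀ : IsConforming T₀) {P : Tri} (hP : InForest T₀ P) :
    interior P.carrier ⊆ domain T₀ := interior_mono (forest_subset_region hT₀ hP)

/-- Almost every point of the domain lies in the interior of an element. -/
theorem ae_mem_interior (hT₀ : IsConforming T₀) (hT : IsRefinement T₀ T) :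
    ∀ᵐ x ∂(volume.restrict (domain T₀)), ∃ E ∈ T, x ∈ interior E.carrier := by
  rw [ae_restrict_iff' (isOpen_domain T₀).measurableSet, ae_iff]
  refine measure_mono_null (t := ⋃ E ∈ T, frontier E.carrier) (fun x hx => ?_)
    ((measure_biUnion_null_iff T.countable_toSet).2 fun E _ => E.volume_frontier)
  simp only [Set.mem_ofPred_eq, Classical.not_imp, not_exists, not_and] at hx
  have hxr := domain_subset_region T₀ hx.1
  rw [region, ← hT.union_eq hT₀] at hxr
  obtain ⟨E, hE, hxE⟩ := Set.mem_iUnion₂.1 hxr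
  exact Set.mem_iUnion₂.2 ⟨E, hE, by rw [Tri.frontier_eq]; exact ⟨hxE, hx.2 E hE⟩⟩

theorem nodalFun_eventuallyEq (hT₀ : IsConforming T₀) (hT : IsRefinement T₀ T) {Λ : ℕ}
    (hA : IsAdmissible T₀ T Λ) (g : Plane → ℝ) {E : Tri} (hE : E ∈ T) {x : Plane}
    (hx : x ∈ interior E.carrier) :
    nodalFun T₀ T g =ᶠ[𝓝 x] (nodalAffine T₀ T g E).eval := by
  filter_upwards [isOpen_interior.mem_nhds hx] with y hy
  exact nodalFun_eq hT₀ hT hA g hE (interior_subset hy)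

/-- The criterion for Lipschitz functions demands zero slope wherever the function vanishes. It can
fail only on element boundaries and on zero lines of nonconstant affine pieces, all of measure zero.
-/
theorem nodalFun_memH10 (hT₀ : IsConforming T₀) (hT : IsRefinement T₀ T) {Λ : ℕ}
    (hA : IsAdmissible T₀ T Λ) {g : Plane → ℝ} (hg : ∀ z ∉ domain T₀, g z = 0) :
    MemH10 (domain T₀) (nodalFun T₀ T g) := by
  obtain ⟨L, hL⟩ := nodalFun_lipschitz hT₀ hT hA hg
  refine memH10_of_lipschitz (isOpen_domain T₀) (isBounded_domain T₀) hL
    (fun x hx => nodalFun_boundary hT₀ hT hA hg hx) ?_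
  have h2 : ∀ᵐ x ∂(volume.restrict (domain T₀)), ∀ E ∈ T, (nodalAffine T₀ T g E).g ≠ 0 →
      (nodalAffine T₀ T g E).eval x ≠ 0 := by
    refine ae_restrict_of_ae ((ae_ball_iff T.countable_toSet).2 fun E _ => ?_)
    by_cases hg0 : (nodalAffine T₀ T g E).g = 0
    · exact ae_of_all _ fun x h => absurd hg0 h
    · rw [ae_iff]
      refine measure_mono_null (fun x hx => ?_) (P1.volume_zero_set _ hg0)
      simp only [Set.mem_ofPred_eq, Classical.not_imp, not_not] at hx
      exact hx.2
  filter_upwards [ae_mem_interior hT₀ hT, h2] with x ⟨E, hE, hx⟩ hx2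
  refine ⟨_, nodalFun_eventuallyEq hT₀ hT hA g hE hx, fun h0 => ?_⟩
  by_contra hne
  refine hx2 E hE hne ?_
  rwa [nodalFun_eq hT₀ hT hA g hE (interior_subset hx)] at h0

/-! ### Weak gradients on elements -/

theorem P1.isWeakGrad (p : P1) {U : Set Plane} (hU : Bornology.IsBounded U) :
    IsWeakGrad U p.eval (fun _ => p.g) := by
  have : IsFiniteMeasure (volume.restrict U) := ⟨by simpa using hU.measure_lt_top⟩
  have h := isWeakGrad_gradient (U := U) p.contDiff_eval (by
    have : gradient p.eval = fun _ => p.g := funext p.gradient_eval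
    rw [this]; exact memLp_const _)
  rwa [show gradient p.eval = fun _ => p.g from funext p.gradient_eval] at h

theorem P1.memLp_eval (p : P1) {U : Set Plane} (hU : Bornology.IsBounded U) :
    MemLp p.eval 2 (volume.restrict U) := by
  refine MemLp.mono_measure (Measure.restrict_mono_set _ subset_closure) ?_
  have : IsFiniteMeasure (volume.restrict (closure U)) :=
    ⟨by simpa using hU.closure.measure_lt_top⟩
  obtain ⟨C, hC⟩ := (hU.isCompact_closure.image p.continuous_eval).isBounded.exists_norm_le
  exact MemLp.of_bound p.continuous_eval.aestronglyMeasurable C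
    (ae_restrict_of_forall_mem isClosed_closure.measurableSet fun x hx =>
      hC _ (Set.mem_image_of_mem _ hx))

theorem Tri.isBounded_interior (E : Tri) : Bornology.IsBounded (interior E.carrier) :=
  E.isCompact_carrier.isBounded.subset interior_subset

theorem Tri.restrict_interior (E : Tri) :
    volume.restrict (interior E.carrier) = volume.restrict E.carrier :=
  Measure.restrict_congr_set E.interior_ae_eq

section Element

variable {E : Tri} {w : Plane → ℝ} {G : Plane → Plane}

theorem Tri.volume_real_pos (hE : E.Nondeg) : 0 < volume.real E.carrier := by
  rw [Tri.volume_carrier hE]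
  exact mul_pos (abs_pos.2 (Tri.det_ne_zero_iff.2 hE)) Tri.refArea_pos

theorem Tri.isFiniteMeasure_restrict (E : Tri) : IsFiniteMeasure (volume.restrict E.carrier) :=
  ⟨by simpa using E.isCompact_carrier.measure_lt_top⟩

/-- The mean of an `L²` vector field is its best constant approximation. -/
theorem integral_sub_mean_le (hG : MemLp G 2 (volume.restrict E.carrier)) {p : Plane}
    (hp : ∀ y : Plane, ∫ x in E.carrier, inner ℝ (G x - p) y = 0) (r : Plane) :
    ∫ x in E.carrier, ‖G x - p‖ ^ 2 ≤ ∫ x in E.carrier, ‖G x - r‖ ^ 2 := by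
  have := E.isFiniteMeasure_restrict
  have h1 := (hG.sub (memLp_const p)).integrable_norm_pow (p := 2) (by norm_num)
  have h2 := (hG.sub (memLp_const r)).integrable_norm_pow (p := 2) (by norm_num)
  have h3 : Integrable (fun x => inner ℝ (G x - p) (p - r)) (volume.restrict E.carrier) :=
    integrable_inner (hG.sub (memLp_const p)) (memLp_const _)
  simp only [Pi.sub_apply] at h1 h2
  have e : ∀ x, ‖G x - r‖ ^ 2 = ‖G x - p‖ ^ 2 + 2 * inner ℝ (G x - p) (p - r) + ‖p - r‖ ^ 2 :=
    fun x => by rw [← norm_add_sq_real]; congr 2; abel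
  simp only [e]
  have h12 : ∫ x in E.carrier, (‖G x - p‖ ^ 2 + 2 * inner ℝ (G x - p) (p - r) + ‖p - r‖ ^ 2) =
      (∫ x in E.carrier, ‖G x - p‖ ^ 2) + 2 * (∫ x in E.carrier, inner ℝ (G x - p) (p - r)) +
        ∫ _x in E.carrier, ‖p - r‖ ^ 2 := by
    have h4 : Integrable (fun x => ‖G x - p‖ ^ 2 + 2 * inner ℝ (G x - p) (p - r))
      (volume.restrict E.carrier) := h1.add (h3.const_mul 2)
    rw [integral_add h4 (integrable_const _),
      integral_add h1 (h3.const_mul 2), integral_const_mul]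
  rw [h12, hp, mul_zero, add_zero]
  exact le_add_of_nonneg_right (integral_nonneg fun x => by positivity)

theorem lagrange_spec (hE : E.Nondeg) (v : Plane → ℝ) (i : Fin 3) :
    (lagrange E v).eval (E.vert i) = v (E.vert i) :=
  Classical.epsilon_spec (p := fun p : P1 => ∀ i, p.eval (E.vert i) = v (E.vert i))
    ⟨E.interp fun i => v (E.vert i), fun i => Tri.interp_vert hE _ i⟩ i

theorem lagrange_eq (hE : E.Nondeg) {v : Plane → ℝ} {p : P1}
    (h : ∀ i, v (E.vert i) = p.eval (E.vert i)) : lagrange E v = p :=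
  P1.ext_vert hE fun i => by rw [lagrange_spec hE, h]

theorem Tri.perimeter_pos (hE : E.Nondeg) :
    0 < ∑ i : Fin 3, dist (E.vert i) (E.vert (i + 1)) :=
  Finset.sum_pos (fun i _ => dist_pos.2 fun h => by
    have := Tri.vert_injective hE h
    fin_cases i <;> simp at this) Finset.univ_nonempty

theorem Tri.lineMap_mem (E : Tri) (i j : Fin 3) {t : ℝ} (ht : t ∈ Set.Icc (0 : ℝ) 1) :
    AffineMap.lineMap (E.vert i) (E.vert j) t ∈ E.carrier :=
  E.convex_carrier.lineMap_mem (E.vert_mem i) (E.vert_mem j) ht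

theorem Tri.intervalIntegrable_side (hw : ContinuousOn w E.carrier) (i j : Fin 3) :
    IntervalIntegrable (fun t => w (AffineMap.lineMap (E.vert i) (E.vert j) t)) volume 0 1 := by
  refine ContinuousOn.intervalIntegrable ?_
  rw [Set.uIcc_of_le zero_le_one]
  exact hw.comp AffineMap.lineMap_continuous.continuousOn fun t ht => E.lineMap_mem i j ht

theorem Tri.bdryIntegral_sub {w' : Plane → ℝ} (hw : ContinuousOn w E.carrier)
    (hw' : ContinuousOn w' E.carrier) :
    E.bdryIntegral (fun x => w x - w' x) = E.bdryIntegral w - E.bdryIntegral w' := by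
  unfold Tri.bdryIntegral
  rw [← Finset.sum_sub_distrib]
  refine Finset.sum_congr rfl fun i _ => ?_
  rw [intervalIntegral.integral_sub (E.intervalIntegrable_side hw _ _)
    (E.intervalIntegrable_side hw' _ _)]
  ring

theorem Tri.bdryIntegral_const (E : Tri) (c : ℝ) :
    E.bdryIntegral (fun _ => c) = c * ∑ i : Fin 3, dist (E.vert i) (E.vert (i + 1)) := by
  simp [Tri.bdryIntegral, Finset.mul_sum, mul_comm]

theorem Tri.bdryIntegral_P1 (hw : ContinuousOn w E.carrier) (p : P1) :
    E.bdryIntegral (fun x => w x - p.eval x) =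
      E.bdryIntegral (fun x => w x - inner ℝ p.g x) -
        p.b * ∑ i : Fin 3, dist (E.vert i) (E.vert (i + 1)) := by
  rw [← E.bdryIntegral_const, ← Tri.bdryIntegral_sub (by fun_prop) (by fun_prop)]
  congr 1
  funext x
  rw [P1.eval]; ring

theorem integral_weakGrad_inner (hw : IsWeakGrad (interior E.carrier) w G) (p y : Plane) :
    ∫ x in interior E.carrier, inner ℝ (weakGrad (interior E.carrier) w x - p) y =
      ∫ x in E.carrier, inner ℝ (G x - p) y := by
  rw [← E.restrict_interior]
  refine integral_congr_ae ?_
  filter_upwards [hw.weakGrad_ae isOpen_interior] with x hx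
  rw [hx]

/-- The slope is the mean of the gradient, and the additive constant is fixed by the mean over the
boundary. Existence is what makes the arbitrary choice in `piNabla` satisfy its defining conditions.
-/
theorem exists_isPiNabla (hE : E.Nondeg) (hc : ContinuousOn w E.carrier)
    (hw : IsWeakGrad (interior E.carrier) w G) : ∃ p, IsPiNabla E w p := by
  have := E.isFiniteMeasure_restrict
  have hG : MemLp G 2 (volume.restrict E.carrier) := by
    rw [← E.restrict_interior]; exact hw.1
  have hv := Tri.volume_real_pos hE
  set g : Plane := (volume.real E.carrier)⁻¹ • ∫ x in E.carrier, G x with hg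
  have hP := Tri.perimeter_pos hE
  refine ⟨⟨E.bdryIntegral (fun x => w x - inner ℝ g x) /
    ∑ i : Fin 3, dist (E.vert i) (E.vert (i + 1)), g⟩, fun y => ?_, ?_⟩
  · have hi : Integrable G (volume.restrict E.carrier) := hG.integrable (by norm_num)
    rw [integral_weakGrad_inner hw]
    have e : ∀ x, inner ℝ (G x - g) y.g = inner ℝ y.g (G x - g) := fun x => real_inner_comm _ _
    simp only [e]
    rw [integral_inner (f := fun x => G x - g) (hi.sub (integrable_const g)), integral_sub hi (integrable_const g),
      setIntegral_const, hg, smul_inv_smul₀ hv.ne', sub_self, inner_zero_right]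
  · rw [Tri.bdryIntegral_P1 hc]
    simp only
    rw [div_mul_cancel₀ _ hP.ne', sub_self]

theorem piNabla_spec (hE : E.Nondeg) (hc : ContinuousOn w E.carrier)
    (hw : IsWeakGrad (interior E.carrier) w G) :
    (∀ y : Plane, ∫ x in E.carrier, inner ℝ (G x - (piNabla E w).g) y = 0) ∧
      E.bdryIntegral (fun x => w x - (piNabla E w).eval x) = 0 := by
  have h : IsPiNabla E w (piNabla E w) := Classical.epsilon_spec (exists_isPiNabla hE hc hw)
  exact ⟨fun y => by rw [← integral_weakGrad_inner hw]; exact h.1 ⟨0, y⟩, h.2⟩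

/-- The projector reproduces affine functions; together with `lagrange_eq` this lets the
quasi-interpolant pass unchanged through the discrete forms. -/
theorem piNabla_eq (hE : E.Nondeg) {p : P1} (hp : ∀ x ∈ E.carrier, w x = p.eval x) :
    piNabla E w = p := by
  have := E.isFiniteMeasure_restrict
  have hc : ContinuousOn w E.carrier := p.continuous_eval.continuousOn.congr hp
  have hw : IsWeakGrad (interior E.carrier) w (fun _ => p.g) :=
    (p.isWeakGrad E.isBounded_interior).congr isOpen_interior.measurableSet
      fun x hx => (hp x (interior_subset hx)).symm
  obtain ⟨h1, h2⟩ := piNabla_spec hE hc hw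
  set r := piNabla E w
  have hg : r.g = p.g := by
    have h3 := h1 (p.g - r.g)
    rw [setIntegral_const, smul_eq_mul, real_inner_self_eq_norm_sq] at h3
    have := (mul_eq_zero.1 h3).resolve_left (Tri.volume_real_pos hE).ne'
    rw [sq_eq_zero_iff, norm_eq_zero, sub_eq_zero] at this
    exact this.symm
  have hconst : E.bdryIntegral (fun x => w x - r.eval x) = E.bdryIntegral (fun _ => p.b - r.b) := by
    unfold Tri.bdryIntegral
    refine Finset.sum_congr rfl fun i _ => ?_
    congr 1
    refine intervalIntegral.integral_congr fun t ht => ?_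
    rw [Set.uIcc_of_le zero_le_one] at ht
    simp only
    rw [hp _ (E.lineMap_mem _ _ ht), P1.eval, P1.eval, hg]; ring
  rw [hconst, E.bdryIntegral_const] at h2
  have hb := (mul_eq_zero.1 h2).resolve_right (Tri.perimeter_pos hE).ne'
  cases hr : r
  cases p
  rw [hr] at hg hb
  simp only at hg hb
  rw [hg, show _ = _ from (sub_eq_zero.1 hb).symm]

/-- The local stabilization term controls the distance to the projection. -/
theorem stab_bound (hT₀ : IsConforming T₀) (hT : IsRefinement T₀ T) (hE : E ∈ T) {cs Cs : ℝ}
    (hcs : 0 < cs) {V : Submodule ℝ (Plane → ℝ)} (hV : IsLocalSpace T E V)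
    (hst : IsStable T E cs Cs V) (hwV : E.carrier.indicator w ∈ V)
    (hw2 : MemLp w 2 (volume.restrict (interior E.carrier)))
    (hw : IsWeakGrad (interior E.carrier) w G) :
    ∫ x in E.carrier, ‖G x - (piNabla E w).g‖ ^ 2 ≤ cs⁻¹ * SE T E w w := by
  have nE := (hT.inForest E hE).nondeg hT₀
  have hc : ContinuousOn w E.carrier :=
    (hV.continuousOn _ hwV).congr fun x hx => (Set.indicator_of_mem hx w).symm
  have hG : MemLp G 2 (volume.restrict E.carrier) := by
    rw [← E.restrict_interior]; exact hw.1
  set I := lagrange E w with hI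
  set N := nodesOn T E with hN
  have hNE : ∀ z ∈ N, z ∈ E.carrier := fun z hz => ((mem_nodesOn hT₀ hT hE).1 hz).2
  have hNpos : 0 < (N.card : ℝ) := by
    have : E.vert 0 ∈ N := (mem_nodesOn hT₀ hT hE).2 ⟨vert_mem_nodes hE 0, E.vert_mem 0⟩
    exact_mod_cast Finset.card_pos.2 ⟨_, this⟩
  set r : Plane → ℝ := fun z => w z - I.eval z with hr
  -- Stability is available only for zero nodal sum, so the nodal mean of `w` minus its vertex
  -- interpolant is subtracted as well. This leaves gradients unchanged and can only lower the nodal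
  -- sum of squares.
  set m := (∑ z ∈ N, r z) / N.card with hm
  let q : P1 := ⟨I.b + m, I.g⟩
  have hq : ∀ x, q.eval x = I.eval x + m := fun x => by
    show (I.b + m) + inner ℝ I.g x = (I.b + inner ℝ I.g x) + m
    ring
  let v : Plane → ℝ := E.carrier.indicator w - E.carrier.indicator q.eval
  have hvV : v ∈ V := V.sub_mem hwV (hV.affine_mem q)
  have hvE : ∀ x ∈ E.carrier, v x = r x - m := fun x hx => by
    have : v x = w x - q.eval x := by
      simp only [v, Pi.sub_apply, Set.indicator_of_mem hx]
    rw [this, hq]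
    show _ = w x - I.eval x - m
    ring
  have hsum : ∑ x ∈ N, v x = 0 := by
    rw [Finset.sum_congr rfl fun z hz => hvE z (hNE z hz), Finset.sum_sub_distrib,
      Finset.sum_const, nsmul_eq_mul, hm]
    field_simp
    ring
  have h1 := (hst v hvV hsum).1
  have h2 : sE T E v v ≤ SE T E w w := by
    have e1 : sE T E v v = ∑ z ∈ N, (r z - m) * (r z - m) :=
      Finset.sum_congr rfl fun z hz => by rw [hvE z (hNE z hz)]
    have e2 : SE T E w w = ∑ z ∈ N, r z * r z := rfl
    have hmN : ∑ z ∈ N, r z = m * N.card := by rw [hm]; field_simp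
    have e3 : ∑ z ∈ N, (r z - m) * (r z - m) = ∑ z ∈ N, r z * r z - m ^ 2 * N.card := by
      have : ∀ z, (r z - m) * (r z - m) = r z * r z - (2 * m) * r z + m ^ 2 := fun z => by ring
      rw [Finset.sum_congr rfl fun z _ => this z, Finset.sum_add_distrib,
        Finset.sum_sub_distrib, ← Finset.mul_sum, hmN, Finset.sum_const, nsmul_eq_mul]
      ring
    rw [e1, e2, e3]
    have : 0 ≤ m ^ 2 * N.card := mul_nonneg (sq_nonneg m) hNpos.le
    linarith
  have hvG : IsWeakGrad (interior E.carrier) v (fun x => G x - I.g) := by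
    refine (hw.sub (q.isWeakGrad E.isBounded_interior) hw2
      (q.memLp_eval E.isBounded_interior)).congr isOpen_interior.measurableSet fun x hx => ?_
    simp only [v, Pi.sub_apply, Set.indicator_of_mem (interior_subset hx)]
  have h3 : h1SemiSq (interior E.carrier) v = ∫ x in E.carrier, ‖G x - I.g‖ ^ 2 := by
    rw [h1SemiSq, ← E.restrict_interior]
    refine integral_congr_ae ?_
    filter_upwards [hvG.weakGrad_ae isOpen_interior] with x hx
    rw [hx]
  -- The slope of the projection is the mean of the gradient, hence at least as good an
  -- approximation of it as the slope of the vertex interpolant.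
  have h4 := integral_sub_mean_le hG (piNabla_spec nE hc hw).1 I.g
  rw [h3] at h1
  rw [← div_eq_inv_mul, le_div_iff₀ hcs, mul_comm]
  calc _ ≤ _ := mul_le_mul_of_nonneg_left h4 hcs.le
    _ ≤ _ := h1
    _ ≤ _ := h2

end Element

end

end VEM

/-! ### Trace inequality and divergence theorem on a triangle. -/

namespace VEM

noncomputable section

namespace Tri

variable {E : Tri} {f : Plane → ℝ} {ψ : Plane → ℝ}

/-! ### Cyclic relabelling of the vertices -/

/-- Cyclic relabelling of the vertices. -/
def rot (E : Tri) (k : Fin 3) : Tri := ⟨fun m => E.vert (m + k)⟩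

theorem rot_carrier (E : Tri) (k : Fin 3) : (E.rot k).carrier = E.carrier := by
  unfold carrier
  congr 1
  ext x
  constructor
  · rintro ⟨m, rfl⟩; exact ⟨m + k, rfl⟩
  · rintro ⟨m, rfl⟩; exact ⟨m - k, by simp [rot]⟩

theorem rot_det (E : Tri) (k : Fin 3) : (E.rot k).det = E.det := by
  fin_cases k <;> simp [rot, det] <;> ring

theorem rot_nondeg (hE : E.Nondeg) (k : Fin 3) : (E.rot k).Nondeg := by
  rw [← det_ne_zero_iff, rot_det]; exact det_ne_zero_iff.2 hE

/-! ### Mean values over the sides -/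

/-- The mean of `f` over the side opposite to the vertex `k`. -/
def sideAvg (E : Tri) (k : Fin 3) (f : Plane → ℝ) : ℝ :=
  ∫ t in (0 : ℝ)..1, f (AffineMap.lineMap (E.vert (k + 1)) (E.vert (k + 2)) t)

theorem integral_lineMap_symm (f : Plane → ℝ) (x y : Plane) :
    ∫ t in (0 : ℝ)..1, f (AffineMap.lineMap x y t) =
      ∫ t in (0 : ℝ)..1, f (AffineMap.lineMap y x t) := by
  have h := intervalIntegral.integral_comp_sub_left (a := 0) (b := 1)
    (fun t => f (AffineMap.lineMap x y t)) (1 : ℝ)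
  simp only [sub_self, sub_zero, AffineMap.lineMap_apply_one_sub] at h
  exact h.symm

theorem sideAvg_symm (E : Tri) (k : Fin 3) (f : Plane → ℝ) : E.sideAvg k f =
    ∫ t in (0 : ℝ)..1, f (AffineMap.lineMap (E.vert (k + 2)) (E.vert (k + 1)) t) :=
  integral_lineMap_symm _ _ _

theorem rot_sideAvg (E : Tri) (k m : Fin 3) (f : Plane → ℝ) :
    (E.rot k).sideAvg m f = E.sideAvg (m + k) f := by
  simp only [sideAvg, rot]
  have h1 : m + 1 + k = m + k + 1 := by abel
  have h2 : m + 2 + k = m + k + 2 := by abel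
  rw [h1, h2]

theorem bdryIntegral_eq (E : Tri) (f : Plane → ℝ) : E.bdryIntegral f =
    ∑ k : Fin 3, dist (E.vert (k + 1)) (E.vert (k + 2)) * E.sideAvg k f := by
  unfold bdryIntegral sideAvg
  rw [← Equiv.sum_comp (Equiv.addRight (1 : Fin 3))]
  refine Finset.sum_congr rfl fun k _ => ?_
  simp only [Equiv.coe_addRight, add_assoc]
  rfl

/-! ### Polar coordinates about a vertex -/

/-- Polar coordinates about the vertex `1`. -/
def cone (E : Tri) (r τ : ℝ) : Plane :=
  E.vert 1 + r • (AffineMap.lineMap (E.vert 0) (E.vert 2) τ - E.vert 1)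

theorem cone_eq_param (E : Tri) (r τ : ℝ) : E.cone r τ = E.param (1 - r, r * τ) := by
  simp only [cone, param, AffineMap.lineMap_apply_module]
  module

theorem continuous_cone (E : Tri) : Continuous fun p : ℝ × ℝ => E.cone p.1 p.2 := by
  simp only [cone, AffineMap.lineMap_apply_module]
  fun_prop

/-- The substitution s = 1 - r, t = rτ in the affine parametrization; its Jacobian is r. -/
theorem integral_cone (hE : E.Nondeg) (hf : IntegrableOn f E.carrier) : ∫ x in E.carrier, f x =
    |E.det| * ∫ r in (0 : ℝ)..1, r * ∫ τ in (0 : ℝ)..1, f (E.cone r τ) := by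
  have hi := (integrableOn_iff_param hE E.carrier f).1 hf
  rw [param_preimage_carrier hE] at hi
  rw [setIntegral_eq_param hE, param_preimage_carrier hE, smul_eq_mul, integral_refTri hi]
  congr 1
  have h := intervalIntegral.integral_comp_sub_left (a := 0) (b := 1)
    (fun s => ∫ t in (0 : ℝ)..(1 - s), f (E.param (s, t))) (1 : ℝ)
  simp only [sub_self, sub_zero, sub_sub_cancel] at h
  rw [← h]
  refine intervalIntegral.integral_congr fun r _ => ?_
  have h2 := intervalIntegral.mul_integral_comp_mul_left (a := 0) (b := 1) (c := r)
    (f := fun t => f (E.param (1 - r, t)))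
  rw [mul_zero, mul_one] at h2
  rw [← h2]
  simp only [cone_eq_param]

theorem integral_cone_continuous (hE : E.Nondeg) (hf : Continuous f) : ∫ x in E.carrier, f x =
    |E.det| * ∫ τ in (0 : ℝ)..1, ∫ r in (0 : ℝ)..1, r * f (E.cone r τ) := by
  rw [integral_cone hE (hf.continuousOn.integrableOn_compact E.isCompact_carrier)]
  congr 1
  simp only [← intervalIntegral.integral_const_mul]
  have hc := E.continuous_cone
  simp only [intervalIntegral.integral_of_le (zero_le_one (α := ℝ))]
  refine integral_integral_swap ?_
  rw [Measure.prod_restrict]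
  refine (Continuous.integrableOn_Icc (μ := volume.prod volume) (a := ((0 : ℝ), (0 : ℝ)))
    (b := ((1 : ℝ), (1 : ℝ))) ?_).mono_set ?_
  · simp only [Function.uncurry_def]; fun_prop
  · rw [← Set.Icc_prod_Icc]
    exact Set.prod_mono Set.Ioc_subset_Icc_self Set.Ioc_subset_Icc_self

/-- The trace inequality in `L¹`, on lines parallel to a side. -/
theorem integral_abs_cone_le (hE : E.Nondeg) (hψ : ContDiff ℝ 1 ψ) {S : ℝ}
    (hS : ∀ x ∈ E.carrier, dist x (E.vert 1) ≤ S) {r : ℝ} (hr : 1 / 2 ≤ r)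
    (hr1 : r ≤ 1) : |E.det| * ∫ τ in (0 : ℝ)..1, |ψ (E.cone r τ)| ≤
      4 * ∫ x in E.carrier, (2 * |ψ x| + S * ‖gradient ψ x‖) := by
  have hS0 : 0 ≤ S := dist_nonneg.trans (hS _ (E.vert_mem 0))
  have hψc := hψ.continuous
  have hg := continuous_gradient hψ
  have hc := E.continuous_cone
  rw [integral_cone_continuous hE (by fun_prop), mul_left_comm]
  refine mul_le_mul_of_nonneg_left ?_ (abs_nonneg _)
  rw [← intervalIntegral.integral_const_mul]
  have hc1 : ∀ r, Continuous fun τ => E.cone r τ := fun r => by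
    exact hc.comp (Continuous.prodMk continuous_const continuous_id)
  have hc2 : ∀ τ, Continuous fun r => E.cone r τ := fun τ => by
    exact hc.comp (Continuous.prodMk continuous_id continuous_const)
  have hF : Continuous (Function.uncurry fun τ r : ℝ =>
      r * (2 * |ψ (E.cone r τ)| + S * ‖gradient ψ (E.cone r τ)‖)) := by
    have : Continuous fun p : ℝ × ℝ => E.cone p.2 p.1 := hc.comp continuous_swap
    simp only [Function.uncurry_def]; fun_prop
  refine intervalIntegral.integral_mono_on zero_le_one
    (Continuous.intervalIntegrable (by have := hc1 r; fun_prop) _ _)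
    (Continuous.intervalIntegrable (continuous_const.mul
      (intervalIntegral.continuous_parametric_intervalIntegral_of_continuous' hF 0 1)) _ _)
    fun τ hτ => ?_
  set y := AffineMap.lineMap (E.vert 0) (E.vert 2) τ - E.vert 1 with hy
  -- The weight ρ² removes the contribution of the apex and supplies the Jacobian factor ρ after
  -- differentiation. For r ≥ 1/2 dividing by r² costs the factor 4.
  have hder : ∀ ρ : ℝ, HasDerivAt (fun ρ : ℝ => ρ ^ 2 * ψ (E.cone ρ τ))
      (2 * ρ * ψ (E.cone ρ τ) + ρ ^ 2 * inner ℝ (gradient ψ (E.cone ρ τ)) y) ρ := by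
    intro ρ
    have h1 : HasDerivAt (fun ρ : ℝ => E.cone ρ τ) y ρ := by
      unfold cone
      simpa using ((hasDerivAt_id ρ).smul_const y).const_add (E.vert 1)
    have h2 := (hψ.differentiable (by norm_num)).differentiableAt.hasFDerivAt.comp_hasDerivAt ρ h1
    rw [fderiv_eq_inner] at h2
    have h3 := (hasDerivAt_pow 2 ρ).mul h2
    refine h3.congr_deriv ?_
    simp
  have hcd : Continuous fun ρ : ℝ => 2 * ρ * ψ (E.cone ρ τ) +
      ρ ^ 2 * inner ℝ (gradient ψ (E.cone ρ τ)) y := by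
    have := hc2 τ; fun_prop
  have h0 : (0 : ℝ) ≤ r := by linarith
  have hFTC := intervalIntegral.integral_eq_sub_of_hasDerivAt (a := 0) (b := r)
    (fun ρ _ => hder ρ) (hcd.intervalIntegrable 0 r)
  have hynorm : ‖y‖ ≤ S := by
    rw [hy, ← dist_eq_norm]
    exact hS _ (E.lineMap_mem 0 2 hτ)
  have hbound : r ^ 2 * |ψ (E.cone r τ)| ≤ ∫ ρ in (0 : ℝ)..1,
      ρ * (2 * |ψ (E.cone ρ τ)| + S * ‖gradient ψ (E.cone ρ τ)‖) := by
    have hgc : Continuous fun ρ =>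
        ρ * (2 * |ψ (E.cone ρ τ)| + S * ‖gradient ψ (E.cone ρ τ)‖) := by
      have := hc2 τ; fun_prop
    have e : r ^ 2 * |ψ (E.cone r τ)| = ‖∫ ρ in (0 : ℝ)..r, (2 * ρ * ψ (E.cone ρ τ) +
        ρ ^ 2 * inner ℝ (gradient ψ (E.cone ρ τ)) y)‖ := by
      rw [hFTC, Real.norm_eq_abs]; simp [abs_mul]
    rw [e]
    refine (intervalIntegral.norm_integral_le_integral_norm h0).trans ?_
    refine (intervalIntegral.integral_mono_on (g := fun ρ =>
      ρ * (2 * |ψ (E.cone ρ τ)| + S * ‖gradient ψ (E.cone ρ τ)‖)) h0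
      (hcd.norm.intervalIntegrable _ _) (hgc.intervalIntegrable _ _) fun ρ hρ => ?_).trans ?_
    · have hρ1 : ρ ≤ 1 := hρ.2.trans hr1
      have hin := abs_real_inner_le_norm (gradient ψ (E.cone ρ τ)) y
      have hn := norm_nonneg (gradient ψ (E.cone ρ τ))
      calc ‖2 * ρ * ψ (E.cone ρ τ) + ρ ^ 2 * inner ℝ (gradient ψ (E.cone ρ τ)) y‖
          ≤ |2 * ρ * ψ (E.cone ρ τ)| + |ρ ^ 2 * inner ℝ (gradient ψ (E.cone ρ τ)) y| :=
            norm_add_le _ _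
        _ = 2 * ρ * |ψ (E.cone ρ τ)| + ρ ^ 2 * |inner ℝ (gradient ψ (E.cone ρ τ)) y| := by
            rw [abs_mul (2 * ρ), abs_mul (ρ ^ 2), abs_of_nonneg (by linarith [hρ.1] : 0 ≤ 2 * ρ),
              abs_of_nonneg (sq_nonneg ρ)]
        _ ≤ 2 * ρ * |ψ (E.cone ρ τ)| + ρ * (‖gradient ψ (E.cone ρ τ)‖ * S) := by
            have h5 : ρ ^ 2 ≤ ρ := by nlinarith [hρ.1]
            have h6 : |inner ℝ (gradient ψ (E.cone ρ τ)) y| ≤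
              ‖gradient ψ (E.cone ρ τ)‖ * S := hin.trans (by gcongr)
            have := hρ.1
            gcongr
        _ = _ := by ring
    · refine intervalIntegral.integral_mono_interval le_rfl h0 hr1 ?_
        (hgc.intervalIntegrable _ _)
      refine ae_restrict_of_forall_mem measurableSet_Ioc fun ρ hρ => ?_
      have := hρ.1
      have := hS0
      simp only [Pi.zero_apply]
      positivity
  have h7 : 1 / 4 ≤ r ^ 2 := by nlinarith
  have := abs_nonneg (ψ (E.cone r τ))
  nlinarith

theorem cone_one (E : Tri) (τ : ℝ) : E.cone 1 τ = AffineMap.lineMap (E.vert 0) (E.vert 2) τ := by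
  simp [cone]

/-- Relabelling by `k + 2` moves vertex `k` to position 1, the apex of the polar coordinates. -/
theorem sideAvg_eq_cone (E : Tri) (k : Fin 3) (f : Plane → ℝ) :
    E.sideAvg k f = ∫ τ in (0 : ℝ)..1, f ((E.rot (k + 2)).cone 1 τ) := by
  rw [sideAvg_symm]
  simp only [cone_one, rot]
  congr! 5 <;> fin_cases k <;> rfl

theorem rot_vert_mem (E : Tri) (k m : Fin 3) : (E.rot k).vert m ∈ E.carrier := E.vert_mem _

/-- The trace inequality in `L¹`. -/
theorem integral_abs_rot_cone_le (hE : E.Nondeg) (hψ : ContDiff ℝ 1 ψ) (k : Fin 3) {r : ℝ}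
    (hr : 1 / 2 ≤ r) (hr1 : r ≤ 1) : |E.det| * ∫ τ in (0 : ℝ)..1, |ψ ((E.rot k).cone r τ)| ≤
      4 * ∫ x in E.carrier, (2 * |ψ x| + E.sz * ‖gradient ψ x‖) := by
  have h := integral_abs_cone_le (rot_nondeg hE k) hψ (S := E.sz) (fun x hx => by
    rw [rot_carrier] at hx; exact E.dist_le_sz hx (E.rot_vert_mem k 1)) hr hr1
  rwa [rot_det, rot_carrier] at h

/-- The trace inequality in `L²`. -/
theorem sideAvg_sq_le (hE : E.Nondeg) (hψ : ContDiff ℝ 1 ψ) (k : Fin 3) :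
    |E.det| * E.sideAvg k (fun x => ψ x ^ 2) ≤
      4 * ∫ x in E.carrier, (3 * ψ x ^ 2 + E.sz ^ 2 * ‖gradient ψ x‖ ^ 2) := by
  have hψc := hψ.continuous
  have hg := continuous_gradient hψ
  -- The L² inequality is the L¹ inequality for ψ², followed by Young's inequality for the product
  -- ψ∇ψ.
  have h := integral_abs_rot_cone_le hE (hψ.pow 2) (k + 2) (r := 1) (by norm_num) le_rfl
  rw [sideAvg_eq_cone]
  simp only [abs_pow, sq_abs] at h
  refine h.trans ?_
  have hgr : ∀ x, ‖gradient (fun x => ψ x ^ 2) x‖ ≤ 2 * |ψ x| * ‖gradient ψ x‖ := fun x => by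
    have hd := ((hψ.differentiable (by norm_num)).differentiableAt (x := x)).hasFDerivAt.pow 2
    have e : gradient (fun x => ψ x ^ 2) x = (2 * ψ x) • gradient ψ x := by
      rw [gradient, hd.fderiv, gradient]
      simp
    rw [e, norm_smul, Real.norm_eq_abs, abs_mul, abs_of_pos (by norm_num : (0 : ℝ) < 2)]
  refine mul_le_mul_of_nonneg_left ?_ (by norm_num)
  refine setIntegral_mono_on ?_ ?_ E.isClosed_carrier.measurableSet fun x _ => ?_
  · have := continuous_gradient (hψ.pow 2)
    exact (Continuous.continuousOn (by fun_prop)).integrableOn_compact E.isCompact_carrier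
  · exact (Continuous.continuousOn (by fun_prop)).integrableOn_compact E.isCompact_carrier
  · have h1 := hgr x
    have h2 := E.sz_nonneg
    have h3 := norm_nonneg (gradient ψ x)
    have h4 : E.sz * ‖gradient (fun x => ψ x ^ 2) x‖ ≤ E.sz * (2 * |ψ x| * ‖gradient ψ x‖) := by
      gcongr
    have h5 : 2 * (|ψ x| * (E.sz * ‖gradient ψ x‖)) ≤
        ψ x ^ 2 + (E.sz * ‖gradient ψ x‖) ^ 2 := by
      rw [← sq_abs (ψ x)]
      nlinarith [sq_nonneg (|ψ x| - E.sz * ‖gradient ψ x‖)]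
    rw [mul_pow] at h5
    nlinarith

/-! ### Integration by parts -/

/-- On each line parallel to the side from vertex 0 to vertex 2 the fundamental theorem leaves the
difference of the values on the other two sides. -/
theorem integral_gradient_aux (hE : E.Nondeg) (hψ : ContDiff ℝ 1 ψ) :
    ∫ x in E.carrier, inner ℝ (gradient ψ x) (E.vert 2 - E.vert 0) =
      |E.det| * (E.sideAvg 0 ψ - E.sideAvg 2 ψ) := by
  have hψc := hψ.continuous
  have hg := continuous_gradient hψ
  have hp := E.continuous_param
  have hi : IntegrableOn (fun p => inner ℝ (gradient ψ (E.param p)) (E.vert 2 - E.vert 0))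
      refTri := ((Continuous.continuousOn (by fun_prop)).integrableOn_compact
    (isCompact_Icc.prod isCompact_Icc)).mono_set refTri_subset
  rw [setIntegral_eq_param hE, param_preimage_carrier hE, smul_eq_mul, integral_refTri hi]
  congr 1
  have hin : ∀ s : ℝ, ∫ t in (0 : ℝ)..(1 - s),
      inner ℝ (gradient ψ (E.param (s, t))) (E.vert 2 - E.vert 0) =
      ψ (AffineMap.lineMap (E.vert 2) (E.vert 1) s) -
        ψ (AffineMap.lineMap (E.vert 0) (E.vert 1) s) := by
    intro s
    have hder : ∀ t : ℝ, HasDerivAt (fun t : ℝ => ψ (E.param (s, t)))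
        (inner ℝ (gradient ψ (E.param (s, t))) (E.vert 2 - E.vert 0)) t := by
      intro t
      have h1 : HasDerivAt (fun τ : ℝ => E.param (s, τ)) (E.vert 2 - E.vert 0) t := by
        unfold Tri.param
        simpa using ((((hasDerivAt_id t).smul_const (E.vert 2 - E.vert 0)).const_add
          (s • (E.vert 1 - E.vert 0))).const_add (E.vert 0))
      rw [← fderiv_eq_inner]
      exact (hψ.differentiable (by norm_num)).differentiableAt.hasFDerivAt.comp_hasDerivAt t h1
    rw [intervalIntegral.integral_eq_sub_of_hasDerivAt (fun t _ => hder t)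
      (Continuous.intervalIntegrable (by fun_prop) _ _)]
    congr 2
    · simp only [param, AffineMap.lineMap_apply_module]; module
    · simp only [param, AffineMap.lineMap_apply_module]; module
  simp only [hin]
  rw [intervalIntegral.integral_sub
    (Continuous.intervalIntegrable (by simp only [AffineMap.lineMap_apply_module]; fun_prop) _ _)
    (Continuous.intervalIntegrable (by simp only [AffineMap.lineMap_apply_module]; fun_prop) _ _)]
  rw [sideAvg_symm]
  rfl

theorem integral_gradient_side (hE : E.Nondeg) (hψ : ContDiff ℝ 1 ψ) (k : Fin 3) :
    ∫ x in E.carrier, inner ℝ (gradient ψ x) (E.vert (k + 2) - E.vert k) =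
      |E.det| * (E.sideAvg k ψ - E.sideAvg (k + 2) ψ) := by
  have h := integral_gradient_aux (rot_nondeg hE k) hψ
  rw [rot_det, rot_carrier, rot_sideAvg, rot_sideAvg, zero_add, add_comm 2 k] at h
  rw [← h]
  simp only [rot, zero_add, add_comm 2 k]

theorem sum_gradLam (hE : E.Nondeg) : ∑ k, E.gradLam k = 0 := by
  refine ext_inner_right ℝ fun y => ?_
  rw [sum_inner, inner_zero_left]
  have h : ∀ k, inner ℝ (E.gradLam k) y = E.lam k y - E.lam k 0 := fun k => by
    rw [← inner_gradLam_sub, sub_zero]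
  simp only [h, Finset.sum_sub_distrib, sum_lam hE, sub_self]

theorem sum_inner_gradLam_smul (hE : E.Nondeg) (y : Plane) :
    ∑ k, (inner ℝ (E.gradLam k) y : ℝ) • E.vert k = y := by
  have h : ∀ k, inner ℝ (E.gradLam k) y = E.lam k y - E.lam k 0 := fun k => by
    rw [← inner_gradLam_sub, sub_zero]
  simp only [h, sub_smul, Finset.sum_sub_distrib, comb_lam hE, sub_zero]

/-- The divergence theorem on a triangle, for constant fields times functions. -/
theorem integral_inner_gradient (hE : E.Nondeg) (hψ : ContDiff ℝ 1 ψ) (y : Plane) :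
    ∫ x in E.carrier, inner ℝ y (gradient ψ x) =
      -(|E.det| * ∑ k, inner ℝ (E.gradLam k) y * E.sideAvg k ψ) := by
  have hg := continuous_gradient hψ
  set a := fun k => (inner ℝ (E.gradLam k) y : ℝ) with ha
  have hs : a 0 + a 1 + a 2 = 0 := by
    have := congrArg (fun v => (inner ℝ v y : ℝ)) (sum_gradLam hE)
    simp only [inner_zero_left, Fin.sum_univ_three, inner_add_left] at this
    exact this
  have hy := sum_inner_gradLam_smul hE y
  rw [Fin.sum_univ_three] at hy
  -- The coordinate gradients sum to zero, so any direction is a combination of two side vectors,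
  -- for which the identity is already known.
  have hy2 : y = a 2 • (E.vert 2 - E.vert 0) - a 1 • (E.vert 0 - E.vert 1) := by
    have h0 : a 0 = -a 1 - a 2 := by linarith
    rw [← hy]
    show a 0 • E.vert 0 + a 1 • E.vert 1 + a 2 • E.vert 2 = _
    rw [h0]; module
  have hi : ∀ z : Plane, IntegrableOn (fun x => inner ℝ (gradient ψ x) z) E.carrier := fun z =>
    (Continuous.continuousOn (by fun_prop)).integrableOn_compact E.isCompact_carrier
  have e : ∀ x, inner ℝ y (gradient ψ x) = a 2 * inner ℝ (gradient ψ x) (E.vert 2 - E.vert 0) -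
      a 1 * inner ℝ (gradient ψ x) (E.vert 0 - E.vert 1) := fun x => by
    conv_lhs => rw [hy2]
    rw [real_inner_comm, inner_sub_right, inner_smul_right, inner_smul_right]
  have h0 := integral_gradient_side hE hψ 0
  have h1 := integral_gradient_side hE hψ 1
  simp only [zero_add, show (1 : Fin 3) + 2 = 0 from rfl] at h0 h1
  simp only [e]
  rw [integral_sub ((hi _).const_mul _) ((hi _).const_mul _), integral_const_mul,
    integral_const_mul, h0, h1, Fin.sum_univ_three]
  change _ = -(|E.det| * (a 0 * _ + a 1 * _ + a 2 * _))
  have h0 : a 0 = -a 1 - a 2 := by linarith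
  rw [h0]; ring

end Tri

end

end VEM

namespace VEM

noncomputable section

namespace Tri

variable {E : Tri} {ψ w : Plane → ℝ} {G : Plane → Plane}

/-! ### The Poincaré inequality on a triangle -/

-- The homothety maps the triangle into itself with Jacobian (1 - t)² ≥ 1/4. The restriction t ≤ 1/2
-- is why points are later joined only up to their midpoint.
open scoped Pointwise in
theorem integral_homothety_le (E : Tri) {h : Plane → ℝ} (hc : Continuous h) (h0 : ∀ x, 0 ≤ h x)
    {y : Plane} (hy : y ∈ E.carrier) {t : ℝ} (ht : 0 ≤ t) (ht1 : t ≤ 1 / 2) :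
    ∫ x in E.carrier, h (x + t • (y - x)) ≤ 4 * ∫ x in E.carrier, h x := by
  have hpos : 0 < 1 - t := by linarith
  have e : ∀ x, x + t • (y - x) = t • y + (1 - t) • x := fun x => by module
  simp only [e]
  rw [Measure.setIntegral_comp_smul_of_pos volume (fun x => h (t • y + x)) _ hpos]
  have h1 := (measurePreserving_add_left volume (t • y)).setIntegral_preimage_emb
    (measurableEmbedding_addLeft (t • y)) h ((fun x => t • y + x) '' ((1 - t) • E.carrier))
  rw [Set.preimage_image_eq _ (add_right_injective _)] at h1
  rw [h1]
  have hsub : (fun x => t • y + x) '' ((1 - t) • E.carrier) ⊆ E.carrier := by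
    rintro _ ⟨_, ⟨x, hx, rfl⟩, rfl⟩
    exact E.convex_carrier hy hx ht hpos.le (by ring)
  have h2 : ∫ x in (fun x => t • y + x) '' ((1 - t) • E.carrier), h x ≤ ∫ x in E.carrier, h x :=
    setIntegral_mono_set (hc.continuousOn.integrableOn_compact E.isCompact_carrier)
      (ae_of_all _ h0) (ae_of_all _ hsub)
  have hd : Module.finrank ℝ Plane = 2 := by simp
  rw [hd, smul_eq_mul]
  have h3 : ((1 - t) ^ 2)⁻¹ ≤ 4 := by
    rw [inv_le_comm₀ (by positivity) (by norm_num)]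
    nlinarith
  exact mul_le_mul h3 h2 (integral_nonneg h0) (by norm_num)

theorem sq_sub_midpoint_le (hψ : ContDiff ℝ 1 ψ) {x y : Plane} (hx : x ∈ E.carrier)
    (hy : y ∈ E.carrier) : (ψ x - ψ (x + (1 / 2 : ℝ) • (y - x))) ^ 2 ≤
      E.sz ^ 2 / 4 * ∫ s in Set.Ioc (0 : ℝ) 1, ‖gradient ψ (x + (s / 2) • (y - x))‖ ^ 2 := by
  have hg := continuous_gradient hψ
  have h := abs_sub_le_integral hψ x ((1 / 2 : ℝ) • (y - x))
  have hgr : ∀ x, gradNorm ψ x = ‖gradient ψ x‖ := fun x => by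
    rw [gradNorm, gradient, LinearIsometryEquiv.norm_map]
  have e : ∀ s : ℝ, s • (1 / 2 : ℝ) • (y - x) = (s / 2) • (y - x) := fun s => by
    rw [smul_smul]; congr 1; ring
  simp only [hgr, e] at h
  have hn : ‖(1 / 2 : ℝ) • (y - x)‖ ≤ E.sz / 2 := by
    rw [norm_smul, ← dist_eq_norm]
    have := E.dist_le_sz hy hx
    norm_num; linarith
  have hfin : MemLp (fun s : ℝ => ‖gradient ψ (x + (s / 2) • (y - x))‖) 2
      (volume.restrict (Set.Ioc (0 : ℝ) 1)) := by
    refine MemLp.mono_measure (Measure.restrict_mono_set _ Set.Ioc_subset_Icc_self) ?_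
    obtain ⟨C, hC⟩ := isCompact_Icc.exists_bound_of_continuousOn (s := Set.Icc (0 : ℝ) 1)
      (f := fun s : ℝ => ‖gradient ψ (x + (s / 2) • (y - x))‖)
      (Continuous.continuousOn (by fun_prop))
    exact MemLp.of_bound (Continuous.aestronglyMeasurable (by fun_prop)) C
      (ae_restrict_of_forall_mem measurableSet_Icc hC)
  have hcs := abs_integral_mul_le hfin (memLp_const (1 : ℝ))
  simp only [mul_one, norm_norm, norm_one, one_pow, integral_const, measureReal_restrict_apply_univ,
    Real.volume_real_Ioc, sub_zero, max_eq_left zero_le_one, smul_eq_mul, Real.sqrt_one] at hcs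
  set I := ∫ s in Set.Ioc (0 : ℝ) 1, ‖gradient ψ (x + (s / 2) • (y - x))‖ with hI
  set J := ∫ s in Set.Ioc (0 : ℝ) 1, ‖gradient ψ (x + (s / 2) • (y - x))‖ ^ 2 with hJ
  have hJ0 : 0 ≤ J := integral_nonneg fun _ => by positivity
  have hI0 : 0 ≤ I := integral_nonneg fun _ => norm_nonneg _
  have hIJ : I ^ 2 ≤ J := by
    rw [← Real.sq_sqrt hJ0, ← sq_abs I]
    gcongr
  rw [← sq_abs, abs_sub_comm]
  have hs := E.sz_nonneg
  calc _ ≤ (E.sz / 2 * I) ^ 2 := by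
        gcongr
        exact h.trans (by gcongr)
    _ = E.sz ^ 2 / 4 * I ^ 2 := by ring
    _ ≤ _ := by gcongr

theorem integral_sq_sub_midpoint_le (hψ : ContDiff ℝ 1 ψ) {y : Plane} (hy : y ∈ E.carrier) :
    ∫ x in E.carrier, (ψ x - ψ (x + (1 / 2 : ℝ) • (y - x))) ^ 2 ≤
      E.sz ^ 2 * ∫ x in E.carrier, ‖gradient ψ x‖ ^ 2 := by
  have hg := continuous_gradient hψ
  have hψc := hψ.continuous
  have hint : Integrable (Function.uncurry fun (x : Plane) (s : ℝ) =>
      ‖gradient ψ (x + (s / 2) • (y - x))‖ ^ 2)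
      ((volume.restrict E.carrier).prod (volume.restrict (Set.Ioc (0 : ℝ) 1))) := by
    rw [Measure.prod_restrict]
    refine (Continuous.continuousOn ?_ |>.integrableOn_compact
      (E.isCompact_carrier.prod isCompact_Icc)).mono_set
      (Set.prod_mono subset_rfl Set.Ioc_subset_Icc_self)
    simp only [Function.uncurry_def]; fun_prop
  calc _ ≤ ∫ x in E.carrier, E.sz ^ 2 / 4 *
        ∫ s in Set.Ioc (0 : ℝ) 1, ‖gradient ψ (x + (s / 2) • (y - x))‖ ^ 2 :=
        setIntegral_mono_on ((Continuous.continuousOn (by fun_prop)).integrableOn_compact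
          E.isCompact_carrier) (hint.integral_prod_left.const_mul _)
          E.isClosed_carrier.measurableSet fun x hx => sq_sub_midpoint_le hψ hx hy
    _ = E.sz ^ 2 / 4 * ∫ s in Set.Ioc (0 : ℝ) 1,
        ∫ x in E.carrier, ‖gradient ψ (x + (s / 2) • (y - x))‖ ^ 2 := by
        rw [integral_const_mul, integral_integral_swap hint]
    _ ≤ E.sz ^ 2 / 4 * ∫ _s in Set.Ioc (0 : ℝ) 1,
        4 * ∫ x in E.carrier, ‖gradient ψ x‖ ^ 2 := by
        gcongr ?_ * ?_
        refine setIntegral_mono_on hint.integral_prod_right (integrableOn_const (by simp))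
          measurableSet_Ioc fun s hs => ?_
        exact E.integral_homothety_le (h := fun x => ‖gradient ψ x‖ ^ 2) (by fun_prop)
          (fun _ => by positivity) hy (by linarith [hs.1]) (by linarith [hs.2])
    _ = _ := by rw [setIntegral_const]; simp; ring

/-- The values at x and y are both compared with the value at the midpoint. The two contributions
are exchanged by swapping variables, so each is bounded by the one-sided estimate. -/
theorem integral_integral_sq_sub_le (hψ : ContDiff ℝ 1 ψ) :
    ∫ y in E.carrier, ∫ x in E.carrier, (ψ x - ψ y) ^ 2 ≤
      4 * (volume.real E.carrier * (E.sz ^ 2 * ∫ x in E.carrier, ‖gradient ψ x‖ ^ 2)) := by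
  have hψc := hψ.continuous
  have hfin := E.isFiniteMeasure_restrict
  set μ := (volume : Measure Plane).restrict E.carrier with hμ
  have hint : ∀ F : Plane × Plane → ℝ, Continuous F →
      Integrable (Function.uncurry fun y x => F (y, x)) (μ.prod μ) := fun F hF => by
    rw [hμ, Measure.prod_restrict]
    exact (hF.continuousOn.integrableOn_compact (E.isCompact_carrier.prod E.isCompact_carrier))
  set A := E.sz ^ 2 * ∫ x in E.carrier, ‖gradient ψ x‖ ^ 2 with hA
  let M : Plane → Plane → ℝ := fun y x => (ψ x - ψ (x + (1 / 2 : ℝ) • (y - x))) ^ 2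
  have hM := hint (fun p => M p.1 p.2) (by simp only [M]; fun_prop)
  have hM' := hint (fun p => M p.2 p.1) (by simp only [M]; fun_prop)
  have h1 : ∫ y, ∫ x, M y x ∂μ ∂μ ≤ volume.real E.carrier * A := by
    have : ∫ y, ∫ x, M y x ∂μ ∂μ ≤ ∫ _y, A ∂μ :=
      setIntegral_mono_on hM.integral_prod_left (integrable_const _)
        E.isClosed_carrier.measurableSet fun y hy => integral_sq_sub_midpoint_le hψ hy
    rwa [setIntegral_const, smul_eq_mul] at this
  have h2 : ∫ y, ∫ x, M x y ∂μ ∂μ ≤ volume.real E.carrier * A := by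
    rw [integral_integral_swap hM']; exact h1
  have hpt : ∀ y x, (ψ x - ψ y) ^ 2 ≤ 2 * M y x + 2 * M x y := fun y x => by
    have e : x + (1 / 2 : ℝ) • (y - x) = y + (1 / 2 : ℝ) • (x - y) := by module
    simp only [M, e]
    set c := ψ (y + (1 / 2 : ℝ) • (x - y))
    nlinarith [sq_nonneg ((ψ x - c) + (ψ y - c))]
  have hD := hint (fun p => (ψ p.2 - ψ p.1) ^ 2) (by fun_prop)
  have hS : Integrable (Function.uncurry fun y x => 2 * M y x + 2 * M x y) (μ.prod μ) :=
    (hM.const_mul 2).add (hM'.const_mul 2)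
  have h3 : ∫ y, ∫ x, (ψ x - ψ y) ^ 2 ∂μ ∂μ ≤ ∫ y, ∫ x, (2 * M y x + 2 * M x y) ∂μ ∂μ := by
    rw [integral_integral hD, integral_integral hS]
    exact integral_mono hD hS fun p => hpt p.1 p.2
  have h4 : ∫ y, ∫ x, (2 * M y x + 2 * M x y) ∂μ ∂μ =
      2 * (∫ y, ∫ x, M y x ∂μ ∂μ) + 2 * ∫ y, ∫ x, M x y ∂μ ∂μ := by
    have hMc : Integrable (fun p : Plane × Plane => 2 * M p.1 p.2) (μ.prod μ) := hM.const_mul 2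
    have hMc' : Integrable (fun p : Plane × Plane => 2 * M p.2 p.1) (μ.prod μ) := hM'.const_mul 2
    rw [integral_integral hS, integral_integral hM, integral_integral hM', ← integral_const_mul,
      ← integral_const_mul, integral_add hMc hMc']
  linarith

/-- The mean of `f` over the triangle. -/
def mean (E : Tri) (f : Plane → ℝ) : ℝ := (∫ x in E.carrier, f x) / volume.real E.carrier

theorem integral_sub_mean_sq_le_const (hE : E.Nondeg) {f : Plane → ℝ}
    (hf : MemLp f 2 (volume.restrict E.carrier)) (c : ℝ) :
    ∫ x in E.carrier, (f x - E.mean f) ^ 2 ≤ ∫ x in E.carrier, (f x - c) ^ 2 := by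
  have hfin := E.isFiniteMeasure_restrict
  have hv := Tri.volume_real_pos hE
  have h1 : Integrable f (volume.restrict E.carrier) := hf.integrable (by norm_num)
  have h2 : Integrable (fun x => f x ^ 2) (volume.restrict E.carrier) := hf.integrable_sq
  have key : ∀ b : ℝ, ∫ x in E.carrier, (f x - b) ^ 2 =
      (∫ x in E.carrier, f x ^ 2) - 2 * b * (∫ x in E.carrier, f x) +
        volume.real E.carrier * b ^ 2 := fun b => by
    have e : ∀ x, (f x - b) ^ 2 = f x ^ 2 - 2 * b * f x + b ^ 2 := fun x => by ring
    have h3 : Integrable (fun x => f x ^ 2 - 2 * b * f x) (volume.restrict E.carrier) :=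
      h2.sub (h1.const_mul _)
    simp only [e]
    rw [integral_add h3 (integrable_const _), integral_sub h2 (h1.const_mul _),
      integral_const_mul, setIntegral_const, smul_eq_mul]
  rw [key, key, mean]
  set I := ∫ x in E.carrier, f x
  set V := volume.real E.carrier
  have : 0 ≤ V * (c - I / V) ^ 2 := by positivity
  have e : V * (c - I / V) ^ 2 = V * c ^ 2 - 2 * c * I + V * (I / V) ^ 2 := by field_simp; ring
  have e2 : V * (I / V) ^ 2 = I / V * I := by field_simp
  nlinarith

/-- For each y the integral of (ψ - ψ(y))² is at least that of (ψ - mean)², since the mean is the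
best constant; now integrate over y. -/
theorem poincare_smooth (hE : E.Nondeg) (hψ : ContDiff ℝ 1 ψ) :
    ∫ x in E.carrier, (ψ x - E.mean ψ) ^ 2 ≤
      4 * E.sz ^ 2 * ∫ x in E.carrier, ‖gradient ψ x‖ ^ 2 := by
  have hψc := hψ.continuous
  have hfin := E.isFiniteMeasure_restrict
  have hv := Tri.volume_real_pos hE
  have hmem : MemLp ψ 2 (volume.restrict E.carrier) := by
    obtain ⟨C, hC⟩ := E.isCompact_carrier.exists_bound_of_continuousOn hψc.continuousOn
    exact MemLp.of_bound hψc.aestronglyMeasurable C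
      (ae_restrict_of_forall_mem E.isClosed_carrier.measurableSet hC)
  have h := integral_integral_sq_sub_le (E := E) hψ
  have h2 : volume.real E.carrier * ∫ x in E.carrier, (ψ x - E.mean ψ) ^ 2 ≤
      ∫ y in E.carrier, ∫ x in E.carrier, (ψ x - ψ y) ^ 2 := by
    rw [← smul_eq_mul, ← setIntegral_const]
    refine setIntegral_mono_on (integrable_const _) ?_ E.isClosed_carrier.measurableSet
      fun y _ => integral_sub_mean_sq_le_const hE hmem _
    exact (continuous_parametric_integral_of_continuous (f := fun y x => (ψ x - ψ y) ^ 2)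
      (by simp only [Function.uncurry_def]; fun_prop)
      E.isCompact_carrier).continuousOn.integrableOn_compact E.isCompact_carrier
  refine le_of_mul_le_mul_left ?_ hv
  linarith

end Tri

end

end VEM

/-! ### Trace and Poincaré inequalities for limits of smooth functions. -/

namespace VEM

noncomputable section

theorem sq_integral_le {α : Type*} {m : MeasurableSpace α} {μ : Measure α} [IsFiniteMeasure μ]
    {f : α → ℝ} (hf : MemLp f 2 μ) : (∫ x, f x ∂μ) ^ 2 ≤ μ.real Set.univ * ∫ x, f x ^ 2 ∂μ := by
  have h := abs_integral_mul_le hf (memLp_const (1 : ℝ))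
  simp only [mul_one, norm_one, one_pow, integral_const, smul_eq_mul, Real.norm_eq_abs,
    sq_abs] at h
  have h0 : 0 ≤ ∫ x, f x ^ 2 ∂μ := integral_nonneg fun _ => sq_nonneg _
  rw [← Real.sqrt_mul h0] at h
  have h1 : 0 ≤ (∫ x, f x ^ 2 ∂μ) * μ.real Set.univ := mul_nonneg h0 measureReal_nonneg
  rw [← sq_abs, mul_comm, ← Real.sq_sqrt h1]
  gcongr

theorem tendsto_integral_norm_of_sq {α F : Type*} [NormedAddCommGroup F] {m : MeasurableSpace α}
    {μ : Measure α} [IsFiniteMeasure μ] {f : ℕ → α → F} (hf : ∀ n, MemLp (f n) 2 μ)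
    (h : Tendsto (fun n => ∫ x, ‖f n x‖ ^ 2 ∂μ) atTop (𝓝 0)) :
    Tendsto (fun n => ∫ x, ‖f n x‖ ∂μ) atTop (𝓝 0) := by
  have h1 : Tendsto (fun n => Real.sqrt (μ.real Set.univ * ∫ x, ‖f n x‖ ^ 2 ∂μ)) atTop (𝓝 0) := by
    have := (Real.continuous_sqrt.tendsto _).comp (h.const_mul (μ.real Set.univ))
    rw [mul_zero, Real.sqrt_zero] at this
    exact this
  refine squeeze_zero (fun n => integral_nonneg fun x => norm_nonneg _) (fun n => ?_) h1
  exact Real.le_sqrt_of_sq_le (sq_integral_le (hf n).norm)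

/-- `w` and `G` are the limits in `L²(E)` of `C¹` functions and their gradients. -/
structure Approximates (E : Tri) (ψ : ℕ → Plane → ℝ) (w : Plane → ℝ) (G : Plane → Plane) :
    Prop where
  smooth : ∀ n, ContDiff ℝ 1 (ψ n)
  memLp : MemLp G 2 (volume.restrict E.carrier)
  tendsto : Tendsto (fun n => ∫ x in E.carrier, ‖w x - ψ n x‖ ^ 2) atTop (𝓝 0)
  tendsto_gradient : Tendsto (fun n => ∫ x in E.carrier, ‖G x - gradient (ψ n) x‖ ^ 2) atTop (𝓝 0)

namespace Tri

variable {E : Tri} {w : Plane → ℝ} {G : Plane → Plane} {ψ : ℕ → Plane → ℝ}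

theorem memLp_of_continuousOn {F : Type*} [NormedAddCommGroup F] {f : Plane → F}
    (hf : ContinuousOn f E.carrier) : MemLp f 2 (volume.restrict E.carrier) := by
  have := E.isFiniteMeasure_restrict
  obtain ⟨C, hC⟩ := E.isCompact_carrier.exists_bound_of_continuousOn hf
  exact MemLp.of_bound (hf.aestronglyMeasurable_of_isCompact E.isCompact_carrier
    E.isClosed_carrier.measurableSet) C
    (ae_restrict_of_forall_mem E.isClosed_carrier.measurableSet hC)

theorem _root_.VEM.Approximates.sub_const (h : Approximates E ψ w G) (a : ℝ) :
    Approximates E (fun n x => ψ n x - a) (fun x => w x - a) G where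
  smooth n := (h.smooth n).sub contDiff_const
  memLp := h.memLp
  tendsto := by simpa using h.tendsto
  tendsto_gradient := by
    have e : ∀ n x, gradient (fun x => ψ n x - a) x = gradient (ψ n) x := fun n x => by
      rw [gradient, fderiv_sub_const, gradient]
    simpa only [e] using h.tendsto_gradient

/-- For r ≥ 1/2 the polar weight r is at least 1/2, so it may be inserted at the cost of a factor 2.
-/
theorem integral_Icc_cone_le (hE : E.Nondeg) {f : Plane → ℝ} (hf : Continuous f)
    (h0 : ∀ x, 0 ≤ f x) {b : ℝ} (hb : 1 / 2 ≤ b) (hb1 : b ≤ 1) :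
    ∫ r in b..1, |E.det| * ∫ τ in (0 : ℝ)..1, f (E.cone r τ) ≤ 2 * ∫ x in E.carrier, f x := by
  rw [integral_cone hE (hf.continuousOn.integrableOn_compact E.isCompact_carrier), mul_left_comm,
    ← intervalIntegral.integral_const_mul, ← intervalIntegral.integral_const_mul]
  have hc := E.continuous_cone
  have hI : Continuous fun r => ∫ τ in (0 : ℝ)..1, f (E.cone r τ) :=
    intervalIntegral.continuous_parametric_intervalIntegral_of_continuous'
      (f := fun r τ => f (E.cone r τ)) (by simp only [Function.uncurry_def]; fun_prop) 0 1
  have hI0 : ∀ r, 0 ≤ ∫ τ in (0 : ℝ)..1, f (E.cone r τ) := fun r =>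
    intervalIntegral.integral_nonneg zero_le_one fun _ _ => h0 _
  refine (intervalIntegral.integral_mono_on hb1 (Continuous.intervalIntegrable (by fun_prop) _ _)
    (g := fun r => |E.det| * (2 * (r * ∫ τ in (0 : ℝ)..1, f (E.cone r τ))))
    (Continuous.intervalIntegrable (by fun_prop) _ _) fun r hr => ?_).trans ?_
  · gcongr
    have := hI0 r
    nlinarith [hr.1]
  · refine (intervalIntegral.integral_mono_interval (c := 0) (d := 1) (by linarith) hb1 le_rfl ?_
      (Continuous.intervalIntegrable (by fun_prop) _ _)).trans_eq ?_
    · refine ae_restrict_of_forall_mem measurableSet_Ioc fun r hr => ?_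
      have := hI0 r
      have := hr.1
      simp only [Pi.zero_apply]; positivity
    · simp only [intervalIntegral.integral_const_mul]

theorem integral_combo_le (h : Approximates E ψ w G) (hw : Continuous w) {S : ℝ} (hS : 0 ≤ S)
    (n : ℕ) : ∫ x in E.carrier, (2 * |ψ n x| + S * ‖gradient (ψ n) x‖) ≤
      (∫ x in E.carrier, (2 * |w x| + S * ‖G x‖)) + 2 * (∫ x in E.carrier, ‖w x - ψ n x‖) +
        S * ∫ x in E.carrier, ‖G x - gradient (ψ n) x‖ := by
  have := E.isFiniteMeasure_restrict
  have hψ := (h.smooth n).continuous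
  have hg := continuous_gradient (h.smooth n)
  have i1 : IntegrableOn (fun x => 2 * |ψ n x| + S * ‖gradient (ψ n) x‖) E.carrier :=
    (Continuous.continuousOn (by fun_prop)).integrableOn_compact E.isCompact_carrier
  have i2 : IntegrableOn (fun x => 2 * |w x|) E.carrier :=
    (Continuous.continuousOn (by fun_prop)).integrableOn_compact E.isCompact_carrier
  have i3 : IntegrableOn (fun x => ‖w x - ψ n x‖) E.carrier :=
    (Continuous.continuousOn (by fun_prop)).integrableOn_compact E.isCompact_carrier
  have i4 : IntegrableOn (fun x => ‖G x‖) E.carrier := (h.memLp.integrable (by norm_num)).norm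
  have i5 : IntegrableOn (fun x => ‖G x - gradient (ψ n) x‖) E.carrier :=
    ((h.memLp.sub (memLp_of_continuousOn hg.continuousOn)).integrable (by norm_num)).norm
  have i6 : IntegrableOn (fun x => 2 * |w x| + S * ‖G x‖) E.carrier := i2.add (i4.const_mul S)
  have i7 : IntegrableOn (fun x => 2 * |w x| + S * ‖G x‖ + 2 * ‖w x - ψ n x‖) E.carrier :=
    i6.add (i3.const_mul 2)
  rw [← integral_const_mul, ← integral_const_mul, ← integral_add i6 (i3.const_mul 2),
    ← integral_add i7 (i5.const_mul S)]
  refine integral_mono i1 (i7.add (i5.const_mul S)) fun x => ?_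
  have a1 : |ψ n x| ≤ |w x| + ‖w x - ψ n x‖ := by
    rw [Real.norm_eq_abs, abs_sub_comm]
    have := abs_add_le (w x) (ψ n x - w x)
    rwa [add_sub_cancel] at this
  have a2 : ‖gradient (ψ n) x‖ ≤ ‖G x‖ + ‖G x - gradient (ψ n) x‖ := by
    have := norm_add_le (G x) (gradient (ψ n) x - G x)
    rwa [add_sub_cancel, norm_sub_rev] at this
  have a3 := mul_le_mul_of_nonneg_left a2 hS
  beta_reduce
  linarith

/-- The trace inequality in `L¹`, for limits of `C¹` functions. -/
theorem abs_integral_cone_le (hE : E.Nondeg) (h : Approximates E ψ w G) (hw : Continuous w) {S : ℝ}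
    (hS : ∀ x ∈ E.carrier, dist x (E.vert 1) ≤ S) :
    |E.det| * |∫ τ in (0 : ℝ)..1, w (E.cone 1 τ)| ≤
      4 * ∫ x in E.carrier, (2 * |w x| + S * ‖G x‖) := by
  have hS0 : 0 ≤ S := dist_nonneg.trans (hS _ (E.vert_mem 0))
  have := E.isFiniteMeasure_restrict
  have hc := E.continuous_cone
  have hc1 : ∀ r, Continuous fun τ => E.cone r τ := fun r =>
    hc.comp (Continuous.prodMk continuous_const continuous_id)
  set Z := ∫ x in E.carrier, (2 * |w x| + S * ‖G x‖) with hZ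
  set H : ℝ → ℝ := fun r => |E.det| * |∫ τ in (0 : ℝ)..1, w (E.cone r τ)| with hH
  have hHc : Continuous H := by
    have : Continuous fun r => ∫ τ in (0 : ℝ)..1, w (E.cone r τ) :=
      intervalIntegral.continuous_parametric_intervalIntegral_of_continuous'
        (f := fun r τ => w (E.cone r τ)) (by simp only [Function.uncurry_def]; fun_prop) 0 1
    fun_prop
  set a : ℕ → ℝ := fun n => ∫ x in E.carrier, ‖w x - ψ n x‖ with ha
  set b : ℕ → ℝ := fun n => ∫ x in E.carrier, ‖G x - gradient (ψ n) x‖ with hb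
  have ha0 : Tendsto a atTop (𝓝 0) := tendsto_integral_norm_of_sq
    (fun n => memLp_of_continuousOn (hw.sub (h.smooth n).continuous).continuousOn) h.tendsto
  have hb0 : Tendsto b atTop (𝓝 0) := tendsto_integral_norm_of_sq
    (fun n => h.memLp.sub (memLp_of_continuousOn
      (continuous_gradient (h.smooth n)).continuousOn)) h.tendsto_gradient
  -- The smooth functions converge only in L², which says nothing on the side itself. By continuity
  -- of `w` a violated inequality would persist, with a margin, on all parallels with r close to 1;
  -- averaging over these parallels brings in area integrals, which do converge.
  by_contra hcon
  push Not at hcon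
  obtain ⟨m, hm, hmH⟩ := exists_between hcon
  obtain ⟨δ, hδ, hball⟩ := Metric.eventually_nhds_iff.1 (hHc.continuousAt.eventually_const_lt hmH)
  set d := min (δ / 2) (1 / 2) with hd
  have hd0 : 0 < d := lt_min (by linarith) (by norm_num)
  have hd1 : d ≤ 1 / 2 := min_le_right _ _
  have key : ∀ n, d * m ≤ 2 * a n + d * (4 * (Z + 2 * a n + S * b n)) := fun n => by
    have hψ := (h.smooth n).continuous
    have hp : ∀ r ∈ Set.Icc (1 - d) 1, m ≤
        (|E.det| * ∫ τ in (0 : ℝ)..1, ‖w (E.cone r τ) - ψ n (E.cone r τ)‖) +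
          4 * (Z + 2 * a n + S * b n) := fun r hr => by
      have h1 : m < H r := hball (by
        rw [Real.dist_eq, abs_lt]
        have : d ≤ δ / 2 := min_le_left _ _
        constructor <;> linarith [hr.1, hr.2])
      have h2 := integral_abs_cone_le hE (h.smooth n) hS (r := r) (by linarith [hr.1]) hr.2
      have h3 := integral_combo_le h hw hS0 n
      have h4 : |∫ τ in (0 : ℝ)..1, w (E.cone r τ)| ≤
          (∫ τ in (0 : ℝ)..1, ‖w (E.cone r τ) - ψ n (E.cone r τ)‖) +
            ∫ τ in (0 : ℝ)..1, |ψ n (E.cone r τ)| := by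
        have := hc1 r
        rw [← intervalIntegral.integral_add (Continuous.intervalIntegrable (by fun_prop) _ _)
          (Continuous.intervalIntegrable (by fun_prop) _ _)]
        refine (intervalIntegral.abs_integral_le_integral_abs zero_le_one).trans ?_
        refine intervalIntegral.integral_mono_on zero_le_one
          (Continuous.intervalIntegrable (by fun_prop) _ _)
          (Continuous.intervalIntegrable (by fun_prop) _ _) fun τ _ => ?_
        have := abs_add_le (w (E.cone r τ) - ψ n (E.cone r τ)) (ψ n (E.cone r τ))
        rwa [sub_add_cancel] at this
      have h5 := mul_le_mul_of_nonneg_left h4 (abs_nonneg E.det)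
      rw [mul_add] at h5
      simp only [hH] at h1
      linarith
    have hI : Continuous fun r =>
        ∫ τ in (0 : ℝ)..1, ‖w (E.cone r τ) - ψ n (E.cone r τ)‖ :=
      intervalIntegral.continuous_parametric_intervalIntegral_of_continuous'
        (f := fun r τ => ‖w (E.cone r τ) - ψ n (E.cone r τ)‖)
        (by simp only [Function.uncurry_def]; fun_prop) 0 1
    have h6 := intervalIntegral.integral_mono_on (by linarith : 1 - d ≤ 1)
      (f := fun _ => m) (μ := volume) intervalIntegrable_const
      (Continuous.intervalIntegrable (by fun_prop) _ _) hp
    rw [intervalIntegral.integral_add (Continuous.intervalIntegrable (by fun_prop) _ _)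
      intervalIntegrable_const,
      intervalIntegral.integral_const, intervalIntegral.integral_const, smul_eq_mul, smul_eq_mul,
      sub_sub_cancel] at h6
    have h7 := integral_Icc_cone_le hE (f := fun x => ‖w x - ψ n x‖) (by fun_prop)
      (fun _ => norm_nonneg _) (b := 1 - d) (by linarith) (by linarith)
    linarith
  have hlim : Tendsto (fun n => 2 * a n + d * (4 * (Z + 2 * a n + S * b n))) atTop
      (𝓝 (2 * 0 + d * (4 * (Z + 2 * 0 + S * 0)))) :=
    (ha0.const_mul 2).add ((((ha0.const_mul 2).const_add Z).add (hb0.const_mul S)).const_mul 4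
      |>.const_mul d)
  have := ge_of_tendsto' hlim key
  simp only [mul_zero, add_zero, zero_add] at this
  have := le_of_mul_le_mul_left this hd0
  linarith

theorem abs_sideAvg_le (hE : E.Nondeg) (h : Approximates E ψ w G) (hw : Continuous w) (k : Fin 3) :
    |E.det| * |E.sideAvg k w| ≤ 4 * ∫ x in E.carrier, (2 * |w x| + E.sz * ‖G x‖) := by
  have h' : Approximates (E.rot (k + 2)) ψ w G := by
    constructor
    · exact h.smooth
    all_goals rw [rot_carrier]
    exacts [h.memLp, h.tendsto, h.tendsto_gradient]
  have h1 := abs_integral_cone_le (rot_nondeg hE _) h' hw (S := E.sz) (fun x hx => by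
    rw [rot_carrier] at hx; exact E.dist_le_sz hx (E.rot_vert_mem _ 1))
  rwa [rot_det, rot_carrier, ← sideAvg_eq_cone] at h1

/-- The Poincaré inequality for limits of `C¹` functions. -/
theorem poincare (hE : E.Nondeg) (h : Approximates E ψ w G) (hw : Continuous w) :
    ∫ x in E.carrier, (w x - E.mean w) ^ 2 ≤ 16 * E.sz ^ 2 * ∫ x in E.carrier, ‖G x‖ ^ 2 := by
  have hfin := E.isFiniteMeasure_restrict
  have hwm : MemLp w 2 (volume.restrict E.carrier) := memLp_of_continuousOn hw.continuousOn
  set Q := ∫ x in E.carrier, ‖G x‖ ^ 2 with hQ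
  have iG := h.memLp.integrable_norm_pow (p := 2) (by norm_num)
  have key : ∀ n, ∫ x in E.carrier, (w x - E.mean w) ^ 2 ≤
      2 * (∫ x in E.carrier, ‖w x - ψ n x‖ ^ 2) + 2 * (4 * E.sz ^ 2 *
        (2 * Q + 2 * ∫ x in E.carrier, ‖G x - gradient (ψ n) x‖ ^ 2)) := fun n => by
    have hψ := (h.smooth n).continuous
    have hg := continuous_gradient (h.smooth n)
    have i1 : IntegrableOn (fun x => ‖w x - ψ n x‖ ^ 2) E.carrier :=
      (Continuous.continuousOn (by fun_prop)).integrableOn_compact E.isCompact_carrier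
    have i2 : IntegrableOn (fun x => (ψ n x - E.mean (ψ n)) ^ 2) E.carrier :=
      (Continuous.continuousOn (by fun_prop)).integrableOn_compact E.isCompact_carrier
    have i3 : IntegrableOn (fun x => (w x - E.mean (ψ n)) ^ 2) E.carrier :=
      (Continuous.continuousOn (by fun_prop)).integrableOn_compact E.isCompact_carrier
    have i4 : IntegrableOn (fun x => ‖gradient (ψ n) x‖ ^ 2) E.carrier :=
      (Continuous.continuousOn (by fun_prop)).integrableOn_compact E.isCompact_carrier
    have i5 := (h.memLp.sub (memLp_of_continuousOn hg.continuousOn)).integrable_norm_pow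
      (p := 2) (by norm_num)
    simp only [Pi.sub_apply] at i5
    have h1 := integral_sub_mean_sq_le_const hE hwm (E.mean (ψ n))
    have h2 : ∫ x in E.carrier, (w x - E.mean (ψ n)) ^ 2 ≤
        2 * (∫ x in E.carrier, ‖w x - ψ n x‖ ^ 2) +
          2 * ∫ x in E.carrier, (ψ n x - E.mean (ψ n)) ^ 2 := by
      rw [← integral_const_mul, ← integral_const_mul,
        ← integral_add (i1.const_mul 2) (i2.const_mul 2)]
      refine integral_mono i3 ((i1.const_mul 2).add (i2.const_mul 2)) fun x => ?_
      simp only [Real.norm_eq_abs, sq_abs]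
      nlinarith [sq_nonneg ((w x - ψ n x) - (ψ n x - E.mean (ψ n)))]
    have h3 := poincare_smooth hE (h.smooth n)
    have h4 : ∫ x in E.carrier, ‖gradient (ψ n) x‖ ^ 2 ≤
        2 * Q + 2 * ∫ x in E.carrier, ‖G x - gradient (ψ n) x‖ ^ 2 := by
      rw [hQ, ← integral_const_mul, ← integral_const_mul,
        ← integral_add (iG.const_mul 2) (i5.const_mul 2)]
      refine integral_mono i4 ((iG.const_mul 2).add (i5.const_mul 2)) fun x => ?_
      have a2 : ‖gradient (ψ n) x‖ ≤ ‖G x‖ + ‖G x - gradient (ψ n) x‖ := by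
        have := norm_add_le (G x) (gradient (ψ n) x - G x)
        rwa [add_sub_cancel, norm_sub_rev] at this
      have a3 := norm_nonneg (gradient (ψ n) x)
      beta_reduce
      nlinarith [sq_nonneg (‖G x‖ - ‖G x - gradient (ψ n) x‖)]
    have h5 := mul_le_mul_of_nonneg_left h4 (by positivity : 0 ≤ 4 * E.sz ^ 2)
    linarith
  have hlim := (h.tendsto.const_mul 2).add
    ((((h.tendsto_gradient.const_mul 2).const_add (2 * Q)).const_mul (4 * E.sz ^ 2)).const_mul 2)
  have := ge_of_tendsto' hlim key
  linarith

theorem sideAvg_sub_const (hw : Continuous w) (k : Fin 3) (a : ℝ) :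
    E.sideAvg k (fun x => w x - a) = E.sideAvg k w - a := by
  unfold sideAvg
  rw [intervalIntegral.integral_sub (E.intervalIntegrable_side hw.continuousOn _ _) (by simp)]
  simp

/-- The mean over the boundary is a weighted average of the three side means; if it is zero while
all of them are within M of a, then |a| ≤ M. -/
theorem abs_mean_le (hE : E.Nondeg) (h0 : E.bdryIntegral w = 0) {M : ℝ}
    {a : ℝ} (hM : ∀ k, |E.sideAvg k w - a| ≤ M) : |a| ≤ M := by
  rw [bdryIntegral_eq] at h0
  have hP : 0 < ∑ k : Fin 3, dist (E.vert (k + 1)) (E.vert (k + 2)) :=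
    Finset.sum_pos (fun i _ => dist_pos.2 fun h => by
      have := Tri.vert_injective hE h
      fin_cases i <;> simp at this) Finset.univ_nonempty
  have e : (∑ k : Fin 3, dist (E.vert (k + 1)) (E.vert (k + 2))) * a =
      -∑ k : Fin 3, dist (E.vert (k + 1)) (E.vert (k + 2)) * (E.sideAvg k w - a) := by
    simp only [mul_sub, Finset.sum_sub_distrib, h0, Finset.sum_mul]; ring
  refine le_of_mul_le_mul_left ?_ hP
  rw [← abs_of_pos hP, ← abs_mul, e, abs_neg, abs_of_pos hP, Finset.sum_mul]
  refine (Finset.abs_sum_le_sum_abs _ _).trans (Finset.sum_le_sum fun k _ => ?_)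
  rw [abs_mul, abs_of_nonneg dist_nonneg]
  exact mul_le_mul_of_nonneg_left (hM k) dist_nonneg

/-- Split `w` into its deviation from the area mean and that mean. The first is bounded by the
Poincaré inequality; the second by the trace inequality for the deviation, because the boundary mean
of `w` is zero. -/
theorem integral_sq_le_aux (hE : E.Nondeg) (h : Approximates E ψ w G) (hw : Continuous w)
    (h0 : E.bdryIntegral w = 0) : ∫ x in E.carrier, w x ^ 2 ≤
      (32 + 4160 * refArea ^ 2) * E.sz ^ 2 * ∫ x in E.carrier, ‖G x‖ ^ 2 := by
  have hfin := E.isFiniteMeasure_restrict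
  set a := E.mean w with ha
  set Q := ∫ x in E.carrier, ‖G x‖ ^ 2 with hQ
  set V := volume.real E.carrier with hV
  have hQ0 : 0 ≤ Q := integral_nonneg fun _ => by positivity
  have hV0 : 0 < V := volume_real_pos hE
  have hs := E.sz_nonneg
  have hpo := poincare hE h hw
  have iwa : IntegrableOn (fun x => (w x - a) ^ 2) E.carrier :=
    (Continuous.continuousOn (by fun_prop)).integrableOn_compact E.isCompact_carrier
  have iG := h.memLp.integrable_norm_pow (p := 2) (by norm_num)
  have hma : MemLp (fun x => 2 * |w x - a|) 2 (volume.restrict E.carrier) :=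
    memLp_of_continuousOn (Continuous.continuousOn (by fun_prop))
  have hmb : MemLp (fun x => E.sz * ‖G x‖) 2 (volume.restrict E.carrier) :=
    h.memLp.norm.const_mul _
  have hm : MemLp (fun x => 2 * |w x - a| + E.sz * ‖G x‖) 2 (volume.restrict E.carrier) :=
    hma.add hmb
  -- The constants are 130 = 8·16 + 2, then 2080 = 4²·130 from the trace inequality; the final
  -- splitting doubles 16 and 2080.
  have h1 : (∫ x in E.carrier, (2 * |w x - a| + E.sz * ‖G x‖)) ^ 2 ≤
      V * (130 * E.sz ^ 2 * Q) := by
    refine (sq_integral_le hm).trans ?_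
    rw [measureReal_restrict_apply_univ]
    refine mul_le_mul_of_nonneg_left ?_ hV0.le
    have h2 : ∫ x in E.carrier, (2 * |w x - a| + E.sz * ‖G x‖) ^ 2 ≤
        8 * (∫ x in E.carrier, (w x - a) ^ 2) + 2 * E.sz ^ 2 * Q := by
      rw [hQ, ← integral_const_mul, ← integral_const_mul,
        ← integral_add (iwa.const_mul _) (iG.const_mul _)]
      refine integral_mono hm.integrable_sq ((iwa.const_mul _).add (iG.const_mul _)) fun x => ?_
      beta_reduce
      nlinarith [sq_nonneg (2 * |w x - a| - E.sz * ‖G x‖), sq_abs (w x - a)]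
    linarith
  have hdet : 0 < |E.det| := abs_pos.2 (det_ne_zero_iff.2 hE)
  have h3 : |a| ≤ 4 * Real.sqrt (V * (130 * E.sz ^ 2 * Q)) / |E.det| := by
    refine abs_mean_le hE h0 fun k => ?_
    rw [← sideAvg_sub_const hw, le_div_iff₀ hdet, mul_comm]
    refine (abs_sideAvg_le hE (h.sub_const a) (by fun_prop) k).trans ?_
    gcongr
    exact Real.le_sqrt_of_sq_le h1
  have h4 : a ^ 2 * E.det ^ 2 ≤ 2080 * V * E.sz ^ 2 * Q := by
    rw [le_div_iff₀ hdet] at h3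
    have h5 := pow_le_pow_left₀ (by positivity) h3 2
    rw [mul_pow, sq_abs, sq_abs, mul_pow, Real.sq_sqrt (by positivity)] at h5
    linarith
  have hVd : V = |E.det| * refArea := volume_carrier hE
  have h6 : V * a ^ 2 ≤ 2080 * refArea ^ 2 * (E.sz ^ 2 * Q) := by
    have : E.det ^ 2 * (V * a ^ 2) ≤ E.det ^ 2 * (2080 * refArea ^ 2 * (E.sz ^ 2 * Q)) := by
      have := mul_le_mul_of_nonneg_left h4 hV0.le
      have e : V ^ 2 = E.det ^ 2 * refArea ^ 2 := by rw [hVd, mul_pow, sq_abs]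
      calc _ = V * (a ^ 2 * E.det ^ 2) := by ring
        _ ≤ V * (2080 * V * E.sz ^ 2 * Q) := this
        _ = 2080 * V ^ 2 * (E.sz ^ 2 * Q) := by ring
        _ = _ := by rw [e]; ring
    exact le_of_mul_le_mul_left this (by rw [← sq_abs]; positivity)
  have h7 : ∫ x in E.carrier, w x ^ 2 ≤ 2 * (∫ x in E.carrier, (w x - a) ^ 2) + 2 * (V * a ^ 2) := by
    have e : V * a ^ 2 = ∫ _x in E.carrier, a ^ 2 := by rw [setIntegral_const, smul_eq_mul]
    have ic : Integrable (fun _ : Plane => a ^ 2) (volume.restrict E.carrier) := integrable_const _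
    rw [e, ← integral_const_mul, ← integral_const_mul,
      ← integral_add (iwa.const_mul _) (ic.const_mul _)]
    refine integral_mono ((hw.pow 2).continuousOn.integrableOn_compact E.isCompact_carrier)
      ((iwa.const_mul _).add (ic.const_mul _)) fun x => ?_
    beta_reduce
    nlinarith [sq_nonneg (w x - a - a)]
  linarith

/-- The Poincaré inequality for functions with vanishing mean over the boundary. -/
theorem integral_sq_le_of_bdryIntegral_eq_zero (hE : E.Nondeg) (h : Approximates E ψ w G)
    (hw : ContinuousOn w E.carrier) (h0 : E.bdryIntegral w = 0) : ∫ x in E.carrier, w x ^ 2 ≤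
      (32 + 4160 * refArea ^ 2) * E.sz ^ 2 * ∫ x in E.carrier, ‖G x‖ ^ 2 := by
  -- Tietze extension to a function continuous on the plane; only its values on the triangle enter.
  obtain ⟨g, hg⟩ := ContinuousMap.exists_restrict_eq E.isClosed_carrier
    ⟨E.carrier.domRestrict w, hw.domRestrict⟩
  have hgw : ∀ x ∈ E.carrier, g x = w x := fun x hx => DFunLike.congr_fun hg ⟨x, hx⟩
  have hms := E.isClosed_carrier.measurableSet
  rw [setIntegral_congr_fun (g := fun x => g x ^ 2) hms fun x hx => by
    simp only [hgw x hx]]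
  refine integral_sq_le_aux hE (ψ := ψ) (w := g) (G := G) ⟨h.smooth, h.memLp, ?_, h.tendsto_gradient⟩
    g.continuous ?_
  · convert h.tendsto using 2
    exact setIntegral_congr_fun hms fun x hx => by simp only [hgw x hx]
  · rw [← h0]
    unfold bdryIntegral
    refine Finset.sum_congr rfl fun i _ => ?_
    congr 1
    refine intervalIntegral.integral_congr fun t ht => hgw _ ?_
    rw [Set.uIcc_of_le zero_le_one] at ht
    exact E.lineMap_mem _ _ ht

end Tri

end

end VEM

namespace VEM

noncomputable section

/-! ### Integration over segments -/

theorem diam_segment (a b : Plane) : Metric.diam (segment ℝ a b) = dist a b := by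
  rw [← convexHull_pair, convexHull_diam, Metric.diam_pair]

theorem isCompact_segment (a b : Plane) : IsCompact (segment ℝ a b) := by
  rw [← convexHull_pair]; exact (Set.toFinite _).isCompact_convexHull ℝ

theorem measureReal_segment (a b : Plane) : (μH[1] : Measure Plane).real (segment ℝ a b) = dist a b := by
  rw [Measure.real, hausdorffMeasure_segment, edist_dist, ENNReal.toReal_ofReal dist_nonneg]

theorem isFiniteMeasure_restrict_segment (a b : Plane) :
    IsFiniteMeasure ((μH[1] : Measure Plane).restrict (segment ℝ a b)) :=
  ⟨by simp [hausdorffMeasure_segment, edist_lt_top]⟩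

theorem memLp_segment {f : Plane → ℝ} (hf : Continuous f) (a b : Plane) (p : ENNReal) :
    MemLp f p ((μH[1] : Measure Plane).restrict (segment ℝ a b)) := by
  have := isFiniteMeasure_restrict_segment a b
  obtain ⟨C, hC⟩ := (isCompact_segment a b).exists_bound_of_continuousOn hf.continuousOn
  exact MemLp.of_bound hf.aestronglyMeasurable C
    (ae_restrict_of_forall_mem (isCompact_segment a b).measurableSet hC)

/-- Arc length is an isometric parametrization, under which one-dimensional Hausdorff measure is
Lebesgue measure. -/
theorem integral_segment {a b : Plane} (hab : a ≠ b) (f : Plane → ℝ) :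
    ∫ x in segment ℝ a b, f x ∂μH[1] =
      dist a b * ∫ t in (0 : ℝ)..1, f (AffineMap.lineMap a b t) := by
  have hL : 0 < dist a b := dist_pos.2 hab
  set L := dist a b with hLd
  set u : Plane := L⁻¹ • (b - a) with hu
  have hun : ‖u‖ = 1 := by
    rw [hu, norm_smul, ← dist_eq_norm, dist_comm, ← hLd, norm_inv, Real.norm_eq_abs,
      abs_of_pos hL, inv_mul_cancel₀ hL.ne']
  let i : ℝ → Plane := fun s => a + s • u
  have hi : Isometry i := Isometry.of_dist_eq fun s t => by
    rw [dist_eq_norm, add_sub_add_left_eq_sub, ← sub_smul, norm_smul, hun, mul_one, dist_eq_norm]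
  have hiL : ∀ t : ℝ, i (L * t) = AffineMap.lineMap a b t := fun t => by
    simp only [i, hu, AffineMap.lineMap_apply_module', smul_smul]
    rw [mul_right_comm, mul_inv_cancel₀ hL.ne', one_mul, add_comm]
  have hpre : i ⁻¹' segment ℝ a b = Set.Icc 0 L := by
    ext s
    rw [Set.mem_preimage, segment_eq_image_lineMap]
    constructor
    · rintro ⟨t, ⟨ht0, ht1⟩, h⟩
      rw [← hiL] at h
      rw [← hi.injective h]
      exact ⟨by positivity, by nlinarith⟩
    · rintro ⟨h0, h1⟩
      refine ⟨s / L, ⟨by positivity, (div_le_one hL).2 h1⟩, ?_⟩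
      rw [← hiL, mul_div_cancel₀ _ hL.ne']
  have hran : segment ℝ a b ⊆ Set.range i := by
    rw [segment_eq_image_lineMap]
    rintro _ ⟨t, -, rfl⟩
    exact ⟨L * t, hiL t⟩
  have hmap := hi.map_hausdorffMeasure (d := 1) (Or.inl zero_le_one)
  rw [hausdorffMeasure_real] at hmap
  have h := hi.isClosedEmbedding.measurableEmbedding.setIntegral_map (μ := volume) f
    (segment ℝ a b)
  rw [hmap, Measure.restrict_restrict (isCompact_segment a b).measurableSet,
    Set.inter_eq_left.2 hran, hpre, integral_Icc_eq_integral_Ioc,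
    ← intervalIntegral.integral_of_le hL.le] at h
  have h2 := intervalIntegral.mul_integral_comp_mul_left (a := 0) (b := 1) (c := L)
    (f := fun s => f (i s))
  rw [mul_zero, mul_one] at h2
  rw [h, ← h2]
  simp only [hiL]

/-! ### The edges of an element -/

theorem mem_edges {T : Finset Tri} {E : Tri} {e : Set Plane} : e ∈ edges T E ↔
    ∃ p ∈ nodesOn T E, ∃ q ∈ nodesOn T E, p ≠ q ∧ segment ℝ p q ⊆ frontier E.carrier ∧
      (∀ z ∈ nodesOn T E, z ∉ openSegment ℝ p q) ∧ segment ℝ p q = e := by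
  classical
  simp only [edges, Finset.mem_image, Finset.mem_filter, Finset.mem_product, Prod.exists]
  constructor
  · rintro ⟨p, q, ⟨⟨hp, hq⟩, h1, h2, h3⟩, h4⟩
    exact ⟨p, hp, q, hq, h1, h2, h3, h4⟩
  · rintro ⟨p, hp, q, hq, h1, h2, h3, h4⟩
    exact ⟨p, q, ⟨⟨hp, hq⟩, h1, h2, h3⟩, h4⟩

namespace Tri

/-- The side opposite to the vertex `k`. -/
def side (E : Tri) (k : Fin 3) : Set Plane := segment ℝ (E.vert (k + 1)) (E.vert (k + 2))

variable {E : Tri}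

theorem fin_ne_add_one (k : Fin 3) : k ≠ k + 1 ∧ k ≠ k + 2 ∧ k + 1 ≠ k + 2 := by
  revert k; decide

theorem mem_side (hE : E.Nondeg) {k : Fin 3} {x : Plane} :
    x ∈ E.side k ↔ x ∈ E.carrier ∧ E.lam k x = 0 :=
  mem_segment_iff hE (fin_ne_add_one k).2.2 (fin_ne_add_one k).1 (fin_ne_add_one k).2.1

theorem side_subset_frontier (hE : E.Nondeg) (k : Fin 3) : E.side k ⊆ frontier E.carrier := by
  intro x hx
  rw [mem_side hE] at hx
  rw [frontier_eq]
  exact ⟨hx.1, fun h => ((mem_interior hE).1 h k).ne' hx.2⟩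

theorem eq_of_lam_side (hE : E.Nondeg) {k : Fin 3} {x y : Plane} (hx : E.lam k x = 0)
    (hy : E.lam k y = 0) (h : E.lam (k + 1) x = E.lam (k + 1) y) : x = y := by
  obtain ⟨h1, h2, h3⟩ := fin_ne_add_one k
  have sx := sum_lam_distinct hE x h1 h2.symm h3.symm
  have sy := sum_lam_distinct hE y h1 h2.symm h3.symm
  refine ext_lam hE fun m => ?_
  rcases eq_of_distinct h1 h2.symm h3.symm m with rfl | rfl | rfl
  · rw [hx, hy]
  · exact h
  · linarith

theorem mem_openSegment_of_lam (hE : E.Nondeg) {k : Fin 3} {p q x : Plane} (hp : E.lam k p = 0)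
    (hq : E.lam k q = 0) (hx : E.lam k x = 0) (h1 : E.lam (k + 1) p < E.lam (k + 1) x)
    (h2 : E.lam (k + 1) x < E.lam (k + 1) q) : x ∈ openSegment ℝ p q := by
  rw [openSegment_eq_image_lineMap]
  have hd : 0 < E.lam (k + 1) q - E.lam (k + 1) p := by linarith
  refine ⟨(E.lam (k + 1) x - E.lam (k + 1) p) / (E.lam (k + 1) q - E.lam (k + 1) p),
    ⟨div_pos (by linarith) hd, (div_lt_one hd).2 (by linarith)⟩, ?_⟩
  refine eq_of_lam_side hE (k := k) ?_ hx ?_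
  · rw [lam_lineMap, hp, hq]; ring
  · rw [lam_lineMap]; field_simp; ring

theorem lam_openSegment (E : Tri) {m : Fin 3} {p q x : Plane} (hx : x ∈ openSegment ℝ p q)
    (h : E.lam m p < E.lam m q) : E.lam m p < E.lam m x ∧ E.lam m x < E.lam m q := by
  rw [openSegment_eq_image_lineMap] at hx
  obtain ⟨t, ⟨h0, h1⟩, rfl⟩ := hx
  rw [lam_lineMap]
  constructor <;> nlinarith

/-- A coordinate that vanishes at the midpoint of the segment vanishes at both ends. -/
theorem exists_side (hE : E.Nondeg) {p q : Plane} (h : segment ℝ p q ⊆ frontier E.carrier) :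
    ∃ k, segment ℝ p q ⊆ E.side k := by
  have hsub : ∀ x ∈ segment ℝ p q, x ∈ E.carrier ∧ x ∉ interior E.carrier := fun x hx => by
    have := h hx
    rwa [frontier_eq] at this
  have hp := hsub p (left_mem_segment ℝ p q)
  have hq := hsub q (right_mem_segment ℝ p q)
  have hm := hsub (midpoint ℝ p q) (midpoint_mem_segment p q)
  obtain ⟨k, hk⟩ := exists_lam_eq_zero hE hm.1 hm.2
  rw [lam_midpoint] at hk
  have h1 := (mem_carrier hE).1 hp.1 k
  have h2 := (mem_carrier hE).1 hq.1 k
  exact ⟨k, (convex_segment _ _).segment_subset ((mem_side hE).2 ⟨hp.1, by linarith⟩)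
    ((mem_side hE).2 ⟨hq.1, by linarith⟩)⟩

theorem side_unique (hE : E.Nondeg) {p q : Plane} (hpq : p ≠ q) {k l : Fin 3}
    (hk : segment ℝ p q ⊆ E.side k) (hl : segment ℝ p q ⊆ E.side l) : k = l := by
  by_contra hne
  obtain ⟨m, hm1, hm2, hm⟩ := exists_third k l hne
  have hp := left_mem_segment ℝ p q
  have hq := right_mem_segment ℝ p q
  have a1 := ((mem_side hE).1 (hk hp)).2
  have a2 := ((mem_side hE).1 (hl hp)).2
  have b1 := ((mem_side hE).1 (hk hq)).2
  have b2 := ((mem_side hE).1 (hl hq)).2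
  have s1 := sum_lam_distinct hE p hne hm1 hm2
  have s2 := sum_lam_distinct hE q hne hm1 hm2
  refine hpq (ext_lam hE fun i => ?_)
  rcases hm i with rfl | rfl | rfl <;> linarith

end Tri

section Edges

variable {T : Finset Tri} {E : Tri}

-- Each edge is contained in exactly one side of the triangle.
open scoped Classical in
theorem sum_edges (hE : E.Nondeg) (F : Set Plane → ℝ) : ∑ e ∈ edges T E, F e =
    ∑ k, ∑ e ∈ edges T E with e ⊆ E.side k, F e := by
  simp only [Finset.sum_filter]
  rw [Finset.sum_comm]
  refine Finset.sum_congr rfl fun e he => ?_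
  obtain ⟨p, -, q, -, hpq, hf, -, rfl⟩ := mem_edges.1 he
  obtain ⟨k, hk⟩ := Tri.exists_side hE hf
  rw [Finset.sum_eq_single k (fun l _ hl => if_neg fun h => hl (Tri.side_unique hE hpq h hk))
    (fun h => absurd (Finset.mem_univ k) h), if_pos hk]

theorem vert_mem_nodesOn (hE : E.Nondeg) (hET : E ∈ T) (i : Fin 3) : E.vert i ∈ nodesOn T E := by
  classical
  rw [nodesOn, Finset.mem_filter, Tri.frontier_eq]
  exact ⟨vert_mem_nodes hET i, E.vert_mem i, Tri.vert_not_interior hE i⟩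

/-- Two edges on a side meet in nodes only. -/
theorem edge_eq_of_mem (hE : E.Nondeg) {k : Fin 3} {p q p' q' x : Plane}
    (hp : p ∈ nodesOn T E) (hq : q ∈ nodesOn T E) (hp' : p' ∈ nodesOn T E) (hq' : q' ∈ nodesOn T E)
    (hz : ∀ z ∈ nodesOn T E, z ∉ openSegment ℝ p q)
    (hz' : ∀ z ∈ nodesOn T E, z ∉ openSegment ℝ p' q')
    (hk : segment ℝ p q ⊆ E.side k) (hk' : segment ℝ p' q' ⊆ E.side k)
    (hpq : E.lam (k + 1) p < E.lam (k + 1) q) (hpq' : E.lam (k + 1) p' < E.lam (k + 1) q')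
    (hx : x ∈ openSegment ℝ p q) (hx' : x ∈ openSegment ℝ p' q') :
    segment ℝ p q = segment ℝ p' q' := by
  have z1 := ((Tri.mem_side hE).1 (hk (left_mem_segment ℝ p q))).2
  have z2 := ((Tri.mem_side hE).1 (hk (right_mem_segment ℝ p q))).2
  have z3 := ((Tri.mem_side hE).1 (hk' (left_mem_segment ℝ p' q'))).2
  have z4 := ((Tri.mem_side hE).1 (hk' (right_mem_segment ℝ p' q'))).2
  obtain ⟨a1, a2⟩ := E.lam_openSegment hx hpq
  obtain ⟨b1, b2⟩ := E.lam_openSegment hx' hpq'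
  have c1 : p = p' := by
    refine Tri.eq_of_lam_side hE z1 z3 (le_antisymm ?_ ?_) <;> by_contra! h
    · exact hz' p hp (Tri.mem_openSegment_of_lam hE z3 z4 z1 h (by linarith))
    · exact hz p' hp' (Tri.mem_openSegment_of_lam hE z1 z2 z3 h (by linarith))
  have c2 : q = q' := by
    refine Tri.eq_of_lam_side hE z2 z4 (le_antisymm ?_ ?_) <;> by_contra! h
    · exact hz q' hq' (Tri.mem_openSegment_of_lam hE z1 z2 z4 (by linarith) h)
    · exact hz' q hq (Tri.mem_openSegment_of_lam hE z3 z4 z2 (by linarith) h)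
  rw [c1, c2]

theorem mem_edges_side (hE : E.Nondeg) {k : Fin 3} {e : Set Plane} (he : e ∈ edges T E)
    (hk : e ⊆ E.side k) : ∃ p ∈ nodesOn T E, ∃ q ∈ nodesOn T E,
      (∀ z ∈ nodesOn T E, z ∉ openSegment ℝ p q) ∧ E.lam (k + 1) p < E.lam (k + 1) q ∧
        segment ℝ p q = e := by
  obtain ⟨p, hp, q, hq, hpq, -, hz, rfl⟩ := mem_edges.1 he
  have z1 := ((Tri.mem_side hE).1 (hk (left_mem_segment ℝ p q))).2
  have z2 := ((Tri.mem_side hE).1 (hk (right_mem_segment ℝ p q))).2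
  rcases lt_trichotomy (E.lam (k + 1) p) (E.lam (k + 1) q) with h | h | h
  · exact ⟨p, hp, q, hq, hz, h, rfl⟩
  · exact absurd (Tri.eq_of_lam_side hE z1 z2 h) hpq
  · exact ⟨q, hq, p, hp, by rwa [openSegment_symm], h, segment_symm _ _ _⟩

/-- The nearest nodes on either side of x along the side span the edge containing it; the vertices
guarantee that such nodes exist. -/
theorem exists_edge (hE : E.Nondeg) (hET : E ∈ T) {k : Fin 3} {x : Plane} (hx : x ∈ E.side k)
    (hxn : x ∉ nodesOn T E) : ∃ e ∈ edges T E, e ⊆ E.side k ∧ x ∈ e := by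
  classical
  obtain ⟨h1, h2, h3⟩ := Tri.fin_ne_add_one k
  obtain ⟨hxE, hx0⟩ := (Tri.mem_side hE).1 hx
  have hxv : ∀ i, x ≠ E.vert i := fun i h => hxn (h ▸ vert_mem_nodesOn hE hET i)
  have hpos : 0 < E.lam (k + 1) x := lt_of_le_of_ne ((Tri.mem_carrier hE).1 hxE _) fun h =>
    hxv (k + 2) (Tri.eq_of_lam_side hE hx0 (Tri.lam_vert_ne hE h2)
      (by rw [← h, Tri.lam_vert_ne hE h3]))
  have hlt : E.lam (k + 1) x < 1 := lt_of_le_of_ne (Tri.lam_le_one hE hxE _) fun h =>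
    hxv (k + 1) (Tri.eq_vert_of_lam_eq_one hE hxE h)
  let N := (nodesOn T E).filter fun z => z ∈ E.side k
  have hN : ∀ z, z ∈ N ↔ z ∈ nodesOn T E ∧ z ∈ E.side k := fun z => Finset.mem_filter
  obtain ⟨p, hp, hpmax⟩ := (N.filter fun z => E.lam (k + 1) z < E.lam (k + 1) x).exists_max_image
    (E.lam (k + 1)) ⟨E.vert (k + 2), by
      rw [Finset.mem_filter, hN, Tri.lam_vert_ne hE h3]
      exact ⟨⟨vert_mem_nodesOn hE hET _, right_mem_segment ℝ _ _⟩, hpos⟩⟩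
  obtain ⟨q, hq, hqmin⟩ := (N.filter fun z => E.lam (k + 1) x < E.lam (k + 1) z).exists_min_image
    (E.lam (k + 1)) ⟨E.vert (k + 1), by
      rw [Finset.mem_filter, hN, Tri.lam_vert_self hE]
      exact ⟨⟨vert_mem_nodesOn hE hET _, left_mem_segment ℝ _ _⟩, hlt⟩⟩
  rw [Finset.mem_filter, hN] at hp hq
  have hsub : segment ℝ p q ⊆ E.side k := (convex_segment _ _).segment_subset hp.1.2 hq.1.2
  have hp0 := ((Tri.mem_side hE).1 hp.1.2).2
  have hq0 := ((Tri.mem_side hE).1 hq.1.2).2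
  have hpq : E.lam (k + 1) p < E.lam (k + 1) q := hp.2.trans hq.2
  refine ⟨segment ℝ p q, mem_edges.2 ⟨p, hp.1.1, q, hq.1.1, fun h => hpq.ne (by rw [h]),
    hsub.trans (Tri.side_subset_frontier hE k), fun z hz hzo => ?_, rfl⟩, hsub,
    openSegment_subset_segment ℝ p q (Tri.mem_openSegment_of_lam hE hp0 hq0 hx0 hp.2 hq.2)⟩
  have hzs : z ∈ E.side k := hsub (openSegment_subset_segment ℝ p q hzo)
  obtain ⟨l1, l2⟩ := E.lam_openSegment hzo hpq
  rcases lt_trichotomy (E.lam (k + 1) z) (E.lam (k + 1) x) with h | h | h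
  · exact absurd (hpmax z (by rw [Finset.mem_filter, hN]; exact ⟨⟨hz, hzs⟩, h⟩)) (not_le.2 l1)
  · exact hxn (Tri.eq_of_lam_side hE hx0 ((Tri.mem_side hE).1 hzs).2 h.symm ▸ hz)
  · exact absurd (hqmin z (by rw [Finset.mem_filter, hN]; exact ⟨⟨hz, hzs⟩, h⟩)) (not_le.2 l2)

-- The edges on a side cover it up to nodes and overlap in nodes only; finite sets are null for
-- one-dimensional Hausdorff measure.
open scoped Classical in
theorem sum_integral_edges_side (hE : E.Nondeg) (hET : E ∈ T) {f : Plane → ℝ} (hf : Continuous f)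
    (k : Fin 3) : ∑ e ∈ edges T E with e ⊆ E.side k, ∫ x in e, f x ∂μH[1] =
      dist (E.vert (k + 1)) (E.vert (k + 2)) * E.sideAvg k f := by
  have hne : E.vert (k + 1) ≠ E.vert (k + 2) := fun h =>
    (Tri.fin_ne_add_one k).2.2 (Tri.vert_injective hE h)
  rw [Tri.sideAvg, ← integral_segment hne]
  change _ = ∫ x in E.side k, f x ∂μH[1]
  set S : Set Plane := ↑(nodesOn T E) with hS
  have := Measure.nullSingletonClass_hausdorff Plane zero_lt_one
  have hS0 : (μH[1] : Measure Plane) S = 0 := (nodesOn T E).finite_toSet.measure_zero _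
  have hSm : MeasurableSet S := (nodesOn T E).finite_toSet.measurableSet
  have hdiff : ∀ A : Set Plane, ∫ x in A, f x ∂μH[1] = ∫ x in A \ S, f x ∂μH[1] := fun A =>
    (setIntegral_congr_set (sdiff_null_ae_eq_self hS0)).symm
  rw [hdiff (E.side k), Finset.sum_congr rfl fun e _ => hdiff e]
  have hcov : E.side k \ S = ⋃ e ∈ (edges T E).filter (fun e => e ⊆ E.side k), e \ S := by
    ext x
    simp only [Set.mem_iUnion, Finset.mem_filter, exists_prop]
    constructor
    · rintro ⟨hx, hxS⟩
      obtain ⟨e, he, hek, hxe⟩ := exists_edge hE hET hx hxS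
      exact ⟨e, ⟨he, hek⟩, hxe, hxS⟩
    · rintro ⟨e, ⟨-, hek⟩, hxe, hxS⟩
      exact ⟨hek hxe, hxS⟩
  rw [hcov, integral_biUnion_finset]
  · intro e he
    obtain ⟨p, -, q, -, -, -, -, rfl⟩ := mem_edges.1 (Finset.mem_filter.1 he).1
    exact (isCompact_segment p q).measurableSet.diff hSm
  · intro e he e' he' hee'
    rw [Finset.mem_coe, Finset.mem_filter] at he he'
    obtain ⟨p, hp, q, hq, hz, hl, rfl⟩ := mem_edges_side hE he.1 he.2
    obtain ⟨p', hp', q', hq', hz', hl', rfl⟩ := mem_edges_side hE he'.1 he'.2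
    refine Set.disjoint_left.2 fun x hx hx' => hee' ?_
    have hop : ∀ {p q : Plane}, p ∈ nodesOn T E → q ∈ nodesOn T E → x ∈ segment ℝ p q \ S →
        x ∈ openSegment ℝ p q := fun hp hq h =>
      mem_openSegment_of_ne_left_right (fun h' => h.2 (h' ▸ hp)) (fun h' => h.2 (h' ▸ hq)) h.1
    exact edge_eq_of_mem hE hp hq hp' hq' hz hz' he.2 he'.2 hl hl' (hop hp hq hx) (hop hp' hq' hx')
  · intro e he
    obtain ⟨p, -, q, -, -, -, -, rfl⟩ := mem_edges.1 (Finset.mem_filter.1 he).1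
    have := isFiniteMeasure_restrict_segment p q
    have h : IntegrableOn f (segment ℝ p q) μH[1] := (memLp_segment hf p q 1).integrable le_rfl
    exact h.mono_set Set.sdiff_subset

/-! ### Outward normals -/

theorem gradLam_ne_zero (hE : E.Nondeg) (k : Fin 3) : E.gradLam k ≠ 0 := fun h => by
  have h1 := E.inner_gradLam_sub k (E.vert k) (E.vert (k + 1))
  rw [h, inner_zero_left, Tri.lam_vert_self hE, Tri.lam_vert_ne hE (Tri.fin_ne_add_one k).1] at h1
  norm_num at h1

theorem norm_mul_inner_of_orthogonal {n d w : Plane} (hn : ‖n‖ = 1) (hd : inner ℝ n d = 0)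
    (hw : inner ℝ n w ≤ 0) : ‖d‖ * inner ℝ n w = -|d 0 * w 1 - d 1 * w 0| := by
  have hn2 : n 0 * n 0 + n 1 * n 1 = 1 := by
    rw [← inner_plane, real_inner_self_eq_norm_sq, hn, one_pow]
  have hd2 : ‖d‖ ^ 2 = d 0 * d 0 + d 1 * d 1 := by
    rw [← inner_plane, real_inner_self_eq_norm_sq]
  have hdet : d 0 * w 1 - d 1 * w 0 = -(n 0 * d 1 - n 1 * d 0) * inner ℝ n w := by
    rw [inner_plane] at hd ⊢
    linear_combination (n 0 * w 1 - n 1 * w 0) * hd - (d 0 * w 1 - d 1 * w 0) * hn2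
  have hc : |n 0 * d 1 - n 1 * d 0| = ‖d‖ := by
    rw [← abs_of_nonneg (norm_nonneg d), ← sq_eq_sq_iff_abs_eq_abs, hd2]
    rw [inner_plane] at hd
    linear_combination (d 0 * d 0 + d 1 * d 1) * hn2 - (n 0 * d 0 + n 1 * d 1) * hd
  rw [hdet, abs_mul, abs_neg, hc, abs_of_nonpos hw]
  ring

theorem eq_zero_of_orthogonal {z d w : Plane} (hd : inner ℝ z d = 0) (hw : inner ℝ z w = 0)
    (hdet : d 0 * w 1 - d 1 * w 0 ≠ 0) : z = 0 := by
  rw [inner_plane] at hd hw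
  have h0 : z 0 = 0 := by
    refine (mul_eq_zero.1 ?_).resolve_right hdet
    linear_combination w 1 * hd - d 1 * hw
  have h1 : z 1 = 0 := by
    refine (mul_eq_zero.1 ?_).resolve_right hdet
    linear_combination d 0 * hw - w 0 * hd
  ext i
  fin_cases i
  · exact h0
  · exact h1

theorem Tri.abs_det_eq (E : Tri) (k : Fin 3) :
    |(E.vert (k + 2) - E.vert (k + 1)) 0 * (E.vert k - E.vert (k + 1)) 1 -
      (E.vert (k + 2) - E.vert (k + 1)) 1 * (E.vert k - E.vert (k + 1)) 0| = |E.det| := by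
  rw [abs_eq_abs, Tri.det]
  left
  fin_cases k <;> simp <;> ring

theorem Tri.sub_side (hE : E.Nondeg) {k : Fin 3} {x y : Plane} (hx : x ∈ E.side k)
    (hy : y ∈ E.side k) : x - y =
      (E.lam (k + 1) y - E.lam (k + 1) x) • (E.vert (k + 2) - E.vert (k + 1)) := by
  obtain ⟨h1, h2, h3⟩ := Tri.fin_ne_add_one k
  have key : ∀ x ∈ E.side k,
      x = E.vert (k + 2) + E.lam (k + 1) x • (E.vert (k + 1) - E.vert (k + 2)) := fun x hx => by
    have hx0 := ((Tri.mem_side hE).1 hx).2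
    have e : E.vert (k + 2) + E.lam (k + 1) x • (E.vert (k + 1) - E.vert (k + 2)) =
        AffineMap.lineMap (E.vert (k + 2)) (E.vert (k + 1)) (E.lam (k + 1) x) := by
      rw [AffineMap.lineMap_apply_module']; abel
    rw [e]
    refine Tri.eq_of_lam_side hE hx0 ?_ ?_
    · rw [Tri.lam_lineMap, Tri.lam_vert_ne hE h1, Tri.lam_vert_ne hE h2]; ring
    · rw [Tri.lam_lineMap, Tri.lam_vert_ne hE h3, Tri.lam_vert_self hE]; ring
  conv_lhs => rw [key x hx, key y hy]
  module

theorem exists_outwardNormal (hE : E.Nondeg) {k : Fin 3} {e : Set Plane} (hk : e ⊆ E.side k) :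
    ∃ n, IsOutwardNormal E e n := by
  have hg : 0 < ‖E.gradLam k‖ := norm_pos_iff.2 (gradLam_ne_zero hE k)
  refine ⟨-‖E.gradLam k‖⁻¹ • E.gradLam k, ?_, fun x hx y hy => ?_⟩
  · rw [norm_smul, norm_neg, norm_inv, norm_norm, inv_mul_cancel₀ hg.ne']
  · rw [inner_smul_left, Tri.inner_gradLam_sub, ((Tri.mem_side hE).1 (hk hx)).2]
    have := (Tri.mem_carrier hE).1 hy k
    simp only [map_neg, conj_trivial, sub_zero, neg_mul, Left.neg_nonpos_iff]
    positivity

/-- The outward normal is the multiple of the coordinate gradient by its component along the vector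
to the opposite vertex: both sides are orthogonal to the side and agree on that vector. The
multiplier times the side length is minus |`E.det`|, which also covers normals given only by choice.
-/
theorem inner_outwardNormal (hE : E.Nondeg) {k : Fin 3} {e : Set Plane} (he : e ∈ edges T E)
    (hk : e ⊆ E.side k) (y : Plane) :
    dist (E.vert (k + 1)) (E.vert (k + 2)) * inner ℝ (outwardNormal E e) y =
      -(|E.det| * inner ℝ (E.gradLam k) y) := by
  obtain ⟨p, -, q, -, -, hpq, rfl⟩ := mem_edges_side hE he hk
  have hspec : IsOutwardNormal E (segment ℝ p q) (outwardNormal E (segment ℝ p q)) :=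
    Classical.epsilon_spec (exists_outwardNormal hE hk)
  set n := outwardNormal E (segment ℝ p q)
  set d := E.vert (k + 2) - E.vert (k + 1) with hd
  set w := E.vert k - E.vert (k + 1) with hw
  obtain ⟨h1, h2, h3⟩ := Tri.fin_ne_add_one k
  have hp := hk (left_mem_segment ℝ p q)
  have hq := hk (right_mem_segment ℝ p q)
  have hpE := ((Tri.mem_side hE).1 hp).1
  have hqE := ((Tri.mem_side hE).1 hq).1
  have hnd : inner ℝ n d = 0 := by
    have a := hspec.2 p (left_mem_segment ℝ p q) q hqE
    have b := hspec.2 q (right_mem_segment ℝ p q) p hpE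
    rw [Tri.sub_side hE hq hp, inner_smul_right] at a
    rw [Tri.sub_side hE hp hq, inner_smul_right] at b
    nlinarith
  have hnw : inner ℝ n w ≤ 0 := by
    have a := hspec.2 p (left_mem_segment ℝ p q) (E.vert k) (E.vert_mem k)
    have e : E.vert k - p = w + (E.vert (k + 1) - p) := by rw [hw]; abel
    rwa [e, inner_add_right, Tri.sub_side hE (left_mem_segment ℝ _ _) hp, inner_smul_right, ← hd,
      hnd, mul_zero, add_zero] at a
  have hdet : |d 0 * w 1 - d 1 * w 0| = |E.det| := E.abs_det_eq k
  have hkey := norm_mul_inner_of_orthogonal hspec.1 hnd hnw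
  rw [hdet] at hkey
  have hz : n - (inner ℝ n w : ℝ) • E.gradLam k = 0 := by
    refine eq_zero_of_orthogonal (d := d) (w := w) ?_ ?_ fun h => ?_
    · rw [inner_sub_left, inner_smul_left, hnd, hd, Tri.inner_gradLam_sub, Tri.lam_vert_ne hE h1,
        Tri.lam_vert_ne hE h2]
      simp
    · rw [inner_sub_left, inner_smul_left]
      have : inner ℝ (E.gradLam k) w = (1 : ℝ) := by
        rw [hw, Tri.inner_gradLam_sub, Tri.lam_vert_ne hE h1, Tri.lam_vert_self hE, sub_zero]
      rw [this]
      simp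
    · rw [h, abs_zero] at hdet
      exact Tri.det_ne_zero_iff.2 hE (abs_eq_zero.1 hdet.symm)
  have hnorm : dist (E.vert (k + 1)) (E.vert (k + 2)) = ‖d‖ := by
    rw [hd, ← dist_eq_norm, dist_comm]
  have hny : inner ℝ n y = inner ℝ n w * inner ℝ (E.gradLam k) y := by
    conv_lhs => rw [sub_eq_zero.1 hz, inner_smul_left]
    simp
  rw [hnorm, hny, ← mul_assoc, hkey]
  ring

/-- The divergence theorem on an element, with the boundary split into edges. -/
theorem integral_inner_gradient_edges (hE : E.Nondeg) (hET : E ∈ T) {ψ : Plane → ℝ}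
    (hψ : ContDiff ℝ 1 ψ) (y : Plane) : ∫ x in E.carrier, inner ℝ y (gradient ψ x) =
      ∑ e ∈ edges T E, inner ℝ y (outwardNormal E e) * ∫ x in e, ψ x ∂μH[1] := by
  classical
  rw [Tri.integral_inner_gradient hE hψ, sum_edges hE, Finset.mul_sum, ← Finset.sum_neg_distrib]
  refine Finset.sum_congr rfl fun k _ => ?_
  have hne : 0 < dist (E.vert (k + 1)) (E.vert (k + 2)) := dist_pos.2 fun h =>
    (Tri.fin_ne_add_one k).2.2 (Tri.vert_injective hE h)
  refine mul_left_cancel₀ hne.ne' ?_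
  have h := sum_integral_edges_side hE hET hψ.continuous k
  rw [Finset.mul_sum]
  have e : ∀ e ∈ (edges T E).filter (fun e => e ⊆ E.side k),
      dist (E.vert (k + 1)) (E.vert (k + 2)) *
        (inner ℝ y (outwardNormal E e) * ∫ x in e, ψ x ∂μH[1]) =
      -(|E.det| * inner ℝ (E.gradLam k) y) * ∫ x in e, ψ x ∂μH[1] := fun e he => by
    rw [Finset.mem_filter] at he
    rw [← inner_outwardNormal hE he.1 he.2, real_inner_comm]; ring
  rw [Finset.sum_congr rfl e, ← Finset.mul_sum, h]
  ring

end Edges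

end

end VEM

namespace VEM

noncomputable section

variable {T₀ T : Finset Tri} {E : Tri}

/-! ### Decomposition of integrals over the domain -/

theorem setIntegral_domain (hT₀ : IsConforming T₀) (hT : IsRefinement T₀ T) {f : Plane → ℝ}
    (hf : IntegrableOn f (domain T₀)) :
    ∫ x in domain T₀, f x = ∑ E ∈ T, ∫ x in E.carrier, f x := by
  have hsub : ∀ E ∈ T, interior E.carrier ⊆ domain T₀ := fun E hE =>
    interior_subset_domain hT₀ (hT.inForest E hE)
  have h1 : (⋃ E ∈ T, interior E.carrier : Set Plane) =ᵐ[volume] domain T₀ := by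
    refine (Set.iUnion₂_subset hsub).eventuallyLE.antisymm ?_
    have h := (ae_restrict_iff' (isOpen_domain T₀).measurableSet).1 (ae_mem_interior hT₀ hT)
    filter_upwards [h] with x hx hxΩ
    obtain ⟨E, hE, hxE⟩ := hx hxΩ
    exact Set.mem_iUnion₂.2 ⟨E, hE, hxE⟩
  rw [← setIntegral_congr_set h1, integral_biUnion_finset T
    (fun E _ => isOpen_interior.measurableSet) (fun E hE E' hE' => hT.disjoint hT₀ E hE E' hE')
    fun E hE => hf.mono_set (hsub E hE)]
  exact Finset.sum_congr rfl fun E _ => setIntegral_congr_set E.interior_ae_eq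

theorem restrict_carrier_le (hT₀ : IsConforming T₀) (hT : IsRefinement T₀ T) (hE : E ∈ T) :
    (volume.restrict E.carrier : Measure Plane) ≤ volume.restrict (domain T₀) := by
  rw [← E.restrict_interior]
  exact Measure.restrict_mono_set _ (interior_subset_domain hT₀ (hT.inForest E hE))

/-! ### Edge terms -/

theorem two_mul_abs_mul_le {a b c d I j : ℝ} (ha : 0 ≤ a) (hb : 0 ≤ b) (hI : I ^ 2 ≤ c * d)
    (hab : a * b = c * j ^ 2 * d) : 2 * (|I| * |j|) ≤ a + b := by
  have h : (|I| * |j|) ^ 2 ≤ a * b := by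
    rw [mul_pow, sq_abs, sq_abs, hab]
    nlinarith [mul_le_mul_of_nonneg_right hI (sq_nonneg j)]
  refine abs_le_of_sq_le_sq' ?_ (add_nonneg ha hb) |>.2
  nlinarith [sq_nonneg (a - b)]

/-- Cauchy–Schwarz on the edge, whose measure is its diameter, and Young's inequality with weight
t·h, matching the scaling of the estimator. -/
theorem abs_integral_edge_mul_le {e : Set Plane} (he : e ∈ edges T E) {ψ : Plane → ℝ}
    (hψ : Continuous ψ) (j : ℝ) {h t : ℝ} (hh : 0 < h) (ht : 0 < t) :
    |∫ x in e, ψ x ∂μH[1]| * |j| ≤ t / 2 * (h * (Metric.diam e * j ^ 2)) +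
      1 / (2 * t * h) * ∫ x in e, ψ x ^ 2 ∂μH[1] := by
  obtain ⟨p, -, q, -, -, -, -, rfl⟩ := mem_edges.1 he
  have := isFiniteMeasure_restrict_segment p q
  have h1 := sq_integral_le (memLp_segment hψ p q 2)
  rw [measureReal_restrict_apply_univ, measureReal_segment, ← diam_segment] at h1
  have hd : 0 ≤ Metric.diam (segment ℝ p q) := Metric.diam_nonneg
  have hQ : 0 ≤ ∫ x in segment ℝ p q, ψ x ^ 2 ∂μH[1] := integral_nonneg fun _ => sq_nonneg _
  have h2 := two_mul_abs_mul_le (a := t * (h * (Metric.diam (segment ℝ p q) * j ^ 2)))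
    (b := 1 / (t * h) * ∫ x in segment ℝ p q, ψ x ^ 2 ∂μH[1]) (j := j) (by positivity)
    (by positivity) h1 (by field_simp)
  have e : 1 / (2 * t * h) * ∫ x in segment ℝ p q, ψ x ^ 2 ∂μH[1] =
      (1 / (t * h) * ∫ x in segment ℝ p q, ψ x ^ 2 ∂μH[1]) / 2 := by field_simp
  rw [e]
  linarith

/-- The trace inequality on an element, summed over its edges. -/
theorem sum_integral_edges_sq_le (hE : E.Nondeg) (hET : E ∈ T) {ψ : Plane → ℝ}
    (hψ : ContDiff ℝ 1 ψ) : |E.det| * ∑ e ∈ edges T E, ∫ x in e, ψ x ^ 2 ∂μH[1] ≤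
      12 * E.sz * (3 * (∫ x in E.carrier, ψ x ^ 2) +
        E.sz ^ 2 * ∫ x in E.carrier, ‖gradient ψ x‖ ^ 2) := by
  classical
  have hψc := hψ.continuous
  have hg := continuous_gradient hψ
  rw [sum_edges hE, Finset.mul_sum]
  have hk : ∀ k : Fin 3, |E.det| * ∑ e ∈ edges T E with e ⊆ E.side k,
      ∫ x in e, ψ x ^ 2 ∂μH[1] ≤ 4 * E.sz * (3 * (∫ x in E.carrier, ψ x ^ 2) +
        E.sz ^ 2 * ∫ x in E.carrier, ‖gradient ψ x‖ ^ 2) := fun k => by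
    rw [sum_integral_edges_side hE hET (f := fun x => ψ x ^ 2) (hψc.pow 2)]
    have h1 := Tri.sideAvg_sq_le hE hψ k
    have i1 : IntegrableOn (fun x => 3 * ψ x ^ 2) E.carrier :=
      (Continuous.continuousOn (by fun_prop)).integrableOn_compact E.isCompact_carrier
    have i2 : IntegrableOn (fun x => E.sz ^ 2 * ‖gradient ψ x‖ ^ 2) E.carrier :=
      (Continuous.continuousOn (by fun_prop)).integrableOn_compact E.isCompact_carrier
    rw [integral_add i1 i2, integral_const_mul, integral_const_mul] at h1
    have h2 : dist (E.vert (k + 1)) (E.vert (k + 2)) ≤ E.sz := E.dist_vert_le _ _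
    have h3 : 0 ≤ |E.det| * E.sideAvg k fun x => ψ x ^ 2 := mul_nonneg (abs_nonneg _)
      (intervalIntegral.integral_nonneg zero_le_one fun _ _ => sq_nonneg _)
    calc _ = dist (E.vert (k + 1)) (E.vert (k + 2)) *
          (|E.det| * E.sideAvg k fun x => ψ x ^ 2) := by ring
      _ ≤ E.sz * (|E.det| * E.sideAvg k fun x => ψ x ^ 2) := by gcongr
      _ ≤ E.sz * _ := mul_le_mul_of_nonneg_left h1 E.sz_nonneg
      _ = _ := by ring
  refine (Finset.sum_le_sum fun k _ => hk k).trans_eq ?_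
  rw [Finset.sum_const, Finset.card_univ, Fintype.card_fin, nsmul_eq_mul]
  push_cast; ring

theorem edge_subset_carrier {e : Set Plane} (he : e ∈ edges T E) : e ⊆ E.carrier := by
  obtain ⟨p, -, q, -, -, h, -, rfl⟩ := mem_edges.1 he
  exact h.trans E.isClosed_carrier.frontier_subset

theorem measurableSet_edge {e : Set Plane} (he : e ∈ edges T E) : MeasurableSet e := by
  obtain ⟨p, -, q, -, -, h, -, rfl⟩ := mem_edges.1 he
  exact (isCompact_segment p q).measurableSet

/-- The normal fluxes of the elements combine to the jumps. -/
theorem abs_sum_flux_le (hT₀ : IsConforming T₀) (hT : IsRefinement T₀ T) {Λ : ℕ}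
    (hA : IsAdmissible T₀ T Λ) (D : ProblemData) (w : Plane → ℝ) {φ : Plane → ℝ}
    (hφ : ContDiff ℝ 1 φ) (hφ0 : ∀ x ∉ domain T₀, φ x = 0) :
    |∑ E ∈ T, ∫ x in E.carrier,
      inner ℝ (Matrix.toEuclideanLin (D.A E.barycenter) (piNabla E w).g)
        (gradient φ x - (quasi T₀ T φ E).g)| ≤
    ∑ E ∈ T, ∑ e ∈ edges T E, |∫ x in e, (φ x - (quasi T₀ T φ E).eval x) ∂μH[1]| *
      |jump (domain T₀) D T w e| := by
  classical
  set σ : Tri → Plane := fun E => Matrix.toEuclideanLin (D.A E.barycenter) (piNabla E w).g with hσ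
  set v := nodalFun T₀ T (nodalAvg T₀ T φ) with hv
  -- Continuity of the quasi-interpolant makes this integral depend on the edge only, not on the
  -- element. Hence the fluxes of all elements having the edge can be collected into its jump.
  set J : Set Plane → ℝ := fun e => ∫ x in e, (φ x - v x) ∂μH[1] with hJ
  have hJe : ∀ E ∈ T, ∀ e ∈ edges T E,
      ∫ x in e, (φ x - (quasi T₀ T φ E).eval x) ∂μH[1] = J e := fun E hE e he =>
    setIntegral_congr_fun (measurableSet_edge he) fun x hx => by
      simp only [hv]; rw [nodalFun_eq hT₀ hT hA _ hE (edge_subset_carrier he hx)]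
  -- On boundary edges φ and its quasi-interpolant both vanish, in accordance with the jump being
  -- set to zero there.
  have hJ0 : ∀ e, e ⊆ frontier (domain T₀) → J e = 0 := fun e he => by
    refine setIntegral_eq_zero_of_forall_eq_zero fun x hx => ?_
    have hxΩ : x ∉ domain T₀ := ((frontier_domain hT₀) ▸ he hx).2
    rw [hφ0 x hxΩ, hv, nodalFun_boundary hT₀ hT hA (g := nodalAvg T₀ T φ) 
      (fun z hz => nodalAvg_of_notMem φ hz) hxΩ, sub_zero]
  have h1 : ∀ E ∈ T, ∫ x in E.carrier, inner ℝ (σ E) (gradient φ x - (quasi T₀ T φ E).g) =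
      ∑ e ∈ edges T E, inner ℝ (σ E) (outwardNormal E e) * J e := fun E hE => by
    have nE := (hT.inForest E hE).nondeg hT₀
    have h := integral_inner_gradient_edges nE hE
      (hφ.sub (quasi T₀ T φ E).contDiff_eval) (σ E)
    have hgr : ∀ x, gradient (fun x => φ x - (quasi T₀ T φ E).eval x) x =
        gradient φ x - (quasi T₀ T φ E).g := fun x => by
      rw [gradient_sub hφ (quasi T₀ T φ E).contDiff_eval, P1.gradient_eval]
    simp only [hgr] at h
    rw [h]
    exact Finset.sum_congr rfl fun e he => by rw [hJe E hE e he]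
  set U := T.biUnion (edges T) with hU
  have hsw : ∀ F : Tri → Set Plane → ℝ, ∑ E ∈ T, ∑ e ∈ edges T E, F E e =
      ∑ e ∈ U, ∑ E ∈ T with e ∈ edges T E, F E e := fun F => Finset.sum_comm' fun E e => by
    simp only [hU, Finset.mem_biUnion, Finset.mem_filter]
    exact ⟨fun h => ⟨h, E, h⟩, fun h => h.1⟩
  rw [Finset.sum_congr rfl h1, hsw]
  have h2 : ∑ E ∈ T, ∑ e ∈ edges T E, |∫ x in e, (φ x - (quasi T₀ T φ E).eval x) ∂μH[1]| *
      |jump (domain T₀) D T w e| = ∑ E ∈ T, ∑ e ∈ edges T E,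
        |J e| * |jump (domain T₀) D T w e| :=
    Finset.sum_congr rfl fun E hE => Finset.sum_congr rfl fun e he => by rw [hJe E hE e he]
  rw [h2, hsw]
  refine (Finset.abs_sum_le_sum_abs _ _).trans (Finset.sum_le_sum fun e he => ?_)
  rw [← Finset.sum_mul]
  obtain ⟨E, hE, heE⟩ := Finset.mem_biUnion.1 he
  have hjump : (∑ E ∈ T with e ∈ edges T E, inner ℝ (σ E) (outwardNormal E e)) * J e =
      jump (domain T₀) D T w e * J e := by
    unfold jump
    split_ifs with hf
    · rw [hJ0 e hf, mul_zero, mul_zero]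
    · rfl
  rw [hjump, abs_mul, mul_comm]
  -- Each edge occurs in the right-hand sum once for every element having it, hence at least once.
  exact Finset.single_le_sum (f := fun _ : Tri => |J e| * |jump (domain T₀) D T w e|)
    (fun _ _ => by positivity) (Finset.mem_filter.2 ⟨hE, heE⟩)

/-! ### The projection error -/

theorem MemH10.isWeakGrad_interior (hT₀ : IsConforming T₀) (hT : IsRefinement T₀ T) (hE : E ∈ T)
    {w : Plane → ℝ} (hw : MemH10 (domain T₀) w) :
    IsWeakGrad (interior E.carrier) w (weakGrad (domain T₀) w) :=
  hw.1.spec.mono (interior_subset_domain hT₀ (hT.inForest E hE))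

theorem MemH10.approximates (hT₀ : IsConforming T₀) (hT : IsRefinement T₀ T) (hE : E ∈ T)
    {w : Plane → ℝ} (hw : MemH10 (domain T₀) w) (p : P1) :
    ∃ ψ, Approximates E ψ (fun x => w x - p.eval x) (fun x => weakGrad (domain T₀) w x - p.g) := by
  have hfin := E.isFiniteMeasure_restrict
  have hle := restrict_carrier_le hT₀ hT hE
  obtain ⟨φ, hφ, h0, h1⟩ := hw.exists_seq
  have hsq : ∀ {F : Type} [NormedAddCommGroup F] {f : Plane → F},
      MemLp f 2 (volume.restrict (domain T₀)) →
      ∫ x in E.carrier, ‖f x‖ ^ 2 ≤ ∫ x in domain T₀, ‖f x‖ ^ 2 := fun hf =>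
    integral_mono_measure hle (ae_of_all _ fun _ => by positivity)
      (hf.integrable_norm_pow (p := 2) (by norm_num))
  refine ⟨fun n x => φ n x - p.eval x, fun n => (hφ n).contDiff_one.sub p.contDiff_eval,
    (hw.1.spec.1.mono_measure hle).sub (memLp_const _), ?_, ?_⟩
  · refine squeeze_zero (fun n => integral_nonneg fun _ => by positivity) (fun n => ?_) h0
    simp only [sub_sub_sub_cancel_right]
    exact hsq (hw.1.1.sub ((hφ n).memLp _))
  · refine squeeze_zero (fun n => integral_nonneg fun _ => by positivity) (fun n => ?_) h1
    simp only [gradient_sub (hφ n).contDiff_one p.contDiff_eval, P1.gradient_eval,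
      sub_sub_sub_cancel_right]
    exact hsq (hw.1.spec.1.sub ((hφ n).memLp_gradient _))

theorem integral_sub_piNabla_sq_le (hT₀ : IsConforming T₀) (hT : IsRefinement T₀ T) (hE : E ∈ T)
    {w : Plane → ℝ} (hw : MemH10 (domain T₀) w) (hc : ContinuousOn w E.carrier) :
    ∫ x in E.carrier, (w x - (piNabla E w).eval x) ^ 2 ≤
      (32 + 4160 * Tri.refArea ^ 2) * E.sz ^ 2 *
        ∫ x in E.carrier, ‖weakGrad (domain T₀) w x - (piNabla E w).g‖ ^ 2 := by
  have nE := (hT.inForest E hE).nondeg hT₀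
  obtain ⟨ψ, hψ⟩ := hw.approximates hT₀ hT hE (piNabla E w)
  exact Tri.integral_sq_le_of_bdryIntegral_eq_zero nE hψ
    (hc.sub (piNabla E w).continuous_eval.continuousOn)
    (piNabla_spec nE hc (hw.isWeakGrad_interior hT₀ hT hE)).2

/-! ### The data -/

theorem exists_bound_of_memLp_top {μ : Measure Plane} {f : Plane → ℝ} (hf : MemLp f ⊤ μ) :
    ∃ M, 0 ≤ M ∧ ∀ᵐ x ∂μ, |f x| ≤ M := by
  refine ⟨(eLpNorm f ⊤ μ).toReal, ENNReal.toReal_nonneg, ?_⟩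
  filter_upwards [ae_le_eLpNormEssSup (f := f) (μ := μ)] with x hx
  rw [← eLpNorm_exponent_top] at hx
  rw [← Real.norm_eq_abs, ← toReal_enorm]
  exact ENNReal.toReal_mono hf.2.ne hx

theorem norm_toEuclideanLin_le {A : Matrix (Fin 2) (Fin 2) ℝ} {M : ℝ} (hA : ∀ i j, |A i j| ≤ M)
    (y : Plane) : ‖Matrix.toEuclideanLin A y‖ ≤ 4 * M * ‖y‖ := by
  have hM : 0 ≤ M := (abs_nonneg _).trans (hA 0 0)
  refine (norm_le_abs_add_abs _).trans ?_
  have h : ∀ i, |Matrix.toEuclideanLin A y i| ≤ 2 * M * ‖y‖ := fun i => by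
    have e : Matrix.toEuclideanLin A y i = A i 0 * y 0 + A i 1 * y 1 := by
      simp [Matrix.toEuclideanLin, Matrix.mulVec, dotProduct, Fin.sum_univ_two]
    rw [e]
    refine (abs_add_le _ _).trans ?_
    rw [abs_mul, abs_mul]
    have h0 := mul_le_mul (hA i 0) (abs_apply_le_norm y 0) (abs_nonneg _) hM
    have h1 := mul_le_mul (hA i 1) (abs_apply_le_norm y 1) (abs_nonneg _) hM
    linarith
  linarith [h 0, h 1]

theorem exists_mem_interior_of_ae (hE : E.Nondeg) {P : Plane → Prop}
    (h : ∀ᵐ x ∂(volume.restrict (interior E.carrier)), P x) : ∃ x ∈ interior E.carrier, P x := by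
  have hne : (volume.restrict (interior E.carrier) : Measure Plane) ≠ 0 := by
    rw [Ne, Measure.restrict_eq_zero]
    exact (isOpen_interior.measure_pos volume (Tri.interior_nonempty hE)).ne'
  have : NeBot (ae (volume.restrict (interior E.carrier) : Measure Plane)) := ae_neBot.2 hne
  exact ((ae_restrict_mem isOpen_interior.measurableSet).and h).exists

/-- The data bounds hold almost everywhere in the domain. The interior of an element has positive
measure, so they hold at some interior point, where the data agree with those at the barycenter. The
bound is therefore independent of the mesh. -/
theorem exists_data_bound (hT₀ : IsConforming T₀) {D : ProblemData} (hD : D.IsValid (domain T₀)) :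
    ∃ M, 0 ≤ M ∧ ∀ T, IsRefinement T₀ T → D.PiecewiseConstant T → ∀ E ∈ T,
      (∀ y, ‖Matrix.toEuclideanLin (D.A E.barycenter) y‖ ≤ M * ‖y‖) ∧ |D.c E.barycenter| ≤ M := by
  choose M hM0 hM using fun i j => exists_bound_of_memLp_top (hD.A_bdd i j)
  obtain ⟨N, hN0, hN⟩ := exists_bound_of_memLp_top hD.c_bdd
  have hs : ∀ i j, M i j ≤ ∑ i, ∑ j, M i j := fun i j =>
    (Finset.single_le_sum (f := fun j => M i j) (fun j _ => hM0 i j) (Finset.mem_univ j)).trans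
      (Finset.single_le_sum (f := fun i => ∑ j, M i j)
        (fun i _ => Finset.sum_nonneg fun j _ => hM0 i j) (Finset.mem_univ i))
  have hS0 : 0 ≤ ∑ i, ∑ j, M i j := Finset.sum_nonneg fun i _ => Finset.sum_nonneg fun j _ => hM0 i j
  refine ⟨4 * (∑ i, ∑ j, M i j) + N, by positivity, fun T hT hpc E hE => ?_⟩
  have nE := (hT.inForest E hE).nondeg hT₀
  have hle := Measure.restrict_mono_set (volume : Measure Plane)
    (interior_subset_domain hT₀ (hT.inForest E hE))
  have hall : ∀ᵐ x ∂(volume.restrict (interior E.carrier)),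
      (∀ i j, |D.A x i j| ≤ M i j) ∧ |D.c x| ≤ N := by
    refine ae_mono hle ?_
    filter_upwards [ae_all_iff.2 fun i => ae_all_iff.2 fun j => hM i j, hN] with x h1 h2
    exact ⟨h1, h2⟩
  obtain ⟨x, hx, h1, h2⟩ := exists_mem_interior_of_ae nE hall
  obtain ⟨e1, e2, -⟩ := hpc E hE x hx
  rw [e1] at h1
  rw [e2] at h2
  constructor
  · intro y
    refine (norm_toEuclideanLin_le (fun i j => (h1 i j).trans (hs i j)) y).trans ?_
    gcongr
    linarith
  · linarith

end

end VEM

namespace VEM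

noncomputable section

variable {T₀ T : Finset Tri} {E : Tri} {D : ProblemData}

/-! ### Young inequalities -/

theorem abs_integral_inner_le {α : Type*} {m : MeasurableSpace α} {μ : Measure α}
    {F G : α → Plane} (hF : MemLp F 2 μ) (hG : MemLp G 2 μ) :
    |∫ x, inner ℝ (F x) (G x) ∂μ| ≤
      Real.sqrt (∫ x, ‖F x‖ ^ 2 ∂μ) * Real.sqrt (∫ x, ‖G x‖ ^ 2 ∂μ) := by
  have h := abs_integral_mul_le hF.norm hG.norm
  simp only [norm_norm] at h
  refine le_trans ?_ ((le_abs_self _).trans h)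
  refine abs_integral_le_integral_abs.trans (integral_mono (integrable_inner hF hG).abs
    (integrable_mul_two hF.norm hG.norm) fun x => abs_real_inner_le_norm _ _)

theorem sqrt_mul_sqrt_le {a b s : ℝ} (ha : 0 ≤ a) (hb : 0 ≤ b) (hs : 0 < s) :
    Real.sqrt a * Real.sqrt b ≤ s / 2 * a + 1 / (2 * s) * b := by
  have h := sq_nonneg (s * Real.sqrt a - Real.sqrt b)
  have e : s / 2 * a + 1 / (2 * s) * b - Real.sqrt a * Real.sqrt b =
      1 / (2 * s) * (s * Real.sqrt a - Real.sqrt b) ^ 2 := by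
    rw [sub_sq, mul_pow, Real.sq_sqrt ha, Real.sq_sqrt hb]
    field_simp
    ring
  have : 0 ≤ 1 / (2 * s) * (s * Real.sqrt a - Real.sqrt b) ^ 2 := by positivity
  linarith

theorem integral_inner_young {α : Type*} {m : MeasurableSpace α} {μ : Measure α}
    {F G : α → Plane} (hF : MemLp F 2 μ) (hG : MemLp G 2 μ) {s : ℝ} (hs : 0 < s) :
    ∫ x, inner ℝ (F x) (G x) ∂μ ≤
      s / 2 * (∫ x, ‖F x‖ ^ 2 ∂μ) + 1 / (2 * s) * ∫ x, ‖G x‖ ^ 2 ∂μ :=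
  (le_abs_self _).trans ((abs_integral_inner_le hF hG).trans (sqrt_mul_sqrt_le
    (integral_nonneg fun _ => by positivity) (integral_nonneg fun _ => by positivity) hs))

theorem integral_mul_young {α : Type*} {m : MeasurableSpace α} {μ : Measure α}
    {F G : α → ℝ} (hF : MemLp F 2 μ) (hG : MemLp G 2 μ) {s : ℝ} (hs : 0 < s) :
    ∫ x, F x * G x ∂μ ≤ s / 2 * (∫ x, F x ^ 2 ∂μ) + 1 / (2 * s) * ∫ x, G x ^ 2 ∂μ := by
  have h := abs_integral_mul_le hF hG
  simp only [Real.norm_eq_abs, sq_abs] at h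
  exact (le_abs_self _).trans (h.trans (sqrt_mul_sqrt_le
    (integral_nonneg fun _ => by positivity) (integral_nonneg fun _ => by positivity) hs))

/-! ### The residual identity -/

theorem toEuclideanLin_eq (A : Matrix (Fin 2) (Fin 2) ℝ) (y : Plane) :
    Matrix.toEuclideanLin A y =
      (A 0 0 * y 0) • EuclideanSpace.single 0 1 + (A 0 1 * y 1) • EuclideanSpace.single 0 1 +
      ((A 1 0 * y 0) • EuclideanSpace.single 1 1 + (A 1 1 * y 1) • EuclideanSpace.single 1 1) := by
  ext i
  fin_cases i <;>
  simp [Matrix.toEuclideanLin, Matrix.mulVec, dotProduct, Fin.sum_univ_two]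

theorem memLp_apply {μ : Measure Plane} {g : Plane → Plane} (hg : MemLp g 2 μ) (j : Fin 2) :
    MemLp (fun x => g x j) 2 μ :=
  hg.norm.mono ((EuclideanSpace.proj j : Plane →L[ℝ] ℝ).continuous.comp_aestronglyMeasurable hg.1)
    (ae_of_all _ fun x => by rw [norm_norm]; exact abs_apply_le_norm (g x) j)

theorem ProblemData.IsValid.memLp_A {Ω : Set Plane} (hD : D.IsValid Ω) {g : Plane → Plane}
    (hg : MemLp g 2 (volume.restrict Ω)) :
    MemLp (fun x => Matrix.toEuclideanLin (D.A x) (g x)) 2 (volume.restrict Ω) := by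
  have h : ∀ (i j : Fin 2) (v : Plane),
      MemLp (fun x => (D.A x i j * g x j) • v) 2 (volume.restrict Ω) := fun i j v => by
    have h1 : MemLp (fun x => D.A x i j * g x j) 2 (volume.restrict Ω) :=
      MemLp.mul (memLp_apply hg j) (hD.A_bdd i j)
    exact (h1.norm.mul_const ‖v‖).mono (h1.1.smul_const v) (ae_of_all _ fun x => by
      rw [norm_smul]; simp)
  simp only [toEuclideanLin_eq]
  exact ((h _ _ _).add (h _ _ _)).add ((h _ _ _).add (h _ _ _))

theorem ProblemData.IsValid.memLp_c {Ω : Set Plane} (hD : D.IsValid Ω) {w : Plane → ℝ}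
    (hw : MemLp w 2 (volume.restrict Ω)) :
    MemLp (fun x => D.c x * w x) 2 (volume.restrict Ω) := MemLp.mul hw hD.c_bdd

/-- The quasi-interpolant is an admissible test function because every local space contains the
affine functions. -/
theorem memVT_nodalFun (hT₀ : IsConforming T₀) (hT : IsRefinement T₀ T) {Λ : ℕ}
    (hA : IsAdmissible T₀ T Λ) {V : Tri → Submodule ℝ (Plane → ℝ)}
    (hV : ∀ E ∈ T, IsLocalSpace T E (V E)) (φ : Plane → ℝ) :
    MemVT (domain T₀) T V (nodalFun T₀ T (nodalAvg T₀ T φ)) := by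
  refine ⟨nodalFun_memH10 hT₀ hT hA fun z hz => nodalAvg_of_notMem φ hz, fun E hE => ?_⟩
  have e : E.carrier.indicator (nodalFun T₀ T (nodalAvg T₀ T φ)) =
      E.carrier.indicator (quasi T₀ T φ E).eval :=
    Set.indicator_congr fun x hx => nodalFun_eq hT₀ hT hA _ hE hx
  rw [e]
  exact (hV E hE).affine_mem _

theorem piNabla_nodalFun (hT₀ : IsConforming T₀) (hT : IsRefinement T₀ T) {Λ : ℕ}
    (hA : IsAdmissible T₀ T Λ) (φ : Plane → ℝ) (hE : E ∈ T) :
    piNabla E (nodalFun T₀ T (nodalAvg T₀ T φ)) = quasi T₀ T φ E :=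
  piNabla_eq ((hT.inForest E hE).nondeg hT₀) fun _ hx => nodalFun_eq hT₀ hT hA _ hE hx

/-- Vertex interpolation reproduces the quasi-interpolant on each element. This removes γ from the
argument and makes the final constant independent of it. -/
theorem ST_nodalFun (hT₀ : IsConforming T₀) (hT : IsRefinement T₀ T) {Λ : ℕ}
    (hA : IsAdmissible T₀ T Λ) (φ w : Plane → ℝ) :
    ST T w (nodalFun T₀ T (nodalAvg T₀ T φ)) = 0 := by
  refine Finset.sum_eq_zero fun E hE => Finset.sum_eq_zero fun z hz => ?_
  have hv : ∀ x ∈ E.carrier, nodalFun T₀ T (nodalAvg T₀ T φ) x = (quasi T₀ T φ E).eval x :=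
    fun x hx => nodalFun_eq hT₀ hT hA _ hE hx
  have hl : lagrange E (nodalFun T₀ T (nodalAvg T₀ T φ)) = quasi T₀ T φ E :=
    lagrange_eq ((hT.inForest E hE).nondeg hT₀) fun i => hv _ (E.vert_mem i)
  beta_reduce
  rw [hl, hv z ((mem_nodesOn hT₀ hT hE).1 hz).2, sub_self, mul_zero]

/-- The discrete problem, tested with the quasi-interpolant. -/
theorem galerkin_quasi (hT₀ : IsConforming T₀) (hT : IsRefinement T₀ T) {Λ : ℕ}
    (hA : IsAdmissible T₀ T Λ) {V : Tri → Submodule ℝ (Plane → ℝ)}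
    (hV : ∀ E ∈ T, IsLocalSpace T E (V E)) {γ : ℝ} {uT : Plane → ℝ}
    (hG : IsGalerkinSolution (domain T₀) D T V γ uT) (φ : Plane → ℝ) :
    ∑ E ∈ T, (D.f E.barycenter * (∫ x in E.carrier, (quasi T₀ T φ E).eval x) -
      (∫ _x in E.carrier, inner ℝ (Matrix.toEuclideanLin (D.A E.barycenter) (piNabla E uT).g)
        (quasi T₀ T φ E).g) -
      D.c E.barycenter * ∫ x in E.carrier, (piNabla E uT).eval x * (quasi T₀ T φ E).eval x) = 0 := by
  have h := hG.2 _ (memVT_nodalFun hT₀ hT hA hV φ)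
  rw [ST_nodalFun hT₀ hT hA, mul_zero, add_zero] at h
  rw [aT, mT, FT] at h
  set v := nodalFun T₀ T (nodalAvg T₀ T φ)
  have key : ∑ E ∈ T, (D.f E.barycenter * (∫ x in E.carrier, (piNabla E v).eval x) -
      (∫ _x in E.carrier, inner ℝ (Matrix.toEuclideanLin (D.A E.barycenter) (piNabla E uT).g)
        (piNabla E v).g) -
      D.c E.barycenter * ∫ x in E.carrier, (piNabla E uT).eval x * (piNabla E v).eval x) = 0 := by
    simp only [Finset.sum_sub_distrib]
    linarith
  rw [← key]
  exact Finset.sum_congr rfl fun E hE => by rw [piNabla_nodalFun hT₀ hT hA φ hE]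

theorem setIntegral_interior_congr {f g : Plane → ℝ} (h : ∀ x ∈ interior E.carrier, f x = g x) :
    ∫ x in E.carrier, f x = ∫ x in E.carrier, g x := by
  rw [← E.restrict_interior]
  exact setIntegral_congr_fun isOpen_interior.measurableSet h

/-- Bookkeeping on one element: the weak form for φ minus the discrete form for v equals the
projected residual on φ - v plus the error of replacing u_T by its projection against φ. -/
theorem element_identity {uT φ : Plane → ℝ} {gT : Plane → Plane} {p v : P1} {a : Plane →ₗ[ℝ] Plane}
    {c f : ℝ} (hφ : ContDiff ℝ 1 φ) (hu : ContinuousOn uT E.carrier)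
    (hg : MemLp gT 2 (volume.restrict E.carrier)) :
    (f * (∫ x in E.carrier, φ x) - (∫ x in E.carrier, inner ℝ (a (gT x)) (gradient φ x)) -
      c * ∫ x in E.carrier, uT x * φ x) -
    (f * (∫ x in E.carrier, v.eval x) - (∫ _x in E.carrier, inner ℝ (a p.g) v.g) -
      c * ∫ x in E.carrier, p.eval x * v.eval x) =
    (∫ x in E.carrier, (f - c * p.eval x) * (φ x - v.eval x)) -
      (∫ x in E.carrier, inner ℝ (a p.g) (gradient φ x - v.g)) +
      ((∫ x in E.carrier, inner ℝ (a (p.g - gT x)) (gradient φ x)) +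
        ∫ x in E.carrier, c * (p.eval x - uT x) * φ x) := by
  have hfin := E.isFiniteMeasure_restrict
  have hφc := hφ.continuous
  have hgr := continuous_gradient hφ
  have hp := p.continuous_eval
  have hv := v.continuous_eval
  have ic : ∀ {F : Plane → ℝ}, ContinuousOn F E.carrier → Integrable F (volume.restrict E.carrier) :=
    fun hF => hF.integrableOn_compact E.isCompact_carrier
  have i1 : Integrable φ (volume.restrict E.carrier) := ic hφc.continuousOn
  have i2 : Integrable v.eval (volume.restrict E.carrier) := ic hv.continuousOn
  have i3 : Integrable (fun x => p.eval x * φ x) (volume.restrict E.carrier) :=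
    ic (hp.mul hφc).continuousOn
  have i4 : Integrable (fun x => p.eval x * v.eval x) (volume.restrict E.carrier) :=
    ic (hp.mul hv).continuousOn
  have i5 : Integrable (fun x => uT x * φ x) (volume.restrict E.carrier) :=
    ic (hu.mul hφc.continuousOn)
  have i6 : Integrable (fun x => inner ℝ (a p.g) (gradient φ x)) (volume.restrict E.carrier) :=
    ic (Continuous.continuousOn (by fun_prop))
  have haG : MemLp (fun x => a (gT x)) 2 (volume.restrict E.carrier) :=
    (LinearMap.toContinuousLinearMap a).comp_memLp' hg
  have i7 : Integrable (fun x => inner ℝ (a (gT x)) (gradient φ x)) (volume.restrict E.carrier) :=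
    integrable_inner haG (Tri.memLp_of_continuousOn hgr.continuousOn)
  have e1 : ∀ x, (f - c * p.eval x) * (φ x - v.eval x) =
      (f * φ x - f * v.eval x) - (c * (p.eval x * φ x) - c * (p.eval x * v.eval x)) :=
    fun x => by ring
  have e2 : ∀ x, c * (p.eval x - uT x) * φ x = c * (p.eval x * φ x) - c * (uT x * φ x) :=
    fun x => by ring
  have j1 : Integrable (fun x => f * φ x - f * v.eval x) (volume.restrict E.carrier) :=
    (i1.const_mul _).sub (i2.const_mul _)
  have j2 : Integrable (fun x => c * (p.eval x * φ x) - c * (p.eval x * v.eval x))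
    (volume.restrict E.carrier) := (i3.const_mul _).sub (i4.const_mul _)
  simp only [e1, e2, map_sub, inner_sub_left, inner_sub_right]
  rw [integral_sub j1 j2, integral_sub (i1.const_mul _) (i2.const_mul _),
    integral_sub (i3.const_mul _) (i4.const_mul _), integral_sub (i3.const_mul _) (i5.const_mul _),
    integral_sub i6 (integrable_const _), integral_sub i6 i7]
  simp only [integral_const_mul]
  ring

/-- The residual of the discrete solution, with the quasi-interpolant subtracted. -/
theorem residual_identity (hT₀ : IsConforming T₀) (hD : D.IsValid (domain T₀))
    (hT : IsRefinement T₀ T) {Λ : ℕ} (hA : IsAdmissible T₀ T Λ) (hpc : D.PiecewiseConstant T)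
    {V : Tri → Submodule ℝ (Plane → ℝ)} (hV : ∀ E ∈ T, IsLocalSpace T E (V E)) {γ : ℝ}
    {u uT : Plane → ℝ} (hu : IsWeakSolution (domain T₀) D u)
    (hG : IsGalerkinSolution (domain T₀) D T V γ uT) {φ : Plane → ℝ}
    (hφ : IsTestFunction (domain T₀) φ) :
    (∫ x in domain T₀, inner ℝ (Matrix.toEuclideanLin (D.A x)
      (weakGrad (domain T₀) u x - weakGrad (domain T₀) uT x)) (gradient φ x)) +
      (∫ x in domain T₀, D.c x * (u x - uT x) * φ x) =
    (∑ E ∈ T, ∫ x in E.carrier, (D.f E.barycenter - D.c E.barycenter * (piNabla E uT).eval x) *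
      (φ x - (quasi T₀ T φ E).eval x)) -
    (∑ E ∈ T, ∫ x in E.carrier,
      inner ℝ (Matrix.toEuclideanLin (D.A E.barycenter) (piNabla E uT).g)
        (gradient φ x - (quasi T₀ T φ E).g)) +
    ∑ E ∈ T, ((∫ x in E.carrier, inner ℝ (Matrix.toEuclideanLin (D.A E.barycenter)
      ((piNabla E uT).g - weakGrad (domain T₀) uT x)) (gradient φ x)) +
      ∫ x in E.carrier, D.c E.barycenter * ((piNabla E uT).eval x - uT x) * φ x) := by
  have hφ1 := hφ.contDiff_one
  set Ω := domain T₀ with hΩ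
  have hφL := hφ.memLp Ω
  have hgL := hφ.memLp_gradient Ω
  have hgu := hu.1.1.spec.1
  have hgT := hG.1.1.1.spec.1
  have huL := hu.1.1.1
  have huTL := hG.1.1.1.1
  have iAu := integrable_inner (hD.memLp_A hgu) hgL
  have iAT := integrable_inner (hD.memLp_A hgT) hgL
  have icu := integrable_mul_two (hD.memLp_c huL) hφL
  have icT := integrable_mul_two (hD.memLp_c huTL) hφL
  have iff := integrable_mul_two hD.f_sq hφL
  have h1 := hu.2 φ (hφ.memH10 (isOpen_domain T₀))
  have hwg : ∫ x in Ω, inner ℝ (Matrix.toEuclideanLin (D.A x) (weakGrad Ω u x)) (weakGrad Ω φ x) =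
      ∫ x in Ω, inner ℝ (Matrix.toEuclideanLin (D.A x) (weakGrad Ω u x)) (gradient φ x) := by
    refine integral_congr_ae ?_
    filter_upwards [(isWeakGrad_gradient hφ1 hgL).weakGrad_ae (isOpen_domain T₀)] with x hx
    rw [hx]
  rw [hwg] at h1
  have e1 : ∀ x, inner ℝ (Matrix.toEuclideanLin (D.A x) (weakGrad Ω u x - weakGrad Ω uT x))
      (gradient φ x) = inner ℝ (Matrix.toEuclideanLin (D.A x) (weakGrad Ω u x)) (gradient φ x) -
      inner ℝ (Matrix.toEuclideanLin (D.A x) (weakGrad Ω uT x)) (gradient φ x) := fun x => by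
    rw [map_sub, inner_sub_left]
  have e2 : ∀ x, D.c x * (u x - uT x) * φ x = D.c x * u x * φ x - D.c x * uT x * φ x :=
    fun x => by ring
  simp only [e1, e2]
  rw [integral_sub iAu iAT, integral_sub icu icT]
  have s1 : ∫ x in Ω, D.f x * φ x = ∑ E ∈ T, D.f E.barycenter * ∫ x in E.carrier, φ x := by
    rw [setIntegral_domain hT₀ hT iff]
    refine Finset.sum_congr rfl fun E hE => ?_
    rw [← integral_const_mul]
    exact setIntegral_interior_congr fun x hx => by rw [(hpc E hE x hx).2.2]
  have s2 : ∫ x in Ω, inner ℝ (Matrix.toEuclideanLin (D.A x) (weakGrad Ω uT x)) (gradient φ x) =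
      ∑ E ∈ T, ∫ x in E.carrier,
        inner ℝ (Matrix.toEuclideanLin (D.A E.barycenter) (weakGrad Ω uT x)) (gradient φ x) := by
    rw [setIntegral_domain hT₀ hT iAT]
    exact Finset.sum_congr rfl fun E hE =>
      setIntegral_interior_congr fun x hx => by rw [(hpc E hE x hx).1]
  have s3 : ∫ x in Ω, D.c x * uT x * φ x =
      ∑ E ∈ T, D.c E.barycenter * ∫ x in E.carrier, uT x * φ x := by
    rw [setIntegral_domain hT₀ hT icT]
    refine Finset.sum_congr rfl fun E hE => ?_
    rw [← integral_const_mul]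
    exact setIntegral_interior_congr fun x hx => by rw [(hpc E hE x hx).2.1]; ring
  -- The discrete equation contributes zero in total and is subtracted element by element.
  have hgal := galerkin_quasi hT₀ hT hA hV hG φ
  rw [← Finset.sum_sub_distrib, ← Finset.sum_add_distrib]
  rw [← Finset.sum_congr rfl fun E hE => element_identity (E := E) (p := piNabla E uT)
    (v := quasi T₀ T φ E) (a := Matrix.toEuclideanLin (D.A E.barycenter)) (c := D.c E.barycenter)
    (f := D.f E.barycenter) (gT := weakGrad Ω uT) hφ1
    (((hV E hE).continuousOn _ (hG.1.2 E hE)).congr fun x hx => (Set.indicator_of_mem hx uT).symm)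
    (hgT.mono_measure (restrict_carrier_le hT₀ hT hE))]
  rw [Finset.sum_sub_distrib, hgal, sub_zero, Finset.sum_sub_distrib, Finset.sum_sub_distrib,
    ← s1, ← s2, ← s3]
  linarith

end

end VEM

namespace VEM

noncomputable section

variable {T₀ T : Finset Tri} {E : Tri} {D : ProblemData}

/-! ### Reliability -/

theorem SE_nonneg (T : Finset Tri) (E : Tri) (w : Plane → ℝ) : 0 ≤ SE T E w w :=
  Finset.sum_nonneg fun _ _ => mul_self_nonneg _

theorem Tri.h_pos (hE : E.Nondeg) : 0 < E.h := Real.sqrt_pos.2 (Tri.volume_real_pos hE)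

/-- Young's inequality with parameter t h²; by shape regularity h² is bounded below by a multiple of
the squared diameter bound. -/
theorem volume_term_le (hE : E.Nondeg) {κ : ℝ} (hq : E.q ≤ κ * |E.det|) {r ψ : Plane → ℝ}
    (hr : Continuous r) (hψ : Continuous ψ) {t : ℝ} (ht : 0 < t) :
    ∫ x in E.carrier, r x * ψ x ≤ t / 2 * (E.h ^ 2 * ∫ x in E.carrier, r x ^ 2) +
      κ / Tri.refArea / t * ((E.sz ^ 2)⁻¹ * ∫ x in E.carrier, ψ x ^ 2) := by
  have hh := Tri.h_pos hE
  have hρ := Tri.refArea_pos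
  have hs := Tri.sz_pos hE
  have hd : 0 < |E.det| := abs_pos.2 (Tri.det_ne_zero_iff.2 hE)
  have h1 := integral_mul_young (Tri.memLp_of_continuousOn (E := E) hr.continuousOn)
    (Tri.memLp_of_continuousOn hψ.continuousOn) (s := t * E.h ^ 2) (by positivity)
  have hQ : 0 ≤ ∫ x in E.carrier, ψ x ^ 2 := integral_nonneg fun _ => sq_nonneg _
  have h2 : 1 / (2 * (t * E.h ^ 2)) ≤ κ / Tri.refArea / t * (E.sz ^ 2)⁻¹ := by
    have e : κ / Tri.refArea / t * (E.sz ^ 2)⁻¹ = κ / (Tri.refArea * t * E.sz ^ 2) := by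
      field_simp
    rw [e, div_le_div_iff₀ (by positivity) (by positivity), Tri.h_sq hE, Tri.sz_sq]
    have := mul_le_mul_of_nonneg_left hq (by positivity : 0 ≤ 2 * (Tri.refArea * t))
    nlinarith
  calc _ ≤ _ := h1
    _ = t / 2 * (E.h ^ 2 * ∫ x in E.carrier, r x ^ 2) +
        1 / (2 * (t * E.h ^ 2)) * ∫ x in E.carrier, ψ x ^ 2 := by ring
    _ ≤ t / 2 * (E.h ^ 2 * ∫ x in E.carrier, r x ^ 2) +
        κ / Tri.refArea / t * (E.sz ^ 2)⁻¹ * ∫ x in E.carrier, ψ x ^ 2 := by gcongr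
    _ = _ := by ring

/-- The edge estimate is combined with the scaled trace inequality. The coefficient t/2 in front of
the jumps reproduces the factor 1/2 of the estimator. -/
theorem edge_terms_le (hE : E.Nondeg) (hET : E ∈ T) {κ : ℝ} (hκ : 0 < κ) (hq : E.q ≤ κ * |E.det|)
    {ψ : Plane → ℝ} (hψ : ContDiff ℝ 1 ψ) (j : Set Plane → ℝ) {t : ℝ} (ht : 0 < t) :
    ∑ e ∈ edges T E, |∫ x in e, ψ x ∂μH[1]| * |j e| ≤
      t / 2 * (∑ e ∈ edges T E, E.h * (Metric.diam e * j e ^ 2)) +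
      36 * κ * Real.sqrt (2 * κ / Tri.refArea) / t * ((E.sz ^ 2)⁻¹ * (∫ x in E.carrier, ψ x ^ 2) +
        ∫ x in E.carrier, ‖gradient ψ x‖ ^ 2) := by
  have hh := Tri.h_pos hE
  have hρ := Tri.refArea_pos
  have hs := Tri.sz_pos hE
  have hd : 0 < |E.det| := abs_pos.2 (Tri.det_ne_zero_iff.2 hE)
  set c := Real.sqrt (2 * κ / Tri.refArea) with hc
  set P := ∫ x in E.carrier, ψ x ^ 2 with hP
  set N := ∫ x in E.carrier, ‖gradient ψ x‖ ^ 2 with hN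
  set Q := ∑ e ∈ edges T E, ∫ x in e, ψ x ^ 2 ∂μH[1] with hQ
  have hP0 : 0 ≤ P := integral_nonneg fun _ => sq_nonneg _
  have hN0 : 0 ≤ N := integral_nonneg fun _ => by positivity
  set Y := (E.sz ^ 2)⁻¹ * P + N with hY
  have hY0 : 0 ≤ Y := by positivity
  have h1 := Finset.sum_le_sum fun e he =>
    abs_integral_edge_mul_le (E := E) (T := T) he hψ.continuous (j e) hh ht
  rw [Finset.sum_add_distrib, ← Finset.mul_sum, ← Finset.mul_sum, ← Finset.mul_sum, ← hQ] at h1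
  have hsz : E.sz ^ 2 ≤ 2 * κ * |E.det| := by rw [Tri.sz_sq]; linarith
  have hsc : E.sz ≤ c * E.h := by
    refine le_of_sq_le_sq ?_ (by positivity)
    rw [mul_pow, hc, Real.sq_sqrt (by positivity), Tri.h_sq hE]
    refine hsz.trans_eq ?_
    field_simp
  have h2 := sum_integral_edges_sq_le hE hET hψ
  have h3 : 3 * P + E.sz ^ 2 * N ≤ 3 * E.sz ^ 2 * Y := by
    have : E.sz ^ 2 * Y = P + E.sz ^ 2 * N := by
      rw [hY, mul_add, mul_inv_cancel_left₀ (by positivity)]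
    have := mul_nonneg (sq_nonneg E.sz) hN0
    linarith
  have h4 : Q ≤ 72 * κ * c * E.h * Y := by
    refine le_of_mul_le_mul_left ?_ hd
    calc |E.det| * Q ≤ 12 * E.sz * (3 * P + E.sz ^ 2 * N) := h2
      _ ≤ 12 * E.sz * (3 * E.sz ^ 2 * Y) := by gcongr
      _ = 36 * E.sz * E.sz ^ 2 * Y := by ring
      _ ≤ 36 * (c * E.h) * (2 * κ * |E.det|) * Y := by gcongr
      _ = _ := by ring
  refine h1.trans ?_
  rw [← Finset.mul_sum]
  refine add_le_add le_rfl ?_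
  calc 1 / (2 * t * E.h) * Q ≤ 1 / (2 * t * E.h) * (72 * κ * c * E.h * Y) := by gcongr
    _ = _ := by field_simp; ring

/-- The price of replacing the discrete function by its projection. Stabilization controls the
gradient part, and the Poincaré inequality for vanishing boundary mean reduces the L² part to it. -/
theorem consistency_terms_le (hT₀ : IsConforming T₀) (hT : IsRefinement T₀ T) (hE : E ∈ T)
    {cs Cs : ℝ} (hcs : 0 < cs) {V : Submodule ℝ (Plane → ℝ)} (hV : IsLocalSpace T E V)
    (hst : IsStable T E cs Cs V) {w : Plane → ℝ} (hwV : E.carrier.indicator w ∈ V)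
    (hw : MemH10 (domain T₀) w) {a : Plane →ₗ[ℝ] Plane} {c M : ℝ}
    (ha : ∀ y, ‖a y‖ ≤ M * ‖y‖) (hc : |c| ≤ M) {φ : Plane → ℝ} (hφ : ContDiff ℝ 1 φ)
    {t : ℝ} (ht : 0 < t) :
    (∫ x in E.carrier, inner ℝ (a ((piNabla E w).g - weakGrad (domain T₀) w x)) (gradient φ x)) +
      (∫ x in E.carrier, c * ((piNabla E w).eval x - w x) * φ x) ≤
    t / 2 * SE T E w w + (M ^ 2 * cs⁻¹ + 1) / t * (∫ x in E.carrier, ‖gradient φ x‖ ^ 2) +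
      (M ^ 2 * ((32 + 4160 * Tri.refArea ^ 2) * maxSize T₀ ^ 2 * cs⁻¹) + 1) / t *
        ∫ x in E.carrier, φ x ^ 2 := by
  have hfin := E.isFiniteMeasure_restrict
  have hle := restrict_carrier_le hT₀ hT hE
  set p := piNabla E w with hp
  set g := weakGrad (domain T₀) w with hg
  set S := SE T E w w with hS
  have hS0 : 0 ≤ S := SE_nonneg T E w
  -- The summand 1 keeps the divisor in the Young parameter positive when `M = 0`.
  set B := M ^ 2 * cs⁻¹ + 1 with hB
  set B' := M ^ 2 * ((32 + 4160 * Tri.refArea ^ 2) * maxSize T₀ ^ 2 * cs⁻¹) + 1 with hB'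
  have hB0 : 0 < B := by positivity
  have hB0' : 0 < B' := by positivity
  have hwc : ContinuousOn w E.carrier :=
    (hV.continuousOn _ hwV).congr fun x hx => (Set.indicator_of_mem hx w).symm
  have hgL : MemLp g 2 (volume.restrict E.carrier) := hw.1.spec.1.mono_measure hle
  have hwg := hw.isWeakGrad_interior hT₀ hT hE
  have hw2 : MemLp w 2 (volume.restrict (interior E.carrier)) := by
    rw [E.restrict_interior]; exact hw.1.1.mono_measure hle
  have hstab := stab_bound hT₀ hT hE hcs hV hst hwV hw2 hwg
  have hpo := integral_sub_piNabla_sq_le hT₀ hT hE hw hwc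
  set R := ∫ x in E.carrier, ‖g x - p.g‖ ^ 2 with hR
  have hR0 : 0 ≤ R := integral_nonneg fun _ => by positivity
  have hφL : MemLp φ 2 (volume.restrict E.carrier) :=
    Tri.memLp_of_continuousOn hφ.continuous.continuousOn
  have hgφL : MemLp (gradient φ) 2 (volume.restrict E.carrier) :=
    Tri.memLp_of_continuousOn (continuous_gradient hφ).continuousOn
  have hdL : MemLp (fun x => g x - p.g) 2 (volume.restrict E.carrier) := hgL.sub (memLp_const _)
  have h1 : ∫ x in E.carrier, inner ℝ (a (p.g - g x)) (gradient φ x) ≤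
      t / 4 * S + B / t * ∫ x in E.carrier, ‖gradient φ x‖ ^ 2 := by
    have haL : MemLp (fun x => a (p.g - g x)) 2 (volume.restrict E.carrier) :=
      (LinearMap.toContinuousLinearMap a).comp_memLp' ((memLp_const _).sub hgL)
    refine (integral_inner_young haL hgφL (s := t / (2 * B)) (by positivity)).trans ?_
    have h2 : ∫ x in E.carrier, ‖a (p.g - g x)‖ ^ 2 ≤ B * S := by
      have h3 : ∫ x in E.carrier, ‖a (p.g - g x)‖ ^ 2 ≤ ∫ x in E.carrier, M ^ 2 * ‖g x - p.g‖ ^ 2 :=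
        integral_mono (haL.integrable_norm_pow (p := 2) (by norm_num))
          ((hdL.integrable_norm_pow (p := 2) (by norm_num)).const_mul _) fun x => by
            beta_reduce
            rw [← mul_pow, norm_sub_rev (g x)]
            exact pow_le_pow_left₀ (norm_nonneg _) (ha _) 2
      rw [integral_const_mul] at h3
      calc _ ≤ M ^ 2 * R := h3
        _ ≤ M ^ 2 * (cs⁻¹ * S) := by gcongr
        _ ≤ B * S := by rw [hB]; linarith
    have e1 : t / (2 * B) / 2 * (B * S) = t / 4 * S := by field_simp; ring
    have e2 : 1 / (2 * (t / (2 * B))) = B / t := by field_simp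
    rw [e2, ← e1]
    gcongr
  have h2 : ∫ x in E.carrier, c * (p.eval x - w x) * φ x ≤
      t / 4 * S + B' / t * ∫ x in E.carrier, φ x ^ 2 := by
    have hcL : MemLp (fun x => c * (p.eval x - w x)) 2 (volume.restrict E.carrier) :=
      Tri.memLp_of_continuousOn
        (continuousOn_const.mul (p.continuous_eval.continuousOn.sub hwc))
    refine (integral_mul_young hcL hφL (s := t / (2 * B')) (by positivity)).trans ?_
    have h3 : ∫ x in E.carrier, (c * (p.eval x - w x)) ^ 2 ≤ B' * S := by
      have e : ∀ x, (c * (p.eval x - w x)) ^ 2 = c ^ 2 * (w x - p.eval x) ^ 2 := fun x => by ring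
      simp only [e]
      rw [integral_const_mul]
      have hc2 : c ^ 2 ≤ M ^ 2 := by rw [← sq_abs]; gcongr
      have hsz : E.sz ≤ maxSize T₀ := (hT.inForest E hE).sz_le
      have hs0 := E.sz_nonneg
      calc _ ≤ M ^ 2 * ((32 + 4160 * Tri.refArea ^ 2) * E.sz ^ 2 * R) :=
            mul_le_mul hc2 hpo (integral_nonneg fun _ => sq_nonneg _) (sq_nonneg M)
        _ ≤ M ^ 2 * ((32 + 4160 * Tri.refArea ^ 2) * maxSize T₀ ^ 2 * (cs⁻¹ * S)) := by gcongr
        _ ≤ B' * S := by rw [hB']; linarith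
    have e1 : t / (2 * B') / 2 * (B' * S) = t / 4 * S := by field_simp; ring
    have e2 : 1 / (2 * (t / (2 * B'))) = B' / t := by field_simp
    rw [e2, ← e1]
    gcongr
  linarith

/-- The residual, tested with smooth functions, is controlled by the estimator. -/
theorem exists_residual_constant (hT₀ : IsConforming T₀) (hD : D.IsValid (domain T₀)) (Λ : ℕ)
    {cs Cs : ℝ} (hcs : 0 < cs) :
    ∃ K : ℝ, 0 < K ∧ ∀ T : Finset Tri, IsRefinement T₀ T → IsAdmissible T₀ T Λ →
      D.PiecewiseConstant T → ∀ V : Tri → Submodule ℝ (Plane → ℝ),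
      (∀ E ∈ T, IsLocalSpace T E (V E) ∧ IsStable T E cs Cs (V E)) → ∀ (γ : ℝ) (u uT : Plane → ℝ),
      IsWeakSolution (domain T₀) D u → IsGalerkinSolution (domain T₀) D T V γ uT →
      ∀ φ : Plane → ℝ, IsTestFunction (domain T₀) φ → ∀ t : ℝ, 0 < t →
      (∫ x in domain T₀, inner ℝ (Matrix.toEuclideanLin (D.A x)
        (weakGrad (domain T₀) u x - weakGrad (domain T₀) uT x)) (gradient φ x)) +
        (∫ x in domain T₀, D.c x * (u x - uT x) * φ x) ≤
      t * (etaSq (domain T₀) D T uT + ST T uT uT) + K / t * ∫ x, ‖gradient φ x‖ ^ 2 := by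
  obtain ⟨κ, hκ1, hκ⟩ := exists_shape_constant hT₀
  obtain ⟨Cq, hCq, hquasi⟩ := exists_quasi_constant hT₀ Λ
  obtain ⟨CF, hCF, hfri⟩ := exists_friedrichs_constant T₀
  obtain ⟨M, hM, hdata⟩ := exists_data_bound hT₀ hD
  have hρ := Tri.refArea_pos
  have hκ0 : 0 < κ := by linarith
  set k₁ := κ / Tri.refArea with hk₁
  set k₂ := 36 * κ * Real.sqrt (2 * κ / Tri.refArea) with hk₂
  set k₃ := M ^ 2 * cs⁻¹ + 1 with hk₃
  set k₄ := M ^ 2 * ((32 + 4160 * Tri.refArea ^ 2) * maxSize T₀ ^ 2 * cs⁻¹) + 1 with hk₄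
  have hk₁0 : 0 ≤ k₁ := by positivity
  have hk₂0 : 0 ≤ k₂ := by positivity
  have hk₃0 : 0 < k₃ := by positivity
  have hk₄0 : 0 ≤ k₄ := by positivity
  -- The four coefficients belong to the element residuals, the jumps and the two consistency terms;
  -- the quasi-interpolation and Friedrichs constants turn their second factors into the norm of the
  -- gradient of φ.
  refine ⟨(k₁ + k₂) * Cq + k₃ + k₄ * CF, by positivity, ?_⟩
  intro T hT hA hpc V hV γ u uT hu hG φ hφ t ht
  have hφ1 := hφ.contDiff_one
  have hφ0 : ∀ x ∉ domain T₀, φ x = 0 := fun x hx => hφ.zero_off hx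
  set Nφ := ∫ x, ‖gradient φ x‖ ^ 2 with hNφ
  rw [residual_identity hT₀ hD hT hA hpc (fun E hE => (hV E hE).1) hu hG hφ]
  set p : Tri → P1 := fun E => piNabla E uT with hp
  set v : Tri → P1 := fun E => quasi T₀ T φ E with hv
  set j : Set Plane → ℝ := jump (domain T₀) D T uT with hj
  let Y : Tri → ℝ := fun E => (E.sz ^ 2)⁻¹ * (∫ x in E.carrier, (φ x - (v E).eval x) ^ 2) +
    ∫ x in E.carrier, ‖gradient φ x - (v E).g‖ ^ 2
  have hYsum : ∑ E ∈ T, Y E ≤ Cq * Nφ := hquasi T hT hA φ hφ1 hφ.2.1 hφ0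
  have hgsum : ∑ E ∈ T, ∫ x in E.carrier, ‖gradient φ x‖ ^ 2 ≤ Nφ :=
    sum_setIntegral_le hT₀ hT (by
      have := (hφ.memLp_gradient Set.univ).integrable_norm_pow (p := 2) (by norm_num)
      rwa [Measure.restrict_univ] at this) fun x => by positivity
  have hfsum : ∑ E ∈ T, ∫ x in E.carrier, φ x ^ 2 ≤ CF * Nφ :=
    (sum_setIntegral_le hT₀ hT (by
      have := (hφ.memLp Set.univ).integrable_sq
      rwa [Measure.restrict_univ] at this) fun x => sq_nonneg _).trans (hfri φ hφ1 hφ.2.1 hφ0)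
  have hflux := neg_le_of_abs_le (abs_sum_flux_le hT₀ hT hA D uT hφ1 hφ0)
  have hgr : ∀ E x, gradient (fun x => φ x - (v E).eval x) x = gradient φ x - (v E).g :=
    fun E x => by rw [gradient_sub hφ1 (v E).contDiff_eval, P1.gradient_eval]
  have hel : ∀ E ∈ T,
      (∫ x in E.carrier, (D.f E.barycenter - D.c E.barycenter * (p E).eval x) *
        (φ x - (v E).eval x)) +
      (∑ e ∈ edges T E, |∫ x in e, (φ x - (v E).eval x) ∂μH[1]| * |j e|) +
      ((∫ x in E.carrier, inner ℝ (Matrix.toEuclideanLin (D.A E.barycenter)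
        ((p E).g - weakGrad (domain T₀) uT x)) (gradient φ x)) +
        ∫ x in E.carrier, D.c E.barycenter * ((p E).eval x - uT x) * φ x) ≤
      t * (etaSqLocal (domain T₀) D T uT E + SE T E uT uT) + (k₁ + k₂) / t * Y E +
        k₃ / t * (∫ x in E.carrier, ‖gradient φ x‖ ^ 2) + k₄ / t * ∫ x in E.carrier, φ x ^ 2 := by
    intro E hE
    have nE := (hT.inForest E hE).nondeg hT₀
    have hq := hκ E (hT.inForest E hE)
    have hφc := hφ1.continuous
    have hpc' := (p E).continuous_eval
    have hvc := (v E).continuous_eval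
    have a1 := volume_term_le nE hq
      (r := fun x => D.f E.barycenter - D.c E.barycenter * (p E).eval x)
      (ψ := fun x => φ x - (v E).eval x) (by fun_prop) (by fun_prop) ht
    have a2 := edge_terms_le nE hE hκ0 hq (hφ1.sub (v E).contDiff_eval) j ht
    simp only [hgr] at a2
    have a3 := consistency_terms_le hT₀ hT hE hcs (hV E hE).1 (hV E hE).2 (hG.1.2 E hE) hG.1.1
      (hdata T hT hpc E hE).1 (hdata T hT hpc E hE).2 hφ1 ht
    have b1 : 0 ≤ E.h ^ 2 * ∫ x in E.carrier,
        (D.f E.barycenter - D.c E.barycenter * (p E).eval x) ^ 2 :=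
      mul_nonneg (sq_nonneg _) (integral_nonneg fun _ => sq_nonneg _)
    have b2 := SE_nonneg T E uT
    have b3 : (E.sz ^ 2)⁻¹ * (∫ x in E.carrier, (φ x - (v E).eval x) ^ 2) ≤ Y E :=
      le_add_of_nonneg_right (integral_nonneg fun _ => by positivity)
    have b4 := mul_le_mul_of_nonneg_left b3 (by positivity : 0 ≤ k₁ / t)
    have b5 : etaSqLocal (domain T₀) D T uT E = E.h ^ 2 * (∫ x in E.carrier,
        (D.f E.barycenter - D.c E.barycenter * (p E).eval x) ^ 2) +
        (1 / 2 : ℝ) * ∑ e ∈ edges T E, E.h * (Metric.diam e * j e ^ 2) := rfl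
    have b6 := mul_nonneg ht.le b1
    have b7 := mul_nonneg ht.le b2
    have b8 : (k₁ + k₂) / t * Y E = k₁ / t * Y E + k₂ / t * Y E := by ring
    rw [b5, b8]
    change _ ≤ t / 2 * _ + k₂ / t * Y E at a2
    linarith
  have hsum := Finset.sum_le_sum hel
  simp only [Finset.sum_add_distrib, ← Finset.mul_sum] at hsum
  have c1 := mul_le_mul_of_nonneg_left hYsum (by positivity : 0 ≤ (k₁ + k₂) / t)
  have c2 := mul_le_mul_of_nonneg_left hgsum (by positivity : 0 ≤ k₃ / t)
  have c3 := mul_le_mul_of_nonneg_left hfsum (by positivity : 0 ≤ k₄ / t)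
  have c4 : ((k₁ + k₂) * Cq + k₃ + k₄ * CF) / t * Nφ =
      (k₁ + k₂) / t * (Cq * Nφ) + k₃ / t * Nφ + k₄ / t * (CF * Nφ) := by ring
  rw [c4, Finset.sum_add_distrib]
  change _ ≤ t * (∑ E ∈ T, etaSqLocal (domain T₀) D T uT E + ∑ E ∈ T, SE T E uT uT) + _
  linarith

theorem tendsto_integral_inner {μ : Measure Plane} {F g : Plane → Plane} {G : ℕ → Plane → Plane}
    (hF : MemLp F 2 μ) (hg : MemLp g 2 μ) (hG : ∀ n, MemLp (G n) 2 μ)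
    (h : Tendsto (fun n => ∫ x, ‖g x - G n x‖ ^ 2 ∂μ) atTop (𝓝 0)) :
    Tendsto (fun n => ∫ x, inner ℝ (F x) (G n x) ∂μ) atTop (𝓝 (∫ x, inner ℝ (F x) (g x) ∂μ)) := by
  have h1 : Tendsto (fun n => Real.sqrt (∫ x, ‖F x‖ ^ 2 ∂μ) *
      Real.sqrt (∫ x, ‖g x - G n x‖ ^ 2 ∂μ)) atTop (𝓝 0) := by
    have := ((Real.continuous_sqrt.tendsto _).comp h).const_mul (Real.sqrt (∫ x, ‖F x‖ ^ 2 ∂μ))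
    rwa [Real.sqrt_zero, mul_zero] at this
  rw [tendsto_iff_dist_tendsto_zero]
  refine squeeze_zero (fun n => dist_nonneg) (fun n => ?_) h1
  rw [dist_comm, Real.dist_eq, ← integral_sub (integrable_inner hF hg) (integrable_inner hF (hG n))]
  simp only [← inner_sub_right]
  exact abs_integral_inner_le hF (hg.sub (hG n))

theorem tendsto_integral_mul {μ : Measure Plane} {F g : Plane → ℝ} {G : ℕ → Plane → ℝ}
    (hF : MemLp F 2 μ) (hg : MemLp g 2 μ) (hG : ∀ n, MemLp (G n) 2 μ)
    (h : Tendsto (fun n => ∫ x, ‖g x - G n x‖ ^ 2 ∂μ) atTop (𝓝 0)) :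
    Tendsto (fun n => ∫ x, F x * G n x ∂μ) atTop (𝓝 (∫ x, F x * g x ∂μ)) := by
  have h1 : Tendsto (fun n => Real.sqrt (∫ x, ‖F x‖ ^ 2 ∂μ) *
      Real.sqrt (∫ x, ‖g x - G n x‖ ^ 2 ∂μ)) atTop (𝓝 0) := by
    have := ((Real.continuous_sqrt.tendsto _).comp h).const_mul (Real.sqrt (∫ x, ‖F x‖ ^ 2 ∂μ))
    rwa [Real.sqrt_zero, mul_zero] at this
  rw [tendsto_iff_dist_tendsto_zero]
  refine squeeze_zero (fun n => dist_nonneg) (fun n => ?_) h1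
  rw [dist_comm, Real.dist_eq, ← integral_sub (integrable_mul_two hF hg)
    (integrable_mul_two hF (hG n))]
  simp only [← mul_sub]
  exact abs_integral_mul_le hF (hg.sub (hG n))

/-- Passing from smooth functions to the error itself. -/
theorem error_le_of_residual_le {Ω : Set Plane} (hΩ : IsOpen Ω) (hD : D.IsValid Ω) {α : ℝ}
    (hα : 0 < α) (hcoer : ∀ᵐ x ∂(volume.restrict Ω), ∀ ξ : Plane,
      α * ‖ξ‖ ^ 2 ≤ inner ℝ (Matrix.toEuclideanLin (D.A x) ξ) ξ) {u w : Plane → ℝ}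
    (hu : MemH10 Ω u) (hw : MemH10 Ω w) {K X : ℝ} (hK : 0 < K)
    (h : ∀ φ : Plane → ℝ, IsTestFunction Ω φ → ∀ t : ℝ, 0 < t →
      (∫ x in Ω, inner ℝ (Matrix.toEuclideanLin (D.A x) (weakGrad Ω u x - weakGrad Ω w x))
        (gradient φ x)) + (∫ x in Ω, D.c x * (u x - w x) * φ x) ≤
      t * X + K / t * ∫ x, ‖gradient φ x‖ ^ 2) :
    h1SemiSq Ω (fun x => u x - w x) ≤ 4 * K / α ^ 2 * X := by
  have he := hu.sub hΩ hw
  have hae := weakGrad_sub_ae hΩ hu.1 hw.1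
  set g : Plane → Plane := fun x => weakGrad Ω u x - weakGrad Ω w x with hg
  have hgL : MemLp g 2 (volume.restrict Ω) := hu.1.spec.1.sub hw.1.spec.1
  have heL : MemLp (fun x => u x - w x) 2 (volume.restrict Ω) := hu.1.1.sub hw.1.1
  have hN : h1SemiSq Ω (fun x => u x - w x) = ∫ x in Ω, ‖g x‖ ^ 2 := by
    refine integral_congr_ae ?_
    filter_upwards [hae] with x hx
    rw [hx]
  rw [hN]
  set N := ∫ x in Ω, ‖g x‖ ^ 2 with hNdef
  obtain ⟨φ, hφ, h0, h1⟩ := he.exists_seq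
  have h1' : Tendsto (fun n => ∫ x in Ω, ‖g x - gradient (φ n) x‖ ^ 2) atTop (𝓝 0) := by
    refine h1.congr fun n => integral_congr_ae ?_
    filter_upwards [hae] with x hx
    rw [hx]
  have hgφ := fun n => (hφ n).memLp_gradient Ω
  have l1 := tendsto_integral_inner (hD.memLp_A hgL) hgL hgφ h1'
  have l2 := tendsto_integral_mul (hD.memLp_c heL) heL (fun n => (hφ n).memLp Ω) h0
  -- Norm convergence from ‖∇φ_n‖² = ‖g - ∇φ_n‖² + 2(g, ∇φ_n) - ‖g‖².
  have l3 : Tendsto (fun n => ∫ x, ‖gradient (φ n) x‖ ^ 2) atTop (𝓝 N) := by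
    have hfull : ∀ n, ∫ x, ‖gradient (φ n) x‖ ^ 2 = ∫ x in Ω, ‖gradient (φ n) x‖ ^ 2 := fun n =>
      (setIntegral_eq_integral_of_forall_compl_eq_zero fun x hx => by
        rw [(hφ n).gradient_zero_off hx]; simp).symm
    have m1 := (tendsto_integral_inner hgL hgL hgφ h1').const_mul 2
    have m2 := (h1'.add m1).sub_const N
    have e : ∀ x, inner ℝ (g x) (g x) = ‖g x‖ ^ 2 := fun x => real_inner_self_eq_norm_sq _
    simp only [e] at m2
    rw [zero_add, ← hNdef, show 2 * N - N = N by ring] at m2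
    refine m2.congr fun n => ?_
    have i1 := (hgL.sub (hgφ n)).integrable_norm_pow (p := 2) (by norm_num)
    have i2 := (integrable_inner hgL (hgφ n)).const_mul 2
    have i3 := hgL.integrable_norm_pow (p := 2) (by norm_num)
    simp only [Pi.sub_apply] at i1
    have i4 : Integrable (fun x => ‖g x - gradient (φ n) x‖ ^ 2 +
      2 * inner ℝ (g x) (gradient (φ n) x)) (volume.restrict Ω) := i1.add i2
    rw [hfull, hNdef, ← integral_const_mul, ← integral_add i1 i2, ← integral_sub i4 i3]
    refine integral_congr_ae (ae_of_all _ fun x => ?_)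
    beta_reduce
    rw [norm_sub_sq_real]; ring
  have hlim : ∀ t : ℝ, 0 < t → (∫ x in Ω, inner ℝ (Matrix.toEuclideanLin (D.A x) (g x)) (g x)) +
      (∫ x in Ω, D.c x * (u x - w x) * (u x - w x)) ≤ t * X + K / t * N := fun t ht =>
    le_of_tendsto_of_tendsto' (l1.add l2) ((l3.const_mul (K / t)).const_add (t * X))
      fun n => h (φ n) (hφ n) t ht
  have hc : 0 ≤ ∫ x in Ω, D.c x * (u x - w x) * (u x - w x) := by
    refine integral_nonneg_of_ae ?_
    filter_upwards [hD.c_nonneg] with x hx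
    rw [mul_assoc]
    exact mul_nonneg hx (mul_self_nonneg _)
  have hco : α * N ≤ ∫ x in Ω, inner ℝ (Matrix.toEuclideanLin (D.A x) (g x)) (g x) := by
    rw [hNdef, ← integral_const_mul]
    refine integral_mono_ae ((hgL.integrable_norm_pow (p := 2) (by norm_num)).const_mul α)
      (integrable_inner (hD.memLp_A hgL) hgL) ?_
    filter_upwards [hcoer] with x hx
    exact hx (g x)
  -- This t makes K/t = α/2, so that half of the coercive term absorbs the gradient norm on the
  -- right.
  have hfin := hlim (2 * K / α) (by positivity)
  have e1 : K / (2 * K / α) = α / 2 := by field_simp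
  rw [e1] at hfin
  have h2 : α / 2 * N ≤ 2 * K / α * X := by linarith
  have e2 : 4 * K / α ^ 2 * X = (2 / α) * (2 * K / α * X) := by field_simp; ring
  have e3 : N = (2 / α) * (α / 2 * N) := by field_simp
  rw [e2, e3]
  exact mul_le_mul_of_nonneg_left h2 (by positivity)

end

end VEM

theorem proposition4p1 (T₀ : Finset VEM.Tri) (hT₀ : VEM.IsConforming T₀)
    (D : VEM.ProblemData) (hD : D.IsValid (VEM.domain T₀))
    (Λ : ℕ) (hΛ : 1 ≤ Λ) (cs Cs : ℝ) (hcs : 0 < cs) (hCs : cs ≤ Cs) :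
    ∃ Capost : ℝ, 0 < Capost ∧
      ∀ T : Finset VEM.Tri, VEM.IsRefinement T₀ T → VEM.IsAdmissible T₀ T Λ →
        D.PiecewiseConstant T →
      ∀ V : VEM.Tri → Submodule ℝ (VEM.Plane → ℝ),
        (∀ E ∈ T, VEM.IsLocalSpace T E (V E) ∧ VEM.IsStable T E cs Cs (V E)) →
      ∀ γ : ℝ, 0 < γ →
      ∀ u uT : VEM.Plane → ℝ, VEM.IsWeakSolution (VEM.domain T₀) D u →
        VEM.IsGalerkinSolution (VEM.domain T₀) D T V γ uT →
        VEM.h1SemiSq (VEM.domain T₀) (fun x => u x - uT x) ≤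
          Capost * (VEM.etaSq (VEM.domain T₀) D T uT + VEM.ST T uT uT) := by
  obtain ⟨α, hα, hcoer⟩ := hD.A_pos
  obtain ⟨K, hK, h⟩ := VEM.exists_residual_constant hT₀ hD Λ (Cs := Cs) hcs
  refine ⟨4 * K / α ^ 2, by positivity, fun T hT hA hpc V hV γ _ u uT hu hG => ?_⟩
  exact VEM.error_le_of_residual_le (VEM.isOpen_domain T₀) hD hα hcoer hu.1 hG.1.1 hK
    (h T hT hA hpc V hV γ u uT hu hG)
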